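/- **Setting.** Let $p>3$ be a prime, $\bar k$ an algebraically closed field of characteristic $p$, $\bar W$ its ring of Witt vectors with Frobenius $\sigma$, $K^{\mathrm u}=\bar W[1/p]$, $\bar A=\bar W[[t_1,\dots,t_n]]$, $\bar A_0=\bar A/p\bar A=\bar k[[t_1,\dots,t_n]]$. A *lift of Frobenius* is a ring endomorphism $\psi$ of $\bar A$ with $\psi|_{\bar W}=\sigma$ and $\psi(a)\equiv a^p \pmod p$; it is applied to power series over $K^{\mathrm u}$ by $\psi(\sum a_mt^m)=\sum\sigma(a_m)\psi(t)^m$ whenever this converges coefficientwise $p$-adically. An *$F$-crystal* over $\bar A_0$ is a free $\bar A$-module $\bar H$ of finite rank with an integrable, $p$-adically topologically nilpotent connection $\nabla$ (relative to $\bar W$, with values in $\Omega^1_{\bar A/\bar W}\otimes\bar H$, where $\Omega^1_{\bar A/\bar W}=\bigoplus_j\bar A\,dt_j$; put $D_j=\nabla(\partial/\partial t_j)$) and, for every lift of Frobenius $\phi$, an $\bar A$-linear horizontal map $F(\phi):\phi^*\bar H\to\bar H$ which becomes an isomorphism after inverting $p$, such that for all $\phi,\psi$ $$F(\phi)\phi^*(x)=\sum_{m}\prod_j\frac{(\phi(t_j)-\psi(t_j))^{m_j}}{m_j!}\,F(\psi)\psi^*(D_1^{m_1}\cdots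 D_n^{m_n}x).$$ It is a *unit* $F$-crystal if the $F(\phi)$ are isomorphisms. On $H_0=\bar H/p\bar H$ one has the conjugate filtration $\mathrm{Fil}_iH_0$ (classes of the $y$ with $p^iy\in\mathrm{Im}\,F(\phi)$) and the Hodge filtration $\mathrm{Fil}^iH_0$ (classes of the $y$ with $F(\phi)\phi^*y\in p^i\bar H$). The $F$-crystal is *ordinary* if all $\mathrm{Fil}_iH_0/\mathrm{Fil}_{i-1}H_0$ are free over $\bar A_0$ and $H_0=\mathrm{Fil}_iH_0\oplus\mathrm{Fil}^{i+1}H_0$ for all $i$; it is of level $\le N$ if $\mathrm{Fil}_NH_0=H_0$ and $\mathrm{Fil}^{N+1}H_0=0$. A *Hodge $F$-crystal* carries in addition a decreasing filtration $\bar H=\mathrm{Fil}^0\bar H\supset\mathrm{Fil}^1\bar H\supset\cdots$ by free submodules with $\mathrm{Fil}^i\bar H\otimes\bar A_0=\mathrm{Fil}^iH_0$ and $\nabla\,\mathrm{Fil}^i\bar H\subset\Omega^1_{\bar A/\bar W}\otimes\mathrm{Fil}^{i-1}\bar H$; if it has level $\le N$, it is *divisible* if $F(\phi)\phi^*\mathrm{Fil}^i\bar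 H\subset p^i\bar H$ for $0\le i\le N$ and some $\phi$. If the crystal is ordinary, let $0=U_{-1}\subset U_0\subset U_1\subset\cdots$ denote the filtration by sub-$F$-crystals such that $U_i\otimes\bar A_0=\mathrm{Fil}_iH_0$ and $U_i/U_{i-1}$ is a unit $F$-crystal with Frobenius multiplied by $p^i$, and put $\bar H^i=U_i\cap\mathrm{Fil}^i\bar H\simeq\mathrm{Fil}^i\bar H/\mathrm{Fil}^{i+1}\bar H$. An *ordinary CY3 crystal* is a divisible ordinary Hodge $F$-crystal of level $3$ over $\bar A_0$ with $\bar H^0,\bar H^1,\bar H^2,\bar H^3$ of ranks $1,h,h,1$, with a perfect alternating bilinear form $\langle\,,\rangle:\bar H\times\bar H\to\bar A$ such that $\langle\nabla x,y\rangle+\langle x,\nabla y\rangle=d\langle x,y\rangle$, $\langle F(\phi)\phi^*x,F(\phi)\phi^*y\rangle=p^3\phi(\langle x,y\rangle)$ for every lift $\phi$, $(\mathrm{Fil}^3\bar H)^\perp=\mathrm{Fil}^1\bar H$ and $(\mathrm{Fil}^2\bar H)^\perp=\mathrm{Fil}^2\bar H$. **Theorem 2.4 (integralities).** Let $\bar H$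 be an ordinary CY3 crystal such that the map $\bigoplus_j\bar A\,\partial/\partial t_j\to\mathrm{Hom}_{\bar A}(\bar H^3,\bar H^2)$ induced by $\nabla$ is an isomorphism. Then $n=h$. There are a basis $e_0\in\bar H^0$, $e_1,\dots,e_h\in\bar H^1$, $e_{h+1},\dots,e_{2h}\in\bar H^2$, $e_{2h+1}\in\bar H^3$ of $\bar H$ with Gram matrix $$\begin{pmatrix}0&0&0&-1\\0&0&I_h&0\\0&-I_h&0&0\\1&0&0&0\end{pmatrix}$$ and a matrix over $K^{\mathrm u}[[t_1,\dots,t_h]]$ of the form $$\mathcal T=\begin{pmatrix}1&\tau_{23}^{\star}&0&0\\0&I_h&0&0\\0&0&I_h&\tau_{23}\\0&0&0&1\end{pmatrix}\begin{pmatrix}1&0&-\tau_{13}^{\star}&Z\\0&I_h&\tau_{12}&\tau_{13}\\0&0&I_h&0\\0&0&0&1\end{pmatrix}$$ ($^\star$ is the transpose) such that, in this basis, $\nabla$ has matrix $\mathcal T^{-1}d\mathcal T$ and $F(\psi)\psi^*$ has matrix $\mathcal T^{-1}\,\mathrm{diag}(1,pI_h,p^2I_h,p^3)\,\psi(\mathcal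 T)$ for every lift of Frobenius $\psi$. For every such basis and matrix, write $\tau_{23}=(\tau_1,\dots,\tau_h)^\star$. Then: 1. $q_i=\exp(\tau_i)=\sum_m\tau_i^m/m!$ is well defined, $q_i\in\bar A$ and $q_i(0)-1\in p\bar W$ for $i=1,\dots,h$. 2. $p,q_1-1,\dots,q_h-1$ is a regular system of parameters of $\bar A$, and $\bar A=\bar W[[q_1-1,\dots,q_h-1]]$, i.e. there is an isomorphism of $\bar W$-algebras $\bar W[[x_1,\dots,x_h]]\to\bar A$ with $x_i\mapsto q_i-1$. 3. There is a unique lift of Frobenius $\varphi$ on $\bar A$ with $\varphi(q_i)=q_i^p$ for all $i$ (the canonical lift). For it, $\varphi(Z)$ is well defined, $$\langle e_{2h+1},F(\varphi)\varphi^*(e_{2h+1})\rangle=\varphi(Z)-p^3Z\qquad\text{and}\qquad p^{-3}\varphi(Z)-Z\in\bar A.$$ -/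

import Mathlib

universe u v

noncomputable section

namespace CY3

/-! ### The base rings -/

/-- The ring `W` of Witt vectors of `k`. -/
abbrev W (p : ℕ) [Fact p.Prime] (k : Type v) [Field k] : Type v := WittVector p k

/-- The power series ring `A = W[[t_1, …, t_n]]`. -/
abbrev A (p : ℕ) [Fact p.Prime] (k : Type v) [Field k] (n : ℕ) : Type v :=
  MvPowerSeries (Fin n) (W p k)

/-- The field `K = W[1/p] = Frac W`. -/
abbrev K (p : ℕ) [Fact p.Prime] (k : Type v) [Field k] : Type v := FractionRing (W p k)

/-- The power series ring `K[[t_1, …, t_n]]`. -/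
abbrev KA (p : ℕ) [Fact p.Prime] (k : Type v) [Field k] (n : ℕ) : Type v :=
  MvPowerSeries (Fin n) (K p k)

/-- The ring `A_0 = A / pA = k[[t_1, …, t_n]]`. -/
abbrev A₀ (p : ℕ) [Fact p.Prime] (k : Type v) [Field k] (n : ℕ) : Type v :=
  A p k n ⧸ Ideal.span {(p : A p k n)}

/-- The inclusion `A ⊂ K[[t_1, …, t_n]]`. -/
def incl (p : ℕ) [Fact p.Prime] (k : Type v) [Field k] (n : ℕ) : A p k n →+* KA p k n :=
  MvPowerSeries.map (algebraMap (W p k) (K p k))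

section Rings

variable {p : ℕ} [Fact p.Prime] {k : Type v} [Field k] {n : ℕ}

/-- `∑ f = g` in `K[[t_1, …, t_n]]`, where each coefficient converges (unconditionally) for the
`p`-adic topology of `K`, whose basic neighbourhoods of `0` are the `p^r W`. -/
def PadicHasSum {ι : Type*} (f : ι → KA p k n) (g : KA p k n) : Prop :=
  ∀ (d : Fin n →₀ ℕ) (r : ℕ), ∃ S : Finset ι, ∀ S' : Finset ι, S ⊆ S' → ∃ w : W p k,
    MvPowerSeries.coeff d g - ∑ m ∈ S', MvPowerSeries.coeff d (f m)
      = algebraMap (W p k) (K p k) ((p : W p k) ^ r * w)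

/-- `g = exp(τ)`, i.e. `g = ∑ τ^m / m!`. -/
def IsExp [CharP k p] (τ g : KA p k n) : Prop :=
  PadicHasSum (fun m : ℕ => MvPowerSeries.C (((Nat.factorial m : ℕ) : K p k)⁻¹) * τ ^ m) g

/-- The submodule `p^r H` of an `A`-module `H`. -/
def pPow (p : ℕ) [Fact p.Prime] (k : Type v) [Field k] (n : ℕ)
    (H : Type u) [AddCommGroup H] [Module (A p k n) H] (r : ℕ) : Submodule (A p k n) H :=
  LinearMap.range (((p : A p k n) ^ r) • (LinearMap.id : H →ₗ[A p k n] H))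

/-- The members of the family `x` form a regular system of parameters of `R`: the ring `R` is
Noetherian and local, of dimension the number of members, and they generate its maximal ideal. -/
def IsRegularSystemOfParameters {R : Type*} [CommRing R] {ι : Type*} [Fintype ι]
    (x : ι → R) : Prop :=
  IsNoetherianRing R ∧ ∃ _ : IsLocalRing R,
    ringKrullDim R = (Fintype.card ι : ℕ) ∧
    Ideal.span (Set.range x) = IsLocalRing.maximalIdeal R

end Rings

/-! ### Lifts of Frobenius -/

/-- A lift of Frobenius on `A`: a ring endomorphism which restricts to the Witt vector Frobenius
`σ` on `W` and which reduces to `x ↦ x^p` modulo `p`. -/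
structure FrobLift (p : ℕ) [Fact p.Prime] (k : Type v) [Field k] [CharP k p] (n : ℕ) where
  toRingHom : A p k n →+* A p k n
  map_C : ∀ w : W p k,
    toRingHom (MvPowerSeries.C w) = MvPowerSeries.C (WittVector.frobenius w)
  dvd_sub_pow : ∀ a : A p k n, (p : A p k n) ∣ toRingHom a - a ^ p

/-- `g = ψ(f)` for the extension of `ψ` to (suitable) power series over `K`:
`ψ(∑ a_m t^m) = ∑ σ(a_m) ψ(t)^m`, with coefficientwise `p`-adic convergence.
(The constant terms of the `ψ(t_j)` lie in `pW` and need not vanish.) -/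
def FrobLift.MapsTo {p : ℕ} [Fact p.Prime] {k : Type v} [Field k] [CharP k p] [PerfectRing k p]
    {n : ℕ} (ψ : FrobLift p k n) (f g : KA p k n) : Prop :=
  PadicHasSum
    (fun m : Fin n →₀ ℕ =>
      MvPowerSeries.C (WittVector.FractionRing.frobenius p k (MvPowerSeries.coeff m f)) *
        ∏ j, incl p k n (ψ.toRingHom (MvPowerSeries.X j)) ^ (m j)) g

/-! ### Crystals and `F`-crystals -/

/-- A crystal over `A_0` on the `A`-module `H`: `H` is free of finite rank and carries an
integrable, `p`-adically topologically nilpotent connection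
`∇ : H → Ω¹_{A/W} ⊗ H`, where `Ω¹_{A/W}` is the module of continuous differentials, free on
`dt_1, …, dt_n`.  The connection is given by `D_j = ∇(∂/∂t_j)`, that is
`∇ x = ∑ dt_j ⊗ D_j x`. -/
structure Crystal (p : ℕ) [Fact p.Prime] (k : Type v) [Field k] (n : ℕ)
    (H : Type u) [AddCommGroup H] [Module (A p k n) H] where
  free : Module.Free (A p k n) H
  finite : Module.Finite (A p k n) H
  D : Fin n → AddMonoid.End H
  leibniz : ∀ (j : Fin n) (a : A p k n) (x : H),
    D j (a • x) = MvPowerSeries.pderiv (W p k) j a • x + a • D j x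
  integrable : ∀ (i j : Fin n) (x : H), D i (D j x) = D j (D i x)
  nilpotent : ∀ (j : Fin n) (r : ℕ), ∃ M : ℕ, ∀ m : ℕ, M ≤ m → ∀ x : H,
    (D j ^ m) x ∈ pPow p k n H r

/-- The operator `D_1^{m_1} ∘ ⋯ ∘ D_n^{m_n}`. -/
def Crystal.Dpow {p : ℕ} [Fact p.Prime] {k : Type v} [Field k] {n : ℕ}
    {H : Type u} [AddCommGroup H] [Module (A p k n) H] (E : Crystal p k n H)
    (m : Fin n →₀ ℕ) : AddMonoid.End H :=
  (List.ofFn fun j => E.D j ^ m j).prod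

/-- An `F`-crystal over `A_0`.  The `A`-linear map `F(φ) : φ^* H → H` is given by the corresponding
`φ`-linear map `F(φ)φ^* : H → H`, so that the image of `F(φ)` is the `A`-span of the range
of `F φ`.
* `horizontal`: `∇ ∘ F(φ)φ^* = (φ ⊗ F(φ)φ^*) ∘ ∇`.
* `taylor`: `F(φ) = F(ψ) ∘ χ(φ, ψ)`; here `c m` is `∏ (φ(t_j) - ψ(t_j))^{m_j} / m_j!`
  and the series converges `p`-adically in `H`.
* `isogeny`: `F(φ) ⊗ ℚ_p` is onto (hence bijective, as source and target are free of the same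
  finite rank). -/
structure FCrystal (p : ℕ) [Fact p.Prime] (k : Type v) [Field k] [CharP k p] (n : ℕ)
    (H : Type u) [AddCommGroup H] [Module (A p k n) H] extends Crystal p k n H where
  F : ∀ φ : FrobLift p k n, H →ₛₗ[φ.toRingHom] H
  horizontal : ∀ (φ : FrobLift p k n) (i : Fin n) (x : H),
    D i (F φ x) =
      ∑ j, MvPowerSeries.pderiv (W p k) i (φ.toRingHom (MvPowerSeries.X j)) • F φ (D j x)
  taylor : ∀ φ ψ : FrobLift p k n, ∃ c : (Fin n →₀ ℕ) → A p k n,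
    (∀ m, (∏ j, ((Nat.factorial (m j) : ℕ) : A p k n)) * c m =
      ∏ j, (φ.toRingHom (MvPowerSeries.X j) - ψ.toRingHom (MvPowerSeries.X j)) ^ m j) ∧
    ∀ (x : H) (r : ℕ), ∃ S : Finset (Fin n →₀ ℕ), ∀ S' : Finset (Fin n →₀ ℕ), S ⊆ S' →
      F φ x - ∑ m ∈ S', c m • F ψ (toCrystal.Dpow m x)
        ∈ pPow p k n H r
  isogeny : ∀ φ : FrobLift p k n, ∃ N : ℕ,
    pPow p k n H N ≤ Submodule.span (A p k n) (Set.range (F φ))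

/-- For a filtration indexed by `0, 1, 2, …`, the step before step `i`; step `-1` is `0`. -/
def prev {R : Type*} [Ring R] {M : Type*} [AddCommGroup M] [Module R M]
    (U : ℕ → Submodule R M) : ℕ → Submodule R M
  | 0 => ⊥
  | i + 1 => U i

section FCrystal

variable {p : ℕ} [Fact p.Prime] {k : Type v} [Field k] [CharP k p] {n : ℕ}
  {H : Type u} [AddCommGroup H] [Module (A p k n) H]

/-- `H_0 = H ⊗_A A_0 = H / pH`. -/
abbrev Red (p : ℕ) [Fact p.Prime] (k : Type v) [Field k] (n : ℕ)
    (H : Type u) [AddCommGroup H] [Module (A p k n) H] : Type u :=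
  H ⧸ pPow p k n H 1

/-- The reduction in `H_0` of a submodule of `H`. -/
def red (N : Submodule (A p k n) H) : Submodule (A p k n) (Red p k n H) :=
  N.map (Submodule.mkQ (pPow p k n H 1))

/-- A unit `F`-crystal: `F(φ)` is onto (hence an isomorphism). -/
def FCrystal.IsUnit (E : FCrystal p k n H) : Prop :=
  ∀ φ : FrobLift p k n, Submodule.span (A p k n) (Set.range (E.F φ)) = ⊤

/-- The conjugate filtration:
`Fil_i H_0 = {x | ∃ y lifting x with p^i y ∈ Im F(φ)}`. -/
def FCrystal.conjFil (E : FCrystal p k n H) (φ : FrobLift p k n) (i : ℕ) :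
    Submodule (A p k n) (Red p k n H) :=
  red ((Submodule.span (A p k n) (Set.range (E.F φ))).comap
    (((p : A p k n) ^ i) • (LinearMap.id : H →ₗ[A p k n] H)))

/-- The Hodge filtration:
`Fil^i H_0 = {x | ∃ y lifting x with F(φ)φ^* y ∈ p^i H}`. -/
def FCrystal.hodgeFil (E : FCrystal p k n H) (φ : FrobLift p k n) (i : ℕ) :
    Submodule (A p k n) (Red p k n H) :=
  red ((pPow p k n H i).comap (E.F φ))

/-- `gr_i H_0 = Fil_i H_0 / Fil_{i-1} H_0`. -/
abbrev FCrystal.ConjGr (E : FCrystal p k n H) (φ : FrobLift p k n) (i : ℕ) : Type u :=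
  E.conjFil φ i ⧸ (prev (E.conjFil φ) i).submoduleOf (E.conjFil φ i)

/-- An ordinary `F`-crystal: the `gr_i H_0` are free over `A_0`, and the conjugate filtration and
the Hodge filtration on `H_0` are opposite.  (Both filtrations are independent of the lift of
Frobenius by which they are computed.) -/
def FCrystal.IsOrdinary (E : FCrystal p k n H) : Prop :=
  ∃ φ : FrobLift p k n,
    (∀ i, ∃ r : ℕ, Nonempty (E.ConjGr φ i ≃ₗ[A p k n] (Fin r → A₀ p k n))) ∧
    ∀ i, IsCompl (E.conjFil φ i) (E.hodgeFil φ (i + 1))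

/-- `H` is of level `≤ N`. -/
def FCrystal.HasLevelLE (E : FCrystal p k n H) (N : ℕ) : Prop :=
  ∃ φ : FrobLift p k n, E.conjFil φ N = ⊤ ∧ E.hodgeFil φ (N + 1) = ⊥

/-- The filtration `0 = U_{-1} ⊂ U_0 ⊂ U_1 ⊂ …` of `H` by sub-`F`-crystals such that
`U_i ⊗ A_0 = Fil_i H_0` and `U_i / U_{i-1} ≃ V_i(-i)` with `V_i` a unit `F`-crystal. -/
structure FCrystal.IsSlopeFiltration (E : FCrystal p k n H)
    (U : ℕ → Submodule (A p k n) H) : Prop where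
  free : ∀ i, Module.Free (A p k n) (U i)
  mono : ∀ i, U i ≤ U (i + 1)
  D_mem : ∀ i j, ∀ x ∈ U i, E.D j x ∈ U i
  F_mem : ∀ i φ, ∀ x ∈ U i, E.F φ x ∈ U i
  red_eq : ∀ φ i, red (U i) = E.conjFil φ i
  saturated : ∀ i (x : H), (p : A p k n) • x ∈ U i → x ∈ U i
  graded : ∀ i, ∃ (V : Type u) (_ : AddCommGroup V) (_ : Module (A p k n) V)
    (E' : FCrystal p k n V) (π : U i →ₗ[A p k n] V),
    E'.IsUnit ∧ Function.Surjective π ∧ LinearMap.ker π = (prev U i).submoduleOf (U i) ∧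
    (∀ j (x : U i), π ⟨E.D j x, D_mem i j x x.2⟩ = E'.D j (π x)) ∧
    ∀ φ (x : U i), π ⟨E.F φ x, F_mem i φ x x.2⟩ = ((p : A p k n) ^ i) • E'.F φ (π x)

end FCrystal

/-- A Hodge `F`-crystal: an `F`-crystal with a decreasing filtration by free submodules which
lifts the Hodge filtration of `H_0` (`Fil^i H ⊗ A_0 = Fil^i H_0`, that is, `Fil^i H / p Fil^i H`
maps isomorphically onto `Fil^i H_0`) and satisfies Griffiths transversality. -/
structure HodgeFCrystal (p : ℕ) [Fact p.Prime] (k : Type v) [Field k] [CharP k p] (n : ℕ)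
    (H : Type u) [AddCommGroup H] [Module (A p k n) H] extends FCrystal p k n H where
  Fil : ℕ → Submodule (A p k n) H
  fil_free : ∀ i, Module.Free (A p k n) (Fil i)
  fil_zero : Fil 0 = ⊤
  fil_anti : ∀ i, Fil (i + 1) ≤ Fil i
  fil_red : ∃ φ : FrobLift p k n, ∀ i, red (Fil i) = toFCrystal.hodgeFil φ i
  fil_saturated : ∀ i (x : H), (p : A p k n) • x ∈ Fil i → x ∈ Fil i
  transversal : ∀ i j, ∀ x ∈ Fil (i + 1), D j x ∈ Fil i

section Hodge

variable {p : ℕ} [Fact p.Prime] {k : Type v} [Field k] [CharP k p] {n : ℕ}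
  {H : Type u} [AddCommGroup H] [Module (A p k n) H]

/-- Divisibility of a Hodge `F`-crystal of level `≤ N`: for some lift of Frobenius `φ`,
`F(φ)φ^* Fil^i H ⊂ p^i H` for `0 ≤ i ≤ N`. -/
def HodgeFCrystal.IsDivisible (E : HodgeFCrystal p k n H) (N : ℕ) : Prop :=
  ∃ φ : FrobLift p k n, ∀ i ≤ N, ∀ x ∈ E.Fil i,
    E.F φ x ∈ pPow p k n H i

/-- `gr^i H = Fil^i H / Fil^{i+1} H`.  As `H = U_i ⊕ Fil^{i+1} H`, it is the isomorphic image of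
`H^i = U_i ∩ Fil^i H`. -/
abbrev HodgeFCrystal.Gr (E : HodgeFCrystal p k n H) (i : ℕ) : Type u :=
  E.Fil i ⧸ (E.Fil (i + 1)).submoduleOf (E.Fil i)

/-- The `A`-linear map `Fil^{i+1} H → gr^i H` induced by `D_j`. -/
def HodgeFCrystal.grD (E : HodgeFCrystal p k n H) (i : ℕ) (j : Fin n) :
    E.Fil (i + 1) →ₗ[A p k n] E.Gr i where
  toFun x := Submodule.Quotient.mk ⟨E.D j x, E.transversal i j x x.2⟩
  map_add' x y := by
    rw [← Submodule.Quotient.mk_add]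
    congr 1
    ext
    simp
  map_smul' a x := by
    rw [RingHom.id_apply, ← Submodule.Quotient.mk_smul, Submodule.Quotient.eq]
    change E.D j (a • (x : H)) - a • E.D j x ∈ E.Fil (i + 1)
    rw [E.leibniz, add_sub_cancel_right]
    exact (E.Fil (i + 1)).smul_mem _ x.2

end Hodge

/-! ### Ordinary CY3 crystals -/

/-- An ordinary CY3 crystal over `A_0`: a divisible ordinary Hodge `F`-crystal of level `3`
with `rank H^0 = rank H^3 = 1` and `rank H^1 = rank H^2 = h`, with a non-degenerate (perfect)
alternating form which is compatible with `∇` and Frobenius and satisfies the Riemann bilinear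
relations `(Fil^3)^⊥ = Fil^1`, `(Fil^2)^⊥ = Fil^2`. -/
structure OrdinaryCY3Crystal (p : ℕ) [Fact p.Prime] (k : Type v) [Field k] [CharP k p] (n h : ℕ)
    (H : Type u) [AddCommGroup H] [Module (A p k n) H] extends HodgeFCrystal p k n H where
  ordinary : toFCrystal.IsOrdinary
  level : toFCrystal.HasLevelLE 3
  divisible : toHodgeFCrystal.IsDivisible 3
  rank_zero : Module.finrank (A p k n) (toHodgeFCrystal.Gr 0) = 1
  rank_one : Module.finrank (A p k n) (toHodgeFCrystal.Gr 1) = h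
  rank_two : Module.finrank (A p k n) (toHodgeFCrystal.Gr 2) = h
  rank_three : Module.finrank (A p k n) (toHodgeFCrystal.Gr 3) = 1
  form : H →ₗ[A p k n] H →ₗ[A p k n] A p k n
  alternating : ∀ x, form x x = 0
  perfect : Function.Bijective form
  form_D : ∀ j x y,
    form (D j x) y + form x (D j y) = MvPowerSeries.pderiv (W p k) j (form x y)
  form_F : ∀ φ x y,
    form (F φ x) (F φ y) = (p : A p k n) ^ 3 * φ.toRingHom (form x y)
  riemann_three : ∀ x, x ∈ Fil 1 ↔ ∀ y ∈ Fil 3, form x y = 0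
  riemann_two : ∀ x, x ∈ Fil 2 ↔ ∀ y ∈ Fil 2, form x y = 0

/-- The index set of an adapted basis `e_0; e_1, …, e_h; e_{h+1}, …, e_{2h}; e_{2h+1}`. -/
abbrev Idx (h : ℕ) : Type := Unit ⊕ Fin h ⊕ Fin h ⊕ Unit

namespace Idx

variable {h : ℕ}

/-- The index `0`. -/
abbrev i0 : Idx h := Sum.inl ()

/-- The indices `1, …, h`. -/
abbrev i1 (i : Fin h) : Idx h := Sum.inr (Sum.inl i)

/-- The indices `h+1, …, 2h`. -/
abbrev i2 (i : Fin h) : Idx h := Sum.inr (Sum.inr (Sum.inl i))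

/-- The index `2h+1`. -/
abbrev i3 : Idx h := Sum.inr (Sum.inr (Sum.inr ()))

/-- The degree `i` of the summand `H^i` to which a basis vector belongs. -/
def deg : Idx h → ℕ
  | Sum.inl _ => 0
  | Sum.inr (Sum.inl _) => 1
  | Sum.inr (Sum.inr (Sum.inl _)) => 2
  | Sum.inr (Sum.inr (Sum.inr _)) => 3

end Idx

/-- The Gram matrix with block rows `(0,0,0,-1)`, `(0,0,I,0)`, `(0,-I,0,0)`, `(1,0,0,0)`. -/
def gram (R : Type*) [CommRing R] (h : ℕ) : Matrix (Idx h) (Idx h) R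
  | Sum.inl _, Sum.inr (Sum.inr (Sum.inr _)) => -1
  | Sum.inr (Sum.inl i), Sum.inr (Sum.inr (Sum.inl j)) => if i = j then 1 else 0
  | Sum.inr (Sum.inr (Sum.inl i)), Sum.inr (Sum.inl j) => if i = j then -1 else 0
  | Sum.inr (Sum.inr (Sum.inr _)), Sum.inl _ => 1
  | _, _ => 0

/-- The block matrix with rows `(1, τ₂₃^*, 0, 0)`, `(0, I, 0, 0)`, `(0, 0, I, τ₂₃)`,
`(0, 0, 0, 1)`. -/
def leftFactor {R : Type*} [CommRing R] {h : ℕ} (τ23 : Fin h → R) :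
    Matrix (Idx h) (Idx h) R
  | Sum.inl _, Sum.inl _ => 1
  | Sum.inl _, Sum.inr (Sum.inl j) => τ23 j
  | Sum.inr (Sum.inl i), Sum.inr (Sum.inl j) => if i = j then 1 else 0
  | Sum.inr (Sum.inr (Sum.inl i)), Sum.inr (Sum.inr (Sum.inl j)) => if i = j then 1 else 0
  | Sum.inr (Sum.inr (Sum.inl i)), Sum.inr (Sum.inr (Sum.inr _)) => τ23 i
  | Sum.inr (Sum.inr (Sum.inr _)), Sum.inr (Sum.inr (Sum.inr _)) => 1
  | _, _ => 0

/-- The block matrix with rows `(1, 0, -τ₁₃^*, Z)`, `(0, I, τ₁₂, τ₁₃)`, `(0, 0, I, 0)`,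
`(0, 0, 0, 1)`. -/
def rightFactor {R : Type*} [CommRing R] {h : ℕ} (τ13 : Fin h → R)
    (τ12 : Matrix (Fin h) (Fin h) R) (Z : R) : Matrix (Idx h) (Idx h) R
  | Sum.inl _, Sum.inl _ => 1
  | Sum.inl _, Sum.inr (Sum.inr (Sum.inl j)) => -τ13 j
  | Sum.inl _, Sum.inr (Sum.inr (Sum.inr _)) => Z
  | Sum.inr (Sum.inl i), Sum.inr (Sum.inl j) => if i = j then 1 else 0
  | Sum.inr (Sum.inl i), Sum.inr (Sum.inr (Sum.inl j)) => τ12 i j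
  | Sum.inr (Sum.inl i), Sum.inr (Sum.inr (Sum.inr _)) => τ13 i
  | Sum.inr (Sum.inr (Sum.inl i)), Sum.inr (Sum.inr (Sum.inl j)) => if i = j then 1 else 0
  | Sum.inr (Sum.inr (Sum.inr _)), Sum.inr (Sum.inr (Sum.inr _)) => 1
  | _, _ => 0

section CY3

variable {p : ℕ} [Fact p.Prime] {k : Type v} [Field k] [CharP k p] {n h : ℕ}
  {H : Type u} [AddCommGroup H] [Module (A p k n) H]

/-- The map `T_{A/W} → Hom(H^3, H^2)`, `∂/∂t_j ↦ D_j`, induced by `∇`; here `H^3 = Fil^3 H`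
and `H^2 ≃ Fil^2 H / Fil^3 H`.  It is the `A`-linear map sending `(v_j)`, that is the derivation
`∑ v_j ∂/∂t_j`, to the map induced by `∑ v_j D_j`. -/
def OrdinaryCY3Crystal.kodairaSpencer (E : OrdinaryCY3Crystal p k n h H) :
    (Fin n → A p k n) →ₗ[A p k n] (E.Fil 3 →ₗ[A p k n] E.Gr 2) :=
  Fintype.linearCombination (A p k n) (E.grD 2)

/-- An adapted basis `e_0, …, e_{2h+1}` together with a matrix `𝒯` over `K[[t_1, …, t_n]]`:
* `e_0 ∈ H^0`, `e_1, …, e_h ∈ H^1`, `e_{h+1}, …, e_{2h} ∈ H^2`, `e_{2h+1} ∈ H^3`, where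
  `H^i = U_i ∩ Fil^i H`;
* the Gram matrix of the form is `gram`;
* `𝒯 = leftFactor τ₂₃ * rightFactor τ₁₃ τ₁₂ Z`;
* the matrix of `∇` is `𝒯⁻¹ d𝒯`;
* for every lift of Frobenius `ψ` the matrix of `F(ψ)ψ^*` is `𝒯⁻¹ P ψ(𝒯)`, where
  `P = diag(1, p I, p² I, p³)`.
Column `b` of the matrix of a map holds the coordinates of the image of `e_b`. -/
structure Frame [PerfectRing k p] (E : OrdinaryCY3Crystal p k n h H) where
  U : ℕ → Submodule (A p k n) H
  slope : E.IsSlopeFiltration U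
  e : Module.Basis (Idx h) (A p k n) H
  e_mem : ∀ a, e a ∈ U a.deg ⊓ E.Fil a.deg
  e_gram : ∀ a b, E.form (e a) (e b) = gram (A p k n) h a b
  τ23 : Fin h → KA p k n
  τ13 : Fin h → KA p k n
  τ12 : Matrix (Fin h) (Fin h) (KA p k n)
  Z : KA p k n
  T : Matrix (Idx h) (Idx h) (KA p k n)
  T_eq : T = leftFactor τ23 * rightFactor τ13 τ12 Z
  conn : ∀ j : Fin n,
    (Matrix.of fun a b => incl p k n (e.repr (E.D j (e b)) a)) =
      T⁻¹ * T.map (MvPowerSeries.pderiv (K p k) j)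
  frob : ∀ ψ : FrobLift p k n, ∃ ψT : Matrix (Idx h) (Idx h) (KA p k n),
    (∀ a b, ψ.MapsTo (T a b) (ψT a b)) ∧
    (Matrix.of fun a b => incl p k n (e.repr (E.F ψ (e b)) a)) =
      T⁻¹ * Matrix.diagonal (fun a : Idx h => (p : KA p k n) ^ a.deg) * ψT

end CY3

end CY3

end

set_option linter.unusedSectionVars false

/-! Integrality for a given frame. In the last column of `𝒯⁻¹ d𝒯` the block of degree 2 is `dτ₂₃`,
and in the last column of the matrix of `F(ψ)` it is `p²(ψ(τ₂₃) - pτ₂₃)`. Since the last basis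
vector lies in `Fil³`, divisibility makes its whole Frobenius column a multiple of `p³`; hence
`ψ(τ_i) - pτ_i ∈ pA` for every lift `ψ`. For `ψ : t_j ↦ t_j^p`, Dwork's criterion
(`exists_incl_of_dwork`, `exists_exp_integral`) turns this into `q_i = exp(τ_i) ∈ A`. The
Kodaira–Spencer matrix is the Jacobian of the `τ_i`, and `dq_i = q_i dτ_i`, so the Jacobian of the
`q_i - 1` is invertible. Therefore `p, q_1 - 1, …` generate the maximal ideal, and `t_i ↦ q_i - 1`
extends to a surjective endomorphism of the Noetherian ring `A`, that is, to an automorphism. In the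
new coordinates the canonical lift is `x_i ↦ (1 + x_i)^p - 1`.

For the canonical lift `φ`, `exp(φ(τ_i) - pτ_i) = φ(q_i) q_i^{-p} = 1` with exponent in `pA`, where
`exp` is injective, so `φ(τ_i) = pτ_i`. The degree 2 block of the last column then vanishes, the
entry in row 0 simplifies to `φ(Z) - p³Z`, and it is divisible by `p³` like the rest of the column.

Existence of frames takes most of the work. As `p ≥ 5`, the Taylor coefficients `∏ (φ(t_j) -
ψ(t_j))^{m_j} / m_j!` are divisible by `p^min(|m|,3)` (`taylorCoeff_dvd`). So divisibility and the
filtrations on `H₀` do not depend on the lift in the range needed. A generator `v` of `Fil³`, its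
derivatives `D_j v` and a dual family form a basis adapted to the Hodge filtration
(`exists_isAdapted`). The parts of slope `≤ i` are obtained for the lift `t_j ↦ t_j^p` as fixed
points of a graph transform (`exists_slopeSub`). Comparison of slopes makes them nested, stable
under `∇` and orthogonal to each other in the right range. Intersecting with the Hodge filtration
gives a bigraded basis, and Lang's theorem over `W[[t]]` makes Frobenius standard on the graded
pieces (`exists_good_basis`).

The matrix `𝒯` is the unitriangular solution of `𝒯 M = P ψ(𝒯)`, where `M` is the matrix of the
standard Frobenius and `P = diag(1, p, p², p³)`. Its constant terms come from a `p`-adic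
contraction, the rest from a `t`-adic one, since `ψ` multiplies degrees by `p` (`exists_isPeriod`).
Uniqueness for such equations shows that the rows are horizontal (`row_D`) and that `𝒯` preserves
the Gram matrix (`gram_eq`); the latter forces the product shape (`eq_periodMatrix`). The
coefficients of `𝒯` have denominators growing only logarithmically, so `φ(𝒯)` converges for every
lift, and the Taylor formula carries the Frobenius equation from the standard lift to `φ`
(`mapsTo_of_functional`). -/

noncomputable section

namespace CY3

open Finset

/-! ### The lattices `p^r W` in `K`, `p`-adic limits and contractions. -/

section Scalars

variable {p : ℕ} [Fact p.Prime] {k : Type v} [Field k]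

/-- The lattice `p^r W` in `K`. -/
def lat (p : ℕ) [Fact p.Prime] (k : Type v) [Field k] (r : ℕ) : Submodule (W p k) (K p k) :=
  Submodule.span (W p k) {(p : K p k) ^ r}

theorem mem_lat {r : ℕ} {x : K p k} :
    x ∈ lat p k r ↔ ∃ w : W p k, x = algebraMap (W p k) (K p k) ((p : W p k) ^ r * w) := by
  rw [lat, Submodule.mem_span_singleton]
  constructor
  · rintro ⟨w, rfl⟩
    exact ⟨w, by rw [Algebra.smul_def, map_mul, map_pow, map_natCast, mul_comm]⟩
  · rintro ⟨w, rfl⟩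
    exact ⟨w, by rw [Algebra.smul_def, map_mul, map_pow, map_natCast, mul_comm]⟩

theorem algebraMap_mem_lat (w : W p k) : algebraMap (W p k) (K p k) w ∈ lat p k 0 :=
  mem_lat.2 ⟨w, by simp⟩

theorem mem_lat_zero {x : K p k} : x ∈ lat p k 0 ↔ ∃ w, algebraMap (W p k) (K p k) w = x := by
  rw [mem_lat]
  simp [eq_comm]

theorem lat_anti {r s : ℕ} (h : r ≤ s) : lat p k s ≤ lat p k r := by
  intro x hx
  obtain ⟨w, rfl⟩ := mem_lat.1 hx
  exact mem_lat.2 ⟨(p : W p k) ^ (s - r) * w, by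
    rw [← mul_assoc, ← pow_add, Nat.add_sub_cancel' h]⟩

theorem mul_mem_lat {r s : ℕ} {x y : K p k} (hx : x ∈ lat p k r) (hy : y ∈ lat p k s) :
    x * y ∈ lat p k (r + s) := by
  obtain ⟨w, rfl⟩ := mem_lat.1 hx
  obtain ⟨w', rfl⟩ := mem_lat.1 hy
  exact mem_lat.2 ⟨w * w', by rw [← map_mul]; congr 1; ring⟩

theorem p_pow_mem_lat (r : ℕ) : (p : K p k) ^ r ∈ lat p k r :=
  Submodule.subset_span rfl

theorem one_mem_lat : (1 : K p k) ∈ lat p k 0 := by simpa using p_pow_mem_lat (p := p) (k := k) 0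

theorem natCast_mem_lat (m : ℕ) : (m : K p k) ∈ lat p k 0 := by
  simpa using algebraMap_mem_lat (p := p) (k := k) (m : W p k)

theorem mul_mem_lat_of_integral {r : ℕ} {x y : K p k} (hx : x ∈ lat p k 0) (hy : y ∈ lat p k r) :
    x * y ∈ lat p k r := by
  simpa using mul_mem_lat hx hy

theorem algebraMap_mem_lat_iff {r : ℕ} {w : W p k} :
    algebraMap (W p k) (K p k) w ∈ lat p k r ↔ (p : W p k) ^ r ∣ w := by
  rw [mem_lat]
  constructor
  · rintro ⟨v, hv⟩
    exact ⟨v, IsFractionRing.injective (W p k) (K p k) hv⟩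
  · rintro ⟨v, rfl⟩
    exact ⟨v, rfl⟩

variable [CharP k p]

theorem p_ne_zero_W : (p : W p k) ≠ 0 := by
  exact WittVector.p_nonzero p k

theorem p_ne_zero_K : (p : K p k) ≠ 0 := by
  rw [← map_natCast (algebraMap (W p k) (K p k)) p]
  exact (map_ne_zero_iff _ (IsFractionRing.injective (W p k) (K p k))).2 p_ne_zero_W

/-- Up to a unit of `W`, a positive integer is a power of `p`. -/
theorem natCast_eq_pow_mul_unit {m : ℕ} (hm : m ≠ 0) :
    ∃ u : (W p k)ˣ, (m : W p k) = (p : W p k) ^ padicValNat p m * u := by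
  obtain ⟨c, hc⟩ := pow_padicValNat_dvd (p := p) (n := m)
  have hcop : ¬ p ∣ c := by
    rintro ⟨d, rfl⟩
    refine pow_succ_padicValNat_not_dvd (p := p) hm ⟨d, ?_⟩
    rw [pow_succ, mul_assoc, ← hc]
  have hu : IsUnit (c : W p k) := by
    refine WittVector.isUnit_of_coeff_zero_ne_zero _ ?_
    have : (WittVector.constantCoeff (c : W p k) : k) = c := map_natCast _ c
    change WittVector.constantCoeff (c : W p k) ≠ 0
    rw [this, Ne, CharP.cast_eq_zero_iff k p]
    exact hcop
  exact ⟨hu.unit, by rw [IsUnit.unit_spec]; exact_mod_cast congrArg (Nat.cast (R := W p k)) hc⟩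

instance : CharZero (W p k) :=
  charZero_of_inj_zero fun m hm => by
    by_contra h
    obtain ⟨u, hu⟩ := natCast_eq_pow_mul_unit (p := p) (k := k) h
    rw [hu] at hm
    exact mul_ne_zero (pow_ne_zero _ p_ne_zero_W) u.ne_zero hm

instance : CharZero (K p k) :=
  charZero_of_injective_algebraMap (IsFractionRing.injective (W p k) (K p k))

theorem p_pow_mul_mem_lat {r s : ℕ} {x : K p k} :
    (p : K p k) ^ s * x ∈ lat p k (r + s) ↔ x ∈ lat p k r := by
  constructor
  · intro h
    obtain ⟨w, hw⟩ := mem_lat.1 h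
    refine mem_lat.2 ⟨w, mul_left_cancel₀ (pow_ne_zero s p_ne_zero_K) ?_⟩
    rw [hw, pow_add, mul_comm ((p : W p k) ^ r), mul_assoc, map_mul, map_pow, map_natCast]
  · intro h
    rw [add_comm]
    exact mul_mem_lat (p_pow_mem_lat s) h

theorem p_mul_mem_lat {r : ℕ} {x : K p k} :
    (p : K p k) * x ∈ lat p k (r + 1) ↔ x ∈ lat p k r := by
  simpa using p_pow_mul_mem_lat (p := p) (k := k) (r := r) (s := 1) (x := x)

variable [PerfectRing k p]

theorem W_eq_zero_of_forall_dvd {w : W p k} (h : ∀ r : ℕ, (p : W p k) ^ r ∣ w) : w = 0 := by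
  refine (IsHausdorff.haus (I := Ideal.span {(p : W p k)}) inferInstance w) fun r => ?_
  rw [SModEq.zero, smul_eq_mul, Ideal.mul_top, Ideal.span_singleton_pow,
    Ideal.mem_span_singleton]
  exact h r

/-- Every nonzero element of `W` is a power of `p` times a unit, so a denominator is cleared by a
power of `p`. -/
theorem exists_pow_mul_mem_lat (x : K p k) (s : ℕ) : ∃ a : ℕ, (p : K p k) ^ a * x ∈ lat p k s := by
  obtain ⟨w, d, hd, rfl⟩ := IsFractionRing.div_surjective (A := W p k) x
  obtain ⟨m, u, rfl⟩ := WittVector.exists_eq_pow_p_mul' d (nonZeroDivisors.ne_zero hd)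
  refine ⟨m + s, mem_lat.2 ⟨((u⁻¹ : (W p k)ˣ) : W p k) * w, ?_⟩⟩
  have hu : algebraMap (W p k) (K p k) (u : W p k) * algebraMap (W p k) (K p k)
      ((u⁻¹ : (W p k)ˣ) : W p k) = 1 := by rw [← map_mul]; simp
  have hu0 : algebraMap (W p k) (K p k) (u : W p k) ≠ 0 := left_ne_zero_of_mul_eq_one hu
  have hp := p_ne_zero_K (p := p) (k := k)
  simp only [map_mul, map_pow, map_natCast]
  rw [eq_inv_of_mul_eq_one_right hu]
  field_simp
  ring

theorem K_eq_zero_of_forall_mem_lat {x : K p k} (h : ∀ r, x ∈ lat p k r) : x = 0 := by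
  obtain ⟨w, rfl⟩ := mem_lat_zero.1 (h 0)
  rw [W_eq_zero_of_forall_dvd fun r => algebraMap_mem_lat_iff.1 (h r), map_zero]

/-- Limits of `p`-adic Cauchy sequences in `W`. -/
theorem W_exists_limit (f : ℕ → W p k) (hf : ∀ r, (p : W p k) ^ r ∣ f (r + 1) - f r) :
    ∃ L : W p k, ∀ r, (p : W p k) ^ r ∣ L - f r := by
  have key : ∀ r s, r ≤ s → (p : W p k) ^ r ∣ f s - f r := by
    intro r s h
    induction s, h using Nat.le_induction with
    | base => simp
    | succ s hs ih =>
      have := dvd_add ((pow_dvd_pow _ hs).trans (hf s)) ih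
      simpa using this
  obtain ⟨L, hL⟩ := IsPrecomplete.prec (I := Ideal.span {(p : W p k)}) (M := W p k)
    inferInstance (f := f) (fun {m n} hmn => by
      rw [SModEq.sub_mem, smul_eq_mul, Ideal.mul_top, Ideal.span_singleton_pow,
        Ideal.mem_span_singleton, ← neg_sub, dvd_neg]
      exact key m n hmn)
  refine ⟨L, fun r => ?_⟩
  have := hL r
  rw [SModEq.sub_mem, smul_eq_mul, Ideal.mul_top, Ideal.span_singleton_pow,
    Ideal.mem_span_singleton, ← neg_sub, dvd_neg] at this
  exact this

/-- A `p`-adic contraction of `W^ι` has a fixed point. -/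
theorem exists_fixed_point {ι : Type*} (Φ : (ι → W p k) → ι → W p k)
    (hΦ : ∀ s x y, (∀ i, (p : W p k) ^ s ∣ x i - y i) →
      ∀ i, (p : W p k) ^ (s + 1) ∣ Φ x i - Φ y i) : ∃ x, Φ x = x := by
  -- The iterates of `0` start with an empty congruence modulo `p^0`, and every application of `Φ`
  -- gains a factor `p`; so they form a Cauchy sequence.
  have h1 : ∀ r i, (p : W p k) ^ r ∣ (Φ^[r + 1] 0) i - (Φ^[r] 0) i := by
    intro r
    induction r with
    | zero => simp
    | succ r ih =>
      intro i
      rw [Function.iterate_succ_apply' Φ (r + 1), Function.iterate_succ_apply' Φ r]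
      rw [Function.iterate_succ_apply'] at ih
      exact hΦ r _ _ ih i
  choose x hx using fun i => W_exists_limit (fun r => (Φ^[r] 0) i) fun r => h1 r i
  refine ⟨x, funext fun i => sub_eq_zero.1 (W_eq_zero_of_forall_dvd fun r => ?_)⟩
  have h2 := hΦ r x (Φ^[r] 0) (fun i => hx i r) i
  rw [← Function.iterate_succ_apply' Φ r] at h2
  have h3 := dvd_sub h2 (hx i (r + 1))
  rw [sub_sub_sub_cancel_right] at h3
  exact (pow_dvd_pow _ (Nat.le_succ r)).trans h3

/-- Over a perfect field the Witt vector Frobenius is an automorphism fixing `p`, so it preserves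
divisibility in both directions. -/
theorem p_pow_dvd_frobenius {r : ℕ} {w : W p k} :
    (p : W p k) ^ r ∣ WittVector.frobenius w ↔ (p : W p k) ^ r ∣ w := by
  constructor
  · rintro ⟨v, hv⟩
    refine ⟨(WittVector.frobeniusEquiv p k).symm v, (WittVector.frobeniusEquiv p k).injective ?_⟩
    rw [map_mul, map_pow, map_natCast, RingEquiv.apply_symm_apply]
    exact hv
  · rintro ⟨v, rfl⟩
    exact ⟨WittVector.frobenius v, by rw [map_mul, map_pow, map_natCast]⟩

/-- The Frobenius of `K`, as a ring homomorphism. -/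
abbrev sigK (p : ℕ) [Fact p.Prime] (k : Type v) [Field k] [CharP k p] [PerfectRing k p] :
    K p k →+* K p k := (WittVector.FractionRing.frobenius p k : K p k →+* K p k)

theorem sigK_algebraMap (w : W p k) : sigK p k (algebraMap (W p k) (K p k) w) =
    algebraMap (W p k) (K p k) (WittVector.frobenius w) := by
  simp [sigK, WittVector.FractionRing.frobenius]

theorem sigK_mem_lat {r : ℕ} {x : K p k} : sigK p k x ∈ lat p k r ↔ x ∈ lat p k r := by
  constructor
  · intro h
    obtain ⟨w, hw⟩ := mem_lat.1 h
    refine mem_lat.2 ⟨(WittVector.frobeniusEquiv p k).symm w, (sigK p k).injective ?_⟩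
    rw [hw, sigK_algebraMap]
    congr 1
    rw [map_mul, map_pow, map_natCast]
    congr 1
    exact ((WittVector.frobeniusEquiv p k).apply_symm_apply w).symm
  · intro h
    obtain ⟨w, rfl⟩ := mem_lat.1 h
    rw [sigK_algebraMap, map_mul, map_pow, map_natCast]
    exact mem_lat.2 ⟨_, rfl⟩

end Scalars

/-! ### Unconditional `p`-adic sums in `K`: completeness, interchange of summation, products. -/

section Sums

variable {p : ℕ} [Fact p.Prime] {k : Type v} [Field k]

/-- `∑ f = g` in `K`, unconditionally for the `p`-adic topology. -/
def HS {ι : Type*} (f : ι → K p k) (g : K p k) : Prop :=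
  ∀ r : ℕ, ∃ S : Finset ι, ∀ S' : Finset ι, S ⊆ S' → g - ∑ i ∈ S', f i ∈ lat p k r

/-- The family `f` tends to zero along the cofinite filter. -/
def Null {ι : Type*} (f : ι → K p k) : Prop := ∀ r : ℕ, {i | f i ∉ lat p k r}.Finite

theorem padicHasSum_iff {n : ℕ} {ι : Type*} {f : ι → KA p k n} {g : KA p k n} :
    PadicHasSum f g ↔
      ∀ d, HS (fun i => MvPowerSeries.coeff d (f i)) (MvPowerSeries.coeff d g) := by
  simp only [PadicHasSum, HS, mem_lat]

variable {ι κ : Type*} {f f' : ι → K p k} {g g' : K p k}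

theorem HS.add (h : HS f g) (h' : HS f' g') : HS (fun i => f i + f' i) (g + g') := by
  classical
  intro r
  obtain ⟨S, hS⟩ := h r
  obtain ⟨S', hS'⟩ := h' r
  refine ⟨S ∪ S', fun S'' hS'' => ?_⟩
  rw [Finset.sum_add_distrib, add_sub_add_comm]
  exact add_mem (hS _ (union_subset_left hS'')) (hS' _ (union_subset_right hS''))

theorem hs_of_finite (S : Finset ι) (hf : ∀ i ∉ S, f i = 0) : HS f (∑ i ∈ S, f i) := by
  intro r
  refine ⟨S, fun S' hS' => ?_⟩
  rw [Finset.sum_subset hS' fun i _ hi => hf i hi, sub_self]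
  exact zero_mem _

theorem hs_zero : HS (fun _ : ι => (0 : K p k)) 0 := by
  simpa using hs_of_finite (f := fun _ : ι => (0 : K p k)) ∅ (by simp)

theorem hs_single [DecidableEq ι] (i : ι) (hf : ∀ j ≠ i, f j = 0) : HS f (f i) := by
  simpa using hs_of_finite {i} (f := f) (by simpa using hf)

theorem HS.sum (s : Finset κ) {F : κ → ι → K p k} {G : κ → K p k} (h : ∀ j ∈ s, HS (F j) (G j)) :
    HS (fun i => ∑ j ∈ s, F j i) (∑ j ∈ s, G j) := by
  classical
  induction s using Finset.induction_on with
  | empty => simpa using hs_zero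
  | insert a s ha ih =>
    simp only [Finset.sum_insert ha]
    exact (h a (by simp)).add (ih fun j hj => h j (by simp [hj]))

/-- A single term outside `S` is the difference of two partial sums that are both close to the
limit. -/
theorem HS.null (h : HS f g) : Null f := by
  classical
  intro r
  obtain ⟨S, hS⟩ := h r
  refine S.finite_toSet.subset fun i hi => ?_
  by_contra hiS
  refine hi ?_
  have h1 := hS S subset_rfl
  have h2 := hS (insert i S) (subset_insert _ _)
  rw [Finset.sum_insert hiS] at h2
  simpa using sub_mem h1 h2

theorem sum_sub_sum_mem {r : ℕ} {S S' : Finset ι} (h : S ⊆ S') (hf : ∀ i ∉ S, f i ∈ lat p k r) :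
    ∑ i ∈ S', f i - ∑ i ∈ S, f i ∈ lat p k r := by
  classical
  rw [← Finset.sum_sdiff h, add_sub_cancel_right]
  exact sum_mem fun i hi => hf i (Finset.mem_sdiff.1 hi).2

section Domain

variable [CharP k p] [PerfectRing k p]

theorem HS.unique (h : HS f g) (h' : HS f g') : g = g' := by
  classical
  refine sub_eq_zero.1 (K_eq_zero_of_forall_mem_lat fun r => ?_)
  obtain ⟨S, hS⟩ := h r
  obtain ⟨S', hS'⟩ := h' r
  simpa using sub_mem (hS (S ∪ S') subset_union_left) (hS' (S ∪ S') subset_union_right)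

/-- Multiplication by `c` may lose a fixed number `a` of powers of `p`; asking for precision `p^a`
at the start compensates for a denominator, and precision `p^r` is kept. -/
theorem HS.mul_left (h : HS f g) (c : K p k) : HS (fun i => c * f i) (c * g) := by
  intro r
  obtain ⟨a, ha⟩ := exists_pow_mul_mem_lat c r
  obtain ⟨S, hS⟩ := h a
  refine ⟨S, fun S' hS' => ?_⟩
  rw [← Finset.mul_sum, ← mul_sub, ← p_pow_mul_mem_lat (s := a), ← mul_assoc]
  exact mul_mem_lat ha (hS S' hS')

theorem HS.map_sigK (h : HS f g) : HS (fun i => sigK p k (f i)) (sigK p k g) := by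
  intro r
  obtain ⟨S, hS⟩ := h r
  refine ⟨S, fun S' hS' => ?_⟩
  rw [← map_sum, ← map_sub, sigK_mem_lat]
  exact hS S' hS'

theorem HS.sub_sum_mem (h : HS f g) {r : ℕ} {S : Finset ι} (hf : ∀ i ∉ S, f i ∈ lat p k r) :
    g - ∑ i ∈ S, f i ∈ lat p k r := by
  classical
  obtain ⟨S', hS'⟩ := h r
  have := add_mem (hS' (S ∪ S') subset_union_right)
    (sum_sub_sum_mem (subset_union_left (s₂ := S')) hf)
  simpa using this

theorem HS.mem_lat (h : HS f g) {r : ℕ} (hf : ∀ i, f i ∈ lat p k r) : g ∈ lat p k r := by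
  simpa using h.sub_sum_mem (S := ∅) fun i _ => hf i

/-- A null family is summable. -/
theorem Null.exists_hs (h : Null f) : ∃ g, HS f g := by
  classical
  choose S hS using fun r => (h r).exists_finset
  have hmem : ∀ r i, i ∉ S r → f i ∈ lat p k r := fun r i hi => by
    by_contra h'
    exact hi ((hS r i).2 h')
  have hsub : ∀ r s, r ≤ s → S r ⊆ S s := fun r s hrs i hi =>
    (hS s i).2 fun h' => (hS r i).1 hi (lat_anti hrs h')
  have h1 : ∀ r, ∑ i ∈ S (r + 1), f i - ∑ i ∈ S r, f i ∈ lat p k r := fun r =>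
    sum_sub_sum_mem (hsub r _ r.le_succ) (hmem r)
  -- The partial sums over the exceptional sets `S r` need not be integral, but they differ from the
  -- one over `S 0` by elements of `W`. The limit is taken for these differences, where completeness
  -- of `W` applies.
  have h0 : ∀ r, ∃ w : W p k,
      algebraMap (W p k) (K p k) w = ∑ i ∈ S r, f i - ∑ i ∈ S 0, f i := fun r =>
    mem_lat_zero.1 (sum_sub_sum_mem (hsub 0 r (Nat.zero_le _)) (hmem 0))
  choose w hw using h0
  obtain ⟨L, hL⟩ := W_exists_limit w fun r => by
    rw [← algebraMap_mem_lat_iff, map_sub, hw, hw, sub_sub_sub_cancel_right]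
    exact h1 r
  refine ⟨algebraMap (W p k) (K p k) L + ∑ i ∈ S 0, f i, fun r => ⟨S r, fun S' hS' => ?_⟩⟩
  have h2 := algebraMap_mem_lat_iff.2 (hL r)
  rw [map_sub, hw] at h2
  have h3 := sub_mem h2 (sum_sub_sum_mem hS' (hmem r))
  convert h3 using 1
  ring

/-- Interchange of summation. -/
theorem hs_fubini {f : ι × κ → K p k} (hf : Null f) {R : ι → K p k} {C : κ → K p k} {t : K p k}
    (hR : ∀ i, HS (fun j => f (i, j)) (R i)) (hC : ∀ j, HS (fun i => f (i, j)) (C j))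
    (ht : HS R t) : HS C t := by
  classical
  intro r
  obtain ⟨E, hE⟩ := (hf r).exists_finset
  have hE' : ∀ x ∉ E, f x ∈ lat p k r := fun x hx => by
    by_contra h'
    exact hx ((hE x).2 h')
  obtain ⟨S, hS⟩ := ht r
  -- `E` collects the finitely many entries outside `p^r W`. Enlarging the index sets to contain its
  -- two projections makes row sums and column sums agree with the finite rectangle modulo `p^r`.
  set I := S ∪ E.image Prod.fst with hI
  refine ⟨E.image Prod.snd, fun J hJ => ?_⟩
  have h1 := hS I subset_union_left
  have hEIJ : E ⊆ I ×ˢ J := fun x hx => Finset.mem_product.2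
    ⟨mem_union_right _ (mem_image_of_mem _ hx), hJ (mem_image_of_mem _ hx)⟩
  have h2 : ∑ i ∈ I, R i - ∑ i ∈ I, ∑ j ∈ J, f (i, j) ∈ lat p k r := by
    rw [← Finset.sum_sub_distrib]
    refine sum_mem fun i _ => (hR i).sub_sum_mem fun j hj => hE' _ fun hx => hj ?_
    exact (Finset.mem_product.1 (hEIJ hx)).2
  have h3 : ∑ j ∈ J, C j - ∑ j ∈ J, ∑ i ∈ I, f (i, j) ∈ lat p k r := by
    rw [← Finset.sum_sub_distrib]
    refine sum_mem fun j _ => (hC j).sub_sum_mem fun i hi => hE' _ fun hx => hi ?_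
    exact (Finset.mem_product.1 (hEIJ hx)).1
  rw [Finset.sum_comm] at h3
  have := sub_mem (add_mem h1 h2) h3
  convert this using 1
  ring

/-- The sum over a product from the iterated sum. -/
theorem hs_prod {f : ι × κ → K p k} (hf : Null f) {R : ι → K p k} {t : K p k}
    (hR : ∀ i, HS (fun j => f (i, j)) (R i)) (ht : HS R t) : HS f t := by
  classical
  intro r
  obtain ⟨E, hE⟩ := (hf r).exists_finset
  have hE' : ∀ x ∉ E, f x ∈ lat p k r := fun x hx => by
    by_contra h'
    exact hx ((hE x).2 h')
  obtain ⟨S, hS⟩ := ht r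
  set I := S ∪ E.image Prod.fst with hI
  set J := E.image Prod.snd with hJ
  have h1 := hS I subset_union_left
  have hEIJ : E ⊆ I ×ˢ J := fun x hx => Finset.mem_product.2
    ⟨mem_union_right _ (mem_image_of_mem _ hx), mem_image_of_mem _ hx⟩
  have h2 : ∑ i ∈ I, R i - ∑ i ∈ I, ∑ j ∈ J, f (i, j) ∈ lat p k r := by
    rw [← Finset.sum_sub_distrib]
    refine sum_mem fun i _ => (hR i).sub_sum_mem fun j hj => hE' _ fun hx => hj ?_
    exact (Finset.mem_product.1 (hEIJ hx)).2
  rw [← Finset.sum_product'] at h2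
  refine ⟨I ×ˢ J, fun S' hS' => ?_⟩
  have h3 := sum_sub_sum_mem hS' fun x hx => hE' x fun hx' => hx (hEIJ hx')
  have := sub_mem (add_mem h1 h2) h3
  convert this using 1
  ring

/-- Regrouping of a sum along the fibres of `π`. -/
theorem HS.regroup [DecidableEq κ] (h : HS f g) (π : ι → κ) {C : κ → K p k}
    (hC : ∀ j, HS (fun i => if π i = j then f i else 0) (C j)) : HS C g := by
  classical
  -- Interchange of summation for the array whose entry in position `(i, π i)` is `f i` and which
  -- vanishes elsewhere: rows have one term, columns are fibres.
  refine hs_fubini (f := fun x : ι × κ => if π x.1 = x.2 then f x.1 else 0) ?_ (R := f) ?_ hC h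
  · intro r
    refine ((h.null r).image fun i => (i, π i)).subset ?_
    rintro ⟨i, j⟩ hij
    simp only [Set.mem_ofPred_eq] at hij
    by_cases hπ : π i = j
    · rw [if_pos hπ] at hij
      exact ⟨i, hij, by simp [hπ]⟩
    · rw [if_neg hπ] at hij
      exact absurd (zero_mem _) hij
  · intro i
    have := hs_single (f := fun j => if π i = j then f i else 0) (π i)
      (fun j hj => if_neg (Ne.symm hj))
    simpa using this

/-- Only finitely many terms are not integral, so one power of `p` clears all denominators. -/
theorem Null.exists_bound (h : Null f) :
    ∃ a : ℕ, ∀ i, (p : K p k) ^ a * f i ∈ lat p k 0 := by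
  classical
  obtain ⟨E, hE⟩ := (h 0).exists_finset
  choose a ha using fun x : K p k => exists_pow_mul_mem_lat x 0
  refine ⟨∑ i ∈ E, a (f i), fun i => ?_⟩
  by_cases hi : i ∈ E
  · have hle : a (f i) ≤ ∑ i ∈ E, a (f i) :=
      Finset.single_le_sum (f := fun i => a (f i)) (fun _ _ => Nat.zero_le _) hi
    obtain ⟨c, hc⟩ := Nat.exists_eq_add_of_le' hle
    rw [hc, pow_add, mul_assoc]
    exact mul_mem_lat_of_integral (lat_anti (Nat.zero_le _) (p_pow_mem_lat _)) (ha (f i))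
  · have : f i ∈ lat p k 0 := by
      by_contra h'
      exact hi ((hE i).2 h')
    simpa using mul_mem_lat (lat_anti (Nat.zero_le _) (p_pow_mem_lat (∑ i ∈ E, a (f i)))) this

theorem Null.mul {f' : κ → K p k} (h : Null f) (h' : Null f') :
    Null (fun x : ι × κ => f x.1 * f' x.2) := by
  intro r
  obtain ⟨a, ha⟩ := h.exists_bound
  obtain ⟨b, hb⟩ := h'.exists_bound
  -- The shifts by `b` and `a` pay for the denominators of the other factor.
  refine ((h (r + b)).prod (h' (r + a))).subset ?_
  rintro ⟨i, j⟩ hij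
  constructor
  · intro hi
    refine hij ?_
    have := mul_mem_lat hi (hb j)
    rw [add_zero, mul_left_comm] at this
    exact p_pow_mul_mem_lat.1 this
  · intro hj
    refine hij ?_
    have := mul_mem_lat (ha i) hj
    rw [zero_add, mul_assoc] at this
    exact p_pow_mul_mem_lat.1 this

theorem HS.mul_prod {f' : κ → K p k} (h : HS f g) (h' : HS f' g') :
    HS (fun x : ι × κ => f x.1 * f' x.2) (g * g') := by
  refine hs_prod (h.null.mul h'.null) (R := fun i => f i * g') (fun i => h'.mul_left (f i)) ?_
  simpa [mul_comm] using h.mul_left g'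

end Domain

end Sums

end CY3

end

noncomputable section

namespace CY3

open Finset

/-! ### Coefficientwise summable families of power series. -/

section MkSeries

variable {R : Type*} [CommRing R] {n : ℕ}

/-- The power series with given coefficients. -/
def mkSeries (f : (Fin n →₀ ℕ) → R) : MvPowerSeries (Fin n) R := f

@[simp]
theorem coeff_mkSeries (f : (Fin n →₀ ℕ) → R) (d : Fin n →₀ ℕ) :
    MvPowerSeries.coeff d (mkSeries f) = f d := rfl

end MkSeries

section FamilySums

variable {p : ℕ} [Fact p.Prime] {k : Type v} [Field k] {n : ℕ}
  {ι κ : Type*} {f f' : ι → KA p k n} {g g' : KA p k n}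

theorem PadicHasSum.add (h : PadicHasSum f g) (h' : PadicHasSum f' g') :
    PadicHasSum (fun i => f i + f' i) (g + g') := by
  rw [padicHasSum_iff] at *
  intro d
  simpa using (h d).add (h' d)

theorem padicHasSum_of_finite (S : Finset ι) (hf : ∀ i ∉ S, f i = 0) :
    PadicHasSum f (∑ i ∈ S, f i) := by
  rw [padicHasSum_iff]
  intro d
  rw [map_sum]
  exact hs_of_finite S fun i hi => by simp [hf i hi]

theorem padicHasSum_single [DecidableEq ι] (i : ι) (hf : ∀ j ≠ i, f j = 0) :
    PadicHasSum f (f i) := by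
  simpa using padicHasSum_of_finite {i} (f := f) (by simpa using hf)

variable [CharP k p] [PerfectRing k p]

theorem PadicHasSum.unique (h : PadicHasSum f g) (h' : PadicHasSum f g') : g = g' := by
  refine MvPowerSeries.ext fun d => ?_
  exact (padicHasSum_iff.1 h d).unique (padicHasSum_iff.1 h' d)

theorem PadicHasSum.mul_left (h : PadicHasSum f g) (c : KA p k n) :
    PadicHasSum (fun i => c * f i) (c * g) := by
  classical
  rw [padicHasSum_iff] at *
  intro d
  simp only [MvPowerSeries.coeff_mul]
  exact HS.sum _ fun x _ => (h x.2).mul_left _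

theorem PadicHasSum.mul_prod {f' : κ → KA p k n} (h : PadicHasSum f g) (h' : PadicHasSum f' g') :
    PadicHasSum (fun x : ι × κ => f x.1 * f' x.2) (g * g') := by
  classical
  rw [padicHasSum_iff] at *
  intro d
  simp only [MvPowerSeries.coeff_mul]
  exact HS.sum _ (F := fun (x : (Fin n →₀ ℕ) × (Fin n →₀ ℕ)) (y : ι × κ) =>
    MvPowerSeries.coeff x.1 (f y.1) * MvPowerSeries.coeff x.2 (f' y.2))
    (G := fun x => MvPowerSeries.coeff x.1 g * MvPowerSeries.coeff x.2 g')
    fun x _ => (h x.1).mul_prod (h' x.2)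

theorem PadicHasSum.regroup [DecidableEq κ] (h : PadicHasSum f g) (π : ι → κ) {C : κ → KA p k n}
    (hC : ∀ j, PadicHasSum (fun i => if π i = j then f i else 0) (C j)) : PadicHasSum C g := by
  rw [padicHasSum_iff]
  intro d
  refine (padicHasSum_iff.1 h d).regroup π fun j => ?_
  have := padicHasSum_iff.1 (hC j) d
  simpa only [apply_ite (MvPowerSeries.coeff d), map_zero] using this

/-- Cauchy products. -/
theorem PadicHasSum.mul_antidiagonal {M : Type*} [AddCommMonoid M] [DecidableEq M]
    [Finset.HasAntidiagonal M] {f f' : M → KA p k n} (h : PadicHasSum f g)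
    (h' : PadicHasSum f' g') :
    PadicHasSum (fun m => ∑ x ∈ HasAntidiagonal.antidiagonal m, f x.1 * f' x.2) (g * g') := by
  refine (h.mul_prod h').regroup (fun x => x.1 + x.2) fun m => ?_
  have := padicHasSum_of_finite (HasAntidiagonal.antidiagonal m)
    (f := fun x : M × M => if x.1 + x.2 = m then f x.1 * f' x.2 else 0)
    fun x hx => if_neg (by simpa using hx)
  rwa [Finset.sum_congr rfl fun x hx => if_pos (Finset.HasAntidiagonal.mem_antidiagonal.1 hx)] at this

end FamilySums

/-! ### The `(p, t)`-adic filtration of `A` and the inclusion into `K[[t]]`. -/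

section Filtration

variable {p : ℕ} [Fact p.Prime] {k : Type v} [Field k] {n : ℕ}

/-- The ideals `J N = (p, t_1, …, t_n)^N`, described by coefficients. -/
def J (p : ℕ) [Fact p.Prime] (k : Type v) [Field k] (n : ℕ) (N : ℕ) : Ideal (A p k n) where
  carrier := {a | ∀ d : Fin n →₀ ℕ, (p : W p k) ^ (N - d.degree) ∣ MvPowerSeries.coeff d a}
  add_mem' := fun {a b} ha hb d => by
    rw [map_add]
    exact dvd_add (ha d) (hb d)
  zero_mem' := fun d => by simp
  smul_mem' := fun c a ha d => by
    classical
    rw [smul_eq_mul, MvPowerSeries.coeff_mul]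
    refine Finset.dvd_sum fun x hx => Dvd.dvd.mul_left ((pow_dvd_pow _ ?_).trans (ha x.2)) _
    have := congrArg Finsupp.degree (Finset.HasAntidiagonal.mem_antidiagonal.1 hx)
    rw [map_add] at this
    omega

theorem mem_J {N : ℕ} {a : A p k n} :
    a ∈ J p k n N ↔ ∀ d, (p : W p k) ^ (N - d.degree) ∣ MvPowerSeries.coeff d a := Iff.rfl

theorem J_zero : J p k n 0 = ⊤ := by
  ext a
  simp [mem_J]

theorem mul_mem_J {N M : ℕ} {a b : A p k n} (ha : a ∈ J p k n N) (hb : b ∈ J p k n M) :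
    a * b ∈ J p k n (N + M) := by
  classical
  intro d
  rw [MvPowerSeries.coeff_mul]
  refine Finset.dvd_sum fun x hx => ?_
  have := congrArg Finsupp.degree (Finset.HasAntidiagonal.mem_antidiagonal.1 hx)
  rw [map_add] at this
  refine (pow_dvd_pow _ ?_).trans ((pow_add (p : W p k) _ _).dvd.trans
    (mul_dvd_mul (ha x.1) (hb x.2)))
  omega

theorem pow_mem_J {N : ℕ} {a : A p k n} (ha : a ∈ J p k n N) (m : ℕ) :
    a ^ m ∈ J p k n (m * N) := by
  induction m with
  | zero => simp [J_zero]
  | succ m ih =>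
    rw [pow_succ, Nat.succ_mul]
    exact mul_mem_J ih ha

theorem prod_mem_J {ι : Type*} (s : Finset ι) (f : ι → A p k n) (N : ι → ℕ)
    (h : ∀ i ∈ s, f i ∈ J p k n (N i)) : ∏ i ∈ s, f i ∈ J p k n (∑ i ∈ s, N i) := by
  classical
  induction s using Finset.induction_on with
  | empty => simp [J_zero]
  | insert a s ha ih =>
    rw [Finset.prod_insert ha, Finset.sum_insert ha]
    exact mul_mem_J (h a (by simp)) (ih fun i hi => h i (by simp [hi]))

theorem monomial_prod_mem_J {u : Fin n → A p k n} (hu : ∀ j, u j ∈ J p k n 1) (d : Fin n →₀ ℕ) :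
    ∏ j, u j ^ d j ∈ J p k n d.degree := by
  rw [Finsupp.degree_eq_sum]
  exact prod_mem_J _ _ _ fun j _ => by simpa using pow_mem_J (hu j) (d j)

theorem C_mem_J {N : ℕ} {w : W p k} :
    (MvPowerSeries.C w : A p k n) ∈ J p k n N ↔ (p : W p k) ^ N ∣ w := by
  classical
  constructor
  · intro h
    simpa using h 0
  · intro h d
    rw [MvPowerSeries.coeff_C]
    split_ifs with hd
    · subst hd
      simpa using h
    · exact dvd_zero _

theorem natCast_p_mem_J : (p : A p k n) ∈ J p k n 1 := by
  rw [← map_natCast (MvPowerSeries.C (σ := Fin n) (R := W p k)) p, C_mem_J, pow_one]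

theorem X_mem_J (j : Fin n) : (MvPowerSeries.X j : A p k n) ∈ J p k n 1 := by
  classical
  intro d
  rw [MvPowerSeries.coeff_X]
  split_ifs with hd
  · subst hd
    simp
  · exact dvd_zero _

theorem p_dvd_iff_coeff {r : ℕ} {a : A p k n} :
    (p : A p k n) ^ r ∣ a ↔ ∀ d, (p : W p k) ^ r ∣ MvPowerSeries.coeff d a := by
  rw [← map_natCast (MvPowerSeries.C (σ := Fin n) (R := W p k)) p, ← map_pow]
  constructor
  · rintro ⟨b, rfl⟩ d
    rw [MvPowerSeries.coeff_C_mul]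
    exact dvd_mul_right _ _
  · intro h
    choose b hb using h
    refine ⟨mkSeries b, ?_⟩
    refine MvPowerSeries.ext fun d => ?_
    rw [hb, MvPowerSeries.coeff_C_mul, coeff_mkSeries]

/-- `p^r A` is closed for the `(p, t)`-adic topology: an error in `J (r + |d|)` has its coefficient
at `d` divisible by `p^r`. -/
theorem dvd_of_forall_J {a : A p k n} {r : ℕ}
    (h : ∀ N, ∃ b, (p : A p k n) ^ r ∣ b ∧ a - b ∈ J p k n N) : (p : A p k n) ^ r ∣ a := by
  rw [p_dvd_iff_coeff]
  intro d
  obtain ⟨b, hb, hab⟩ := h (r + d.degree)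
  have h1 := hab d
  rw [Nat.add_sub_cancel, map_sub] at h1
  simpa using dvd_add h1 (p_dvd_iff_coeff.1 hb d)

/-- Each monomial other than `1` is charged to the first variable that divides it, hence exactly
once. Dividing by that variable lowers the degree by one, which turns `J (N + 1)` into `J N`. This
is the device for all later inductions on `N`. -/
theorem exists_sum_X_mul (a : A p k n) :
    ∃ b : Fin n → A p k n,
      a = MvPowerSeries.C (MvPowerSeries.constantCoeff a) + ∑ j, MvPowerSeries.X j * b j ∧
      ∀ N, a ∈ J p k n (N + 1) → ∀ j, b j ∈ J p k n N := by
  classical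
  refine ⟨fun j => mkSeries fun d => if ∀ i < j, d i = 0 then
    MvPowerSeries.coeff (d + Finsupp.single j 1) a else 0, ?_, ?_⟩
  · refine MvPowerSeries.ext fun d => ?_
    simp only [map_add, map_sum, MvPowerSeries.X_def, MvPowerSeries.coeff_monomial_mul, one_mul,
      coeff_mkSeries]
    by_cases hd : d = 0
    · subst hd
      simp
    rw [MvPowerSeries.coeff_C, if_neg hd, zero_add]
    have hne : d.support.Nonempty := Finsupp.support_nonempty_iff.2 hd
    set j := d.support.min' hne with hj
    have hj0 : d j ≠ 0 := Finsupp.mem_support_iff.1 (Finset.min'_mem _ hne)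
    have hlt : ∀ i < j, d i = 0 := fun i hi => by
      by_contra h
      exact absurd (Finset.min'_le _ i (Finsupp.mem_support_iff.2 h)) (not_le.2 hi)
    rw [Finset.sum_eq_single j]
    · have hle : Finsupp.single j 1 ≤ d := by
        rw [Finsupp.single_le_iff]
        omega
      rw [if_pos hle]
      rw [if_pos, tsub_add_cancel_of_le hle]
      intro i hi
      simp [hlt i hi]
    · intro i _ hij
      split_ifs with hle hcond
      · exfalso
        revert hcond
        intro h
        rcases lt_trichotomy i j with hlt' | h' | hlt'
        · have := hlt i hlt'
          rw [Finsupp.single_le_iff] at hle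
          omega
        · exact hij h'
        · have := h j hlt'
          rw [Finsupp.tsub_apply, Finsupp.single_apply, if_neg hij, Nat.sub_zero] at this
          exact hj0 this
      · rfl
      · rfl
    · simp
  · intro N ha j d
    rw [coeff_mkSeries]
    split_ifs
    · have := ha (d + Finsupp.single j 1)
      rw [map_add, Finsupp.degree_single] at this
      simpa using this
    · exact dvd_zero _

/-- Continuity is automatic once the variables go into the maximal ideal: split off the constant
term, which is divisible by `p^(N+1)`, and one variable from each other term. -/
theorem ringHom_mem_J {φ : A p k n →+* A p k n} (hφ : ∀ j, φ (MvPowerSeries.X j) ∈ J p k n 1)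
    (N : ℕ) : ∀ a ∈ J p k n N, φ a ∈ J p k n N := by
  induction N with
  | zero => simp [J_zero]
  | succ N ih =>
    intro a ha
    obtain ⟨b, hb, hJ⟩ := exists_sum_X_mul a
    obtain ⟨w, hw⟩ : (p : W p k) ^ (N + 1) ∣ MvPowerSeries.constantCoeff a := by simpa using ha 0
    rw [hb, map_add, map_sum, hw, map_mul, map_pow, map_natCast, map_mul, map_pow, map_natCast]
    refine add_mem (Ideal.mul_mem_right _ _ ?_) (sum_mem fun j _ => ?_)
    · simpa using pow_mem_J natCast_p_mem_J (N + 1)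
    · rw [map_mul, add_comm]
      exact mul_mem_J (hφ j) (ih _ (hJ N ha j))

theorem coeff_incl (d : Fin n →₀ ℕ) (a : A p k n) :
    MvPowerSeries.coeff d (incl p k n a) =
      algebraMap (W p k) (K p k) (MvPowerSeries.coeff d a) := by
  simp [incl]

theorem incl_injective : Function.Injective (incl p k n) := fun a b h => by
  refine MvPowerSeries.ext fun d => ?_
  refine IsFractionRing.injective (W p k) (K p k) ?_
  rw [← coeff_incl, ← coeff_incl, h]

theorem exists_incl {f : KA p k n} (h : ∀ d, MvPowerSeries.coeff d f ∈ lat p k 0) :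
    ∃ a, incl p k n a = f := by
  choose a ha using fun d => mem_lat_zero.1 (h d)
  refine ⟨mkSeries a, ?_⟩
  refine MvPowerSeries.ext fun d => ?_
  rw [coeff_incl, coeff_mkSeries]
  exact ha d

theorem coeff_incl_mem_lat {a : A p k n} (d : Fin n →₀ ℕ) :
    MvPowerSeries.coeff d (incl p k n a) ∈ lat p k 0 := by
  rw [coeff_incl]
  exact algebraMap_mem_lat _

theorem coeff_incl_mem_lat_of_mem_J {N : ℕ} {a : A p k n} (h : a ∈ J p k n N) (d : Fin n →₀ ℕ) :
    MvPowerSeries.coeff d (incl p k n a) ∈ lat p k (N - d.degree) := by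
  rw [coeff_incl]
  obtain ⟨w, hw⟩ := h d
  exact mem_lat.2 ⟨w, by rw [hw]⟩

end Filtration

/-! ### Substitution `∑ a_m t^m ↦ ∑ s(a_m) u^m` as a partially defined operation on `K[[t]]`. -/

section Subst

variable {p : ℕ} [Fact p.Prime] {k : Type v} [Field k] {n : ℕ}

/-- `g = ∑ s(f_m) u^m`, with coefficientwise `p`-adic convergence. -/
def SubstHas (s : K p k →+* K p k) (u : Fin n → A p k n) (f g : KA p k n) : Prop :=
  PadicHasSum (fun m : Fin n →₀ ℕ =>
    MvPowerSeries.C (s (MvPowerSeries.coeff m f)) * ∏ j, incl p k n (u j) ^ m j) g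

theorem prod_incl_pow (u : Fin n → A p k n) (m : Fin n →₀ ℕ) :
    ∏ j, incl p k n (u j) ^ m j = incl p k n (∏ j, u j ^ m j) := by
  rw [map_prod]
  simp only [map_pow]

variable [CharP k p] [PerfectRing k p] {s : K p k →+* K p k} {u : Fin n → A p k n}
  {f f' g g' : KA p k n}

theorem SubstHas.unique (h : SubstHas s u f g) (h' : SubstHas s u f g') : g = g' :=
  PadicHasSum.unique h h'

theorem SubstHas.add (h : SubstHas s u f g) (h' : SubstHas s u f' g') :
    SubstHas s u (f + f') (g + g') := by
  simpa only [SubstHas, map_add, add_mul] using PadicHasSum.add h h'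

theorem SubstHas.C_mul (h : SubstHas s u f g) (c : K p k) :
    SubstHas s u (MvPowerSeries.C c * f) (MvPowerSeries.C (s c) * g) := by
  simpa only [SubstHas, MvPowerSeries.coeff_C_mul, map_mul, mul_assoc] using
    PadicHasSum.mul_left h (MvPowerSeries.C (s c))

theorem SubstHas.neg (h : SubstHas s u f g) : SubstHas s u (-f) (-g) := by
  simpa using h.C_mul (-1)

theorem SubstHas.sub (h : SubstHas s u f g) (h' : SubstHas s u f' g') :
    SubstHas s u (f - f') (g - g') := by
  simpa only [sub_eq_add_neg] using h.add h'.neg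

theorem substHas_monomial (d : Fin n →₀ ℕ) (c : K p k) :
    SubstHas s u (MvPowerSeries.monomial d c)
      (MvPowerSeries.C (s c) * ∏ j, incl p k n (u j) ^ d j) := by
  classical
  have := padicHasSum_single (f := fun m : Fin n →₀ ℕ =>
    MvPowerSeries.C (s (MvPowerSeries.coeff m (MvPowerSeries.monomial d c))) *
      ∏ j, incl p k n (u j) ^ m j) d fun m hm => by
        rw [MvPowerSeries.coeff_monomial_ne hm, map_zero, map_zero, zero_mul]
  rwa [MvPowerSeries.coeff_monomial_same] at this

theorem substHas_C (c : K p k) :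
    SubstHas s u (MvPowerSeries.C c) (MvPowerSeries.C (s c)) := by
  simpa [MvPowerSeries.monomial_zero_eq_C_apply] using substHas_monomial (s := s) (u := u) 0 c

theorem substHas_zero : SubstHas s u 0 0 := by simpa using substHas_C (s := s) (u := u) 0

theorem substHas_one : SubstHas s u 1 1 := by simpa using substHas_C (s := s) (u := u) 1

theorem substHas_X (j : Fin n) :
    SubstHas s u (MvPowerSeries.X j) (incl p k n (u j)) := by
  classical
  have := substHas_monomial (s := s) (u := u) (Finsupp.single j 1) 1
  rw [← MvPowerSeries.X_def, map_one, map_one, one_mul, Finset.prod_eq_single j (fun i _ hi => by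
    rw [Finsupp.single_apply, if_neg (Ne.symm hi), pow_zero]) (by simp), Finsupp.single_eq_same,
    pow_one] at this
  exact this

theorem SubstHas.sum {ι : Type*} (S : Finset ι) {F G : ι → KA p k n}
    (h : ∀ i ∈ S, SubstHas s u (F i) (G i)) : SubstHas s u (∑ i ∈ S, F i) (∑ i ∈ S, G i) := by
  classical
  induction S using Finset.induction_on with
  | empty => simpa using substHas_zero
  | insert a S ha ih =>
    rw [Finset.sum_insert ha, Finset.sum_insert ha]
    exact (h a (by simp)).add (ih fun i hi => h i (by simp [hi]))

theorem SubstHas.mul (h : SubstHas s u f g) (h' : SubstHas s u f' g') :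
    SubstHas s u (f * f') (g * g') := by
  classical
  have := PadicHasSum.mul_antidiagonal h h'
  unfold SubstHas
  convert this using 2 with m
  rw [MvPowerSeries.coeff_mul, map_sum, map_sum, Finset.sum_mul]
  refine Finset.sum_congr rfl fun x hx => ?_
  have hm : ∀ j, m j = x.1 j + x.2 j := fun j => by
    rw [← Finset.HasAntidiagonal.mem_antidiagonal.1 hx, Finsupp.add_apply]
  simp only [hm, pow_add, Finset.prod_mul_distrib, map_mul]
  ring

theorem SubstHas.pow (h : SubstHas s u f g) (m : ℕ) : SubstHas s u (f ^ m) (g ^ m) := by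
  induction m with
  | zero => simpa using substHas_one
  | succ m ih =>
    rw [pow_succ, pow_succ]
    exact ih.mul h

/-- `φ` is additive and multiplicative, so it is given by substitution on finite sums of monomials;
the tail lies deep in the filtration and stays there because `φ` is continuous. -/
theorem substHas_of_ringHom {φ : A p k n →+* A p k n}
    (hC : ∀ w, incl p k n (φ (MvPowerSeries.C w)) =
      MvPowerSeries.C (s (algebraMap (W p k) (K p k) w)))
    (hX : ∀ j, φ (MvPowerSeries.X j) ∈ J p k n 1) (a : A p k n) :
    SubstHas s (fun j => φ (MvPowerSeries.X j)) (incl p k n a) (incl p k n (φ a)) := by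
  classical
  rw [SubstHas, padicHasSum_iff]
  intro d r
  -- All monomials of degree at most `r + |d|`: what remains lies in `J (r + |d|)`, and so does its
  -- image, whose coefficient at `d` is then divisible by `p^r`.
  set S : Finset (Fin n →₀ ℕ) := (Finsupp.finite_of_degree_le (r + d.degree)).toFinset
  refine ⟨S, fun S' hS' => ?_⟩
  have h1 : a - ∑ m ∈ S', MvPowerSeries.monomial m (MvPowerSeries.coeff m a) ∈
      J p k n (r + d.degree) := by
    intro e
    rw [map_sub, map_sum]
    simp only [MvPowerSeries.coeff_monomial, Finset.sum_ite_eq]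
    split_ifs with he
    · simp
    · have : r + d.degree < e.degree := by
        by_contra hcon
        exact he (hS' (by simpa [S] using hcon))
      rw [Nat.sub_eq_zero_of_le this.le, pow_zero]
      exact one_dvd _
  have h2 := coeff_incl_mem_lat_of_mem_J (ringHom_mem_J hX _ _ h1) d
  rw [Nat.add_sub_cancel, map_sub, map_sub, map_sub, map_sum, map_sum, map_sum] at h2
  convert h2 using 3 with m hm
  rw [coeff_incl]
  rw [← coeff_incl, MvPowerSeries.monomial_eq', map_mul φ, map_mul (incl p k n), hC,
    Finsupp.prod_fintype _ _ (fun i => pow_zero _)]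
  simp only [map_prod, map_pow]
  rw [coeff_incl m]

end Subst

end CY3

end

noncomputable section

namespace CY3

open Finset

/-! ### Continuous endomorphisms of `A` with prescribed images of the variables. -/

section Eval

variable {p : ℕ} [Fact p.Prime] {k : Type v} [Field k] [CharP k p] [PerfectRing k p] {n : ℕ}

/-- A ring endomorphism of `K` preserving the lattices `p^r W`. -/
def LatHom (s : K p k →+* K p k) : Prop := ∀ x ∈ lat p k 0, s x ∈ lat p k 0

theorem latHom_id : LatHom (RingHom.id (K p k)) := fun _ h => h

theorem latHom_sigK : LatHom (sigK p k) := fun _ h => sigK_mem_lat.2 h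

variable {s : K p k →+* K p k} {u : Fin n → A p k n}

/-- The monomial `u^m` lies in `J |m|`, so its coefficient at a fixed `d` is divisible by `p^(|m| -
|d|)`. The series is thus null in every coefficient, with integral terms. -/
theorem exists_substHas_incl (hs : LatHom s) (hu : ∀ j, u j ∈ J p k n 1) (a : A p k n) :
    ∃ b : A p k n, SubstHas s u (incl p k n a) (incl p k n b) := by
  have hterm : ∀ (d m : Fin n →₀ ℕ), MvPowerSeries.coeff d
      (MvPowerSeries.C (s (MvPowerSeries.coeff m (incl p k n a))) *
        ∏ j, incl p k n (u j) ^ m j) ∈ lat p k (m.degree - d.degree) := by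
    intro d m
    rw [MvPowerSeries.coeff_C_mul, prod_incl_pow]
    exact mul_mem_lat_of_integral (hs _ (coeff_incl_mem_lat m))
      (coeff_incl_mem_lat_of_mem_J (monomial_prod_mem_J hu m) d)
  have hnull : ∀ d : Fin n →₀ ℕ, ∃ g, HS (fun m => MvPowerSeries.coeff d
      (MvPowerSeries.C (s (MvPowerSeries.coeff m (incl p k n a))) *
        ∏ j, incl p k n (u j) ^ m j)) g := by
    intro d
    refine Null.exists_hs fun r => (Finsupp.finite_of_degree_le (r + d.degree)).subset ?_
    intro m hm
    by_contra hcon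
    refine hm (lat_anti ?_ (hterm d m))
    have : ¬ m.degree ≤ r + d.degree := hcon
    omega
  choose g hg using hnull
  obtain ⟨b, hb⟩ := exists_incl (f := mkSeries g) fun d => by
    rw [coeff_mkSeries]
    exact (hg d).mem_lat fun m => lat_anti (Nat.zero_le _) (hterm d m)
  refine ⟨b, ?_⟩
  rw [hb, SubstHas, padicHasSum_iff]
  intro d
  rw [coeff_mkSeries]
  exact hg d

/-- The continuous ring endomorphism `∑ a_m t^m ↦ ∑ s(a_m) u^m` of `A`. -/
def evalHom (hs : LatHom s) (hu : ∀ j, u j ∈ J p k n 1) : A p k n →+* A p k n where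
  toFun a := (exists_substHas_incl hs hu a).choose
  map_one' := incl_injective <| (exists_substHas_incl hs hu 1).choose_spec.unique <| by
    simpa using substHas_one
  map_zero' := incl_injective <| (exists_substHas_incl hs hu 0).choose_spec.unique <| by
    simpa using substHas_zero
  map_add' a b := incl_injective <| (exists_substHas_incl hs hu (a + b)).choose_spec.unique <| by
    rw [map_add, map_add]
    exact (exists_substHas_incl hs hu a).choose_spec.add
      (exists_substHas_incl hs hu b).choose_spec
  map_mul' a b := incl_injective <| (exists_substHas_incl hs hu (a * b)).choose_spec.unique <| by
    rw [map_mul, map_mul]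
    exact (exists_substHas_incl hs hu a).choose_spec.mul
      (exists_substHas_incl hs hu b).choose_spec

theorem evalHom_spec (hs : LatHom s) (hu : ∀ j, u j ∈ J p k n 1) (a : A p k n) :
    SubstHas s u (incl p k n a) (incl p k n (evalHom hs hu a)) :=
  (exists_substHas_incl hs hu a).choose_spec

theorem evalHom_X (hs : LatHom s) (hu : ∀ j, u j ∈ J p k n 1) (j : Fin n) :
    evalHom hs hu (MvPowerSeries.X j) = u j :=
  incl_injective <| (evalHom_spec hs hu _).unique <| by
    have : incl p k n (MvPowerSeries.X j) = MvPowerSeries.X j := MvPowerSeries.map_X _ j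
    rw [this]
    exact substHas_X j

theorem incl_C (w : W p k) : incl p k n (MvPowerSeries.C w) =
    MvPowerSeries.C (algebraMap (W p k) (K p k) w) := MvPowerSeries.map_C _ w

theorem incl_X (j : Fin n) : incl p k n (MvPowerSeries.X j) = MvPowerSeries.X j :=
  MvPowerSeries.map_X _ j

theorem evalHom_C (hs : LatHom s) (hu : ∀ j, u j ∈ J p k n 1) {w w' : W p k}
    (hw : s (algebraMap (W p k) (K p k) w) = algebraMap (W p k) (K p k) w') :
    evalHom hs hu (MvPowerSeries.C w) = MvPowerSeries.C w' :=
  incl_injective <| (evalHom_spec hs hu _).unique <| by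
    rw [incl_C, incl_C, ← hw]
    exact substHas_C _

/-- Continuous ring homomorphisms which agree on `W` and on the variables are equal. -/
theorem ringHom_ext {φ ψ : A p k n →+* A p k n}
    (hC : ∀ w, φ (MvPowerSeries.C w) = ψ (MvPowerSeries.C w))
    (hX : ∀ j, φ (MvPowerSeries.X j) = ψ (MvPowerSeries.X j))
    (hJ : ∀ j, φ (MvPowerSeries.X j) ∈ J p k n 1) : φ = ψ := by
  have hJ' : ∀ j, ψ (MvPowerSeries.X j) ∈ J p k n 1 := fun j => hX j ▸ hJ j
  have key : ∀ N, ∀ a, φ a - ψ a ∈ J p k n N := by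
    intro N
    induction N with
    | zero => simp [J_zero]
    | succ N ih =>
      intro a
      obtain ⟨b, hb, -⟩ := exists_sum_X_mul a
      rw [hb, map_add, map_add, map_sum, map_sum, hC, add_sub_add_left_eq_sub,
        ← Finset.sum_sub_distrib]
      refine sum_mem fun j _ => ?_
      rw [map_mul, map_mul, hX, ← mul_sub, add_comm]
      exact mul_mem_J (hJ' j) (ih (b j))
  refine RingHom.ext fun a => sub_eq_zero.1 (MvPowerSeries.ext fun d => ?_)
  rw [map_zero]
  refine W_eq_zero_of_forall_dvd fun r => ?_
  simpa using key (r + d.degree) a d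

end Eval

/-! ### General properties of lifts of Frobenius. -/

section Lifts

variable {p : ℕ} [Fact p.Prime] {k : Type v} [Field k] [CharP k p] [PerfectRing k p] {n : ℕ}

theorem FrobLift.X_mem_J (ψ : FrobLift p k n) (j : Fin n) :
    ψ.toRingHom (MvPowerSeries.X j) ∈ J p k n 1 := by
  obtain ⟨c, hc⟩ := ψ.dvd_sub_pow (MvPowerSeries.X j)
  rw [sub_eq_iff_eq_add] at hc
  rw [hc]
  refine add_mem (Ideal.mul_mem_right _ _ natCast_p_mem_J)
    (Ideal.pow_mem_of_mem _ (CY3.X_mem_J j) _ (Fact.out : p.Prime).pos)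

/-- The extension of `ψ` to series over `K`, defined by substitution, really restricts to `ψ` on
`A`. No continuity has to be assumed, since `ψ(t_j) ≡ t_j^p` already lies in the maximal ideal
modulo `p`. -/
theorem FrobLift.mapsTo_incl (ψ : FrobLift p k n) (a : A p k n) :
    ψ.MapsTo (incl p k n a) (incl p k n (ψ.toRingHom a)) :=
  substHas_of_ringHom (s := sigK p k)
    (fun w => by rw [ψ.map_C, incl_C, sigK_algebraMap]) ψ.X_mem_J a

theorem FrobLift.mapsTo_iff (ψ : FrobLift p k n) (f g : KA p k n) :
    ψ.MapsTo f g ↔ SubstHas (sigK p k) (fun j => ψ.toRingHom (MvPowerSeries.X j)) f g := Iff.rfl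

theorem FrobLift.ext_X {φ ψ : FrobLift p k n}
    (h : ∀ j, φ.toRingHom (MvPowerSeries.X j) = ψ.toRingHom (MvPowerSeries.X j)) : φ = ψ := by
  have := ringHom_ext (fun w => by rw [φ.map_C, ψ.map_C]) h φ.X_mem_J
  cases φ
  cases ψ
  congr

theorem p_dvd_frobenius_sub_pow (w : W p k) : (p : W p k) ∣ WittVector.frobenius w - w ^ p := by
  rw [← Ideal.mem_span_singleton, ← WittVector.ker_constantCoeff, RingHom.mem_ker, map_sub,
    map_pow]
  change (WittVector.frobenius w).coeff 0 - (w.coeff 0) ^ p = 0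
  rw [WittVector.coeff_frobenius_charP, sub_self]

/-- A ring endomorphism of `A` which restricts to Frobenius on `W` and satisfies
`φ(t_j) ≡ t_j^p` is a lift of Frobenius. -/
def FrobLift.ofX (φ : A p k n →+* A p k n)
    (hC : ∀ w, φ (MvPowerSeries.C w) = MvPowerSeries.C (WittVector.frobenius w))
    (hX : ∀ j, (p : A p k n) ∣ φ (MvPowerSeries.X j) - MvPowerSeries.X j ^ p) :
    FrobLift p k n where
  toRingHom := φ
  map_C := hC
  dvd_sub_pow := by
    have hadd : ∀ a b : A p k n, (p : A p k n) ∣ (a + b) ^ p - (a ^ p + b ^ p) := fun a b => by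
      obtain ⟨r, hr⟩ := exists_add_pow_prime_eq (Fact.out : p.Prime) a b
      exact ⟨a * b * r, by rw [hr]; ring⟩
    have hsum : ∀ (S : Finset (Fin n)) (f : Fin n → A p k n),
        (p : A p k n) ∣ (∑ j ∈ S, f j) ^ p - ∑ j ∈ S, f j ^ p := by
      intro S f
      classical
      induction S using Finset.induction_on with
      | empty => simp [(Fact.out : p.Prime).ne_zero]
      | insert a S ha ih =>
        rw [Finset.sum_insert ha, Finset.sum_insert ha]
        have := dvd_add (hadd (f a) (∑ j ∈ S, f j)) ih
        rwa [show ∀ x y z w : A p k n, x - (y + z) + (z - w) = x - (y + w) by intros; ring] at this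
    have key : ∀ N, ∀ a, ∃ b, (p : A p k n) ∣ b ∧ φ a - a ^ p - b ∈ J p k n N := by
      intro N
      induction N with
      | zero => exact fun a => ⟨0, dvd_zero _, by simp [J_zero]⟩
      | succ N ih =>
        intro a
        obtain ⟨b, hb, -⟩ := exists_sum_X_mul a
        choose c hc hcJ using fun j => ih (b j)
        set w := MvPowerSeries.constantCoeff a
        have hCw : (p : A p k n) ∣ φ (MvPowerSeries.C w) - (MvPowerSeries.C w) ^ p := by
          obtain ⟨v, hv⟩ := p_dvd_frobenius_sub_pow w
          exact ⟨MvPowerSeries.C v, by rw [hC, ← map_pow, ← map_sub, hv, map_mul, map_natCast]⟩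
        -- Modulo `p` the `p`-th power is additive, so `φ a - a^p` is congruent to `∑ t_j^p (φ(b_j)
        -- - b_j^p)`, where each bracket is a multiple of `p` up to an error in `J N`. The factor
        -- `t_j^p` moves that error into `J (N + 1)`.
        refine ⟨φ a - a ^ p - ∑ j, MvPowerSeries.X j ^ p * (φ (b j) - b j ^ p - c j), ?_, ?_⟩
        · have h1 : φ a = φ (MvPowerSeries.C w) +
              ∑ j, φ (MvPowerSeries.X j) * φ (b j) := by
            conv_lhs => rw [hb]
            simp only [map_add, map_sum, map_mul]
          have h2 : (p : A p k n) ∣ a ^ p - ((MvPowerSeries.C w) ^ p +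
              ∑ j, MvPowerSeries.X j ^ p * b j ^ p) := by
            have h3 := hadd (MvPowerSeries.C w) (∑ j, MvPowerSeries.X j * b j)
            rw [← hb] at h3
            have h4 := dvd_add h3 (hsum univ fun j => MvPowerSeries.X j * b j)
            simp only [mul_pow] at h4
            rwa [show ∀ x y z w : A p k n, x - (y + z) + (z - w) = x - (y + w) by
              intros; ring] at h4
          have h5 : (p : A p k n) ∣ ∑ j, φ (MvPowerSeries.X j) * φ (b j) -
              ∑ j, MvPowerSeries.X j ^ p * (φ (b j) - c j) := by
            rw [← Finset.sum_sub_distrib]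
            refine Finset.dvd_sum fun j _ => ?_
            have := dvd_add ((hX j).mul_right (φ (b j))) ((hc j).mul_left (MvPowerSeries.X j ^ p))
            convert this using 1
            ring
          have h6 := dvd_sub (dvd_add hCw h5) h2
          convert h6 using 1
          rw [h1]
          simp only [mul_sub, Finset.sum_sub_distrib]
          ring
        · rw [sub_sub_cancel]
          refine sum_mem fun j _ => ?_
          rw [add_comm N 1]
          exact mul_mem_J (Ideal.pow_mem_of_mem _ (CY3.X_mem_J j) _ (Fact.out : p.Prime).pos)
            (hcJ j)
    intro a
    have := dvd_of_forall_J (r := 1) (a := φ a - a ^ p) fun N => by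
      obtain ⟨b, hb, hJ⟩ := key N a
      exact ⟨b, by simpa using hb, hJ⟩
    simpa using this

end Lifts

/-! ### The standard lift `t_j ↦ t_j^p`, which extends to all of `K[[t]]`. -/

section Standard

variable {p : ℕ} [Fact p.Prime] {n : ℕ}

/-- The ring endomorphism `∑ a_m t^m ↦ ∑ s(a_m) t^{pm}` of `R[[t]]`. -/
def frobSeries (p : ℕ) [Fact p.Prime] (n : ℕ) {R : Type*} [CommRing R] (s : R →+* R) :
    MvPowerSeries (Fin n) R →+* MvPowerSeries (Fin n) R :=
  (MvPowerSeries.expand p (Fact.out : p.Prime).ne_zero).toRingHom.comp (MvPowerSeries.map s)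

section

variable {R : Type*} [CommRing R] (s : R →+* R)

theorem frobSeries_C (c : R) :
    frobSeries p n s (MvPowerSeries.C c) = MvPowerSeries.C (s c) := by
  simp [frobSeries, MvPowerSeries.expand_C]

theorem frobSeries_X (j : Fin n) :
    frobSeries p n s (MvPowerSeries.X j) = MvPowerSeries.X j ^ p := by
  simp [frobSeries]

theorem frobSeries_monomial (d : Fin n →₀ ℕ) (c : R) :
    frobSeries p n s (MvPowerSeries.monomial d c) = MvPowerSeries.monomial (p • d) (s c) := by
  simp [frobSeries]

theorem coeff_frobSeries_smul (d : Fin n →₀ ℕ) (f : MvPowerSeries (Fin n) R) :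
    MvPowerSeries.coeff (p • d) (frobSeries p n s f) = s (MvPowerSeries.coeff d f) := by
  simp [frobSeries]

theorem coeff_frobSeries_eq_zero {d : Fin n →₀ ℕ} (h : ∀ e, d ≠ p • e)
    (f : MvPowerSeries (Fin n) R) : MvPowerSeries.coeff d (frobSeries p n s f) = 0 := by
  by_cases hd : ∀ i, p ∣ d i
  · choose c hc using hd
    exact absurd (Finsupp.ext fun i => by simp [hc i]) (h (Finsupp.equivFunOnFinite.symm c))
  · push Not at hd
    obtain ⟨i, hi⟩ := hd
    exact MvPowerSeries.coeff_expand_of_not_dvd p (Fact.out : p.Prime).ne_zero _ hi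

theorem constantCoeff_frobSeries (f : MvPowerSeries (Fin n) R) :
    MvPowerSeries.constantCoeff (frobSeries p n s f) = s (MvPowerSeries.constantCoeff f) := by
  simp [frobSeries]

end

variable {k : Type v} [Field k] [CharP k p] [PerfectRing k p]

/-- The lift of Frobenius with `t_j ↦ t_j^p`. -/
def FrobLift.std (p : ℕ) [Fact p.Prime] (k : Type v) [Field k] [CharP k p] [PerfectRing k p]
    (n : ℕ) : FrobLift p k n :=
  FrobLift.ofX (frobSeries p n WittVector.frobenius) (fun w => frobSeries_C _ w)
    (fun j => by rw [frobSeries_X, sub_self]; exact dvd_zero _)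

theorem FrobLift.std_apply (a : A p k n) :
    (FrobLift.std p k n).toRingHom a = frobSeries p n WittVector.frobenius a := rfl

/-- The extension of the standard lift of Frobenius to `K[[t]]`. -/
abbrev psiK (p : ℕ) [Fact p.Prime] (k : Type v) [Field k] [CharP k p] [PerfectRing k p]
    (n : ℕ) : KA p k n →+* KA p k n := frobSeries p n (sigK p k)

theorem incl_frobSeries (a : A p k n) :
    incl p k n (frobSeries p n WittVector.frobenius a) = psiK p k n (incl p k n a) := by
  refine MvPowerSeries.ext fun d => ?_
  rw [coeff_incl]
  by_cases h : ∃ e, d = p • e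
  · obtain ⟨e, rfl⟩ := h
    rw [coeff_frobSeries_smul, coeff_frobSeries_smul, coeff_incl, sigK_algebraMap]
  · push Not at h
    rw [coeff_frobSeries_eq_zero _ h, coeff_frobSeries_eq_zero _ h, map_zero]

theorem nsmul_p_injective : Function.Injective fun e : Fin n →₀ ℕ => p • e :=
  fun a b h => Finsupp.ext fun i => by
    have := DFunLike.congr_fun h i
    simp only [Finsupp.smul_apply, smul_eq_mul] at this
    exact Nat.eq_of_mul_eq_mul_left (Fact.out : p.Prime).pos this

/-- The `m`-th term is a monomial of exponent `p m`, so every coefficient receives at most one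
contribution and convergence is never an issue. -/
theorem FrobLift.std_mapsTo (f : KA p k n) : (FrobLift.std p k n).MapsTo f (psiK p k n f) := by
  classical
  rw [FrobLift.mapsTo_iff, SubstHas, padicHasSum_iff]
  intro d
  have hterm : ∀ m : Fin n →₀ ℕ, MvPowerSeries.C (sigK p k (MvPowerSeries.coeff m f)) *
      ∏ j, incl p k n ((FrobLift.std p k n).toRingHom (MvPowerSeries.X j)) ^ m j =
      MvPowerSeries.monomial (p • m) (sigK p k (MvPowerSeries.coeff m f)) := by
    intro m
    simp only [FrobLift.std_apply, frobSeries_X, map_pow, incl_X]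
    rw [← frobSeries_monomial, MvPowerSeries.monomial_eq', map_mul, frobSeries_C,
      Finsupp.prod_fintype _ _ (fun i => pow_zero _), map_prod]
    simp only [map_pow, frobSeries_X]
  simp only [hterm]
  by_cases h : ∃ e, d = p • e
  · obtain ⟨e, rfl⟩ := h
    rw [coeff_frobSeries_smul]
    have := hs_single (f := fun m => MvPowerSeries.coeff (p • e)
      (MvPowerSeries.monomial (p • m) (sigK p k (MvPowerSeries.coeff m f)))) e fun m hm =>
        MvPowerSeries.coeff_monomial_ne (fun h => hm (nsmul_p_injective h).symm) _
    rwa [MvPowerSeries.coeff_monomial_same] at this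
  · push Not at h
    rw [coeff_frobSeries_eq_zero _ h]
    have h0 : (fun m : Fin n →₀ ℕ => MvPowerSeries.coeff d (MvPowerSeries.monomial (p • m)
        (sigK p k (MvPowerSeries.coeff m f)))) = fun _ => 0 :=
      funext fun m => MvPowerSeries.coeff_monomial_ne (h m) _
    rw [h0]
    exact hs_zero

end Standard

end CY3

end

noncomputable section

namespace CY3

open Finset

/-! ### Valuations of factorials. -/

section Factorials

variable {p : ℕ} [Fact p.Prime] {k : Type v} [Field k] [CharP k p]

/-- Legendre's bound `(p - 1) v(m!) < m` with `p - 1 ≥ 2`. In this form it gives `m - v(m!) ≥ (m +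
1) / 2`, the convergence rate of `exp` on `pA`. -/
theorem two_mul_padicValNat_factorial_lt (hp : 2 < p) {m : ℕ} (hm : m ≠ 0) :
    2 * padicValNat p m.factorial + 1 ≤ m := by
  have h := sub_one_mul_padicValNat_factorial_lt_of_ne_zero (p := p) hm
  have h3 : 2 * padicValNat p m.factorial ≤ (p - 1) * padicValNat p m.factorial :=
    Nat.mul_le_mul_right _ (by omega)
  omega

theorem inv_factorial_mul_mem {m r : ℕ} {x : K p k}
    (hx : x ∈ lat p k (r + padicValNat p m.factorial)) :
    ((m.factorial : ℕ) : K p k)⁻¹ * x ∈ lat p k r := by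
  obtain ⟨u, hu⟩ := natCast_eq_pow_mul_unit (p := p) (k := k) m.factorial_ne_zero
  have h1 : ((m.factorial : ℕ) : K p k) =
      (p : K p k) ^ padicValNat p m.factorial * algebraMap (W p k) (K p k) u := by
    rw [← map_natCast (algebraMap (W p k) (K p k)) m.factorial, hu, map_mul, map_pow,
      map_natCast]
  have h3 : algebraMap (W p k) (K p k) u *
      algebraMap (W p k) (K p k) ((u⁻¹ : (W p k)ˣ) : W p k) = 1 := by rw [← map_mul]; simp
  rw [← p_pow_mul_mem_lat (s := padicValNat p m.factorial)]
  have h4 := mul_mem_lat_of_integral (algebraMap_mem_lat ((u⁻¹ : (W p k)ˣ) : W p k)) hx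
  convert h4 using 1
  rw [h1, mul_inv, ← eq_inv_of_mul_eq_one_right h3]
  have hp0 := pow_ne_zero (padicValNat p m.factorial) (p_ne_zero_K (p := p) (k := k))
  field_simp

end Factorials

/-! ### Exponentials: convergence on `pA`, Dwork's criterion, compatibility with lifts. -/

section Exp

variable {p : ℕ} [Fact p.Prime] {k : Type v} [Field k] [CharP k p] [PerfectRing k p] {n : ℕ}
  {x y a b : KA p k n}

theorem IsExp.unique (h : IsExp x a) (h' : IsExp x b) : a = b := PadicHasSum.unique h h'

theorem isExp_zero : IsExp (0 : KA p k n) 1 := by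
  classical
  have := padicHasSum_single (f := fun m : ℕ =>
    MvPowerSeries.C (((Nat.factorial m : ℕ) : K p k)⁻¹) * (0 : KA p k n) ^ m) 0
    fun m hm => by simp [hm]
  simpa [IsExp] using this

theorem IsExp.add (h : IsExp x a) (h' : IsExp y b) : IsExp (x + y) (a * b) := by
  have := PadicHasSum.mul_antidiagonal h h'
  unfold IsExp
  convert this using 2 with m
  rw [(Commute.all x y).add_pow', Finset.mul_sum]
  refine Finset.sum_congr rfl fun ij hij => ?_
  obtain ⟨i, j⟩ := ij
  have hm : i + j = m := Finset.HasAntidiagonal.mem_antidiagonal.1 hij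
  subst hm
  have hc : (((i + j).factorial : ℕ) : K p k)⁻¹ * ((i + j).choose i : K p k) =
      ((i.factorial : ℕ) : K p k)⁻¹ * ((j.factorial : ℕ) : K p k)⁻¹ := by
    have h1 := Nat.choose_mul_factorial_mul_factorial (Nat.le_add_right i j)
    rw [Nat.add_sub_cancel_left] at h1
    have h2 : (((i + j).choose i : ℕ) : K p k) * (i.factorial : ℕ) * (j.factorial : ℕ) =
      ((i + j).factorial : ℕ) := by exact_mod_cast congrArg (Nat.cast (R := K p k)) h1
    have hi : ((i.factorial : ℕ) : K p k) ≠ 0 := Nat.cast_ne_zero.2 i.factorial_ne_zero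
    have hj : ((j.factorial : ℕ) : K p k) ≠ 0 := Nat.cast_ne_zero.2 j.factorial_ne_zero
    have hij' : (((i + j).factorial : ℕ) : K p k) ≠ 0 :=
      Nat.cast_ne_zero.2 (i + j).factorial_ne_zero
    field_simp
    rw [← h2]
  have hc' := congrArg (MvPowerSeries.C (σ := Fin n)) hc
  rw [map_mul, map_mul, map_natCast] at hc'
  simp only [nsmul_eq_mul]
  linear_combination x ^ i * y ^ j * hc'

theorem IsExp.natCast_mul (h : IsExp x a) (m : ℕ) : IsExp ((m : KA p k n) * x) (a ^ m) := by
  induction m with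
  | zero => simpa using isExp_zero
  | succ m ih =>
    rw [pow_succ, Nat.cast_succ, add_mul, one_mul]
    exact ih.add h

theorem coeff_pow_eq_zero {R : Type*} [CommRing R] {f : MvPowerSeries (Fin n) R}
    (hf : MvPowerSeries.constantCoeff f = 0) {d : Fin n →₀ ℕ} {m : ℕ} (hm : d.degree < m) :
    MvPowerSeries.coeff d (f ^ m) = 0 :=
  MvPowerSeries.coeff_eq_zero_of_constantCoeff_nilpotent (m := 1) (by simpa using hf)
    (by omega)

theorem exists_isExp (hx : MvPowerSeries.constantCoeff x = 0) : ∃ a, IsExp x a := by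
  refine ⟨mkSeries fun d => ∑ m ∈ range (d.degree + 1), MvPowerSeries.coeff d
    (MvPowerSeries.C (((Nat.factorial m : ℕ) : K p k)⁻¹) * x ^ m), ?_⟩
  rw [IsExp, padicHasSum_iff]
  intro d
  rw [coeff_mkSeries]
  refine hs_of_finite (f := fun m => MvPowerSeries.coeff d
    (MvPowerSeries.C (((Nat.factorial m : ℕ) : K p k)⁻¹) * x ^ m)) _ fun m hm => ?_
  rw [MvPowerSeries.coeff_C_mul, coeff_pow_eq_zero hx, mul_zero]
  simp only [Finset.mem_range, not_lt] at hm
  omega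

theorem IsExp.constantCoeff_eq_one (h : IsExp x a) (hx : MvPowerSeries.constantCoeff x = 0) :
    MvPowerSeries.constantCoeff a = 1 := by
  classical
  have h1 := padicHasSum_iff.1 h 0
  have h2 := hs_single (f := fun m : ℕ => MvPowerSeries.coeff (0 : Fin n →₀ ℕ)
    (MvPowerSeries.C (((Nat.factorial m : ℕ) : K p k)⁻¹) * x ^ m)) 0 fun m hm => by
      simp [hx, hm]
  simpa using h1.unique h2

theorem coeff_exp_term_mem {s : ℕ} {f : KA p k n} (hf : ∀ d, MvPowerSeries.coeff d f ∈ lat p k s)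
    {m r : ℕ} (hm : r + padicValNat p m.factorial ≤ m * s) (d : Fin n →₀ ℕ) :
    MvPowerSeries.coeff d (MvPowerSeries.C (((Nat.factorial m : ℕ) : K p k)⁻¹) * f ^ m) ∈
      lat p k r := by
  classical
  have hpow : ∀ m : ℕ, ∀ d, MvPowerSeries.coeff d (f ^ m) ∈ lat p k (m * s) := by
    intro m
    induction m with
    | zero =>
      intro d
      rw [pow_zero, MvPowerSeries.coeff_one, zero_mul]
      split_ifs
      · exact one_mem_lat
      · exact zero_mem _
    | succ m ih =>
      intro d
      rw [pow_succ, MvPowerSeries.coeff_mul, Nat.succ_mul]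
      exact sum_mem fun x _ => mul_mem_lat (ih x.1) (hf x.2)
  rw [MvPowerSeries.coeff_C_mul]
  exact inv_factorial_mul_mem (lat_anti hm (hpow m d))

theorem coeff_incl_p_mul_mem {r : ℕ} {c : A p k n} (h : (p : A p k n) ^ r ∣ c)
    (d : Fin n →₀ ℕ) : MvPowerSeries.coeff d (incl p k n c) ∈ lat p k r := by
  rw [coeff_incl, algebraMap_mem_lat_iff]
  exact p_dvd_iff_coeff.1 h d

theorem p_pow_dvd_of_coeff_incl {r : ℕ} {c : A p k n}
    (h : ∀ d, MvPowerSeries.coeff d (incl p k n c) ∈ lat p k r) : (p : A p k n) ^ r ∣ c := by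
  rw [p_dvd_iff_coeff]
  intro d
  rw [← algebraMap_mem_lat_iff, ← coeff_incl]
  exact h d

/-- The `m`-th term has valuation at least `m - v(m!) ≥ (m + 1) / 2`. So the series converges
`p`-adically, and all terms but the first are divisible by `p`. -/
theorem exists_isExp_p_mul (hp : 2 < p) (c : A p k n) :
    ∃ b : A p k n, IsExp (incl p k n (p * c)) (incl p k n b) ∧ (p : A p k n) ∣ b - 1 := by
  classical
  have hf := coeff_incl_p_mul_mem (r := 1) (c := (p : A p k n) * c) (by simp)
  have hnull : ∀ d : Fin n →₀ ℕ, ∃ g, HS (fun m : ℕ => MvPowerSeries.coeff d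
      (MvPowerSeries.C (((Nat.factorial m : ℕ) : K p k)⁻¹) * incl p k n (p * c) ^ m)) g := by
    intro d
    refine Null.exists_hs fun r => (Set.finite_lt_nat (2 * r + 1)).subset ?_
    intro m hm
    by_contra hcon
    have hcon' : 2 * r + 1 ≤ m := not_lt.1 hcon
    have := two_mul_padicValNat_factorial_lt (p := p) hp (m := m) (by omega)
    exact hm (coeff_exp_term_mem hf (by omega) d)
  choose g hg using hnull
  have hsub : ∀ d, MvPowerSeries.coeff d (mkSeries g - 1 : KA p k n) ∈ lat p k 1 := by
    intro d
    have := (hg d).sub_sum_mem (r := 1) (S := {0}) fun m hm => coeff_exp_term_mem hf (by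
      have hm0 : m ≠ 0 := by simpa using hm
      have := two_mul_padicValNat_factorial_lt (p := p) hp hm0
      omega) d
    rw [map_sub, coeff_mkSeries]
    simpa using this
  obtain ⟨b', hb'⟩ := exists_incl fun d => lat_anti (Nat.zero_le 1) (hsub d)
  have hb : incl p k n (b' + 1) = mkSeries g := by rw [map_add, hb', map_one, sub_add_cancel]
  refine ⟨b' + 1, ?_, ?_⟩
  · rw [hb, IsExp, padicHasSum_iff]
    exact hg
  · rw [add_sub_cancel_right]
    have := p_pow_dvd_of_coeff_incl (r := 1) (c := b') fun d => by rw [hb']; exact hsub d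
    simpa using this

/-- Injectivity of `exp` on `pA`: if `f = pc` is divisible by `p^(s+1)`, the terms with `m ≥ 2` are
divisible by `p^(s+2)`, so `exp(f) = 1` forces `f ≡ 0` modulo `p^(s+2)`. Iterating gives `f = 0`. -/
theorem eq_zero_of_isExp_one (hp : 2 < p) {c : A p k n} (h : IsExp (incl p k n (p * c)) 1) :
    c = 0 := by
  have key : ∀ s : ℕ, (p : A p k n) ^ s ∣ c := by
    intro s
    induction s with
    | zero => simp
    | succ s ih =>
      have hf := coeff_incl_p_mul_mem (r := s + 1) (c := (p : A p k n) * c)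
        (by rw [pow_succ']; exact mul_dvd_mul_left _ ih)
      have h1 : (p : A p k n) ^ (s + 2) ∣ p * c := by
        refine p_pow_dvd_of_coeff_incl fun d => ?_
        have := (padicHasSum_iff.1 h d).sub_sum_mem (r := s + 2) (S := {0, 1})
          fun m hm => coeff_exp_term_mem hf (by
            simp only [Finset.mem_insert, Finset.mem_singleton, not_or] at hm
            have := two_mul_padicValNat_factorial_lt (p := p) hp hm.1
            have h3 : 2 ≤ m := by omega
            rcases h3.eq_or_lt with h4 | h4
            · subst h4
              omega
            · nlinarith) d
        simpa [neg_mem_iff] using this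
      rw [show s + 2 = (s + 1) + 1 from rfl, pow_succ'] at h1
      refine (mul_dvd_mul_iff_left ?_).1 h1
      rw [← map_natCast (MvPowerSeries.C (σ := Fin n) (R := W p k)) p]
      intro h0
      exact p_ne_zero_W (MvPowerSeries.C_injective (h0.trans (map_zero _).symm))
  refine MvPowerSeries.ext fun d => ?_
  rw [map_zero]
  exact W_eq_zero_of_forall_dvd fun r => p_dvd_iff_coeff.1 (key r) d

theorem PadicHasSum.map_psiK {ι : Type*} {f : ι → KA p k n} {g : KA p k n}
    (h : PadicHasSum f g) : PadicHasSum (fun i => psiK p k n (f i)) (psiK p k n g) := by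
  rw [padicHasSum_iff]
  intro d
  by_cases hd : ∃ e, d = p • e
  · obtain ⟨e, rfl⟩ := hd
    simp only [coeff_frobSeries_smul]
    exact (padicHasSum_iff.1 h e).map_sigK
  · push Not at hd
    simp only [coeff_frobSeries_eq_zero _ hd]
    exact hs_zero

theorem IsExp.map_psiK (h : IsExp x a) : IsExp (psiK p k n x) (psiK p k n a) := by
  have := PadicHasSum.map_psiK h
  simpa only [IsExp, map_mul, map_pow, frobSeries_C, map_inv₀, map_natCast] using this

theorem coeff_mul_of_low {R : Type*} [CommRing R] {N : ℕ} {g f : MvPowerSeries (Fin n) R}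
    (hf : ∀ d : Fin n →₀ ℕ, d.degree < N → MvPowerSeries.coeff d f = 0) {d : Fin n →₀ ℕ}
    (hd : d.degree = N) : MvPowerSeries.coeff d (g * f) =
      MvPowerSeries.constantCoeff g * MvPowerSeries.coeff d f := by
  classical
  rw [MvPowerSeries.coeff_mul, Finset.sum_eq_single (0, d)]
  · simp
  · rintro ⟨i, j⟩ hij hne
    have hij' : i + j = d := Finset.HasAntidiagonal.mem_antidiagonal.1 hij
    rw [hf j, mul_zero]
    have hi : i ≠ 0 := by
      rintro rfl
      rw [zero_add] at hij'
      exact hne (by rw [hij'])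
    have : i.degree ≠ 0 := fun h => hi ((Finsupp.degree_eq_zero_iff i).1 h)
    rw [← hd, ← hij', map_add]
    omega
  · intro h
    exact absurd (Finset.HasAntidiagonal.mem_antidiagonal.2 (by simp)) h

/-- Dwork's criterion for integrality. -/
theorem exists_incl_of_dwork {E : KA p k n} {h : A p k n}
    (hE : MvPowerSeries.constantCoeff E = 1) (hh : (p : A p k n) ∣ h - 1)
    (hh0 : MvPowerSeries.constantCoeff h = 1)
    (hfrob : psiK p k n E = E ^ p * incl p k n h) : ∃ q, incl p k n q = E := by
  classical
  refine exists_incl fun d => ?_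
  induction hN : d.degree using Nat.strong_induction_on generalizing d with
  | _ N ih =>
  rcases Nat.eq_zero_or_pos N with hN0 | hN0
  · have : d = 0 := (Finsupp.degree_eq_zero_iff d).1 (by omega)
    subst this
    rw [MvPowerSeries.coeff_zero_eq_constantCoeff_apply, hE]
    exact one_mem_lat
  -- `w` is the part of `E` of degree below `N`, integral by induction. The rest `z` starts in
  -- degree `N`, and only its coefficients there are examined.
  obtain ⟨w, hw⟩ := exists_incl (f := mkSeries fun d : Fin n →₀ ℕ =>
      if d.degree < N then MvPowerSeries.coeff d E else 0) fun e => by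
    rw [coeff_mkSeries]
    split_ifs with he
    · exact ih _ he e rfl
    · exact zero_mem _
  set z : KA p k n := E - incl p k n w with hz
  have hzlow : ∀ e : Fin n →₀ ℕ, e.degree < N → MvPowerSeries.coeff e z = 0 := by
    intro e he
    rw [hz, map_sub, hw, coeff_mkSeries, if_pos he, sub_self]
  have hzd : MvPowerSeries.coeff d z = MvPowerSeries.coeff d E := by
    rw [hz, map_sub, hw, coeff_mkSeries, if_neg (by omega), sub_zero]
  have hz0 : MvPowerSeries.constantCoeff z = 0 := by
    rw [← MvPowerSeries.coeff_zero_eq_constantCoeff_apply]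
    exact hzlow 0 (by simpa using hN0)
  have hw0 : MvPowerSeries.constantCoeff (incl p k n w) = 1 := by
    rw [show incl p k n w = E - z by rw [hz]; ring, map_sub, hE, hz0, sub_zero]
  obtain ⟨c, hc⟩ := Polynomial.powAddExpansion (incl p k n w) z p
  have hEw : E = incl p k n w + z := by rw [hz]; ring
  -- Expand `(w + z)^p h`. In degree `N` the term linear in `z` contributes `p` times the
  -- coefficient, as `w` and `h` have constant term `1`; terms with `z²` start in higher degree.
  have h1 : MvPowerSeries.coeff d (E ^ p * incl p k n h) =
      MvPowerSeries.coeff d (incl p k n (w ^ p * h)) + p * MvPowerSeries.coeff d E := by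
    have : E ^ p * incl p k n h = incl p k n (w ^ p * h) +
        ((p * incl p k n w ^ (p - 1) * incl p k n h) * z + (c * z * incl p k n h) * z) := by
      rw [hEw, hc, map_mul, map_pow]
      ring
    rw [this, map_add, map_add, coeff_mul_of_low hzlow hN, coeff_mul_of_low hzlow hN, hzd]
    have hih : MvPowerSeries.constantCoeff (incl p k n h) = 1 := by
      simp [incl, hh0]
    simp [hz0, hw0, hih]
  have h2 : MvPowerSeries.coeff d (psiK p k n z) = 0 := by
    by_cases hd : ∃ e, d = p • e
    · obtain ⟨e, rfl⟩ := hd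
      rw [coeff_frobSeries_smul, hzlow, map_zero]
      rw [map_nsmul, smul_eq_mul] at hN
      have := (Fact.out : p.Prime).two_le
      nlinarith
    · push Not at hd
      exact coeff_frobSeries_eq_zero _ hd _
  have h3 : MvPowerSeries.coeff d (psiK p k n E) =
      MvPowerSeries.coeff d (incl p k n ((FrobLift.std p k n).toRingHom w)) := by
    rw [hEw, map_add, map_add, h2, add_zero, FrobLift.std_apply, incl_frobSeries]
  -- `ψ(z)` has nothing in degree `N`, since `ψ` multiplies degrees by `p`. Thus `p` times the
  -- wanted coefficient is a coefficient of `ψ(w) - w^p h`, and this is divisible by `p` because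
  -- `ψ(w) ≡ w^p` and `h ≡ 1`.
  have h4 : (p : A p k n) ∣ (FrobLift.std p k n).toRingHom w - w ^ p * h := by
    have := dvd_sub ((FrobLift.std p k n).dvd_sub_pow w) (hh.mul_left (w ^ p))
    convert this using 1
    ring
  have h5 := coeff_incl_p_mul_mem (r := 1) (by simpa using h4) d
  rw [map_sub, map_sub, ← h3, hfrob, h1, add_sub_cancel_left] at h5
  exact p_mul_mem_lat.1 h5

/-- `σ` preserves valuations. If the least `a` with `p^a c ∈ pW` were positive, then `σ(p^(a-1) c) =
p^(a-1) g + p^a c` would lie in `pW` too, against minimality. -/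
theorem mem_lat_one_of_frobenius {c : K p k} {g : K p k} (hg : g ∈ lat p k 1)
    (h : sigK p k c - p * c = g) : c ∈ lat p k 1 := by
  classical
  have hex : ∃ a : ℕ, (p : K p k) ^ a * c ∈ lat p k 1 := exists_pow_mul_mem_lat c 1
  by_contra hc
  set a := Nat.find hex with ha
  have hspec : (p : K p k) ^ a * c ∈ lat p k 1 := Nat.find_spec hex
  have ha0 : a ≠ 0 := by
    intro h0
    rw [h0, pow_zero, one_mul] at hspec
    exact hc hspec
  obtain ⟨b, hb⟩ := Nat.exists_eq_succ_of_ne_zero ha0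
  refine Nat.find_min hex (m := b) (by omega) ?_
  rw [← sigK_mem_lat, map_mul, map_pow, map_natCast, sub_eq_iff_eq_add.1 h, mul_add]
  refine add_mem (mul_mem_lat_of_integral (lat_anti (Nat.zero_le _) (p_pow_mem_lat b)) hg) ?_
  rwa [hb, pow_succ, mul_assoc] at hspec

/-- If `ψ(τ) - pτ ∈ pA` for the standard lift of Frobenius `ψ`, then `exp(τ) ∈ A`. -/
theorem exists_exp_integral (hp : 2 < p) {τ : KA p k n} {g : A p k n}
    (h : psiK p k n τ - p * τ = incl p k n (p * g)) :
    MvPowerSeries.constantCoeff τ ∈ lat p k 1 ∧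
    ∃ q : A p k n, IsExp τ (incl p k n q) ∧
      (p : W p k) ∣ MvPowerSeries.constantCoeff q - 1 := by
  have hc : MvPowerSeries.constantCoeff τ ∈ lat p k 1 := by
    refine mem_lat_one_of_frobenius
      (coeff_incl_p_mul_mem (r := 1) (c := (p : A p k n) * g) (by simp) 0) ?_
    rw [← h, MvPowerSeries.coeff_zero_eq_constantCoeff_apply, map_sub, map_mul, map_natCast,
      constantCoeff_frobSeries]
  refine ⟨hc, ?_⟩
  -- The constant term and the rest are exponentiated separately. The constant lies in `pW`, where
  -- `exp` converges `p`-adically. The rest has no constant term, so `exp` converges `t`-adically,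
  -- and Dwork's criterion applies to it with `h = exp(p g')`.
  obtain ⟨c, hc'⟩ := mem_lat.1 hc
  rw [pow_one] at hc'
  obtain ⟨e, he, he1⟩ := exists_isExp_p_mul (n := n) hp (MvPowerSeries.C c)
  have hτ0 : incl p k n ((p : A p k n) * MvPowerSeries.C c) =
      MvPowerSeries.C (MvPowerSeries.constantCoeff τ) := by
    rw [hc', ← map_natCast (MvPowerSeries.C (σ := Fin n) (R := W p k)) p, ← map_mul, incl_C]
  set τ' := τ - MvPowerSeries.C (MvPowerSeries.constantCoeff τ) with hτ'
  have hτ'0 : MvPowerSeries.constantCoeff τ' = 0 := by simp [hτ']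
  obtain ⟨E, hE⟩ := exists_isExp hτ'0
  set g' : A p k n := g - MvPowerSeries.C (MvPowerSeries.constantCoeff g) with hg'
  obtain ⟨b, hb, hb1⟩ := exists_isExp_p_mul hp g'
  have hrel : psiK p k n τ' = p * τ' + incl p k n (p * g') := by
    have h0 := congrArg MvPowerSeries.constantCoeff h
    rw [map_sub, constantCoeff_frobSeries, map_mul, map_natCast] at h0
    have h0' : MvPowerSeries.constantCoeff (incl p k n (p * g)) =
        p * algebraMap (W p k) (K p k) (MvPowerSeries.constantCoeff g) := by
      simp [incl]
    rw [h0'] at h0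
    have h0'' := congrArg (MvPowerSeries.C (σ := Fin n)) h0
    rw [map_sub, map_mul, map_mul, map_natCast] at h0''
    have h1 : incl p k n (p * g') = incl p k n (p * g) -
        (p : KA p k n) * MvPowerSeries.C (algebraMap (W p k) (K p k) (MvPowerSeries.constantCoeff g)) := by
      rw [hg', mul_sub, map_sub (incl p k n), map_mul (incl p k n) _ (MvPowerSeries.C _),
        map_natCast, incl_C]
    rw [h1, ← h, hτ', map_sub, frobSeries_C]
    linear_combination -h0''
  have hdw : psiK p k n E = E ^ p * incl p k n b := by
    have h1 := hE.map_psiK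
    rw [hrel] at h1
    exact h1.unique ((hE.natCast_mul p).add hb)
  have hb0 : MvPowerSeries.constantCoeff b = 1 := by
    have h1 := hb.constantCoeff_eq_one (by simp [incl, hg'])
    refine IsFractionRing.injective (W p k) (K p k) ?_
    rw [map_one, ← h1]
    simp [incl]
  obtain ⟨q', hq'⟩ := exists_incl_of_dwork (hE.constantCoeff_eq_one hτ'0) hb1 hb0 hdw
  refine ⟨e * q', ?_, ?_⟩
  · have h1 := he.add hE
    rw [hτ0, hτ', add_sub_cancel, ← hq', ← map_mul] at h1
    exact h1
  · have h1 : MvPowerSeries.constantCoeff q' = 1 := by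
      have h2 := hE.constantCoeff_eq_one hτ'0
      rw [← hq'] at h2
      refine IsFractionRing.injective (W p k) (K p k) ?_
      rw [map_one, ← h2]
      simp [incl]
    rw [map_mul, h1, mul_one]
    obtain ⟨z, hz⟩ := he1
    refine ⟨MvPowerSeries.constantCoeff z, ?_⟩
    have := congrArg MvPowerSeries.constantCoeff hz
    simpa using this

/-- The coefficient at `e` of the `d`-th term of the series defining `φ(f)`. -/
def evalSummand (φ : FrobLift p k n) (e : Fin n →₀ ℕ) (f : KA p k n) (d : Fin n →₀ ℕ) : K p k :=
  MvPowerSeries.coeff e (MvPowerSeries.C (sigK p k (MvPowerSeries.coeff d f)) *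
    ∏ j, incl p k n (φ.toRingHom (MvPowerSeries.X j)) ^ d j)

theorem evalSummand_eq (φ : FrobLift p k n) (e : Fin n →₀ ℕ) (f : KA p k n) (d : Fin n →₀ ℕ) :
    evalSummand φ e f d = MvPowerSeries.coeff e
      (∏ j, incl p k n (φ.toRingHom (MvPowerSeries.X j)) ^ d j) *
        sigK p k (MvPowerSeries.coeff d f) := by
  rw [evalSummand, MvPowerSeries.coeff_C_mul, mul_comm]

theorem FrobLift.MapsTo.hs {φ : FrobLift p k n} {f g : KA p k n} (h : φ.MapsTo f g)
    (e : Fin n →₀ ℕ) : HS (evalSummand φ e f) (MvPowerSeries.coeff e g) :=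
  padicHasSum_iff.1 h e

theorem coeff_prod_mem_lat (φ : FrobLift p k n) (d e : Fin n →₀ ℕ) :
    MvPowerSeries.coeff e (∏ j, incl p k n (φ.toRingHom (MvPowerSeries.X j)) ^ d j) ∈
      lat p k (d.degree - e.degree) := by
  rw [prod_incl_pow]
  exact coeff_incl_mem_lat_of_mem_J (monomial_prod_mem_J φ.X_mem_J d) e

/-- `φ(exp τ) = exp(φ τ)` is an interchange of the sums over monomials `d` and exponents `m`. The
growth hypothesis gives `p^|d|` times the coefficient of `τ^m` at `d` in `p^m W`; the loss `p^|d|`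
is regained from `φ(t)^d ∈ J |d|`, up to `p^|e|` at the coefficient `e`, and `m - v(m!)` tends to
infinity. -/
theorem isExp_mapsTo (hp : 2 < p) (φ : FrobLift p k n) {τ φτ : KA p k n} {q : A p k n}
    (hτ : ∀ d : Fin n →₀ ℕ, (p : K p k) ^ d.degree * MvPowerSeries.coeff d τ ∈ lat p k 1)
    (hq : IsExp τ (incl p k n q)) (hφ : φ.MapsTo τ φτ) :
    IsExp φτ (incl p k n (φ.toRingHom q)) := by
  classical
  rw [IsExp, padicHasSum_iff]
  intro e
  have hpow : ∀ (m : ℕ) (d : Fin n →₀ ℕ),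
      (p : K p k) ^ d.degree * MvPowerSeries.coeff d (τ ^ m) ∈ lat p k m := by
    intro m
    induction m with
    | zero =>
      intro d
      rw [pow_zero, MvPowerSeries.coeff_one]
      split_ifs
      · rw [mul_one]
        exact lat_anti (Nat.zero_le _) (p_pow_mem_lat _)
      · rw [mul_zero]
        exact zero_mem _
    | succ m ih =>
      intro d
      rw [pow_succ, MvPowerSeries.coeff_mul, Finset.mul_sum]
      refine sum_mem fun x hx => ?_
      rw [← Finset.HasAntidiagonal.mem_antidiagonal.1 hx, map_add, pow_add, mul_mul_mul_comm]
      exact mul_mem_lat (ih x.1) (hτ x.2)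
  have hcol : ∀ m : ℕ, HS (evalSummand φ e (MvPowerSeries.C (((Nat.factorial m : ℕ) : K p k)⁻¹) *
      τ ^ m)) (MvPowerSeries.coeff e
        (MvPowerSeries.C (((Nat.factorial m : ℕ) : K p k)⁻¹) * φτ ^ m)) := by
    intro m
    have h1 : φ.MapsTo _ _ := ((SubstHas.pow ((φ.mapsTo_iff _ _).1 hφ) m).C_mul
      (((Nat.factorial m : ℕ) : K p k)⁻¹))
    rw [map_inv₀ (sigK p k), map_natCast] at h1
    exact h1.hs e
  refine hs_fubini (f := fun x : (Fin n →₀ ℕ) × ℕ =>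
    evalSummand φ e (MvPowerSeries.C (((Nat.factorial x.2 : ℕ) : K p k)⁻¹) * τ ^ x.2) x.1) ?_
    (R := evalSummand φ e (incl p k n q)) ?_ hcol ((φ.mapsTo_incl q).hs e)
  · intro r
    -- For each of the finitely many small `m` the row over `d` is null because `φ(τ)^m / m!` is
    -- already a convergent sum; for larger `m` every entry is in `p^r W`.
    have hfin : (⋃ m ∈ Set.Iio (2 * (r + e.degree) + 1), (fun d => (d, m)) ''
        {d | evalSummand φ e (MvPowerSeries.C (((Nat.factorial m : ℕ) : K p k)⁻¹) * τ ^ m) d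
          ∉ lat p k r}).Finite :=
      (Set.finite_lt_nat _).biUnion fun m _ => ((hcol m).null r).image _
    refine hfin.subset ?_
    rintro ⟨d, m⟩ hdm
    by_cases hm : m < 2 * (r + e.degree) + 1
    · exact Set.mem_biUnion (show m ∈ Set.Iio _ from hm) ⟨d, hdm, rfl⟩
    · refine absurd ?_ hdm
      have hv := two_mul_padicValNat_factorial_lt (p := p) hp (m := m) (by omega)
      change evalSummand φ e _ d ∈ lat p k r
      rw [evalSummand_eq, MvPowerSeries.coeff_C_mul]
      have h1 : (p : K p k) ^ d.degree * sigK p k (((Nat.factorial m : ℕ) : K p k)⁻¹ *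
          MvPowerSeries.coeff d (τ ^ m)) ∈ lat p k (r + e.degree) := by
        rw [← map_natCast (sigK p k) p, ← map_pow, ← map_mul, sigK_mem_lat, mul_left_comm]
        exact inv_factorial_mul_mem (lat_anti (by omega) (hpow m d))
      have h2 := mul_mem_lat h1 (coeff_prod_mem_lat φ d e)
      rw [mul_assoc, mul_comm (sigK p k _)] at h2
      exact p_pow_mul_mem_lat.1 (lat_anti (by omega) h2)
  · intro d
    simp only [evalSummand_eq]
    exact ((padicHasSum_iff.1 hq d).map_sigK).mul_left _

end Exp

end CY3

end

noncomputable section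

namespace CY3

open Finset

/-! ### Change of coordinates in `A`, regular parameters, lifts prescribed on coordinates. -/

section Parameters

/-- The kernels of the iterates stabilise, say at `N`. An element of `ker f` is `f^N y`; then `y ∈
ker f^(N+1) = ker f^N`, so it is zero. -/
theorem ringHom_injective_of_surjective {R : Type*} [CommRing R] [IsNoetherianRing R]
    (f : R →+* R) (hf : Function.Surjective f) : Function.Injective f := by
  let F : ℕ →o Ideal R := ⟨fun m => RingHom.ker (f ^ m), monotone_nat_of_le_succ fun m x hx => by
    rw [RingHom.mem_ker] at hx ⊢
    rw [pow_succ', RingHom.mul_def, RingHom.comp_apply, hx, map_zero]⟩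
  obtain ⟨N, hN⟩ := monotone_stabilizes_iff_noetherian.2 (inferInstance : IsNoetherian R R) F
  rw [injective_iff_map_eq_zero]
  intro x hx
  have hsurj : Function.Surjective (f ^ N) := by
    rw [RingHom.coe_pow]
    exact hf.iterate N
  obtain ⟨y, rfl⟩ := hsurj x
  have hy : y ∈ F (N + 1) := by
    change y ∈ RingHom.ker (f ^ (N + 1))
    rw [RingHom.mem_ker, pow_succ', RingHom.mul_def, RingHom.comp_apply, hx]
  rw [← hN (N + 1) (Nat.le_succ N)] at hy
  exact hy

variable {p : ℕ} [Fact p.Prime] {k : Type v} [Field k] [CharP k p] [PerfectRing k p] {n : ℕ}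

theorem isUnit_W_iff {w : W p k} : IsUnit w ↔ ¬ (p : W p k) ∣ w := by
  have hirr := WittVector.irreducible p (k := k)
  rw [← not_iff_not, not_not, ← mem_nonunits_iff, ← IsLocalRing.mem_maximalIdeal,
    hirr.maximalIdeal_eq, Ideal.mem_span_singleton]

theorem isUnit_A_iff {a : A p k n} : IsUnit a ↔ a ∉ J p k n 1 := by
  rw [MvPowerSeries.isUnit_iff_constantCoeff, isUnit_W_iff, not_iff_not]
  constructor
  · intro h d
    by_cases hd : d = 0
    · subst hd
      simpa using h
    · have : d.degree ≠ 0 := fun h0 => hd ((Finsupp.degree_eq_zero_iff d).1 h0)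
      rw [Nat.sub_eq_zero_of_le (by omega), pow_zero]
      exact one_dvd _
  · intro h
    simpa using h 0

theorem maximalIdeal_A : IsLocalRing.maximalIdeal (A p k n) = J p k n 1 := by
  ext a
  rw [IsLocalRing.mem_maximalIdeal, mem_nonunits_iff, isUnit_A_iff, not_not]

/-- Limits of series in `A` with terms in `J N`. -/
theorem exists_sum_limit (f : ℕ → A p k n) (hf : ∀ N, f N ∈ J p k n N) :
    ∃ g, ∀ N, g - ∑ i ∈ range N, f i ∈ J p k n N := by
  have h1 : ∀ d : Fin n →₀ ℕ, ∃ L : W p k, ∀ r, (p : W p k) ^ r ∣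
      L - MvPowerSeries.coeff d (∑ i ∈ range (r + d.degree), f i) := fun d =>
    W_exists_limit _ fun r => by
      rw [show r + 1 + d.degree = r + d.degree + 1 by ring, Finset.sum_range_succ, map_add,
        add_sub_cancel_left]
      simpa using hf (r + d.degree) d
  choose L hL using h1
  refine ⟨mkSeries L, fun N d => ?_⟩
  rw [map_sub, coeff_mkSeries]
  rcases le_or_gt d.degree N with h | h
  · have := hL d (N - d.degree)
    rwa [Nat.sub_add_cancel h] at this
  · rw [Nat.sub_eq_zero_of_le h.le, pow_zero]
    exact one_dvd _

theorem eq_zero_of_forall_mem_J {a : A p k n} (h : ∀ N, a ∈ J p k n N) : a = 0 := by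
  refine MvPowerSeries.ext fun d => ?_
  rw [map_zero]
  refine W_eq_zero_of_forall_dvd fun r => ?_
  simpa using h (r + d.degree) d

variable {u : Fin n → A p k n}

/-- The elements `p, u_1, …, u_n` generate the maximal ideal if the Jacobian is invertible. -/
theorem exists_X_eq (hu : ∀ i, u i ∈ J p k n 1)
    (hjac : IsUnit (Matrix.of fun i j => MvPowerSeries.pderiv (W p k) j (u i)).det) :
    ∃ (α : Fin n → A p k n) (β : Fin n → Fin n → A p k n),
      ∀ j, MvPowerSeries.X j = (p : A p k n) * α j + ∑ i, β j i * u i := by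
  classical
  choose b hb _ using fun i => exists_sum_X_mul (u i)
  have hc : ∀ i, (p : W p k) ∣ MvPowerSeries.constantCoeff (u i) := fun i => by
    simpa using hu i 0
  choose c hc using hc
  set B : Matrix (Fin n) (Fin n) (A p k n) := Matrix.of b with hB
  -- Writing `u = p c + B t`, the constant term of `B` is that of the Jacobian, so `B` is invertible
  -- and `t = B⁻¹(u - p c)`.
  have hB0 : ∀ i j, MvPowerSeries.constantCoeff (b i j) =
      MvPowerSeries.constantCoeff (MvPowerSeries.pderiv (W p k) j (u i)) := by
    intro i j
    conv_rhs => rw [hb i]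
    rw [map_add, MvPowerSeries.pderiv_C, zero_add, map_sum, map_sum, Finset.sum_eq_single j]
    · rw [Derivation.leibniz, MvPowerSeries.pderiv_X_self]
      simp
    · intro l _ hl
      rw [Derivation.leibniz, MvPowerSeries.pderiv_X_of_ne hl]
      simp
    · simp
  have hdet : IsUnit B.det := by
    rw [MvPowerSeries.isUnit_iff_constantCoeff] at hjac ⊢
    rw [RingHom.map_det] at hjac ⊢
    convert hjac using 2
    ext1 i j
    simp [hB, hB0]
  have hinv : B⁻¹ * B = 1 := Matrix.nonsing_inv_mul _ hdet
  refine ⟨fun j => - ∑ i, B⁻¹ j i * MvPowerSeries.C (c i), fun j i => B⁻¹ j i, fun j => ?_⟩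
  have h1 : ∑ i, B⁻¹ j i * u i = ∑ i, B⁻¹ j i * ((p : A p k n) * MvPowerSeries.C (c i)) +
      ∑ l, (B⁻¹ * B) j l * MvPowerSeries.X l := by
    have h2 : ∀ i, u i = (p : A p k n) * MvPowerSeries.C (c i) +
        ∑ l, MvPowerSeries.X l * B i l := fun i => by
      conv_lhs => rw [hb i, hc i, map_mul, map_natCast]
      rfl
    conv_lhs => enter [2, i]; rw [h2 i, mul_add]
    rw [Finset.sum_add_distrib]
    congr 1
    simp only [Matrix.mul_apply, Finset.sum_mul, Finset.mul_sum]
    rw [Finset.sum_comm]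
    exact Finset.sum_congr rfl fun _ _ => Finset.sum_congr rfl fun _ _ => by ring
  rw [h1, hinv]
  simp only [Matrix.one_apply, ite_mul, one_mul, zero_mul, Finset.sum_ite_eq, Finset.mem_univ,
    if_true, Finset.mul_sum, mul_neg]
  rw [show ∀ x y z : A p k n, x = y → -x + (y + z) = z from fun x y z h => by rw [h]; ring]
  exact Finset.sum_congr rfl fun _ _ => by ring

theorem evalHom_id_C (hu : ∀ j, u j ∈ J p k n 1) (w : W p k) :
    evalHom latHom_id hu (MvPowerSeries.C w) = MvPowerSeries.C w :=
  evalHom_C latHom_id hu rfl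

theorem sum_coord_eq {R : Type*} [CommRing R] {P c₀ : R} {X α c u : Fin n → R}
    {β : Fin n → Fin n → R} (hX : ∀ j, X j = P * α j + ∑ i, β j i * u i) :
    P * c₀ + ∑ j, X j * c j =
      P * (c₀ + ∑ j, α j * c j) + ∑ i, u i * ∑ j, β j i * c j := by
  have h1 : ∀ j, X j * c j = P * (α j * c j) + ∑ i, u i * (β j i * c j) := fun j => by
    rw [hX j, add_mul, Finset.sum_mul, mul_assoc]
    congr 1
    exact Finset.sum_congr rfl fun _ _ => by ring
  rw [Finset.sum_congr rfl fun j _ => h1 j, Finset.sum_add_distrib, ← Finset.mul_sum,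
    Finset.sum_comm, mul_add, add_assoc]
  simp only [Finset.mul_sum]

/-- Surjectivity on the graded pieces of the filtration. An element of `J (N + 1)` is a combination
of `p` and the `t_j` with coefficients in `J N`, hence of `p` and the `u_i`. Approximating the
coefficients by values of `E` and replacing `u_i = E(t_i)` by `t_i` gives a preimage one step
further. -/
theorem exists_approx {E : A p k n →+* A p k n} (hE : ∀ w, E (MvPowerSeries.C w) = MvPowerSeries.C w)
    (hEX : ∀ j, E (MvPowerSeries.X j) = u j) (hu : ∀ i, u i ∈ J p k n 1) {α : Fin n → A p k n}
    {β : Fin n → Fin n → A p k n}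
    (hX : ∀ j, MvPowerSeries.X j = (p : A p k n) * α j + ∑ i, β j i * u i) (N : ℕ) :
    ∀ b ∈ J p k n N, ∃ f ∈ J p k n N, b - E f ∈ J p k n (N + 1) := by
  induction N with
  | zero =>
    intro b _
    obtain ⟨c, hc, -⟩ := exists_sum_X_mul b
    refine ⟨MvPowerSeries.C (MvPowerSeries.constantCoeff b), by simp [J_zero], ?_⟩
    rw [hE, show b - MvPowerSeries.C (MvPowerSeries.constantCoeff b) =
      ∑ j, MvPowerSeries.X j * c j from sub_eq_of_eq_add' hc, zero_add]
    exact sum_mem fun j _ => Ideal.mul_mem_right _ _ (X_mem_J j)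
  | succ N ih =>
    intro b hb
    obtain ⟨c, hc, hcJ⟩ := exists_sum_X_mul b
    replace hcJ := hcJ N hb
    obtain ⟨w, hw⟩ : (p : W p k) ^ (N + 1) ∣ MvPowerSeries.constantCoeff b := by
      simpa using hb 0
    obtain ⟨c₀, hc₀⟩ : ∃ c₀ : A p k n, c₀ = MvPowerSeries.C ((p : W p k) ^ N * w) := ⟨_, rfl⟩
    have hb' : b = (p : A p k n) * (c₀ + ∑ j, α j * c j) + ∑ i, u i * ∑ j, β j i * c j := by
      rw [← sum_coord_eq hX, hc₀]
      conv_lhs => rw [hc, hw, pow_succ', mul_assoc, map_mul, map_natCast]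
    obtain ⟨f0, hf0, hf0'⟩ := ih (c₀ + ∑ j, α j * c j)
      (add_mem (hc₀ ▸ C_mem_J.2 (dvd_mul_right _ _))
        (sum_mem fun j _ => Ideal.mul_mem_left _ _ (hcJ j)))
    choose f hf hf' using fun i => ih (∑ j, β j i * c j)
      (sum_mem fun j _ => Ideal.mul_mem_left _ _ (hcJ j))
    refine ⟨(p : A p k n) * f0 + ∑ i, MvPowerSeries.X i * f i, ?_, ?_⟩
    · rw [add_comm N 1]
      exact add_mem (mul_mem_J natCast_p_mem_J hf0)
        (sum_mem fun i _ => mul_mem_J (X_mem_J i) (hf i))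
    · have h1 : E ((p : A p k n) * f0 + ∑ i, MvPowerSeries.X i * f i) =
          (p : A p k n) * E f0 + ∑ i, u i * E (f i) := by
        rw [map_add, map_mul, map_natCast, map_sum]
        simp only [map_mul, hEX]
      have h2 : ∀ P x y : A p k n, ∀ v s t : Fin n → A p k n,
          P * x + ∑ i, v i * s i - (P * y + ∑ i, v i * t i) =
          P * (x - y) + ∑ i, v i * (s i - t i) := fun P x y v s t => by
        simp only [mul_sub, Finset.sum_sub_distrib]
        abel
      rw [h1, hb', h2, show N + 1 + 1 = 1 + (N + 1) by ring]
      exact add_mem (mul_mem_J natCast_p_mem_J hf0')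
        (sum_mem fun i _ => mul_mem_J (hu i) (hf' i))

/-- Successive approximation: `R N` is what is left of `b` after `N` corrections. The corrections
tend to zero, so completeness sums them and continuity of `E` identifies the image. -/
theorem ringHom_surjective {E : A p k n →+* A p k n}
    (hE : ∀ w, E (MvPowerSeries.C w) = MvPowerSeries.C w)
    (hEX : ∀ j, E (MvPowerSeries.X j) = u j) (hu : ∀ i, u i ∈ J p k n 1) {α : Fin n → A p k n}
    {β : Fin n → Fin n → A p k n}
    (hX : ∀ j, MvPowerSeries.X j = (p : A p k n) * α j + ∑ i, β j i * u i) :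
    Function.Surjective E := by
  intro b
  choose! F hF hF' using exists_approx hE hEX hu hX
  let R : ℕ → A p k n := fun N => Nat.rec b (fun N r => r - E (F N r)) N
  have hR0 : R 0 = b := rfl
  have hRs : ∀ N, R (N + 1) = R N - E (F N (R N)) := fun N => rfl
  have hR : ∀ N, R N ∈ J p k n N := by
    intro N
    induction N with
    | zero => simp [J_zero]
    | succ N ih =>
      rw [hRs]
      exact hF' N _ ih
  obtain ⟨g, hg⟩ := exists_sum_limit (fun N => F N (R N)) fun N => hF N _ (hR N)
  refine ⟨g, sub_eq_zero.1 (eq_zero_of_forall_mem_J fun N => ?_)⟩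
  have h1 : ∀ N, b - E (∑ i ∈ range N, F i (R i)) = R N := by
    intro N
    induction N with
    | zero => rw [Finset.range_zero, Finset.sum_empty, map_zero, sub_zero, hR0]
    | succ N ih => rw [Finset.sum_range_succ, map_add, hRs, ← ih, sub_sub]
  have h2 : E (g - ∑ i ∈ range N, F i (R i)) ∈ J p k n N :=
    ringHom_mem_J (fun j => by rw [hEX]; exact hu j) N _ (hg N)
  rw [map_sub] at h2
  have h3 := sub_mem h2 (hR N)
  rwa [← h1 N, sub_sub_sub_cancel_right] at h3

theorem evalHom_surjective (hu : ∀ i, u i ∈ J p k n 1) {α : Fin n → A p k n}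
    {β : Fin n → Fin n → A p k n}
    (hX : ∀ j, MvPowerSeries.X j = (p : A p k n) * α j + ∑ i, β j i * u i) :
    Function.Surjective (evalHom latHom_id hu) :=
  ringHom_surjective (evalHom_id_C hu) (evalHom_X _ hu) hu hX

theorem evalHom_bijective (hu : ∀ i, u i ∈ J p k n 1) {α : Fin n → A p k n}
    {β : Fin n → Fin n → A p k n}
    (hX : ∀ j, MvPowerSeries.X j = (p : A p k n) * α j + ∑ i, β j i * u i) :
    Function.Bijective (evalHom latHom_id hu) :=
  ⟨ringHom_injective_of_surjective _ (evalHom_surjective hu hX), evalHom_surjective hu hX⟩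

/-- The coordinates `u`, as an automorphism of `W[[t]]`. -/
def coordEquiv (hu : ∀ i, u i ∈ J p k n 1) {α : Fin n → A p k n} {β : Fin n → Fin n → A p k n}
    (hX : ∀ j, MvPowerSeries.X j = (p : A p k n) * α j + ∑ i, β j i * u i) : A p k n ≃ₐ[W p k] A p k n :=
  AlgEquiv.ofBijective { evalHom latHom_id hu with commutes' := fun w => evalHom_id_C hu w }
    (evalHom_bijective hu hX)

theorem coordEquiv_apply (hu : ∀ i, u i ∈ J p k n 1) {α : Fin n → A p k n}
    {β : Fin n → Fin n → A p k n}
    (hX : ∀ j, MvPowerSeries.X j = (p : A p k n) * α j + ∑ i, β j i * u i) (a : A p k n) :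
    coordEquiv hu hX a = evalHom latHom_id hu a := rfl

/-- `W` is a discrete valuation ring, and adjoining one power series variable raises the dimension
by at least one. -/
theorem ringKrullDim_A_ge : ((n + 1 : ℕ) : WithBot ℕ∞) ≤ ringKrullDim (A p k n) := by
  induction n with
  | zero =>
    have h1 : ringKrullDim (A p k 0) = ringKrullDim (W p k) :=
      ringKrullDim_eq_of_ringEquiv (MvPowerSeries.isEmptyEquiv (Fin 0) (W p k)).toRingEquiv
    rw [h1]
    have : ringKrullDim (W p k) = 1 :=
      IsPrincipalIdealRing.ringKrullDim_eq_one (W p k) (IsDiscreteValuationRing.not_isField _)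
    rw [this]
    simp
  | succ n ih =>
    have h1 : ringKrullDim (A p k (n + 1)) = ringKrullDim (PowerSeries (A p k n)) :=
      ringKrullDim_eq_of_ringEquiv (MvPowerSeries.finSuccEquiv (W p k) n).toRingEquiv
    rw [h1]
    refine le_trans ?_ ringKrullDim_succ_le_ringKrullDim_powerseries
    rw [Nat.cast_succ]
    exact add_le_add_left ih 1

/-- The maximal ideal is generated by `p` and the `t_j`, hence by `p` and the `u_i`. These `n + 1`
generators bound the dimension from above; the reverse inequality is `ringKrullDim_A_ge`. -/
theorem isRegularSystemOfParameters (hu : ∀ i, u i ∈ J p k n 1) {α : Fin n → A p k n}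
    {β : Fin n → Fin n → A p k n}
    (hX : ∀ j, MvPowerSeries.X j = (p : A p k n) * α j + ∑ i, β j i * u i) :
    IsRegularSystemOfParameters
      (fun o : Option (Fin n) => o.elim (p : A p k n) fun i => u i) := by
  set x : Option (Fin n) → A p k n := fun o => o.elim (p : A p k n) fun i => u i with hx
  have hp : (p : A p k n) ∈ Ideal.span (Set.range x) := Ideal.subset_span ⟨none, rfl⟩
  have hspan : Ideal.span (Set.range x) = IsLocalRing.maximalIdeal (A p k n) := by
    rw [maximalIdeal_A]
    refine le_antisymm (Ideal.span_le.2 ?_) fun a ha => ?_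
    · rintro _ ⟨o, rfl⟩
      cases o with
      | none => exact natCast_p_mem_J
      | some i => exact hu i
    · obtain ⟨b, hb, -⟩ := exists_sum_X_mul a
      obtain ⟨w, hw⟩ : (p : W p k) ∣ MvPowerSeries.constantCoeff a := by simpa using ha 0
      rw [hb, hw, map_mul, map_natCast]
      refine add_mem (Ideal.mul_mem_right _ _ hp) (sum_mem fun j _ => Ideal.mul_mem_right _ _ ?_)
      rw [hX]
      exact add_mem (Ideal.mul_mem_right _ _ hp) (sum_mem fun i _ => Ideal.mul_mem_left _ _
        (Ideal.subset_span ⟨some i, rfl⟩))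
  refine ⟨inferInstance, inferInstance, le_antisymm ?_ ?_, hspan⟩
  · refine (ringKrullDim_le_spanFinrank_maximalIdeal _).trans ?_
    rw [← hspan]
    have h1 := Submodule.spanFinrank_span_le_ncard_of_finite (R := A p k n) (Set.finite_range x)
    have h2 : (Set.range x).ncard ≤ Fintype.card (Option (Fin n)) := by
      rw [← Set.image_univ]
      refine (Set.ncard_image_le Set.finite_univ).trans ?_
      rw [Set.ncard_univ, Nat.card_eq_fintype_card]
    exact_mod_cast h1.trans h2
  · simpa using ringKrullDim_A_ge (p := p) (k := k) (n := n)

theorem one_add_pow_sub_mem (j : Fin n) :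
    (1 + MvPowerSeries.X j : A p k n) ^ p - 1 ∈ J p k n 1 := by
  have h := (Commute.all (1 + MvPowerSeries.X j : A p k n) 1).sub_dvd_pow_sub_pow p
  rw [one_pow, add_sub_cancel_left] at h
  exact Ideal.mem_of_dvd _ h (X_mem_J j)

/-- There is a unique lift of Frobenius with `φ(1 + u_i) = (1 + u_i)^p`. -/
theorem existsUnique_frobLift (hu : ∀ i, u i ∈ J p k n 1) {α : Fin n → A p k n}
    {β : Fin n → Fin n → A p k n}
    (hX : ∀ j, MvPowerSeries.X j = (p : A p k n) * α j + ∑ i, β j i * u i) :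
    ∃! φ : FrobLift p k n, ∀ i, φ.toRingHom (1 + u i) = (1 + u i) ^ p := by
  obtain ⟨Θ, hΘC, hΘX⟩ : ∃ Θ : A p k n ≃+* A p k n,
      (∀ w, Θ (MvPowerSeries.C w) = MvPowerSeries.C w) ∧ ∀ i, Θ (MvPowerSeries.X i) = u i :=
    ⟨(coordEquiv hu hX).toRingEquiv, evalHom_id_C hu, evalHom_X latHom_id hu⟩
  have hΘC' : ∀ w, Θ.symm (MvPowerSeries.C w) = MvPowerSeries.C w := fun w => by
    rw [RingEquiv.symm_apply_eq, hΘC]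
  have hΘX' : ∀ i, Θ.symm (u i) = MvPowerSeries.X i := fun i => by
    rw [RingEquiv.symm_apply_eq, hΘX]
  -- In the coordinates `u` the required lift is `t_j ↦ (1 + t_j)^p - 1`; it is then conjugated by
  -- the coordinate automorphism `Θ`.
  obtain ⟨φ₀, hφ₀X, hφ₀C⟩ : ∃ φ₀ : A p k n →+* A p k n,
      (∀ j, φ₀ (MvPowerSeries.X j) = (1 + MvPowerSeries.X j) ^ p - 1) ∧
      ∀ w, φ₀ (MvPowerSeries.C w) = MvPowerSeries.C (WittVector.frobenius w) :=
    ⟨evalHom latHom_sigK one_add_pow_sub_mem, evalHom_X _ _, fun w => evalHom_C _ _ (sigK_algebraMap w)⟩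
  obtain ⟨φ₁, hφ₁⟩ : ∃ φ₁ : FrobLift p k n, φ₁.toRingHom = φ₀ := ⟨FrobLift.ofX φ₀ hφ₀C fun j => by
    rw [hφ₀X]
    obtain ⟨r, hr⟩ := exists_add_pow_prime_eq (Fact.out : p.Prime) (1 : A p k n)
      (MvPowerSeries.X j)
    exact ⟨1 * MvPowerSeries.X j * r, by rw [hr]; ring⟩, rfl⟩
  obtain ⟨φ, hφ⟩ : ∃ φ : FrobLift p k n, ∀ a, φ.toRingHom a = Θ (φ₀ (Θ.symm a)) :=
    ⟨{ toRingHom := (Θ : A p k n →+* A p k n).comp (φ₀.comp (Θ.symm : A p k n →+* A p k n))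
       map_C := fun w => by
        change Θ (φ₀ (Θ.symm (MvPowerSeries.C w))) = _
        rw [hΘC', hφ₀C, hΘC]
       dvd_sub_pow := fun a => by
        change (p : A p k n) ∣ Θ (φ₀ (Θ.symm a)) - a ^ p
        obtain ⟨c, hc⟩ := φ₁.dvd_sub_pow (Θ.symm a)
        refine ⟨Θ c, ?_⟩
        have h1 := congrArg Θ hc
        rw [map_sub, map_pow, RingEquiv.apply_symm_apply, map_mul, map_natCast, hφ₁] at h1
        exact h1 }, fun _ => rfl⟩
  refine ⟨φ, fun i => ?_, fun φ' hφ' => ?_⟩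
  · rw [hφ, map_add, map_one, hΘX', map_add, map_one, hφ₀X, add_sub_cancel, map_pow, map_add,
      map_one, hΘX]
  -- Uniqueness: another solution, read in the coordinates `u`, agrees with `φ₀` on `W` and on the
  -- variables, and continuous endomorphisms are determined by these.
  · have h1 : (Θ.symm : A p k n →+* A p k n).comp
        (φ'.toRingHom.comp (Θ : A p k n →+* A p k n)) = φ₀ := by
      refine (ringHom_ext (fun w => ?_) (fun j => ?_) fun j => ?_).symm
      · change φ₀ _ = Θ.symm (φ'.toRingHom (Θ _))
        rw [hΘC, φ'.map_C, hΘC', hφ₀C]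
      · change φ₀ _ = Θ.symm (φ'.toRingHom (Θ _))
        have h2 := hφ' j
        rw [map_add, map_one] at h2
        rw [hΘX, eq_sub_of_add_eq' h2, map_sub, map_pow, map_add, map_one, hΘX', hφ₀X]
      · rw [hφ₀X]
        exact one_add_pow_sub_mem j
    refine FrobLift.ext_X fun j => ?_
    have h2 : φ₀ (Θ.symm (MvPowerSeries.X j)) =
        Θ.symm (φ'.toRingHom (Θ (Θ.symm (MvPowerSeries.X j)))) := by
      rw [← h1]
      rfl
    rw [hφ, h2, RingEquiv.apply_symm_apply, RingEquiv.apply_symm_apply]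

end Parameters

end CY3

end

noncomputable section

namespace CY3

open Finset

/-! ### Consequences of the Taylor formula: independence of the lift of Frobenius. -/

section Taylor

variable {p : ℕ} [Fact p.Prime] {k : Type v} [Field k] [CharP k p] [PerfectRing k p] {n : ℕ}

theorem prime_p_W : Prime (p : W p k) := (WittVector.irreducible p (k := k)).prime

/-- `p` generates the kernel of the coefficientwise reduction to `(W/p)[[t]]`, which is a domain. -/
theorem prime_p_A : Prime (p : A p k n) := by
  have : (Ideal.span {(p : W p k)}).IsPrime :=
    (Ideal.span_singleton_prime p_ne_zero_W).2 prime_p_W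
  have key : ∀ a : A p k n, (p : A p k n) ∣ a ↔
      MvPowerSeries.map (σ := Fin n) (Ideal.Quotient.mk (Ideal.span {(p : W p k)})) a = 0 := by
    intro a
    rw [← pow_one (p : A p k n), p_dvd_iff_coeff, MvPowerSeries.ext_iff]
    refine forall_congr' fun d => ?_
    rw [MvPowerSeries.coeff_map, map_zero, Ideal.Quotient.eq_zero_iff_mem,
      Ideal.mem_span_singleton, pow_one]
  refine ⟨?_, ?_, fun a b h => ?_⟩
  · rw [← map_natCast (MvPowerSeries.C (σ := Fin n) (R := W p k)) p, Ne,
      map_eq_zero_iff _ (MvPowerSeries.C_injective), ← Ne]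
    exact p_ne_zero_W
  · intro h
    have h1 := h.dvd (a := 1)
    rw [← pow_one (p : A p k n), p_dvd_iff_coeff] at h1
    have h2 := h1 0
    rw [MvPowerSeries.coeff_zero_one, pow_one] at h2
    exact prime_p_W.not_isUnit (isUnit_of_dvd_one h2)
  · rw [key, key]
    rw [key, map_mul] at h
    exact mul_eq_zero.1 h

theorem p_ne_zero_A : (p : A p k n) ≠ 0 := prime_p_A.ne_zero

/-- `φ(a) ≡ a^p` modulo `p`, and `p` is prime in `A`. -/
theorem FrobLift.dvd_iff (φ : FrobLift p k n) {a : A p k n} :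
    (p : A p k n) ∣ φ.toRingHom a ↔ (p : A p k n) ∣ a := by
  constructor
  · intro h
    exact prime_p_A.dvd_of_dvd_pow ((dvd_sub_right h).1 (φ.dvd_sub_pow a))
  · rintro ⟨b, rfl⟩
    rw [map_mul, map_natCast]
    exact dvd_mul_right _ _

theorem FrobLift.dvd_X_sub_X (φ ψ : FrobLift p k n) (a : A p k n) :
    (p : A p k n) ∣ φ.toRingHom a - ψ.toRingHom a := by
  have := dvd_sub (φ.dvd_sub_pow a) (ψ.dvd_sub_pow a)
  rwa [sub_sub_sub_cancel_right] at this

/-- A prime above `3` is at least `5`, so Legendre's bound gives `4 v(m!) ≤ m`. This is exactly what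
makes `p^m / m!` divisible by `p^min(m,3)`, the range needed for level `3`. -/
theorem four_mul_padicValNat_factorial_le (hp : 3 < p) (m : ℕ) :
    4 * padicValNat p m.factorial ≤ m := by
  have h5 : 5 ≤ p := by
    rcases Nat.lt_or_ge p 5 with h | h
    · exfalso
      have : p = 4 := by omega
      subst this
      exact absurd (Fact.out : Nat.Prime 4) (by norm_num)
    · exact h
  rcases Nat.eq_zero_or_pos m with rfl | hm
  · simp
  have h := sub_one_mul_padicValNat_factorial_lt_of_ne_zero (p := p) hm.ne'
  have h3 : 4 * padicValNat p m.factorial ≤ (p - 1) * padicValNat p m.factorial :=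
    Nat.mul_le_mul_right _ (by omega)
  omega

theorem natCast_eq_pow_mul_unit_A {m : ℕ} (hm : m ≠ 0) :
    ∃ u : (A p k n)ˣ, (m : A p k n) = (p : A p k n) ^ padicValNat p m * u := by
  obtain ⟨u, hu⟩ := natCast_eq_pow_mul_unit (p := p) (k := k) hm
  refine ⟨Units.map (MvPowerSeries.C (σ := Fin n) (R := W p k) : W p k →* A p k n) u, ?_⟩
  rw [← map_natCast (MvPowerSeries.C (σ := Fin n) (R := W p k)) m, hu, map_mul, map_pow,
    map_natCast]
  rfl

theorem min_sum_le {ι : Type*} (s : Finset ι) (f : ι → ℕ) (N : ℕ) :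
    min (∑ i ∈ s, f i) N ≤ ∑ i ∈ s, min (f i) N := by
  classical
  induction s using Finset.induction_on with
  | empty => simp
  | insert a s ha ih =>
    rw [Finset.sum_insert ha, Finset.sum_insert ha]
    omega

/-- The divided powers of multiples of `p` are divisible by `p`, `p²`, `p³`. -/
theorem taylorCoeff_dvd (hp : 3 < p) {m : Fin n →₀ ℕ} {c : A p k n} {y : Fin n → A p k n}
    (hy : ∀ j, (p : A p k n) ∣ y j)
    (hc : (∏ j, ((Nat.factorial (m j) : ℕ) : A p k n)) * c = ∏ j, y j ^ m j) :
    (p : A p k n) ^ min m.degree 3 ∣ c := by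
  choose z hz using hy
  choose w hw using fun j => natCast_eq_pow_mul_unit_A (p := p) (k := k) (n := n)
    (Nat.factorial_ne_zero (m j))
  simp only [hw, hz, mul_pow, Finset.prod_mul_distrib, Finset.prod_pow_eq_pow_sum] at hc
  have hv : ∀ j, padicValNat p (m j).factorial + min (m j) 3 ≤ m j := fun j => by
    have := four_mul_padicValNat_factorial_le hp (m j)
    omega
  have h1 : ∑ j, padicValNat p (m j).factorial + min m.degree 3 ≤ ∑ j, m j := by
    rw [Finsupp.degree_eq_sum]
    refine (Nat.add_le_add_left (min_sum_le _ _ _) _).trans ?_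
    rw [← Finset.sum_add_distrib]
    exact Finset.sum_le_sum fun j _ => hv j
  obtain ⟨e, he⟩ := Nat.exists_eq_add_of_le h1
  rw [he, pow_add, pow_add, mul_assoc, mul_assoc, mul_assoc] at hc
  have h2 := mul_left_cancel₀ (pow_ne_zero _ p_ne_zero_A) hc
  have hu : IsUnit (∏ j, (w j : A p k n)) := by
    rw [← Units.coe_prod]
    exact Units.isUnit _
  rw [← hu.dvd_mul_left, h2]
  exact dvd_mul_right _ _

variable {H : Type u} [AddCommGroup H] [Module (A p k n) H]

theorem mem_pPow {r : ℕ} {x : H} : x ∈ pPow p k n H r ↔ ∃ y, (p : A p k n) ^ r • y = x := Iff.rfl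

theorem mem_pPow_one {x : H} : x ∈ pPow p k n H 1 ↔ ∃ y, (p : A p k n) • y = x := by
  rw [mem_pPow, pow_one]

theorem mem_pPow_zero (x : H) : x ∈ pPow p k n H 0 := mem_pPow.2 ⟨x, by rw [pow_zero, one_smul]⟩

theorem smul_mem_pPow {r s : ℕ} {a : A p k n} {x : H} (ha : (p : A p k n) ^ r ∣ a)
    (hx : x ∈ pPow p k n H s) : a • x ∈ pPow p k n H (r + s) := by
  obtain ⟨b, rfl⟩ := ha
  obtain ⟨y, rfl⟩ := mem_pPow.1 hx
  exact mem_pPow.2 ⟨b • y, by rw [smul_smul, smul_smul, pow_add]; congr 1; ring⟩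

theorem pPow_anti {r s : ℕ} (h : r ≤ s) : pPow p k n H s ≤ pPow p k n H r := by
  intro x hx
  obtain ⟨y, rfl⟩ := mem_pPow.1 hx
  exact mem_pPow.2 ⟨(p : A p k n) ^ (s - r) • y, by rw [smul_smul, ← pow_add]; congr 2; omega⟩

theorem mem_red {N : Submodule (A p k n) H} {x : H} :
    Submodule.mkQ (pPow p k n H 1) x ∈ red N ↔ x ∈ N ⊔ pPow p k n H 1 := by
  rw [red, ← Submodule.mem_comap, Submodule.comap_map_mkQ, sup_comm]

/-- Krull's intersection theorem for the finite module `H / U` over the Noetherian local ring `A`: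
submodules are `p`-adically closed. -/
theorem mem_closure_iff_aux [Module.Finite (A p k n) H] {U : Submodule (A p k n) H} {x : H}
    (h : ∀ r, x ∈ U ⊔ pPow p k n H r) : x ∈ U := by
  have h1 := Ideal.iInf_pow_smul_eq_bot_of_isLocalRing (R := A p k n) (M := H ⧸ U)
    (Ideal.span {(p : A p k n)}) (by
      rw [Ne, Ideal.span_singleton_eq_top]
      exact prime_p_A.not_isUnit)
  rw [← Submodule.Quotient.mk_eq_zero, ← Submodule.mem_bot (R := A p k n), ← h1, Submodule.mem_iInf]
  intro r
  obtain ⟨y, hy, z, hz, rfl⟩ := Submodule.mem_sup.1 (h r)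
  obtain ⟨w, rfl⟩ := mem_pPow.1 hz
  rw [Submodule.Quotient.mk_add, (Submodule.Quotient.mk_eq_zero U).2 hy, zero_add,
    Submodule.Quotient.mk_smul]
  exact Submodule.smul_mem_smul (Ideal.pow_mem_pow (Ideal.mem_span_singleton_self _) r) trivial

/-- The sets `P` are indexed by the number of derivatives still allowed. One statement thus covers
stable submodules, Griffiths transversality, and ad hoc chains that follow a single vector. -/
theorem Crystal.Dpow_mem (E : Crystal p k n H) (P : ℕ → Set H)
    (hP : ∀ i j, ∀ x ∈ P (i + 1), E.D j x ∈ P i) (m : Fin n →₀ ℕ) (i : ℕ) (x : H)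
    (hx : x ∈ P (i + m.degree)) : E.Dpow m x ∈ P i := by
  have hpow : ∀ (j : Fin n) (a i : ℕ) (x : H), x ∈ P (i + a) → (E.D j ^ a) x ∈ P i := by
    intro j a
    induction a with
    | zero => exact fun i x hx => hx
    | succ a ih =>
      intro i x hx
      rw [pow_succ]
      exact ih i _ (hP _ j x hx)
  have hlist : ∀ (l : List (Fin n)) (i : ℕ) (x : H), x ∈ P (i + (l.map m).sum) →
      (l.map fun j => E.D j ^ m j).prod x ∈ P i := by
    intro l
    induction l with
    | nil => exact fun i x hx => hx
    | cons j l ih =>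
      intro i x hx
      rw [List.map_cons, List.prod_cons]
      refine hpow j _ i _ (ih _ x ?_)
      rwa [List.map_cons, List.sum_cons, ← add_assoc] at hx
  rw [Crystal.Dpow, List.ofFn_eq_map]
  refine hlist _ i x ?_
  rwa [← List.ofFn_eq_map, List.sum_ofFn, ← Finsupp.degree_eq_sum]

theorem Crystal.Dpow_mem_of_stable (E : Crystal p k n H) (U : Submodule (A p k n) H)
    (hU : ∀ j, ∀ x ∈ U, E.D j x ∈ U) (m : Fin n →₀ ℕ) {x : H} (hx : x ∈ U) : E.Dpow m x ∈ U :=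
  E.Dpow_mem (fun _ => U) (fun _ => hU) m 0 x hx

theorem Crystal.Dpow_zero (E : Crystal p k n H) (x : H) : E.Dpow 0 x = x :=
  E.Dpow_mem (fun i => if i = 0 then {x} else ∅) (fun i j y hy => by simp at hy) 0 0 x (by simp)

theorem smul_p_injective (E : Crystal p k n H) (r : ℕ) {x y : H}
    (h : (p : A p k n) ^ r • x = (p : A p k n) ^ r • y) : x = y := by
  have := E.free
  exact smul_right_injective H (pow_ne_zero r p_ne_zero_A) h

theorem FCrystal.F_mem_pPow (E : FCrystal p k n H) (φ : FrobLift p k n) {r s : ℕ} {x : H}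
    (hE : ∀ y, E.F φ y ∈ pPow p k n H s) (hx : x ∈ pPow p k n H r) :
    E.F φ x ∈ pPow p k n H (r + s) := by
  obtain ⟨y, rfl⟩ := mem_pPow.1 hx
  rw [map_smulₛₗ, map_pow, map_natCast]
  exact smul_mem_pPow dvd_rfl (hE y)

theorem FCrystal.F_mem_pPow' (E : FCrystal p k n H) (φ : FrobLift p k n) {r : ℕ} {x : H}
    (hx : x ∈ pPow p k n H r) : E.F φ x ∈ pPow p k n H r :=
  E.F_mem_pPow φ (s := 0) (fun _ => mem_pPow_zero _) hx

theorem FCrystal.exists_taylor (E : FCrystal p k n H) (hp : 3 < p) (φ ψ : FrobLift p k n) :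
    ∃ c : (Fin n →₀ ℕ) → A p k n, c 0 = 1 ∧ (∀ m, (p : A p k n) ^ min m.degree 3 ∣ c m) ∧
    (∀ m, (∏ j, ((Nat.factorial (m j) : ℕ) : A p k n)) * c m =
      ∏ j, (φ.toRingHom (MvPowerSeries.X j) - ψ.toRingHom (MvPowerSeries.X j)) ^ m j) ∧
    ∀ (x : H) (r : ℕ), ∃ S : Finset (Fin n →₀ ℕ), ∀ S' : Finset (Fin n →₀ ℕ), S ⊆ S' →
      E.F φ x - ∑ m ∈ S', c m • E.F ψ (E.Dpow m x) ∈ pPow p k n H r := by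
  obtain ⟨c, hc, hF⟩ := E.taylor φ ψ
  refine ⟨c, ?_, fun m => taylorCoeff_dvd hp (fun j => φ.dvd_X_sub_X ψ _) (hc m), hc, hF⟩
  simpa using hc 0

/-- A submodule which contains the terms of the Taylor series of `F(φ) x` contains `F(φ) x`. -/
theorem FCrystal.F_mem_of_taylor (E : FCrystal p k n H) {φ ψ : FrobLift p k n}
    {c : (Fin n →₀ ℕ) → A p k n} {x : H} (hF : ∀ r : ℕ, ∃ S : Finset (Fin n →₀ ℕ),
      ∀ S' : Finset (Fin n →₀ ℕ), S ⊆ S' →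
      E.F φ x - ∑ m ∈ S', c m • E.F ψ (E.Dpow m x) ∈ pPow p k n H r)
    {U : Submodule (A p k n) H} (hU : ∀ m, c m • E.F ψ (E.Dpow m x) ∈ U) : E.F φ x ∈ U := by
  have := E.finite
  refine mem_closure_iff_aux fun r => ?_
  obtain ⟨S, hS⟩ := hF r
  refine Submodule.mem_sup.2 ⟨_, sum_mem fun m (_ : m ∈ S) => hU m, _, hS S subset_rfl, ?_⟩
  abel

theorem FCrystal.F_sub_mem (E : FCrystal p k n H) (hp : 3 < p) (φ ψ : FrobLift p k n) (x : H) :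
    E.F φ x - E.F ψ x ∈ pPow p k n H 1 := by
  obtain ⟨c, hc0, hcd, -, hF⟩ := E.exists_taylor hp φ ψ
  obtain ⟨S, hS⟩ := hF x 1
  have h1 := hS (insert 0 S) (Finset.subset_insert _ _)
  classical
  rw [← Finset.add_sum_erase _ _ (Finset.mem_insert_self 0 S), hc0, one_smul, E.Dpow_zero,
    ← sub_sub] at h1
  have h2 : ∑ m ∈ (insert 0 S).erase 0, c m • E.F ψ (E.Dpow m x) ∈ pPow p k n H 1 := by
    refine sum_mem fun m hm => ?_
    have hm0 : m.degree ≠ 0 := fun h =>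
      (Finset.ne_of_mem_erase hm) ((Finsupp.degree_eq_zero_iff m).1 h)
    exact smul_mem_pPow (s := 0) ((pow_dvd_pow _ (by omega)).trans (hcd m)) (mem_pPow_zero _)
  have := add_mem h1 h2
  rwa [sub_add_cancel] at this

/-- By the Taylor formula `F(φ) x` is a limit of combinations of values of `F(ψ)`, and the span of
these is closed. By symmetry the image of Frobenius, and with it the conjugate filtration, does not
depend on the lift. -/
theorem FCrystal.span_range_le (E : FCrystal p k n H) (hp : 3 < p) (φ ψ : FrobLift p k n) :
    Submodule.span (A p k n) (Set.range (E.F φ)) ≤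
      Submodule.span (A p k n) (Set.range (E.F ψ)) := by
  obtain ⟨c, -, -, -, hF⟩ := E.exists_taylor hp φ ψ
  rw [Submodule.span_le]
  rintro _ ⟨x, rfl⟩
  exact E.F_mem_of_taylor (hF x) fun m =>
    Submodule.smul_mem _ _ (Submodule.subset_span ⟨_, rfl⟩)

theorem FCrystal.conjFil_eq (E : FCrystal p k n H) (hp : 3 < p) (φ ψ : FrobLift p k n) :
    E.conjFil φ = E.conjFil ψ := by
  funext i
  rw [conjFil, conjFil,
    le_antisymm (E.span_range_le hp φ ψ) (E.span_range_le hp ψ φ)]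

/-- A `D`-stable submodule stable under one `F(ψ)` is stable under all. -/
theorem FCrystal.F_mem_of_stable (E : FCrystal p k n H) {φ ψ : FrobLift p k n}
    {U : Submodule (A p k n) H} (hD : ∀ j, ∀ x ∈ U, E.D j x ∈ U) (hψ : ∀ x ∈ U, E.F ψ x ∈ U)
    {x : H} (hx : x ∈ U) : E.F φ x ∈ U := by
  obtain ⟨c, -, hF⟩ := E.taylor φ ψ
  exact E.F_mem_of_taylor (hF x) fun m =>
    U.smul_mem _ (hψ _ (E.Dpow_mem_of_stable U hD m hx))

/-- Divisibility for all lifts of Frobenius. -/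
theorem HodgeFCrystal.F_mem (E : HodgeFCrystal p k n H) (hp : 3 < p) (hE : E.IsDivisible 3)
    (φ : FrobLift p k n) {i : ℕ} (hi : i ≤ 3) {x : H} (hx : x ∈ E.Fil i) :
    E.F φ x ∈ pPow p k n H i := by
  obtain ⟨ψ, hψ⟩ := hE
  obtain ⟨c, -, hcd, -, hF⟩ := E.exists_taylor hp φ ψ
  refine E.F_mem_of_taylor (hF x) fun m => ?_
  -- If `|m| ≥ i` the Taylor coefficient alone supplies `p^i`. Otherwise it supplies `p^|m|`, while
  -- by transversality `D^m x` has dropped only to `Fil^(i-|m|)`, where divisibility for `ψ` gives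
  -- the remaining factor.
  by_cases hm : i ≤ m.degree
  · exact smul_mem_pPow (s := 0) ((pow_dvd_pow _ (by omega)).trans (hcd m)) (mem_pPow_zero _)
  · have h1 : E.Dpow m x ∈ E.Fil (i - m.degree) :=
      E.Dpow_mem (fun i => E.Fil i) (fun i j => E.transversal i j) m _ x (by
        rwa [Nat.sub_add_cancel (by omega)])
    have h2 := smul_mem_pPow (a := c m) (r := m.degree) (by
      have := hcd m
      rwa [min_eq_left (by omega)] at this) (hψ (i - m.degree) (by omega) _ h1)
    rwa [Nat.add_sub_cancel' (by omega)] at h2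

theorem mem_hodgeFil {E : FCrystal p k n H} {φ : FrobLift p k n} {i : ℕ} {x : H} :
    Submodule.mkQ (pPow p k n H 1) x ∈ E.hodgeFil φ i ↔
      ∃ y, E.F φ y ∈ pPow p k n H i ∧ x - y ∈ pPow p k n H 1 := by
  rw [FCrystal.hodgeFil, mem_red, Submodule.mem_sup]
  constructor
  · rintro ⟨y, hy, z, hz, rfl⟩
    exact ⟨y, hy, by rwa [add_sub_cancel_left]⟩
  · rintro ⟨y, hy, hz⟩
    exact ⟨y, hy, _, hz, by abel⟩

theorem FCrystal.hodgeFil_one_le (E : FCrystal p k n H) (hp : 3 < p) (φ ψ : FrobLift p k n) :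
    E.hodgeFil φ 1 ≤ E.hodgeFil ψ 1 := by
  refine Submodule.map_mono fun x hx => ?_
  have := sub_mem (show E.F φ x ∈ pPow p k n H 1 from hx) (E.F_sub_mem hp φ ψ x)
  rwa [sub_sub_cancel] at this

end Taylor

end CY3

end

noncomputable section

namespace CY3

open Finset

/-! ### The form and the ends of the Hodge filtration: `Fil⁴ = 0`, `n = h`, a unimodular generator
of `Fil³`. -/

section CY3Form

variable {p : ℕ} [Fact p.Prime] {k : Type v} [Field k] [CharP k p] [PerfectRing k p] {n h : ℕ}
  {H : Type u} [AddCommGroup H] [Module (A p k n) H]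

theorem A_eq_zero_of_forall_dvd {a : A p k n} (h : ∀ r, (p : A p k n) ^ r ∣ a) : a = 0 := by
  refine MvPowerSeries.ext fun d => ?_
  rw [map_zero]
  exact W_eq_zero_of_forall_dvd fun r => p_dvd_iff_coeff.1 (h r) d

theorem eq_zero_of_forall_mem_pPow [Module.Finite (A p k n) H] {x : H}
    (h : ∀ r, x ∈ pPow p k n H r) : x = 0 := by
  rw [← Submodule.mem_bot (R := A p k n)]
  exact mem_closure_iff_aux fun r => by rw [bot_sup_eq]; exact h r

/-- Nakayama's lemma for `p`: iterate the decomposition and use that submodules are `p`-adically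
closed. -/
theorem eq_top_of_sup_pPow [Module.Finite (A p k n) H] {N : Submodule (A p k n) H}
    (h : N ⊔ pPow p k n H 1 = ⊤) : N = ⊤ := by
  rw [eq_top_iff]
  intro x _
  refine mem_closure_iff_aux fun r => ?_
  suffices h1 : ∀ x, x ∈ N ⊔ pPow p k n H r from h1 x
  induction r with
  | zero => exact fun x => Submodule.mem_sup_right (mem_pPow_zero x)
  | succ r ih =>
    intro x
    obtain ⟨y, hy, z, hz, rfl⟩ := Submodule.mem_sup.1 (ih x)
    obtain ⟨z, rfl⟩ := mem_pPow.1 hz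
    have hz' : z ∈ N ⊔ pPow p k n H 1 := h ▸ Submodule.mem_top
    obtain ⟨y', hy', z', hz₁, rfl⟩ := Submodule.mem_sup.1 hz'
    rw [smul_add, ← add_assoc]
    exact Submodule.add_mem_sup (N.add_mem hy (N.smul_mem _ hy')) (smul_mem_pPow dvd_rfl hz₁)

namespace OrdinaryCY3Crystal

variable (E : OrdinaryCY3Crystal p k n h H)

theorem form_swap (x y : H) : E.form x y = - E.form y x := by
  have := E.alternating (x + y)
  simp only [map_add, LinearMap.add_apply, E.alternating, zero_add, add_zero] at this
  exact eq_neg_of_add_eq_zero_right this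

/-- Dividing the functional `⟨x, ·⟩` by `p` gives a functional, represented by some `z` because the
form is perfect; then `x = p z`. -/
theorem mem_pPow_of_form {x : H} (hx : ∀ y, (p : A p k n) ∣ E.form x y) : x ∈ pPow p k n H 1 := by
  choose l hl using hx
  obtain ⟨z, hz⟩ := E.perfect.2
    { toFun := l
      map_add' := fun a b => mul_left_cancel₀ p_ne_zero_A (by rw [mul_add, ← hl, ← hl, ← hl, map_add])
      map_smul' := fun c a => mul_left_cancel₀ p_ne_zero_A (by
        rw [RingHom.id_apply, smul_eq_mul, mul_left_comm, ← hl, ← hl, map_smul, smul_eq_mul]) }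
  refine mem_pPow_one.2 ⟨z, E.perfect.1 ?_⟩
  refine LinearMap.ext fun y => ?_
  rw [map_smul, LinearMap.smul_apply, hz, smul_eq_mul]
  exact (hl y).symm

/-- `p³ φ⟨x, y⟩ = ⟨F x, F y⟩` is divisible by `p⁴`, and `φ` reflects divisibility by `p`. This is
how Frobenius divisibility is turned into orthogonality modulo `p` below. -/
theorem pow_dvd_form {φ : FrobLift p k n} {i j : ℕ} {x y : H} (hx : E.F φ x ∈ pPow p k n H i)
    (hy : E.F φ y ∈ pPow p k n H j) (hij : 4 ≤ i + j) : (p : A p k n) ∣ E.form x y := by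
  obtain ⟨a, ha⟩ := mem_pPow.1 hx
  obtain ⟨b, hb⟩ := mem_pPow.1 hy
  have h1 := E.form_F φ x y
  rw [← ha, ← hb, map_smul, map_smul, LinearMap.smul_apply, smul_smul, ← pow_add, smul_eq_mul,
    show j + i = 3 + (1 + (i + j - 4)) by omega, pow_add, mul_assoc] at h1
  have h2 := mul_left_cancel₀ (pow_ne_zero 3 p_ne_zero_A) h1
  rw [pow_add, pow_one, mul_assoc] at h2
  exact φ.dvd_iff.1 ⟨_, h2.symm⟩

/-- A vector with Frobenius image in `p⁴H` pairs with everything into `pA`, so it is in `pH` by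
perfectness. Hence `Fil⁴ ⊂ pH`; as `Fil⁴` is saturated, it is infinitely divisible by `p`. -/
theorem fil_four : E.Fil 4 = ⊥ := by
  have := E.finite
  obtain ⟨φ, hφ⟩ := E.fil_red
  have h1 : E.Fil 4 ≤ pPow p k n H 1 := by
    intro x hx
    have h2 : Submodule.mkQ (pPow p k n H 1) x ∈ red (E.Fil 4) := ⟨x, hx, rfl⟩
    rw [hφ, mem_hodgeFil] at h2
    obtain ⟨y, hy, hxy⟩ := h2
    have h3 : y ∈ pPow p k n H 1 :=
      E.mem_pPow_of_form fun z => E.pow_dvd_form hy (mem_pPow_zero _) le_rfl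
    simpa using add_mem hxy h3
  rw [eq_bot_iff]
  intro x hx
  rw [Submodule.mem_bot]
  refine eq_zero_of_forall_mem_pPow (p := p) (k := k) (n := n) fun r => ?_
  suffices h2 : ∀ x ∈ E.Fil 4, x ∈ pPow p k n H r from h2 x hx
  induction r with
  | zero => exact fun x _ => mem_pPow_zero x
  | succ r ih =>
    intro x hx
    obtain ⟨y, rfl⟩ := mem_pPow_one.1 (h1 hx)
    rw [add_comm]
    exact smul_mem_pPow (by rw [pow_one]) (ih y (E.fil_saturated 4 y hx))

theorem exists_generator_fil_three :
    ∃ w ∈ E.Fil 3, w ≠ 0 ∧ ∀ x ∈ E.Fil 3, ∃ a : A p k n, x = a • w := by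
  have := E.finite
  have := E.fil_free 3
  have h0 : (E.Fil (3 + 1)).submoduleOf (E.Fil 3) = ⊥ := by
    rw [show 3 + 1 = 4 from rfl, E.fil_four, Submodule.submoduleOf, ← LinearMap.ker, Submodule.ker_subtype]
  have h1 : Module.finrank (A p k n) (E.Fil 3) = 1 := by
    rw [← E.rank_three]
    exact (Submodule.quotEquivOfEqBot _ h0).finrank_eq.symm
  let b := Module.finBasisOfFinrankEq (A p k n) (E.Fil 3) h1
  refine ⟨b 0, (b 0).2, ?_, fun x hx => ⟨b.repr ⟨x, hx⟩ 0, ?_⟩⟩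
  · exact fun h => b.ne_zero 0 (Subtype.ext h)
  · have := b.sum_repr ⟨x, hx⟩
    rw [Fin.sum_univ_one] at this
    exact (congrArg Subtype.val this).symm

variable {E} in
-- Evaluation at a generator `w` of `Fil³` identifies homomorphisms from `Fil³` to `gr²` with
-- elements of `gr²`. In particular `A^n ≃ gr²`, which yields both `n = h` and the freeness of
-- `gr²`.
theorem kodairaSpencer_at (hKS : Function.Bijective E.kodairaSpencer) {w : H} (hw : w ∈ E.Fil 3)
    (hw0 : w ≠ 0) (hgen : ∀ x ∈ E.Fil 3, ∃ a : A p k n, x = a • w) :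
    Function.Bijective fun a : Fin n → A p k n => ∑ j, a j • E.grD 2 j ⟨w, hw⟩ := by
  have := E.free
  have h1 : ∀ a, E.kodairaSpencer a ⟨w, hw⟩ = ∑ j, a j • E.grD 2 j ⟨w, hw⟩ := fun a => by
    rw [kodairaSpencer, Fintype.linearCombination_apply, LinearMap.sum_apply]
    rfl
  constructor
  · intro a b hab
    apply hKS.1
    refine LinearMap.ext fun x => ?_
    obtain ⟨c, hc⟩ := hgen x x.2
    have hx : x = c • (⟨w, hw⟩ : E.Fil 3) := Subtype.ext hc
    rw [hx, map_smul, map_smul, h1, h1]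
    exact congrArg _ hab
  · intro y
    choose c hc using fun x : E.Fil 3 => hgen x x.2
    have hinj : ∀ a b : A p k n, a • w = b • w → a = b := fun a b hab => by
      by_contra hne
      have h2 : (a - b) • w = 0 := by rw [sub_smul, hab, sub_self]
      rcases smul_eq_zero.1 h2 with h | h
      · exact hne (sub_eq_zero.1 h)
      · exact hw0 h
    obtain ⟨a, ha⟩ := hKS.2
      { toFun := fun x => c x • y
        map_add' := fun x x' => by
          rw [← add_smul]
          congr 1
          exact hinj _ _ (by rw [← hc, add_smul, ← hc, ← hc]; rfl)
        map_smul' := fun a x => by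
          rw [RingHom.id_apply, smul_smul]
          congr 1
          exact hinj _ _ (by rw [← hc, mul_smul, ← hc]; rfl) }
    refine ⟨a, ?_⟩
    change ∑ j, a j • E.grD 2 j ⟨w, hw⟩ = y
    rw [← h1, ha]
    change c ⟨w, hw⟩ • y = y
    rw [hinj (c ⟨w, hw⟩) 1 (by rw [← hc, one_smul]), one_smul]

theorem n_eq_h (hKS : Function.Bijective E.kodairaSpencer) : n = h := by
  obtain ⟨w, hw, hw0, hgen⟩ := E.exists_generator_fil_three
  have e : (Fin n → A p k n) ≃ₗ[A p k n] E.Gr 2 := LinearEquiv.ofBijective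
    (Fintype.linearCombination (A p k n) fun j => E.grD 2 j ⟨w, hw⟩)
    (kodairaSpencer_at hKS hw hw0 hgen)
  rw [← E.rank_two, ← e.finrank_eq, Module.finrank_fintype_fun_eq_card, Fintype.card_fin]

/-- `Fil² / Fil³` is isomorphic to `A^n`, hence torsion free. -/
theorem smul_mem_fil_three (hKS : Function.Bijective E.kodairaSpencer) {a : A p k n} (ha : a ≠ 0)
    {x : H} (hx : x ∈ E.Fil 2) (hax : a • x ∈ E.Fil 3) : x ∈ E.Fil 3 := by
  obtain ⟨w, hw, hw0, hgen⟩ := E.exists_generator_fil_three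
  have e : (Fin n → A p k n) ≃ₗ[A p k n] E.Gr 2 := LinearEquiv.ofBijective
    (Fintype.linearCombination (A p k n) fun j => E.grD 2 j ⟨w, hw⟩)
    (kodairaSpencer_at hKS hw hw0 hgen)
  have h1 : a • (Submodule.Quotient.mk ⟨x, hx⟩ : E.Gr 2) = 0 := by
    rw [← Submodule.Quotient.mk_smul, Submodule.Quotient.mk_eq_zero]
    exact hax
  have h2 : a • e.symm (Submodule.Quotient.mk ⟨x, hx⟩ : E.Gr 2) = 0 := by
    rw [← map_smul, h1, map_zero]
  rw [smul_eq_zero, or_iff_right ha, LinearEquiv.map_eq_zero_iff, Submodule.Quotient.mk_eq_zero] at h2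
  exact h2

/-- The reduction of `Fil¹` is the Hodge filtration for every lift. -/
theorem red_fil_one (hp : 3 < p) (φ : FrobLift p k n) : red (E.Fil 1) = E.hodgeFil φ 1 := by
  obtain ⟨ψ, hψ⟩ := E.fil_red
  rw [hψ]
  exact le_antisymm (E.hodgeFil_one_le hp _ _) (E.hodgeFil_one_le hp _ _)

/-- `Fil_0 H₀` is free over `A₀` and complementary to the reduction of `Fil¹`. Lifts of a basis of
it are therefore a basis of `H` modulo `Fil¹ + pH`. -/
theorem exists_basis_mod_fil_one (hp : 3 < p) : ∃ (r : ℕ) (y : Fin r → H),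
    (∀ x, ∃ a : Fin r → A p k n, x - ∑ i, a i • y i ∈ E.Fil 1 ⊔ pPow p k n H 1) ∧
    ∀ a : Fin r → A p k n, ∑ i, a i • y i ∈ E.Fil 1 ⊔ pPow p k n H 1 → ∀ i, (p : A p k n) ∣ a i := by
  obtain ⟨φ, hfree, hcompl⟩ := E.ordinary
  obtain ⟨r, ⟨g⟩⟩ := hfree 0
  have hcompl := hcompl 0
  rw [zero_add, ← E.red_fil_one hp] at hcompl
  have hb : (prev (E.conjFil φ) 0).submoduleOf (E.conjFil φ 0) = ⊥ := by
    rw [prev, Submodule.submoduleOf, ← LinearMap.ker, Submodule.ker_subtype]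
  obtain ⟨g⟩ : Nonempty (E.conjFil φ 0 ≃ₗ[A p k n] (Fin r → A₀ p k n)) :=
    ⟨(Submodule.quotEquivOfEqBot _ hb).symm.trans g⟩
  have hgsum : ∀ (a : Fin r → A p k n),
      g (∑ i, a i • g.symm (Pi.single i 1)) = fun i => Ideal.Quotient.mk _ (a i) := by
    intro a
    funext i
    rw [map_sum, Finset.sum_apply, Finset.sum_eq_single i]
    · rw [map_smul, LinearEquiv.apply_symm_apply, Pi.smul_apply, Pi.single_eq_same]
      exact congrArg (Ideal.Quotient.mk (Ideal.span {(p : A p k n)})) (mul_one (a i))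
    · intro j _ hj
      rw [map_smul, LinearEquiv.apply_symm_apply, Pi.smul_apply, Pi.single_eq_of_ne hj.symm,
        smul_zero]
    · simp
  choose y hy using fun i => Submodule.mkQ_surjective (pPow p k n H 1)
    (g.symm (Pi.single i 1) : Red p k n H)
  have hsum : ∀ a : Fin r → A p k n, Submodule.mkQ (pPow p k n H 1) (∑ i, a i • y i) =
      ((∑ i, a i • g.symm (Pi.single i 1) : E.conjFil φ 0) : Red p k n H) := fun a => by
    rw [map_sum, Submodule.coe_sum]
    refine Finset.sum_congr rfl fun i _ => ?_
    rw [map_smul, hy]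
    rfl
  refine ⟨r, y, fun x => ?_, fun a ha i => ?_⟩
  · have hx : Submodule.mkQ (pPow p k n H 1) x ∈ E.conjFil φ 0 ⊔ red (E.Fil 1) := by
      rw [hcompl.sup_eq_top]
      trivial
    obtain ⟨c, hc, z, hz, hcz⟩ := Submodule.mem_sup.1 hx
    choose a ha using fun i => Ideal.Quotient.mk_surjective (g ⟨c, hc⟩ i)
    refine ⟨a, ?_⟩
    rw [← mem_red, map_sub, hsum, ← hcz]
    have h1 : (∑ i, a i • g.symm (Pi.single i 1) : E.conjFil φ 0) = ⟨c, hc⟩ := by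
      apply g.injective
      rw [hgsum]
      exact funext ha
    rw [h1, add_sub_cancel_left]
    exact hz
  · rw [← mem_red, hsum] at ha
    have h1 := Submodule.disjoint_def.1 hcompl.disjoint _ (Subtype.mem _) ha
    have h2 : (∑ i, a i • g.symm (Pi.single i 1) : E.conjFil φ 0) = 0 := Subtype.ext h1
    have h3 := congrFun (hgsum a) i
    rw [h2, map_zero, Pi.zero_apply, eq_comm, Ideal.Quotient.eq_zero_iff_mem,
      Ideal.mem_span_singleton] at h3
    exact h3

/-- Generation modulo `Fil¹` lifts from modulo `p` by Nakayama. For independence, saturation of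
`Fil¹` allows a relation to be divided by `p` again and again. The number of vectors is then the
rank of `gr⁰`, which is one. -/
theorem exists_complement_fil_one (hp : 3 < p) :
    ∃ y : H, (∀ x, ∃ a : A p k n, x - a • y ∈ E.Fil 1) ∧
      ∀ a : A p k n, a • y ∈ E.Fil 1 → a = 0 := by
  have := E.finite
  obtain ⟨r, y, hspan, hind⟩ := E.exists_basis_mod_fil_one hp
  have hspan' : ∀ x, ∃ a : Fin r → A p k n, x - ∑ i, a i • y i ∈ E.Fil 1 := by
    have h1 : Submodule.span (A p k n) (Set.range y) ⊔ E.Fil 1 = ⊤ := by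
      refine eq_top_of_sup_pPow (eq_top_iff.2 fun x _ => ?_)
      obtain ⟨a, ha⟩ := hspan x
      rw [← sub_add_cancel x (∑ i, a i • y i), add_comm, sup_assoc]
      exact Submodule.add_mem_sup (sum_mem fun i _ => Submodule.smul_mem _ _
        (Submodule.subset_span ⟨i, rfl⟩)) ha
    intro x
    have h2 : x ∈ Submodule.span (A p k n) (Set.range y) ⊔ E.Fil 1 := h1 ▸ Submodule.mem_top
    obtain ⟨s, hs, z, hz, rfl⟩ := Submodule.mem_sup.1 h2
    obtain ⟨a, rfl⟩ := (Submodule.mem_span_range_iff_exists_fun _).1 hs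
    exact ⟨a, by rwa [add_sub_cancel_left]⟩
  have hind' : ∀ a : Fin r → A p k n, ∑ i, a i • y i ∈ E.Fil 1 → a = 0 := by
    have h1 : ∀ s (a : Fin r → A p k n), ∑ i, a i • y i ∈ E.Fil 1 → ∀ i, (p : A p k n) ^ s ∣ a i := by
      intro s
      induction s with
      | zero => exact fun a _ i => by rw [pow_zero]; exact one_dvd _
      | succ s ih =>
        intro a ha
        choose b hb using hind a (Submodule.mem_sup_left ha)
        have h2 : ∑ i, b i • y i ∈ E.Fil 1 := by
          refine E.fil_saturated 1 _ ?_
          rw [Finset.smul_sum]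
          simpa only [smul_smul, ← hb] using ha
        intro i
        rw [hb, pow_succ']
        exact mul_dvd_mul_left _ (ih b h2 i)
    intro a ha
    funext i
    exact A_eq_zero_of_forall_dvd fun s => h1 s a ha i
  have hr : r = 1 := by
    have hmem : ∀ x, x ∈ E.Fil 0 := fun x => by rw [E.fil_zero]; trivial
    have e : (Fin r → A p k n) ≃ₗ[A p k n] E.Gr 0 := LinearEquiv.ofBijective
      (Fintype.linearCombination (A p k n) fun i =>
        (Submodule.Quotient.mk ⟨y i, hmem _⟩ : E.Gr 0)) (by
      have h1 : ∀ a : Fin r → A p k n, (Fintype.linearCombination (A p k n) fun i =>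
          (Submodule.Quotient.mk ⟨y i, hmem _⟩ : E.Gr 0)) a =
          Submodule.Quotient.mk ⟨∑ i, a i • y i, hmem _⟩ := fun a => by
        rw [Fintype.linearCombination_apply]
        simp only [← Submodule.Quotient.mk_smul]
        rw [← Submodule.mkQ_apply]
        simp only [← Submodule.mkQ_apply]
        rw [← map_sum]
        congr 1
        exact Subtype.ext (by rw [Submodule.coe_sum]; rfl)
      constructor
      · rw [← LinearMap.ker_eq_bot, LinearMap.ker_eq_bot']
        intro a ha
        rw [h1, Submodule.Quotient.mk_eq_zero] at ha
        exact hind' a ha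
      · intro x
        obtain ⟨x, rfl⟩ := Submodule.Quotient.mk_surjective _ x
        obtain ⟨a, ha⟩ := hspan' x
        refine ⟨a, ?_⟩
        rw [h1, eq_comm, Submodule.Quotient.eq]
        exact ha)
    have := e.finrank_eq
    rwa [E.rank_zero, Module.finrank_fintype_fun_eq_card, Fintype.card_fin] at this
  subst hr
  refine ⟨y 0, fun x => ?_, fun a ha => ?_⟩
  · obtain ⟨a, ha⟩ := hspan' x
    exact ⟨a 0, by rwa [Fin.sum_univ_one] at ha⟩
  · exact congrFun (hind' (fun _ => a) (by rwa [Fin.sum_univ_one])) 0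

/-- `Fil³` is generated by a vector `v` with `⟨v, H⟩ = A`. -/
theorem exists_unimodular_generator (hp : 3 < p) (hKS : Function.Bijective E.kodairaSpencer) :
    ∃ v ∈ E.Fil 3, v ≠ 0 ∧ (∀ x ∈ E.Fil 3, ∃ a : A p k n, x = a • v) ∧
      (∀ x, x ∈ E.Fil 1 ↔ E.form v x = 0) ∧ ∃ y, E.form v y = 1 := by
  obtain ⟨y, hspan, hind⟩ := E.exists_complement_fil_one hp
  choose l hl using hspan
  have huniq : ∀ x a, x - a • y ∈ E.Fil 1 → a = l x := fun x a ha => by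
    have := sub_mem ha (hl x)
    rw [sub_sub_sub_cancel_left, ← sub_smul] at this
    exact (sub_eq_zero.1 (hind _ this)).symm
  -- `v` represents the functional with kernel `Fil¹` that takes the value `1` on the complement
  -- `y`. It remains to see that it generates `Fil³`.
  obtain ⟨v, hv⟩ := E.perfect.2
    { toFun := l
      map_add' := fun a b => (huniq _ _ (by
        have := add_mem (hl a) (hl b)
        rwa [sub_add_sub_comm, ← add_smul] at this)).symm
      map_smul' := fun c a => (huniq _ _ (by
        have := (E.Fil 1).smul_mem c (hl a)
        rwa [smul_sub, smul_smul] at this)).symm }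
  have hv' : ∀ x, E.form v x = l x := fun x => by rw [hv]; rfl
  have hker : ∀ x, x ∈ E.Fil 1 ↔ E.form v x = 0 := fun x => by
    rw [hv']
    constructor
    · intro hx
      exact (huniq x 0 (by rwa [zero_smul, sub_zero])).symm
    · intro hx
      have := hl x
      rwa [hx, zero_smul, sub_zero] at this
  -- `v` annihilates `Fil¹ ⊃ Fil²`, and `Fil²` is its own orthogonal.
  have hv2 : v ∈ E.Fil 2 :=
    (E.riemann_two v).2 fun x hx => (hker x).1 (E.fil_anti 1 hx)
  obtain ⟨w, hw, hw0, hgen⟩ := E.exists_generator_fil_three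
  -- The generator `w` of `Fil³` annihilates `Fil¹` as well, so its functional is a multiple of that
  -- of `v`. Torsion freeness of `Fil²/Fil³` then puts `v` itself into `Fil³`.
  have hwv : w = E.form w y • v := by
    apply E.perfect.1
    refine LinearMap.ext fun x => ?_
    have h1 : E.form w (x - l x • y) = 0 := by
      rw [E.form_swap, (E.riemann_three _).1 (hl x) w hw, neg_zero]
    rw [map_sub, sub_eq_zero, map_smul, smul_eq_mul] at h1
    rw [h1, map_smul, LinearMap.smul_apply, hv', smul_eq_mul, mul_comm]
  have ha : E.form w y ≠ 0 := fun h0 => hw0 (by rw [hwv, h0, zero_smul])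
  have hv3 : v ∈ E.Fil 3 := E.smul_mem_fil_three hKS ha hv2 (hwv ▸ hw)
  refine ⟨v, hv3, fun h0 => hw0 (by rw [hwv, h0, smul_zero]), fun x hx => ?_, hker, y, ?_⟩
  swap
  · rw [hv']
    exact (huniq y 1 (by rw [one_smul, sub_self]; exact zero_mem _)).symm
  obtain ⟨c, hc⟩ := hgen x hx
  exact ⟨c * E.form w y, by rw [hc, mul_smul, ← hwv]⟩

end OrdinaryCY3Crystal

end CY3Form

end CY3

end

noncomputable section

namespace CY3

open Finset

/-! ### A basis adapted to the Hodge filtration. -/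

section Adapted

variable {p : ℕ} [Fact p.Prime] {k : Type v} [Field k] [CharP k p] [PerfectRing k p] {n : ℕ}
  {H : Type u} [AddCommGroup H] [Module (A p k n) H]

theorem isUnit_A_of_dvd_sub_one {a : A p k n} (h : (p : A p k n) ∣ a - 1) : IsUnit a := by
  rw [isUnit_A_iff]
  intro h8
  have h9 := Ideal.sub_mem _ h8 (Ideal.mem_of_dvd _ h natCast_p_mem_J)
  rw [sub_sub_cancel] at h9
  exact isUnit_A_iff.1 isUnit_one h9

theorem isUnit_det_of_dvd {ι : Type*} [Fintype ι] [DecidableEq ι] {L : Matrix ι ι (A p k n)}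
    (hL : ∀ i j, (p : A p k n) ∣ L i j - (1 : Matrix ι ι (A p k n)) i j) : IsUnit L.det := by
  refine isUnit_A_of_dvd_sub_one ?_
  rw [← Matrix.det_one (n := ι) (R := A p k n), ← Ideal.mem_span_singleton, ← Ideal.Quotient.eq,
    RingHom.map_det, RingHom.map_det]
  congr 1
  refine Matrix.ext fun o o' => ?_
  simp only [RingHom.mapMatrix_apply, Matrix.map_apply]
  rw [Ideal.Quotient.eq, Ideal.mem_span_singleton]
  exact hL o o'

namespace OrdinaryCY3Crystal

variable (E : OrdinaryCY3Crystal p k n n H)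

/-- The vectors `v, D_1 v, …, D_n v`. -/
def tangentFamily (v : H) : Option (Fin n) → H := fun o => o.elim v fun j => E.D j v

variable {E}

theorem tangentFamily_mem {v : H} (hv : v ∈ E.Fil 3) (o : Option (Fin n)) :
    E.tangentFamily v o ∈ E.Fil 2 := by
  cases o with
  | none => exact E.fil_anti 2 hv
  | some j => exact E.transversal 2 j v hv

theorem sum_tangentFamily (v : H) (a : Option (Fin n) → A p k n) :
    ∑ o, a o • E.tangentFamily v o = a none • v + ∑ j, a (some j) • E.D j v := by
  rw [Fintype.sum_option]
  rfl

theorem sum_grD {v : H} (hv : v ∈ E.Fil 3) (a : Fin n → A p k n)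
    (hmem : ∑ j, a j • E.D j v ∈ E.Fil 2) :
    ∑ j, a j • E.grD 2 j ⟨v, hv⟩ = (Submodule.Quotient.mk ⟨∑ j, a j • E.D j v, hmem⟩ : E.Gr 2) := by
  have h1 : ∀ j, a j • E.grD 2 j ⟨v, hv⟩ = Submodule.mkQ ((E.Fil 3).submoduleOf (E.Fil 2))
      (a j • ⟨E.D j v, E.transversal 2 j v hv⟩) := fun j => rfl
  simp only [h1]
  rw [← map_sum, Submodule.mkQ_apply]
  congr 1
  exact Subtype.ext (by rw [Submodule.coe_sum]; rfl)

/-- Kodaira–Spencer makes the classes of the `D_j v` a basis of `gr²`, and `v` takes care of `Fil³`.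
With `tangentFamily_independent`, the vectors `v, D_1 v, …` form a basis of `Fil²`. -/
theorem exists_tangent_coords (hKS : Function.Bijective E.kodairaSpencer) {v : H}
    (hv : v ∈ E.Fil 3) (hv0 : v ≠ 0) (hgen : ∀ x ∈ E.Fil 3, ∃ a : A p k n, x = a • v)
    {x : H} (hx : x ∈ E.Fil 2) : ∃ a : Option (Fin n) → A p k n, x = ∑ o, a o • E.tangentFamily v o := by
  obtain ⟨a, ha⟩ := (kodairaSpencer_at hKS hv hv0 hgen).2 (Submodule.Quotient.mk ⟨x, hx⟩)
  have hmem : ∑ j, a j • E.D j v ∈ E.Fil 2 :=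
    sum_mem fun j _ => Submodule.smul_mem _ _ (E.transversal 2 j v hv)
  replace ha : ∑ j, a j • E.grD 2 j ⟨v, hv⟩ = Submodule.Quotient.mk ⟨x, hx⟩ := ha
  rw [sum_grD hv a hmem, eq_comm, Submodule.Quotient.eq] at ha
  obtain ⟨c, hc⟩ := hgen _ (show x - ∑ j, a j • E.D j v ∈ E.Fil 3 from ha)
  refine ⟨fun o => o.elim c a, ?_⟩
  rw [sum_tangentFamily]
  change x = c • v + _
  rw [← hc]
  exact (sub_add_cancel _ _).symm

theorem tangentFamily_independent (hKS : Function.Bijective E.kodairaSpencer) {v : H}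
    (hv : v ∈ E.Fil 3) (hv0 : v ≠ 0) (hgen : ∀ x ∈ E.Fil 3, ∃ a : A p k n, x = a • v)
    {a : Option (Fin n) → A p k n} (ha : ∑ o, a o • E.tangentFamily v o = 0) : a = 0 := by
  have := E.free
  rw [sum_tangentFamily] at ha
  have hmem : ∑ j, a (some j) • E.D j v ∈ E.Fil 2 :=
    sum_mem fun j _ => Submodule.smul_mem _ _ (E.transversal 2 j v hv)
  have h1 : (fun j => a (some j)) = 0 := by
    refine (kodairaSpencer_at hKS hv hv0 hgen).1 ?_
    change ∑ j, a (some j) • E.grD 2 j ⟨v, hv⟩ = ∑ j, (0 : Fin n → A p k n) j • _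
    rw [sum_grD hv _ hmem]
    simp only [Pi.zero_apply, zero_smul, Finset.sum_const_zero]
    rw [Submodule.Quotient.mk_eq_zero]
    change ∑ j, a (some j) • E.D j v ∈ E.Fil 3
    rw [eq_neg_of_add_eq_zero_right ha]
    exact neg_mem (Submodule.smul_mem _ _ hv)
  have h2 : a none • v = 0 := by
    simpa [congrFun h1] using ha
  funext o
  cases o with
  | none => exact (smul_eq_zero.1 h2).resolve_right hv0
  | some j => exact congrFun h1 j

theorem dvd_of_sum_tangentFamily_mem (hKS : Function.Bijective E.kodairaSpencer) {v : H}
    (hv : v ∈ E.Fil 3) (hv0 : v ≠ 0) (hgen : ∀ x ∈ E.Fil 3, ∃ a : A p k n, x = a • v)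
    {a : Option (Fin n) → A p k n} (ha : ∑ o, a o • E.tangentFamily v o ∈ pPow p k n H 1)
    (o : Option (Fin n)) : (p : A p k n) ∣ a o := by
  obtain ⟨y, hy⟩ := mem_pPow_one.1 ha
  have hy2 : y ∈ E.Fil 2 := E.fil_saturated 2 y (hy ▸ sum_mem fun o _ =>
    Submodule.smul_mem _ _ (tangentFamily_mem hv o))
  obtain ⟨b, rfl⟩ := exists_tangent_coords hKS hv hv0 hgen hy2
  rw [Finset.smul_sum, ← sub_eq_zero, ← Finset.sum_sub_distrib] at hy
  simp only [smul_smul, ← sub_smul] at hy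
  have := congrFun (tangentFamily_independent hKS hv hv0 hgen hy) o
  exact ⟨b o, (sub_eq_zero.1 this).symm⟩

/-- The second step of the Hodge filtration is the reduction of `Fil²` for every lift. -/
theorem red_fil_two (hp : 3 < p) (hKS : Function.Bijective E.kodairaSpencer)
    (φ : FrobLift p k n) : red (E.Fil 2) = E.hodgeFil φ 2 := by
  obtain ⟨v, hv, hv0, hgen, hker, y₁, hy₁⟩ := E.exists_unimodular_generator hp hKS
  refine le_antisymm (Submodule.map_mono fun x hx => E.F_mem hp E.divisible φ (by norm_num) hx) ?_
  obtain ⟨ψ, hψ⟩ := E.fil_red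
  rw [hψ]
  refine Submodule.map_mono fun y hy => ?_
  replace hy : E.F φ y ∈ pPow p k n H 2 := hy
  change E.F ψ y ∈ pPow p k n H 2
  have h1 : ∀ z ∈ E.Fil 2, (p : A p k n) ∣ E.form z y := fun z hz =>
    E.pow_dvd_form (E.F_mem hp E.divisible φ (by norm_num) hz) hy le_rfl
  -- The first order Taylor term requires `F(φ) D_j y ∈ pH`. Differentiating `⟨v, y⟩ ≡ 0` and using
  -- `⟨D_j v, y⟩ ≡ 0` gives `⟨v, D_j y⟩ ≡ 0` modulo `p`, so `D_j y` lies in `Fil¹ + pH`.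
  have h2 : ∀ j, E.F φ (E.D j y) ∈ pPow p k n H 1 := by
    intro j
    have h3 : (p : A p k n) ∣ E.form v (E.D j y) := by
      obtain ⟨c, hc⟩ := h1 v (E.fil_anti 2 hv)
      have h4 := E.form_D j v y
      rw [hc, Derivation.leibniz, ← map_natCast (MvPowerSeries.C (σ := Fin n) (R := W p k)) p,
        MvPowerSeries.pderiv_C, smul_zero, add_zero, map_natCast, smul_eq_mul] at h4
      exact (dvd_add_right (h1 _ (E.transversal 2 j v hv))).1 ⟨_, h4⟩
    obtain ⟨c, hc⟩ := h3
    have h4 : E.D j y - E.form v (E.D j y) • y₁ ∈ E.Fil 1 := by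
      rw [hker, map_sub, map_smul, hy₁, smul_eq_mul, mul_one, sub_self]
    have h5 := add_mem (E.F_mem hp E.divisible φ (by norm_num) h4)
      (E.F_mem_pPow' φ (mem_pPow_one.2 ⟨c • y₁, by rw [smul_smul, ← hc]⟩))
    rwa [← map_add, sub_add_cancel] at h5
  obtain ⟨c, hc0, hcd, -, hF⟩ := E.exists_taylor hp ψ φ
  refine E.F_mem_of_taylor (hF y) fun m => ?_
  by_cases hm : 2 ≤ m.degree
  · exact smul_mem_pPow (s := 0) ((pow_dvd_pow _ (by omega)).trans (hcd m)) (mem_pPow_zero _)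
  · have h3 := E.Dpow_mem
      (fun i => match i with
        | 0 => Set.univ
        | 1 => {z | E.F φ z ∈ pPow p k n H 1}
        | 2 => {y}
        | _ => ∅)
      (fun i j x hx => by
        match i, hx with
        | 0, _ => trivial
        | 1, hx =>
          rw [Set.mem_singleton_iff.1 hx]
          exact h2 j
        | i + 2, hx => exact hx.elim) m (2 - m.degree) y
      (by rw [Nat.sub_add_cancel (by omega)]; rfl)
    have h4 : m.degree = 0 ∨ m.degree = 1 := by omega
    rcases h4 with h4 | h4
    · rw [(Finsupp.degree_eq_zero_iff m).1 h4, E.Dpow_zero]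
      exact Submodule.smul_mem _ _ hy
    · rw [h4] at h3
      have h5 := hcd m
      rw [h4] at h5
      exact smul_mem_pPow (r := 1) (s := 1) h5 h3

/-- Projection to `Fil²` along `Fil_1 H₀` is defined modulo `p` by ordinarity; lifted coordinates of
it are functionals `l o`. Their values on `v, D_j v` form a matrix congruent to `1` modulo `p`.
Inverting that matrix makes the functionals exactly dual, and perfectness represents them by
vectors. -/
theorem exists_dual_family (hp : 3 < p) (hKS : Function.Bijective E.kodairaSpencer) {v : H}
    (hv : v ∈ E.Fil 3) (hv0 : v ≠ 0) (hgen : ∀ x ∈ E.Fil 3, ∃ a : A p k n, x = a • v) :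
    ∃ ξ : Option (Fin n) → H, ∀ o o', E.form (ξ o) (E.tangentFamily v o') = if o = o' then 1 else 0 := by
  classical
  have := E.free
  have := E.finite
  obtain ⟨φ, -, hcompl⟩ := E.ordinary
  replace hcompl := hcompl 1
  rw [show 1 + 1 = 2 from rfl, ← red_fil_two hp hKS] at hcompl
  have h1 : ∀ x, ∃ a : Option (Fin n) → A p k n,
      Submodule.mkQ (pPow p k n H 1) (x - ∑ o, a o • E.tangentFamily v o) ∈ E.conjFil φ 1 := by
    intro x
    have hx : Submodule.mkQ (pPow p k n H 1) x ∈ E.conjFil φ 1 ⊔ red (E.Fil 2) := by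
      rw [hcompl.sup_eq_top]
      trivial
    obtain ⟨c, hc, _, ⟨z, hz, rfl⟩, hcz⟩ := Submodule.mem_sup.1 hx
    obtain ⟨a, rfl⟩ := exists_tangent_coords hKS hv hv0 hgen hz
    exact ⟨a, by rwa [map_sub, ← hcz, add_sub_cancel_right]⟩
  let β := Module.Free.chooseBasis (A p k n) H
  choose a ha using fun s => h1 (β s)
  let l : Option (Fin n) → H →ₗ[A p k n] A p k n := fun o => β.constr (A p k n) fun s => a s o
  have hl : ∀ x, Submodule.mkQ (pPow p k n H 1) (x - ∑ o, l o x • E.tangentFamily v o) ∈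
      E.conjFil φ 1 := by
    intro x
    have h2 : x - ∑ o, l o x • E.tangentFamily v o =
        ∑ s, β.repr x s • (β s - ∑ o, a s o • E.tangentFamily v o) := by
      simp only [smul_sub, Finset.sum_sub_distrib, β.sum_repr, Finset.smul_sum]
      rw [Finset.sum_comm]
      congr 1
      refine Finset.sum_congr rfl fun o _ => ?_
      rw [Module.Basis.constr_apply_fintype, Finset.sum_smul]
      exact Finset.sum_congr rfl fun s _ => by
        rw [smul_smul, smul_eq_mul, Module.Basis.equivFun_apply]
    rw [h2, map_sum]
    exact sum_mem fun s _ => by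
      rw [map_smul]
      exact Submodule.smul_mem _ _ (ha s)
  let L : Matrix (Option (Fin n)) (Option (Fin n)) (A p k n) :=
    Matrix.of fun o o' => l o (E.tangentFamily v o')
  have hL : ∀ o o', (p : A p k n) ∣ L o o' - (1 : Matrix _ _ (A p k n)) o o' := by
    intro o o'
    have h3 : ∑ o, (L o o' - (1 : Matrix _ _ (A p k n)) o o') • E.tangentFamily v o ∈
        pPow p k n H 1 := by
      have h4 : E.tangentFamily v o' - ∑ o, l o (E.tangentFamily v o') • E.tangentFamily v o =
          - ∑ o, (L o o' - (1 : Matrix _ _ (A p k n)) o o') • E.tangentFamily v o := by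
        simp only [sub_smul, Finset.sum_sub_distrib, Matrix.one_apply, ite_smul, one_smul, zero_smul,
          Finset.sum_ite_eq', Finset.mem_univ, if_true, neg_sub]
        rfl
      have h5 := hl (E.tangentFamily v o')
      rw [h4] at h5
      have h6 := Submodule.disjoint_def.1 hcompl.disjoint _ h5 ⟨_, neg_mem (sum_mem fun o _ =>
        Submodule.smul_mem _ _ (tangentFamily_mem hv o)), rfl⟩
      rw [map_neg, neg_eq_zero, Submodule.mkQ_apply, Submodule.Quotient.mk_eq_zero] at h6
      exact h6
    exact dvd_of_sum_tangentFamily_mem hKS hv hv0 hgen h3 o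
  have hdet : IsUnit L.det := isUnit_det_of_dvd hL
  choose ξ hξ using fun o => E.perfect.2 (∑ o', L⁻¹ o o' • l o')
  refine ⟨ξ, fun o o' => ?_⟩
  rw [hξ, LinearMap.sum_apply]
  exact congrFun (congrFun (Matrix.nonsing_inv_mul L hdet) o) o'

variable (E) in
/-- A basis adapted to the Hodge filtration, with the standard Gram matrix on and below the
antidiagonal. -/
structure IsAdapted (f : Module.Basis (Idx n) (A p k n) H) : Prop where
  mem : ∀ a, f a ∈ E.Fil a.deg
  fil : ∀ i x, x ∈ E.Fil i ↔ ∀ a : Idx n, a.deg < i → f.repr x a = 0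
  gram : ∀ a b, 3 ≤ a.deg + b.deg → E.form (f a) (f b) = CY3.gram (A p k n) n a b

theorem exists_isAdapted (hp : 3 < p) (hKS : Function.Bijective E.kodairaSpencer) :
    ∃ f : Module.Basis (Idx n) (A p k n) H, E.IsAdapted f := by
  obtain ⟨v, hv, hv0, hgen, hker, -⟩ := E.exists_unimodular_generator hp hKS
  obtain ⟨ξ, hξ⟩ := exists_dual_family hp hKS hv hv0 hgen
  have hv2 := E.fil_anti 2 hv
  -- The minus sign produces the entry `-1` of the Gram matrix. Relations among the dual vectors
  -- themselves are not imposed here; the slope filtration will provide them.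
  let f : Idx n → H := fun a => match a with
    | Sum.inl _ => - ξ none
    | Sum.inr (Sum.inl j) => ξ (some j)
    | Sum.inr (Sum.inr (Sum.inl j)) => E.D j v
    | Sum.inr (Sum.inr (Sum.inr _)) => v
  have hξv : ∀ o, E.form (ξ o) v = if o = none then 1 else 0 := fun o => hξ o none
  have hξD : ∀ o j, E.form (ξ o) (E.D j v) = if o = some j then 1 else 0 := fun o j => hξ o (some j)
  have hD2 : ∀ j, E.D j v ∈ E.Fil 2 := fun j => E.transversal 2 j v hv
  have hiso : ∀ x ∈ E.Fil 2, ∀ y ∈ E.Fil 2, E.form x y = 0 := fun x hx => (E.riemann_two x).1 hx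
  have hgram : ∀ a b, 3 ≤ a.deg + b.deg → E.form (f a) (f b) = CY3.gram (A p k n) n a b := by
    rintro (_ | i | i | _) (_ | j | j | _) hab <;> simp only [Idx.deg] at hab <;> try omega
    · change E.form (- ξ none) v = -1
      rw [map_neg, LinearMap.neg_apply, hξv, if_pos rfl]
    · change E.form (ξ (some i)) (E.D j v) = if i = j then 1 else 0
      rw [hξD]
      simp
    · change E.form (ξ (some i)) v = 0
      rw [hξv]
      simp
    · change E.form (E.D i v) (ξ (some j)) = if i = j then -1 else 0
      rw [E.form_swap, hξD]
      simp [eq_comm, apply_ite]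
    · exact hiso _ (hD2 i) _ (hD2 j)
    · exact hiso _ (hD2 i) _ hv2
    · change E.form v (- ξ none) = 1
      rw [E.form_swap, map_neg, LinearMap.neg_apply, hξv, if_pos rfl, neg_neg]
    · change E.form v (ξ (some j)) = 0
      rw [E.form_swap, hξv]
      simp
    · exact hiso _ hv2 _ (hD2 j)
    · exact hiso _ hv2 _ hv2
  have hsum : ∀ c : Idx n → A p k n, ∑ a, c a • f a = (c Idx.i0 • -ξ none +
      ∑ j, c (Idx.i1 j) • ξ (some j)) + ∑ o : Option (Fin n), (o.elim (c Idx.i3)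
        fun j => c (Idx.i2 j)) • E.tangentFamily v o := by
    intro c
    rw [sum_tangentFamily]
    simp only [Fintype.sum_sum_type, Finset.univ_unique, Finset.sum_singleton]
    change c Idx.i0 • -ξ none + (∑ j, c (Idx.i1 j) • ξ (some j) +
      (∑ j, c (Idx.i2 j) • E.D j v + c Idx.i3 • v)) = _ + (c Idx.i3 • v +
        ∑ j, c (Idx.i2 j) • E.D j v)
    abel
  have hpair : ∀ c : Idx n → A p k n, E.form (∑ a, c a • f a) v = - c Idx.i0 ∧
      ∀ j, E.form (∑ a, c a • f a) (E.D j v) = c (Idx.i1 j) := by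
    intro c
    have h0 : E.form (∑ o : Option (Fin n), (o.elim (c Idx.i3)
        fun j => c (Idx.i2 j)) • E.tangentFamily v o) v = 0 ∧ ∀ j, E.form (∑ o : Option (Fin n),
        (o.elim (c Idx.i3) fun j => c (Idx.i2 j)) • E.tangentFamily v o) (E.D j v) = 0 := by
      have hm := sum_mem (S := E.Fil 2) fun (o : Option (Fin n)) (_ : o ∈ Finset.univ) =>
        Submodule.smul_mem _ (o.elim (c Idx.i3) fun j => c (Idx.i2 j)) (tangentFamily_mem hv o)
      exact ⟨hiso _ hm _ hv2, fun j => hiso _ hm _ (hD2 j)⟩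
    rw [hsum]
    constructor
    · rw [map_add, LinearMap.add_apply, h0.1]
      simp [hξv]
    · intro j
      rw [map_add, LinearMap.add_apply, h0.2]
      simp [hξD]
  have hli : LinearIndependent (A p k n) f := by
    rw [Fintype.linearIndependent_iff]
    intro c hc
    have h1 := hpair c
    rw [hc] at h1
    simp only [map_zero, LinearMap.zero_apply] at h1
    have h2 : c Idx.i0 = 0 := neg_eq_zero.1 h1.1.symm
    have h3 : ∀ j, c (Idx.i1 j) = 0 := fun j => (h1.2 j).symm
    rw [hsum] at hc
    simp only [h2, h3, zero_smul, Finset.sum_const_zero, add_zero, zero_add] at hc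
    have h4 := tangentFamily_independent hKS hv hv0 hgen hc
    rintro (_ | i | i | _)
    · exact h2
    · exact h3 i
    · exact congrFun h4 (some i)
    · exact congrFun h4 none
  have hspan2 : ∀ x ∈ E.Fil 2, ∃ c : Idx n → A p k n, x = ∑ a, c a • f a := by
    intro x hx
    obtain ⟨a, rfl⟩ := exists_tangent_coords hKS hv hv0 hgen hx
    refine ⟨fun b => match b with
      | Sum.inl _ => 0
      | Sum.inr (Sum.inl j) => 0
      | Sum.inr (Sum.inr (Sum.inl j)) => a (some j)
      | Sum.inr (Sum.inr (Sum.inr _)) => a none, ?_⟩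
    rw [hsum]
    simp only [zero_smul, Finset.sum_const_zero, add_zero, zero_add]
    exact Finset.sum_congr rfl fun o _ => by cases o <;> rfl
  have hsp : ⊤ ≤ Submodule.span (A p k n) (Set.range f) := by
    intro x _
    -- Subtracting the components seen by `v` and the `D_j v` leaves a vector orthogonal to `Fil²`,
    -- hence in `Fil²`, where `v, D_j v` span.
    let c : Idx n → A p k n := fun a => match a with
      | Sum.inl _ => - E.form x v
      | Sum.inr (Sum.inl j) => E.form x (E.D j v)
      | _ => 0
    have h1 := hpair c
    have h2 : x - ∑ a, c a • f a ∈ E.Fil 2 := by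
      rw [E.riemann_two]
      intro y hy
      obtain ⟨b, rfl⟩ := exists_tangent_coords hKS hv hv0 hgen hy
      rw [map_sum]
      refine Finset.sum_eq_zero fun o _ => ?_
      rw [map_smul, map_sub, LinearMap.sub_apply]
      cases o with
      | none =>
        change b none • (E.form x v - E.form _ v) = 0
        rw [h1.1]
        change b none • (E.form x v - - -E.form x v) = 0
        rw [neg_neg, sub_self, smul_zero]
      | some j =>
        change b (some j) • (E.form x (E.D j v) - E.form _ (E.D j v)) = 0
        rw [h1.2]
        change b (some j) • (E.form x (E.D j v) - E.form x (E.D j v)) = 0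
        rw [sub_self, smul_zero]
    obtain ⟨c', hc'⟩ := hspan2 _ h2
    rw [sub_eq_iff_eq_add.1 hc']
    exact add_mem (sum_mem fun a _ => Submodule.smul_mem _ _ (Submodule.subset_span ⟨a, rfl⟩))
      (sum_mem fun a _ => Submodule.smul_mem _ _ (Submodule.subset_span ⟨a, rfl⟩))
  let F := Module.Basis.mk hli hsp
  have hF : ∀ a, F a = f a := Module.Basis.mk_apply hli hsp
  have hrepr : ∀ x, x = ∑ a, F.repr x a • f a := fun x => by
    conv_lhs => rw [← F.sum_repr x]
    exact Finset.sum_congr rfl fun a _ => by rw [hF]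
  have hFv : ∀ x, E.form x v = - F.repr x Idx.i0 := fun x => by
    conv_lhs => rw [hrepr x]
    exact (hpair _).1
  have hFD : ∀ x j, E.form x (E.D j v) = F.repr x (Idx.i1 j) := fun x j => by
    conv_lhs => rw [hrepr x]
    exact (hpair _).2 j
  have hmem : ∀ a, F a ∈ E.Fil a.deg := by
    intro a
    rw [hF]
    rcases a with (_ | i | i | _)
    · rw [Idx.deg, E.fil_zero]
      trivial
    · change ξ (some i) ∈ E.Fil 1
      rw [hker, E.form_swap, hξv]
      simp
    · exact hD2 i
    · exact hv
  have hle : ∀ i j, i ≤ j → E.Fil j ≤ E.Fil i := fun i j hij =>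
    antitone_nat_of_succ_le E.fil_anti hij
  refine ⟨F, hmem, fun i x => ⟨fun hx => ?_, fun hx => ?_⟩, fun a b hab => ?_⟩
  · rintro (_ | j | j | _) ha
    · have h1 := hle 1 i ha hx
      rw [hker, E.form_swap, hFv, neg_neg] at h1
      exact h1
    · have h1 := hle 2 i ha hx
      exact (hFD x j).symm.trans (hiso _ h1 _ (hD2 j))
    · have h1 := hle 3 i ha hx
      obtain ⟨c, hc⟩ := hgen x h1
      rw [hc, map_smul, show v = F Idx.i3 from (hF Idx.i3).symm, F.repr_self]
      simp
    · have h1 := hle 4 i ha hx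
      rw [E.fil_four, Submodule.mem_bot] at h1
      rw [h1, map_zero, Finsupp.zero_apply]
  · rw [← F.sum_repr x]
    refine sum_mem fun a _ => ?_
    by_cases ha : a.deg < i
    · rw [hx a ha, zero_smul]
      exact zero_mem _
    · exact Submodule.smul_mem _ _ (hle _ _ (not_lt.1 ha) (hmem a))
  · rw [hF, hF]
    exact hgram a b hab

variable {f : Module.Basis (Idx n) (A p k n) H}

theorem IsAdapted.mem_fil_sup_iff (hf : E.IsAdapted f) {i : ℕ} {x : H} :
    x ∈ E.Fil i ⊔ pPow p k n H 1 ↔ ∀ a : Idx n, a.deg < i → (p : A p k n) ∣ f.repr x a := by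
  constructor
  · intro h a ha
    obtain ⟨y, hy, z, hz, rfl⟩ := Submodule.mem_sup.1 h
    obtain ⟨z, rfl⟩ := mem_pPow_one.1 hz
    rw [map_add, Finsupp.add_apply, (hf.fil i y).1 hy a ha, zero_add, map_smul, Finsupp.smul_apply,
      smul_eq_mul]
    exact dvd_mul_right _ _
  · intro h
    rw [← f.sum_repr x]
    refine sum_mem fun a _ => ?_
    by_cases ha : a.deg < i
    · obtain ⟨c, hc⟩ := h a ha
      exact Submodule.mem_sup_right (mem_pPow_one.2 ⟨c • f a, by rw [smul_smul, ← hc]⟩)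
    · refine Submodule.mem_sup_left (Submodule.smul_mem _ _ ((hf.fil i _).2 fun b hb => ?_))
      rw [f.repr_self, Finsupp.single_eq_of_ne]
      rintro rfl
      exact ha hb

/-- Solving a triangular system for the coefficients of a vector. -/
theorem dvd_coeff_of_gram {f : Idx n → H}
    (hf : ∀ a b : Idx n, 3 ≤ a.deg + b.deg → E.form (f a) (f b) = CY3.gram (A p k n) n a b)
    {P : A p k n} {c : Idx n → A p k n} {m : ℕ}
    (h1 : ∀ b : Idx n, m ≤ b.deg → P ∣ E.form (∑ a, c a • f a) (f b)) (a : Idx n)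
    (ha : a.deg + m ≤ 3) : P ∣ c a := by
  have h2 : ∀ b, E.form (∑ a, c a • f a) (f b) = c Idx.i0 * E.form (f Idx.i0) (f b) +
      (∑ j, c (Idx.i1 j) * E.form (f (Idx.i1 j)) (f b) +
      (∑ j, c (Idx.i2 j) * E.form (f (Idx.i2 j)) (f b) +
        c Idx.i3 * E.form (f Idx.i3) (f b))) := fun b => by
    rw [map_sum, LinearMap.sum_apply]
    simp only [Fintype.sum_sum_type, Finset.univ_unique, Finset.sum_singleton, map_smul,
      LinearMap.smul_apply, smul_eq_mul]
  have g03 : E.form (f Idx.i0) (f Idx.i3) = -1 := hf _ _ le_rfl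
  have g13 : ∀ i, E.form (f (Idx.i1 i)) (f Idx.i3) = 0 := fun i => hf _ _ (by simp [Idx.deg])
  have g23 : ∀ i, E.form (f (Idx.i2 i)) (f Idx.i3) = 0 := fun i => hf _ _ (by simp [Idx.deg])
  have g33 : E.form (f Idx.i3) (f Idx.i3) = 0 := hf _ _ (by simp [Idx.deg])
  have g12 : ∀ i j, E.form (f (Idx.i1 i)) (f (Idx.i2 j)) = if i = j then 1 else 0 :=
    fun i j => hf _ _ le_rfl
  have g22 : ∀ i j, E.form (f (Idx.i2 i)) (f (Idx.i2 j)) = 0 :=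
    fun i j => hf _ _ (by simp [Idx.deg])
  have g32 : ∀ j, E.form (f Idx.i3) (f (Idx.i2 j)) = 0 := fun j => hf _ _ (by simp [Idx.deg])
  have g21 : ∀ i j, E.form (f (Idx.i2 i)) (f (Idx.i1 j)) = if i = j then -1 else 0 :=
    fun i j => hf _ _ le_rfl
  have g31 : ∀ j, E.form (f Idx.i3) (f (Idx.i1 j)) = 0 := fun j => hf _ _ (by simp [Idx.deg])
  have g30 : E.form (f Idx.i3) (f Idx.i0) = 1 := hf _ _ le_rfl
  have h0 : m ≤ 3 → P ∣ c Idx.i0 := fun hm => by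
    have h3 := h1 Idx.i3 hm
    rw [h2, g03, g33] at h3
    simpa [g13, g23] using h3
  have h11 : m ≤ 2 → ∀ j, P ∣ c (Idx.i1 j) := fun hm j => by
    have h3 := h1 (Idx.i2 j) hm
    rw [h2, dvd_add_right ((h0 (by omega)).mul_right _), g32] at h3
    simpa [g12, g22] using h3
  have h22 : m ≤ 1 → ∀ j, P ∣ c (Idx.i2 j) := fun hm j => by
    have h3 := h1 (Idx.i1 j) hm
    rw [h2, dvd_add_right ((h0 (by omega)).mul_right _),
      dvd_add_right (Finset.dvd_sum fun j _ => (h11 (by omega) j).mul_right _)] at h3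
    rw [g31] at h3
    simpa [g21] using h3
  have h33 : m = 0 → P ∣ c Idx.i3 := fun hm => by
    have h3 := h1 Idx.i0 (by omega)
    rw [h2, dvd_add_right ((h0 (by omega)).mul_right _),
      dvd_add_right (Finset.dvd_sum fun j _ => (h11 (by omega) j).mul_right _),
      dvd_add_right (Finset.dvd_sum fun j _ => (h22 (by omega) j).mul_right _), g30, mul_one] at h3
    exact h3
  rcases a with (_ | j | j | _) <;> simp only [Idx.deg] at ha
  · exact h0 (by omega)
  · exact h11 (by omega) j
  · exact h22 (by omega) j
  · exact h33 (by omega)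

/-- If `F y ∈ p³H`, then `y` is orthogonal modulo `p` to `Fil¹`, on which `F` is divisible by `p`.
Pairing with `Fil¹` reads off all coordinates of degree below `3`. -/
theorem IsAdapted.hodgeFil_three_le (hf : E.IsAdapted f) (hp : 3 < p) (φ : FrobLift p k n) :
    E.hodgeFil φ 3 ≤ red (E.Fil 3) := by
  rintro _ ⟨y, hy, rfl⟩
  replace hy : E.F φ y ∈ pPow p k n H 3 := hy
  rw [mem_red, hf.mem_fil_sup_iff]
  refine fun a ha => dvd_coeff_of_gram hf.gram (m := 1) (fun b hb => ?_) a (by omega)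
  rw [f.sum_repr]
  exact E.pow_dvd_form hy (E.F_mem hp E.divisible φ (by norm_num)
    (show f b ∈ E.Fil 1 from antitone_nat_of_succ_le E.fil_anti hb (hf.mem b))) le_rfl

/-- Ordinarity holds for one lift and for the Hodge filtration computed with it. That filtration is
contained in the reduction of `Fil^(i+1)` in each of the three degrees, and the conjugate filtration
is independent of the lift. -/
theorem IsAdapted.conjFil_sup (hf : E.IsAdapted f) (hp : 3 < p)
    (hKS : Function.Bijective E.kodairaSpencer) (φ : FrobLift p k n) {i : ℕ} (hi : i ≤ 2) :
    E.conjFil φ i ⊔ red (E.Fil (i + 1)) = ⊤ := by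
  obtain ⟨ψ, -, hcompl⟩ := E.ordinary
  rw [E.conjFil_eq hp φ ψ, eq_top_iff, ← (hcompl i).sup_eq_top]
  refine sup_le_sup_left ?_ _
  match i, hi with
  | 0, _ => exact (E.red_fil_one hp ψ).ge
  | 1, _ => exact (red_fil_two hp hKS ψ).ge
  | 2, _ => exact hf.hodgeFil_three_le hp ψ

end OrdinaryCY3Crystal

end Adapted

end CY3

end

noncomputable section

namespace CY3

open Finset

/-! ### Submodules of slopes `≤ i`: comparison, stability under `∇`, orthogonality. -/

section SlopeSub

variable {p : ℕ} [Fact p.Prime] {k : Type v} [Field k] [CharP k p] [PerfectRing k p] {n : ℕ}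
  {H : Type u} [AddCommGroup H] [Module (A p k n) H]

theorem exists_fixed_point_A {ι : Type*} (Φ : (ι → A p k n) → ι → A p k n)
    (hΦ : ∀ s x y, (∀ i, (p : A p k n) ^ s ∣ x i - y i) →
      ∀ i, (p : A p k n) ^ (s + 1) ∣ Φ x i - Φ y i) : ∃ x, Φ x = x := by
  obtain ⟨x, hx⟩ := exists_fixed_point
    (fun (x : ι × (Fin n →₀ ℕ) → W p k) i =>
      MvPowerSeries.coeff i.2 (Φ (fun j => mkSeries fun d => x (j, d)) i.1)) (by
    intro s x y hxy i
    rw [← map_sub]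
    refine p_dvd_iff_coeff.1 (hΦ s _ _ (fun j => p_dvd_iff_coeff.2 fun d => ?_) i.1) i.2
    rw [map_sub, coeff_mkSeries, coeff_mkSeries]
    exact hxy (j, d))
  refine ⟨fun j => mkSeries fun d => x (j, d), funext fun j => MvPowerSeries.ext fun d => ?_⟩
  rw [coeff_mkSeries]
  exact congrFun hx (j, d)

namespace OrdinaryCY3Crystal

variable {E : OrdinaryCY3Crystal p k n n H} {ψ : FrobLift p k n}

variable (E ψ) in
/-- The part of slopes `≤ i`, for one lift of Frobenius. -/
structure IsSlopeSub (i : ℕ) (U : Submodule (A p k n) H) : Prop where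
  F_mem : ∀ x ∈ U, E.F ψ x ∈ U
  pow_mem : ∀ x ∈ U, (p : A p k n) ^ i • x ∈ Submodule.span (A p k n) (E.F ψ '' U)
  compl : IsCompl U (E.Fil (i + 1))

namespace IsSlopeSub

variable {i j : ℕ} {U V : Submodule (A p k n) H}

theorem sat (hU : E.IsSlopeSub ψ i U) {x : H} (hx : (p : A p k n) • x ∈ U) : x ∈ U := by
  have hx' : x ∈ U ⊔ E.Fil (i + 1) := hU.compl.sup_eq_top ▸ Submodule.mem_top
  obtain ⟨u, hu, z, hz, rfl⟩ := Submodule.mem_sup.1 hx'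
  rw [smul_add, Submodule.add_mem_iff_right _ (U.smul_mem _ hu)] at hx
  have h1 := Submodule.disjoint_def.1 hU.compl.disjoint _ hx (Submodule.smul_mem _ _ hz)
  have h2 : z = 0 := smul_p_injective E.toCrystal 1 (by rw [pow_one, h1, smul_zero])
  rwa [h2, add_zero]

theorem sat_pow (hU : E.IsSlopeSub ψ i U) {r s : ℕ} {x : H}
    (hx : (p : A p k n) ^ r • x ∈ U ⊔ pPow p k n H (r + s)) : x ∈ U ⊔ pPow p k n H s := by
  obtain ⟨u, hu, z, hz, huz⟩ := Submodule.mem_sup.1 hx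
  obtain ⟨z, rfl⟩ := mem_pPow.1 hz
  have h1 : (p : A p k n) ^ r • (x - (p : A p k n) ^ s • z) ∈ U := by
    rw [smul_sub, smul_smul, ← pow_add, ← huz, add_sub_cancel_right]
    exact hu
  have h2 : ∀ (r : ℕ) (y : H), (p : A p k n) ^ r • y ∈ U → y ∈ U := by
    intro r
    induction r with
    | zero => simp
    | succ r ih =>
      intro y hy
      rw [pow_succ, mul_smul] at hy
      exact hU.sat (ih _ hy)
  rw [← sub_add_cancel x ((p : A p k n) ^ s • z)]
  exact Submodule.add_mem_sup (h2 r _ h1) (mem_pPow.2 ⟨z, rfl⟩)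

theorem F_mem_sup (hp : 3 < p) (hU : E.IsSlopeSub ψ i U) (hi : i ≤ 2) {s : ℕ} {x : H}
    (hx : x ∈ U ⊔ pPow p k n H s) : E.F ψ x ∈ U ⊔ pPow p k n H (s + (i + 1)) := by
  obtain ⟨u, hu, z, hz, rfl⟩ := Submodule.mem_sup.1 hx
  obtain ⟨z, rfl⟩ := mem_pPow.1 hz
  have hz' : z ∈ U ⊔ E.Fil (i + 1) := hU.compl.sup_eq_top ▸ Submodule.mem_top
  obtain ⟨y, hy, z, hz₁, rfl⟩ := Submodule.mem_sup.1 hz'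
  have h1 : E.F ψ (u + (p : A p k n) ^ s • (y + z)) =
      (E.F ψ u + (p : A p k n) ^ s • E.F ψ y) + (p : A p k n) ^ s • E.F ψ z := by
    rw [map_add, map_smulₛₗ, map_add, smul_add, map_pow, map_natCast, ← add_assoc]
  have h2 : E.F ψ z ∈ pPow p k n H (i + 1) := E.F_mem hp E.divisible ψ (by omega) hz₁
  rw [h1]
  exact Submodule.add_mem_sup (U.add_mem (hU.F_mem _ hu) (U.smul_mem _ (hU.F_mem _ hy)))
    (smul_mem_pPow dvd_rfl h2)

/-- A map from slopes `≤ i` to slopes `> j`, with `i ≤ j`, vanishes. -/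
theorem mem_of_semilinear (hp : 3 < p) (hU : E.IsSlopeSub ψ i U) (hV : E.IsSlopeSub ψ j V)
    (hij : i ≤ j) (hj : j ≤ 2) (g : AddMonoid.End H) (hsmul : ∀ a : A p k n, ∀ x ∈ U, g (a • x) - a • g x ∈ V)
    (hF : ∀ x ∈ U, ∃ a : A p k n, g (E.F ψ x) - a • E.F ψ (g x) ∈ V) {x : H} (hx : x ∈ U) :
    g x ∈ V := by
  have := E.finite
  refine mem_closure_iff_aux fun s => ?_
  suffices h : ∀ x ∈ U, g x ∈ V ⊔ pPow p k n H s from h x hx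
  have hsmul' : ∀ (s : ℕ) (a : A p k n), ∀ x ∈ U, g x ∈ V ⊔ pPow p k n H s →
      g (a • x) ∈ V ⊔ pPow p k n H s := fun s a x hx h => by
    rw [← sub_add_cancel (g (a • x)) (a • g x)]
    exact add_mem (Submodule.mem_sup_left (hsmul a x hx)) (Submodule.smul_mem _ _ h)
  induction s with
  | zero => exact fun x _ => Submodule.mem_sup_right (mem_pPow_zero _)
  | succ s ih =>
    intro x hx
    -- Passing through `p^i x ∈ span F(U)` costs `p^i`, while Frobenius modulo `V` gains `p^(j+1)`.
    -- As `i ≤ j`, each round improves the precision by at least one power of `p`.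
    have h1 : ∀ y ∈ Submodule.span (A p k n) (E.F ψ '' U),
        y ∈ U ∧ g y ∈ V ⊔ pPow p k n H (s + (j + 1)) := by
      intro y hy
      induction hy using Submodule.span_induction with
      | mem y hy =>
        obtain ⟨z, hz, rfl⟩ := hy
        refine ⟨hU.F_mem z hz, ?_⟩
        obtain ⟨a, ha⟩ := hF z hz
        rw [← sub_add_cancel (g (E.F ψ z)) (a • E.F ψ (g z))]
        exact add_mem (Submodule.mem_sup_left ha)
          (Submodule.smul_mem _ _ (hV.F_mem_sup hp hj (ih z hz)))
      | zero => exact ⟨zero_mem _, by rw [map_zero]; exact zero_mem _⟩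
      | add y z _ _ hy hz => exact ⟨add_mem hy.1 hz.1, by rw [map_add]; exact add_mem hy.2 hz.2⟩
      | smul a y _ hy => exact ⟨U.smul_mem a hy.1, hsmul' _ a y hy.1 hy.2⟩
    have h2 := (h1 _ (hU.pow_mem x hx)).2
    have h3 : (p : A p k n) ^ i • g x ∈ V ⊔ pPow p k n H (i + (s + 1)) := by
      rw [← neg_mem_iff, ← sub_add_cancel (-((p : A p k n) ^ i • g x)) (- g ((p : A p k n) ^ i • x)),
        neg_sub_neg]
      have h4 : pPow p k n H (s + (j + 1)) ≤ pPow p k n H (i + (s + 1)) := pPow_anti (by omega)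
      exact add_mem (Submodule.mem_sup_left (hsmul _ x hx)) (neg_mem (sup_le_sup_left h4 V h2))
    exact hV.sat_pow h3

theorem le (hp : 3 < p) (hU : E.IsSlopeSub ψ i U) (hV : E.IsSlopeSub ψ j V) (hij : i ≤ j)
    (hj : j ≤ 2) : U ≤ V := fun x hx =>
  hU.mem_of_semilinear hp hV hij hj 1 (fun a x _ => by simp) (fun x _ => ⟨1, by simp⟩) hx

theorem D_mem (hp : 3 < p) (hU : E.IsSlopeSub (FrobLift.std p k n) i U) (hi : i ≤ 2) (l : Fin n)
    {x : H} (hx : x ∈ U) : E.D l x ∈ U := by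
  refine hU.mem_of_semilinear hp hU le_rfl hi (E.D l) (fun a x hx => ?_) (fun x _ => ?_) hx
  · rw [E.leibniz, add_sub_cancel_right]
    exact U.smul_mem _ hx
  · have h1 : ∀ m, (FrobLift.std p k n).toRingHom (MvPowerSeries.X m) = MvPowerSeries.X m ^ p :=
      fun m => by rw [FrobLift.std_apply, frobSeries_X]
    refine ⟨MvPowerSeries.pderiv (W p k) l (MvPowerSeries.X l ^ p), ?_⟩
    rw [E.horizontal, Finset.sum_eq_single l, h1, sub_self]
    · exact zero_mem _
    · intro m _ hm
      rw [h1, Derivation.leibniz_pow, MvPowerSeries.pderiv_X_of_ne hm, smul_zero, smul_zero,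
        zero_smul]
    · simp

theorem F_mem_all (hp : 3 < p) (hU : E.IsSlopeSub (FrobLift.std p k n) i U) (hi : i ≤ 2)
    (φ : FrobLift p k n) {x : H} (hx : x ∈ U) : E.F φ x ∈ U :=
  E.F_mem_of_stable (fun l _ hx => hU.D_mem hp hi l hx) hU.F_mem hx

theorem form_eq_zero (hU : E.IsSlopeSub ψ i U) (hV : E.IsSlopeSub ψ j V) (hij : i + j < 3)
    {x y : H} (hx : x ∈ U) (hy : y ∈ V) : E.form x y = 0 := by
  refine A_eq_zero_of_forall_dvd fun s => ?_
  suffices h : ∀ x ∈ U, ∀ y ∈ V, (p : A p k n) ^ s ∣ E.form x y from h x hx y hy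
  induction s with
  | zero => exact fun x _ y _ => by rw [pow_zero]; exact one_dvd _
  | succ s ih =>
    have h1 : ∀ x ∈ U, ∀ y ∈ V, (p : A p k n) ^ (3 + s) ∣ E.form (E.F ψ x) (E.F ψ y) := by
      intro x hx y hy
      rw [E.form_F, pow_add]
      obtain ⟨c, hc⟩ := ih x hx y hy
      rw [hc, map_mul, map_pow, map_natCast]
      exact mul_dvd_mul_left _ (dvd_mul_right _ _)
    have h2 : ∀ x ∈ U, ∀ z ∈ Submodule.span (A p k n) (E.F ψ '' V),
        (p : A p k n) ^ (3 + s) ∣ E.form (E.F ψ x) z := by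
      intro x hx z hz
      induction hz using Submodule.span_induction with
      | mem z hz =>
        obtain ⟨y, hy, rfl⟩ := hz
        exact h1 x hx y hy
      | zero => rw [map_zero]; exact dvd_zero _
      | add y z _ _ hy hz => rw [map_add]; exact dvd_add hy hz
      | smul a y _ hy => rw [map_smul, smul_eq_mul]; exact hy.mul_left _
    have h3 : ∀ w ∈ Submodule.span (A p k n) (E.F ψ '' U), ∀ z ∈ Submodule.span (A p k n) (E.F ψ '' V),
        (p : A p k n) ^ (3 + s) ∣ E.form w z := by
      intro w hw z hz
      induction hw using Submodule.span_induction with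
      | mem w hw =>
        obtain ⟨y, hy, rfl⟩ := hw
        exact h2 y hy z hz
      | zero => rw [map_zero, LinearMap.zero_apply]; exact dvd_zero _
      | add y z _ _ hy hz => rw [map_add, LinearMap.add_apply]; exact dvd_add hy hz
      | smul a y _ hy => rw [map_smul, LinearMap.smul_apply, smul_eq_mul]; exact hy.mul_left _
    intro x hx y hy
    have h4 := h3 _ (hU.pow_mem x hx) _ (hV.pow_mem y hy)
    rw [map_smul, map_smul, LinearMap.smul_apply, smul_smul, smul_eq_mul, ← pow_add,
      show 3 + s = (j + i) + (2 - (i + j) + (s + 1)) by omega, pow_add,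
      mul_dvd_mul_iff_left (pow_ne_zero _ p_ne_zero_A)] at h4
    exact (pow_dvd_pow _ (by omega)).trans h4

end IsSlopeSub

/-! ### Existence -/

variable {f : Module.Basis (Idx n) (A p k n) H}

/-- The Frobenius of the basis, divided by the power of `p` prescribed by the degree. -/
theorem IsAdapted.exists_div (hf : E.IsAdapted f) (hp : 3 < p) (ψ : FrobLift p k n) :
    ∃ Q : Idx n → H, (∀ a, E.F ψ (f a) = (p : A p k n) ^ a.deg • Q a) ∧
      ∀ a b : Idx n, 3 ≤ a.deg + b.deg → E.form (Q a) (Q b) = CY3.gram (A p k n) n a b := by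
  have h1 : ∀ a, E.F ψ (f a) ∈ pPow p k n H a.deg := fun a =>
    E.F_mem hp E.divisible ψ (by rcases a with (_ | _ | _ | _) <;> simp [Idx.deg]) (hf.mem a)
  choose Q hQ using fun a => mem_pPow.1 (h1 a)
  refine ⟨Q, fun a => (hQ a).symm, fun a b hab => ?_⟩
  have h2 := E.form_F ψ (f a) (f b)
  rw [← hQ, ← hQ, map_smul, map_smul, LinearMap.smul_apply, smul_smul, smul_eq_mul, ← pow_add,
    hf.gram a b hab, show b.deg + a.deg = 3 + (a.deg + b.deg - 3) by omega, pow_add, mul_assoc] at h2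
  have h3 := mul_left_cancel₀ (pow_ne_zero _ p_ne_zero_A) h2
  have h4 : ψ.toRingHom (CY3.gram (A p k n) n a b) = CY3.gram (A p k n) n a b := by
    rcases a with (_ | _ | _ | _) <;> rcases b with (_ | _ | _ | _) <;>
      simp [CY3.gram, apply_ite]
  have h5 : a.deg + b.deg = 3 ∨ CY3.gram (A p k n) n a b = 0 := by
    rcases a with (_ | _ | _ | _) <;> rcases b with (_ | _ | _ | _) <;> simp [CY3.gram, Idx.deg]
  rcases h5 with h5 | h5
  · rwa [h5, Nat.sub_self, pow_zero, one_mul, h4] at h3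
  · rw [h5, map_zero] at h3
    rw [h5]
    exact (mul_eq_zero.1 h3).resolve_left (pow_ne_zero _ p_ne_zero_A)

/-- By ordinarity each `f c` is congruent modulo `Fil^(i+1) + pH` to some `y` with `p^i y` in the
image of Frobenius. The triangular Gram matrix of the `Q b` allows division by `p^i` in coordinates,
so `y` is a combination of the `Q b`. This gives a right inverse of the leading block modulo `p`. -/
theorem IsAdapted.isUnit_leading (hf : E.IsAdapted f) (hp : 3 < p)
    (hKS : Function.Bijective E.kodairaSpencer) {Q : Idx n → H}
    (hQ : ∀ a, E.F ψ (f a) = (p : A p k n) ^ a.deg • Q a)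
    (hQg : ∀ a b : Idx n, 3 ≤ a.deg + b.deg → E.form (Q a) (Q b) = CY3.gram (A p k n) n a b)
    {i : ℕ} (hi : i ≤ 2) :
    IsUnit (Matrix.of fun a b : {a : Idx n // a.deg ≤ i} => f.repr (Q b) a).det := by
  have h1 : ∀ c : Idx n, ∃ α : {a : Idx n // a.deg ≤ i} → A p k n,
      f c - ∑ b, α b • Q b ∈ E.Fil (i + 1) ⊔ pPow p k n H 1 := by
    intro c
    have hc : Submodule.mkQ (pPow p k n H 1) (f c) ∈ E.conjFil ψ i ⊔ red (E.Fil (i + 1)) := by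
      rw [hf.conjFil_sup hp hKS ψ hi]
      trivial
    obtain ⟨_, ⟨y, hy, rfl⟩, _, ⟨z, hz, rfl⟩, hyz⟩ := Submodule.mem_sup.1 hc
    rw [← map_add, Submodule.mkQ_apply, Submodule.mkQ_apply, eq_comm, Submodule.Quotient.eq] at hyz
    replace hy : (p : A p k n) ^ i • y ∈ Submodule.span (A p k n) (Set.range (E.F ψ)) := hy
    have h2 : Submodule.span (A p k n) (Set.range (E.F ψ)) ≤
        Submodule.span (A p k n) (Set.range fun b => E.F ψ (f b)) := by
      rw [Submodule.span_le]
      rintro _ ⟨x, rfl⟩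
      rw [← f.sum_repr x, map_sum]
      refine sum_mem fun b _ => ?_
      rw [map_smulₛₗ]
      exact Submodule.smul_mem _ _ (Submodule.subset_span ⟨b, rfl⟩)
    obtain ⟨β, hβ⟩ := (Submodule.mem_span_range_iff_exists_fun _).1 (h2 hy)
    simp only [hQ, smul_smul] at hβ
    have h3 : ∀ b, (p : A p k n) ^ i ∣ β b * (p : A p k n) ^ b.deg := fun b =>
      dvd_coeff_of_gram (f := Q) hQg (c := fun b => β b * (p : A p k n) ^ b.deg) (m := 0)
        (fun b _ => by
          rw [hβ, map_smul, LinearMap.smul_apply, smul_eq_mul]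
          exact dvd_mul_right _ _) b
        (by rcases b with (_ | _ | _ | _) <;> simp [Idx.deg])
    choose α hα using h3
    have hy' : y = ∑ b, α b • Q b := by
      refine smul_p_injective E.toCrystal i ?_
      rw [← hβ, Finset.smul_sum]
      exact Finset.sum_congr rfl fun b _ => by rw [hα, mul_smul]
    have hα' : ∀ b : Idx n, ¬ b.deg ≤ i → (p : A p k n) ∣ α b := fun b hb => by
      have h4 := hα b
      rw [show b.deg = i + (1 + (b.deg - i - 1)) by omega, pow_add, mul_left_comm] at h4
      rw [← mul_left_cancel₀ (pow_ne_zero _ p_ne_zero_A) h4, pow_add, pow_one]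
      exact (dvd_mul_right _ _).mul_left _
    refine ⟨fun b => α b, ?_⟩
    have h5 : f c - ∑ b : {a : Idx n // a.deg ≤ i}, α b • Q b = z + ((f c - (y + z)) +
        ∑ b : {a : Idx n // ¬ a.deg ≤ i}, α b • Q b) := by
      have h6 := Fintype.sum_subtype_add_sum_subtype (fun a : Idx n => a.deg ≤ i)
        fun b => α b • Q b
      rw [← hy'] at h6
      rw [← h6]
      abel
    rw [h5]
    refine Submodule.add_mem_sup hz (add_mem hyz (sum_mem fun b _ => ?_))
    obtain ⟨e, he⟩ := hα' b b.2
    exact mem_pPow_one.2 ⟨e • Q b, by rw [smul_smul, ← he]⟩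
  choose α hα using h1
  have h2 : IsUnit ((Matrix.of fun a b : {a : Idx n // a.deg ≤ i} => f.repr (Q b) a) *
      Matrix.of fun b c : {a : Idx n // a.deg ≤ i} => α c b).det := by
    refine isUnit_det_of_dvd fun a c => ?_
    have h3 := hf.mem_fil_sup_iff.1 (hα c) a (Nat.lt_succ_of_le a.2)
    rw [← dvd_neg, neg_sub]
    convert h3 using 1
    rw [map_sub, Finsupp.sub_apply, f.repr_self, map_sum, Finsupp.finsetSum_apply]
    simp only [Matrix.mul_apply, Matrix.of_apply, Matrix.one_apply, Finsupp.single_apply,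
      map_smul, Finsupp.smul_apply, smul_eq_mul, Subtype.ext_iff]
    congr 1
    · simp only [eq_comm]
    · exact Finset.sum_congr rfl fun b _ => mul_comm _ _
  rw [Matrix.det_mul] at h2
  exact isUnit_of_mul_isUnit_left h2

end OrdinaryCY3Crystal

end SlopeSub

end CY3

end

noncomputable section

namespace CY3

open Finset

/-! ### Existence of the part of slopes `≤ i`. -/

section SlopeExists

variable {p : ℕ} [Fact p.Prime] {k : Type v} [Field k] [CharP k p] [PerfectRing k p] {n : ℕ}
  {H : Type u} [AddCommGroup H] [Module (A p k n) H]

namespace OrdinaryCY3Crystal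

variable {E : OrdinaryCY3Crystal p k n n H} {ψ : FrobLift p k n}

variable {f : Module.Basis (Idx n) (A p k n) H}

section Graph

variable {m : Type*} [Fintype m] [DecidableEq m] {l : Type*}

theorem dvd_mul_sub_mul {ι κ lam : Type*} [Fintype κ] {P : A p k n} {X X' : Matrix ι κ (A p k n)}
    {Y Y' : Matrix κ lam (A p k n)} (hX : ∀ i j, P ∣ (X - X') i j) (hY : ∀ i j, P ∣ (Y - Y') i j)
    (i : ι) (j : lam) : P ∣ (X * Y - X' * Y') i j := by
  rw [show X * Y - X' * Y' = (X - X') * Y + X' * (Y - Y') by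
    rw [Matrix.sub_mul, Matrix.mul_sub]; abel, Matrix.add_apply, Matrix.mul_apply, Matrix.mul_apply]
  exact dvd_add (Finset.dvd_sum fun c _ => (hX i c).mul_right _)
    (Finset.dvd_sum fun c _ => (hY c j).mul_left _)

theorem dvd_inv_sub_inv {P : A p k n} {Y Y' : Matrix m m (A p k n)} (hY : IsUnit Y.det)
    (hY' : IsUnit Y'.det) (h : ∀ i j, P ∣ (Y - Y') i j) (i j : m) : P ∣ (Y⁻¹ - Y'⁻¹) i j := by
  have h1 : Y⁻¹ - Y'⁻¹ = Y⁻¹ * Y' * Y'⁻¹ - Y⁻¹ * Y * Y'⁻¹ := by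
    rw [Matrix.nonsing_inv_mul _ hY, Matrix.one_mul, Matrix.mul_assoc, Matrix.mul_nonsing_inv _ hY',
      Matrix.mul_one]
  rw [h1]
  refine dvd_mul_sub_mul (fun i j => ?_) (fun i j => by simp) i j
  refine dvd_mul_sub_mul (fun i j => by simp) (fun i j => ?_) i j
  rw [← neg_sub, Matrix.neg_apply, dvd_neg]
  exact h i j

theorem isUnit_det_of_dvd_sub {Y Y' : Matrix m m (A p k n)} (hY : IsUnit Y.det)
    (h : ∀ i j, (p : A p k n) ∣ (Y' - Y) i j) : IsUnit Y'.det := by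
  have h1 : IsUnit (Y⁻¹ * Y').det := by
    refine isUnit_det_of_dvd fun i j => ?_
    rw [← Matrix.sub_apply, ← Matrix.nonsing_inv_mul _ hY]
    exact dvd_mul_sub_mul (fun i j => by simp) h i j
  rw [Matrix.det_mul] at h1
  exact isUnit_of_mul_isUnit_right h1

end Graph

/-- The part of slopes `≤ i` exists: the graph transform. -/
theorem IsAdapted.exists_slopeSub (hf : E.IsAdapted f) (hp : 3 < p)
    (hKS : Function.Bijective E.kodairaSpencer) (ψ : FrobLift p k n) {i : ℕ} (hi : i ≤ 2) :
    ∃ U, E.IsSlopeSub ψ i U := by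
  classical
  obtain ⟨Q, hQ, hQg⟩ := hf.exists_div hp ψ
  have hQu := hf.isUnit_leading hp hKS hQ hQg hi
  let L := {a : Idx n // a.deg ≤ i}
  let M := {a : Idx n // ¬ a.deg ≤ i}
  -- the image of the graph of `X`
  let G : (M × L → A p k n) → L → H := fun X b =>
    Q b + ∑ a : M, ((p : A p k n) ^ (a.1.deg - b.1.deg) * ψ.toRingHom (X (a, b))) • Q a
  have hG : ∀ s X X', (∀ c, (p : A p k n) ^ s ∣ X c - X' c) → ∀ b a,
      (p : A p k n) ^ (s + 1) ∣ f.repr (G X b) a - f.repr (G X' b) a := by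
    intro s X X' h b a
    have h1 : G X b - G X' b = ∑ a : M, ((p : A p k n) ^ (a.1.deg - b.1.deg) *
        ψ.toRingHom (X (a, b) - X' (a, b))) • Q a := by
      simp only [G, map_sub, mul_sub, sub_smul, Finset.sum_sub_distrib]
      abel
    rw [← Finsupp.sub_apply, ← map_sub, h1, map_sum, Finsupp.finsetSum_apply]
    refine Finset.dvd_sum fun a' _ => ?_
    rw [map_smul, Finsupp.smul_apply, smul_eq_mul]
    refine Dvd.dvd.mul_right ?_ _
    obtain ⟨c, hc⟩ := h (a', b)
    have h2 : 1 ≤ a'.1.deg - b.1.deg := by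
      have := a'.2
      have := b.2
      omega
    rw [hc, map_mul, map_pow, map_natCast, add_comm, pow_add]
    exact mul_dvd_mul (pow_dvd_pow _ h2) (dvd_mul_right _ _)
  let Y : (M × L → A p k n) → Matrix L L (A p k n) := fun X => Matrix.of fun c b => f.repr (G X b) c
  let Z : (M × L → A p k n) → Matrix M L (A p k n) := fun X => Matrix.of fun a b => f.repr (G X b) a
  have hY0 : IsUnit (Y 0).det := by
    convert hQu using 2
    refine Matrix.ext fun c b => ?_
    change f.repr (G 0 b) c = f.repr (Q b) c
    congr 2
    simp [G]
  have hY : ∀ X, IsUnit (Y X).det := fun X =>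
    isUnit_det_of_dvd_sub hY0 fun c b => by
      have := hG 0 X 0 (fun _ => by rw [pow_zero]; exact one_dvd _) b c
      rwa [zero_add, pow_one] at this
  -- The span of the `G X b` is again a graph, that of `Z Y⁻¹`, so a Frobenius-stable graph is a
  -- fixed point of `X ↦ Z(X) Y(X)⁻¹`. The entries of `X` enter `G` with a factor `p^(deg a - deg
  -- b)` with `deg a > i ≥ deg b`; hence the map is a `p`-adic contraction.
  obtain ⟨X, hX⟩ := exists_fixed_point_A (fun X (c : M × L) => (Z X * (Y X)⁻¹) c.1 c.2)
    (fun s X X' h c => by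
      rw [← Matrix.sub_apply]
      exact dvd_mul_sub_mul (fun a b => hG s X X' h b a)
        (dvd_inv_sub_inv (hY X) (hY X') fun c b => hG s X X' h b c) c.1 c.2)
  let u : L → H := fun b => f b + ∑ a : M, X (a, b) • f a
  have hXY : ∀ a b, f.repr (G X b) (a : M).1 = ∑ c, X (a, c) * Y X c b := by
    intro a b
    have h1 : Matrix.of (fun (a : M) (c : L) => X (a, c)) * Y X = Z X := by
      have h2 : Matrix.of (fun (a : M) (c : L) => X (a, c)) = Z X * (Y X)⁻¹ :=
        Matrix.ext fun a c => (congrFun hX (a, c)).symm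
      rw [h2, Matrix.mul_assoc, Matrix.nonsing_inv_mul _ (hY X), Matrix.mul_one]
    exact (congrFun (congrFun h1 a) b).symm
  have hGu : ∀ b, G X b = ∑ c, Y X c b • u c := by
    intro b
    have h1 := Fintype.sum_subtype_add_sum_subtype (fun a : Idx n => a.deg ≤ i)
        fun a => f.repr (G X b) a • f a
    rw [f.sum_repr] at h1
    rw [← h1]
    simp only [u, smul_add, Finset.sum_add_distrib, Finset.smul_sum, hXY, Finset.sum_smul, smul_smul]
    congr 1
    rw [Finset.sum_comm]
    exact Finset.sum_congr rfl fun _ _ => Finset.sum_congr rfl fun _ _ => by rw [mul_comm]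
  have hFu : ∀ b, E.F ψ (u b) = (p : A p k n) ^ b.1.deg • G X b := by
    intro b
    simp only [u, G, map_add, map_sum, map_smulₛₗ, hQ, smul_add, Finset.smul_sum, smul_smul]
    congr 1
    refine Finset.sum_congr rfl fun a _ => ?_
    congr 1
    rw [← mul_assoc, ← pow_add, mul_comm]
    congr 2
    have := a.2
    have := b.2
    omega
  let U := Submodule.span (A p k n) (Set.range u)
  have hGU : ∀ b, G X b ∈ U := fun b => by
    rw [hGu]
    exact sum_mem fun c _ => Submodule.smul_mem _ _ (Submodule.subset_span ⟨c, rfl⟩)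
  have huG : ∀ c, u c = ∑ b, (Y X)⁻¹ b c • G X b := by
    intro c
    simp only [hGu, Finset.smul_sum, smul_smul]
    rw [Finset.sum_comm]
    simp only [← Finset.sum_smul]
    have h1 := Matrix.mul_nonsing_inv _ (hY X)
    have h2 : ∀ d, ∑ b, (Y X)⁻¹ b c * Y X d b = (1 : Matrix L L (A p k n)) d c := fun d => by
      rw [← h1, Matrix.mul_apply]
      exact Finset.sum_congr rfl fun _ _ => mul_comm _ _
    simp only [h2]
    rw [Finset.sum_eq_single c (fun b _ hb => by rw [Matrix.one_apply_ne hb, zero_smul]) (by simp),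
      Matrix.one_apply_eq, one_smul]
  have hfM : ∀ a : M, f a ∈ E.Fil (i + 1) := fun a =>
    antitone_nat_of_succ_le E.fil_anti (not_le.1 a.2) (hf.mem a)
  have hrepr : ∀ (c : L → A p k n) (a : L), f.repr (∑ b, c b • u b) a = c a := by
    intro c a
    rw [map_sum, Finsupp.finsetSum_apply, Finset.sum_eq_single a]
    · have h1 : ∑ a' : M, f.repr (X (a', a) • f a') a = 0 := Finset.sum_eq_zero fun a' _ => by
        rw [map_smul, f.repr_self, Finsupp.smul_apply, Finsupp.single_eq_of_ne, smul_zero]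
        intro h
        exact a'.2 (h ▸ a.2)
      simp only [u, map_smul, map_add, map_sum, Finsupp.smul_apply, Finsupp.add_apply,
        Finsupp.finsetSum_apply] at h1 ⊢
      rw [h1, f.repr_self, Finsupp.single_eq_same, add_zero, smul_eq_mul, mul_one]
    · intro b _ hb
      have h1 : ∑ a' : M, f.repr (X (a', b) • f a') a = 0 := Finset.sum_eq_zero fun a' _ => by
        rw [map_smul, f.repr_self, Finsupp.smul_apply, Finsupp.single_eq_of_ne, smul_zero]
        intro h
        exact a'.2 (h ▸ a.2)
      simp only [u, map_smul, map_add, map_sum, Finsupp.smul_apply, Finsupp.add_apply,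
        Finsupp.finsetSum_apply] at h1 ⊢
      rw [h1, f.repr_self, Finsupp.single_eq_of_ne, add_zero, smul_zero]
      exact fun h => hb (Subtype.ext h.symm)
    · simp
  refine ⟨U, fun x hx => ?_, fun x hx => ?_, ?_⟩
  · obtain ⟨c, rfl⟩ := (Submodule.mem_span_range_iff_exists_fun _).1 hx
    rw [map_sum]
    refine sum_mem fun b _ => ?_
    rw [map_smulₛₗ, hFu]
    exact U.smul_mem _ (U.smul_mem _ (hGU b))
  · obtain ⟨c, rfl⟩ := (Submodule.mem_span_range_iff_exists_fun _).1 hx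
    rw [Finset.smul_sum]
    refine sum_mem fun d _ => ?_
    rw [smul_comm, huG, Finset.smul_sum]
    refine Submodule.smul_mem _ _ (sum_mem fun b _ => ?_)
    rw [smul_comm]
    refine Submodule.smul_mem _ _ ?_
    rw [show i = (i - b.1.deg) + b.1.deg from (Nat.sub_add_cancel b.2).symm, pow_add, mul_smul, ← hFu]
    exact Submodule.smul_mem _ _ (Submodule.subset_span ⟨u b, Submodule.subset_span ⟨b, rfl⟩, rfl⟩)
  · refine ⟨Submodule.disjoint_def.2 fun x hx hx' => ?_, codisjoint_iff.2 (eq_top_iff.2 ?_)⟩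
    · obtain ⟨c, rfl⟩ := (Submodule.mem_span_range_iff_exists_fun _).1 hx
      refine Finset.sum_eq_zero fun b _ => ?_
      rw [← hrepr c b, (hf.fil (i + 1) _).1 hx' b (Nat.lt_succ_of_le b.2), zero_smul]
    · intro x _
      rw [← f.sum_repr x]
      refine sum_mem fun a _ => Submodule.smul_mem _ _ ?_
      by_cases ha : a.deg ≤ i
      · have h1 : f a = u ⟨a, ha⟩ + - ∑ a' : M, X (a', ⟨a, ha⟩) • f a' := by
          simp only [u]
          abel
        rw [h1]
        exact Submodule.add_mem_sup (Submodule.subset_span ⟨_, rfl⟩)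
          (neg_mem (sum_mem fun a' _ => Submodule.smul_mem _ _ (hfM a')))
      · exact Submodule.mem_sup_right (hfM ⟨a, ha⟩)

end OrdinaryCY3Crystal

end SlopeExists

end CY3

end

noncomputable section

namespace CY3

open Finset

/-! ### The slope flag and bases adapted to both filtrations. -/

section Flag

variable {p : ℕ} [Fact p.Prime] {k : Type v} [Field k] [CharP k p] [PerfectRing k p] {n : ℕ}
  {H : Type u} [AddCommGroup H] [Module (A p k n) H]

theorem Idx.deg_le_three (a : Idx n) : a.deg ≤ 3 := by
  rcases a with (_ | _ | _ | _) <;> simp [Idx.deg]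

namespace OrdinaryCY3Crystal

variable {E : OrdinaryCY3Crystal p k n n H}

theorem fil_le {i j : ℕ} (h : i ≤ j) : E.Fil j ≤ E.Fil i := antitone_nat_of_succ_le E.fil_anti h

theorem fil_eq_bot {i : ℕ} (h : 4 ≤ i) : E.Fil i = ⊥ :=
  eq_bot_iff.2 (E.fil_four ▸ fil_le h)

theorem form_fil {i j : ℕ} (h : 3 < i + j) {x y : H} (hx : x ∈ E.Fil i) (hy : y ∈ E.Fil j) :
    E.form x y = 0 := by
  have h1 : ∀ i j, 3 < i + j → i ≤ j → ∀ x ∈ E.Fil i, ∀ y ∈ E.Fil j, E.form x y = 0 := by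
    intro i j h hij x hx y hy
    rcases lt_or_ge 3 j with hj | hj
    · rw [fil_eq_bot hj, Submodule.mem_bot] at hy
      rw [hy, map_zero]
    rcases eq_or_ne j 2 with rfl | hj2
    · exact (E.riemann_two x).1 (fil_le (by omega) hx) y hy
    · obtain rfl : j = 3 := by omega
      exact (E.riemann_three x).1 (fil_le (by omega) hx) y hy
  rcases le_total i j with hij | hij
  · exact h1 i j h hij x hx y hy
  · rw [E.form_swap, h1 j i (by omega) hij y hy x hx, neg_zero]

variable (E) in
/-- A filtration with the properties of the slope filtration, except those of its graded pieces. -/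
structure IsSlopeFlag (U : ℕ → Submodule (A p k n) H) : Prop where
  mono : ∀ i j, i ≤ j → U i ≤ U j
  D_mem : ∀ i j, ∀ x ∈ U i, E.D j x ∈ U i
  F_mem : ∀ i φ, ∀ x ∈ U i, E.F φ x ∈ U i
  compl : ∀ i, IsCompl (U i) (E.Fil (i + 1))
  form_eq_zero : ∀ i j, i + j < 3 → ∀ x ∈ U i, ∀ y ∈ U j, E.form x y = 0

theorem exists_isSlopeFlag (hp : 3 < p) (hKS : Function.Bijective E.kodairaSpencer) :
    ∃ U, E.IsSlopeFlag U := by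
  obtain ⟨f, hf⟩ := exists_isAdapted hp hKS
  choose! V hV using fun i (hi : i ≤ 2) => hf.exists_slopeSub hp hKS (FrobLift.std p k n) hi
  -- From `i = 3` on the flag is all of `H`, complementary to `Fil^(i+1) = 0`.
  let U : ℕ → Submodule (A p k n) H := fun i => if i ≤ 2 then V i else ⊤
  have hU : ∀ i, i ≤ 2 → U i = V i := fun i hi => if_pos hi
  have hU' : ∀ i, ¬ i ≤ 2 → U i = ⊤ := fun i hi => if_neg hi
  refine ⟨U, fun i j hij => ?_, fun i j x hx => ?_, fun i φ x hx => ?_, fun i => ?_,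
    fun i j hij x hx y hy => ?_⟩
  · by_cases hj : j ≤ 2
    · rw [hU j hj, hU i (hij.trans hj)]
      exact (hV i (hij.trans hj)).le hp (hV j hj) hij hj
    · rw [hU' j hj]
      exact le_top
  · by_cases hi : i ≤ 2
    · rw [hU i hi] at hx ⊢
      exact (hV i hi).D_mem hp hi j hx
    · rw [hU' i hi]
      trivial
  · by_cases hi : i ≤ 2
    · rw [hU i hi] at hx ⊢
      exact (hV i hi).F_mem_all hp hi φ hx
    · rw [hU' i hi]
      trivial
  · by_cases hi : i ≤ 2
    · rw [hU i hi]
      exact (hV i hi).compl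
    · rw [hU' i hi, fil_eq_bot (by omega)]
      exact isCompl_top_bot
  · rw [hU i (by omega)] at hx
    rw [hU j (by omega)] at hy
    exact (hV i (by omega)).form_eq_zero (hV j (by omega)) hij hx hy

variable (E) in
/-- A basis adapted to the Hodge and slope filtrations and to the form. -/
structure IsBigraded (U : ℕ → Submodule (A p k n) H) (u : Module.Basis (Idx n) (A p k n) H) :
    Prop where
  slope : ∀ i x, x ∈ U i ↔ ∀ a : Idx n, i < a.deg → u.repr x a = 0
  fil : ∀ i x, x ∈ E.Fil i ↔ ∀ a : Idx n, a.deg < i → u.repr x a = 0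
  gram : ∀ a b, E.form (u a) (u b) = CY3.gram (A p k n) n a b

theorem linearIndependent_of_gram {u : Idx n → H}
    (hu : ∀ a b, E.form (u a) (u b) = CY3.gram (A p k n) n a b) : LinearIndependent (A p k n) u := by
  rw [Fintype.linearIndependent_iff]
  intro c hc a
  exact zero_dvd_iff.1 (dvd_coeff_of_gram (E := E) (f := u) (fun a b _ => hu a b) (m := 0)
    (fun b _ => by rw [hc, map_zero, LinearMap.zero_apply]) a a.deg_le_three)

theorem mem_of_repr_eq_zero {u : Module.Basis (Idx n) (A p k n) H} {P : Idx n → Prop}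
    {N : Submodule (A p k n) H} (hN : ∀ a, ¬ P a → u a ∈ N) {x : H}
    (hx : ∀ a, P a → u.repr x a = 0) : x ∈ N := by
  rw [← u.sum_repr x]
  refine sum_mem fun a _ => ?_
  by_cases ha : P a
  · rw [hx a ha, zero_smul]
    exact zero_mem _
  · exact N.smul_mem _ (hN a ha)

/-- Cutting an expansion at degree `i` is the decomposition `H = U_i ⊕ Fil^(i+1)`. Uniqueness of
this decomposition lets membership in either filtration be read off the coordinates. -/
theorem IsSlopeFlag.exists_isBigraded {U : ℕ → Submodule (A p k n) H} (hU : E.IsSlopeFlag U)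
    {u : Idx n → H} (hmem : ∀ a, u a ∈ U a.deg ⊓ E.Fil a.deg)
    (hgram : ∀ a b, E.form (u a) (u b) = CY3.gram (A p k n) n a b)
    (hspan : ⊤ ≤ Submodule.span (A p k n) (Set.range u)) :
    ∃ b : Module.Basis (Idx n) (A p k n) H, (∀ a, b a = u a) ∧ E.IsBigraded U b := by
  classical
  let b := Module.Basis.mk (linearIndependent_of_gram hgram) hspan
  have hb : ∀ a, b a = u a := Module.Basis.mk_apply (linearIndependent_of_gram hgram) hspan
  have key : ∀ i x, x = (∑ a : Idx n, if a.deg < i then b.repr x a • b a else 0) +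
      ∑ a : Idx n, if a.deg < i then 0 else b.repr x a • b a := fun i x => by
    rw [← Finset.sum_add_distrib]
    conv_lhs => rw [← b.sum_repr x]
    refine Finset.sum_congr rfl fun a _ => ?_
    split_ifs <;> simp
  have h1 : ∀ i x, (∑ a : Idx n, if a.deg < i + 1 then b.repr x a • b a else 0) ∈ U i :=
    fun i x => sum_mem fun a _ => by
      split_ifs with h
      · refine Submodule.smul_mem _ _ (hU.mono _ _ (Nat.lt_succ_iff.1 h) ?_)
        rw [hb]
        exact (hmem a).1
      · exact zero_mem _
  have h2 : ∀ i x, (∑ a : Idx n, if a.deg < i then 0 else b.repr x a • b a) ∈ E.Fil i :=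
    fun i x => sum_mem fun a _ => by
      split_ifs with h
      · exact zero_mem _
      · refine Submodule.smul_mem _ _ (fil_le (not_lt.1 h) ?_)
        rw [hb]
        exact (hmem a).2
  have hzero : ∀ (P : Idx n → Prop) [DecidablePred P] (c : Idx n → A p k n),
      (∑ a, if P a then c a • b a else 0) = 0 → ∀ a, P a → c a = 0 := by
    intro P _ c hc a ha
    have h3 : ∑ a, (if P a then c a else 0) • b a = 0 := by
      rw [← hc]
      exact Finset.sum_congr rfl fun a _ => by split_ifs <;> simp
    have := Fintype.linearIndependent_iff.1 b.linearIndependent _ h3 a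
    rwa [if_pos ha] at this
  refine ⟨b, hb, fun i x => ⟨fun hx a ha => ?_, fun hx => ?_⟩, fun i x => ⟨fun hx => ?_, fun hx => ?_⟩,
    fun a c => by rw [hb, hb, hgram]⟩
  · have h3 : (∑ a : Idx n, if a.deg < i + 1 then 0 else b.repr x a • b a) = 0 := by
      refine Submodule.disjoint_def.1 (hU.compl i).disjoint _ ?_ (h2 (i + 1) x)
      have := sub_mem hx (h1 i x)
      nth_rewrite 1 [key (i + 1) x] at this
      rwa [add_sub_cancel_left] at this
    refine hzero (fun a => ¬ a.deg < i + 1) (fun a => b.repr x a) ?_ a (by omega)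
    refine Eq.trans (Finset.sum_congr rfl fun a _ => ?_) h3
    by_cases h : a.deg < i + 1
    · rw [if_pos h, if_neg (not_not.2 h)]
    · rw [if_neg h, if_pos h]
  · refine mem_of_repr_eq_zero (u := b) (P := fun a => i < a.deg) (fun a ha => ?_) hx
    rw [hb]
    exact hU.mono _ _ (not_lt.1 ha) (hmem a).1
  · rcases i with _ | i
    · exact fun a ha => absurd ha (Nat.not_lt_zero _)
    have h3 : (∑ a : Idx n, if a.deg < i + 1 then b.repr x a • b a else 0) = 0 := by
      refine Submodule.disjoint_def.1 (hU.compl i).disjoint _ (h1 i x) ?_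
      have := sub_mem hx (h2 (i + 1) x)
      nth_rewrite 1 [key (i + 1) x] at this
      rwa [add_sub_cancel_right] at this
    exact hzero (fun a => a.deg < i + 1) (fun a => b.repr x a) h3
  · refine mem_of_repr_eq_zero (u := b) (P := fun a => a.deg < i) (fun a ha => ?_) hx
    rw [hb]
    exact fil_le (not_lt.1 ha) (hmem a).2

/-- Each adapted vector `f a` is replaced by its component `u a` in `U_(deg a)`, changing it only by
`Fil^(deg a + 1)`. Gram entries of total degree below `3` vanish by slopes, those above `3` by the
Hodge filtration, and those of degree `3` are unchanged since the corrections pair to zero. -/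
theorem IsSlopeFlag.exists_basis (hp : 3 < p) (hKS : Function.Bijective E.kodairaSpencer)
    {U : ℕ → Submodule (A p k n) H} (hU : E.IsSlopeFlag U) :
    ∃ u : Module.Basis (Idx n) (A p k n) H, E.IsBigraded U u := by
  obtain ⟨f, hf⟩ := exists_isAdapted hp hKS
  have h1 : ∀ a : Idx n, ∃ u ∈ U a.deg, f a - u ∈ E.Fil (a.deg + 1) := fun a => by
    have hx : f a ∈ U a.deg ⊔ E.Fil (a.deg + 1) := (hU.compl _).sup_eq_top ▸ Submodule.mem_top
    obtain ⟨u, hu, z, hz, hfz⟩ := Submodule.mem_sup.1 hx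
    exact ⟨u, hu, by rw [← hfz, add_sub_cancel_left]; exact hz⟩
  choose u hu huf using h1
  have hmem : ∀ a, u a ∈ U a.deg ⊓ E.Fil a.deg := fun a => ⟨hu a, by
    have := sub_mem (hf.mem a) (E.fil_anti _ (huf a))
    rwa [sub_sub_cancel] at this⟩
  have hgram : ∀ a b, E.form (u a) (u b) = CY3.gram (A p k n) n a b := by
    intro a b
    rcases lt_trichotomy (a.deg + b.deg) 3 with h | h | h
    · rw [hU.form_eq_zero _ _ h _ (hu a) _ (hu b)]
      rcases a with (_ | _ | _ | _) <;> rcases b with (_ | _ | _ | _) <;>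
        simp_all [CY3.gram, Idx.deg]
    · rw [← hf.gram a b h.ge]
      have h2 := form_fil (E := E) (i := a.deg + 1) (j := b.deg) (by omega) (huf a) (hf.mem b)
      have h3 := form_fil (E := E) (i := a.deg) (j := b.deg + 1) (by omega) (hmem a).2 (huf b)
      rw [map_sub, LinearMap.sub_apply, sub_eq_zero] at h2
      rw [map_sub, sub_eq_zero] at h3
      rw [h2, h3]
    · rw [form_fil h (hmem a).2 (hmem b).2]
      rcases a with (_ | _ | _ | _) <;> rcases b with (_ | _ | _ | _) <;>
        simp_all [CY3.gram, Idx.deg]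
  have hspan : ∀ i, i ≤ 4 → E.Fil (4 - i) ≤ Submodule.span (A p k n) (Set.range u) := by
    intro i
    induction i with
    | zero =>
      intro _
      rw [fil_eq_bot le_rfl]
      exact bot_le
    | succ i ih =>
      intro hi x hx
      rw [← f.sum_repr x]
      refine sum_mem fun a _ => ?_
      have h4 := ih (by omega)
      rcases lt_trichotomy a.deg (4 - (i + 1)) with h | h | h
      · rw [(hf.fil _ _).1 hx a h, zero_smul]
        exact zero_mem _
      · refine Submodule.smul_mem _ _ ?_
        rw [← sub_add_cancel (f a) (u a)]
        refine add_mem (h4 ?_) (Submodule.subset_span ⟨a, rfl⟩)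
        have := huf a
        rwa [show a.deg + 1 = 4 - i by omega] at this
      · exact Submodule.smul_mem _ _ (h4 (fil_le (by omega) (hf.mem a)))
  have htop : ⊤ ≤ Submodule.span (A p k n) (Set.range u) := by
    have := hspan 4 le_rfl
    rwa [Nat.sub_self, E.fil_zero] at this
  obtain ⟨b, -, hb⟩ := hU.exists_isBigraded hmem hgram htop
  exact ⟨b, hb⟩

end OrdinaryCY3Crystal

end Flag

end CY3

end

noncomputable section

namespace CY3

open Finset

/-! ### Lang's theorem over an algebraically closed field. -/

section LangField

variable {p : ℕ} [Fact p.Prime] {k : Type v} [Field k] [CharP k p] [IsAlgClosed k]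

open Polynomial in
/-- The polynomials `b_0 = a_0 X^p`, `b_{i+1} = b_i^p + a_{i+1} X^p`. -/
def cyclicPoly (p : ℕ) {k : Type v} [Field k] (a : ℕ → k) : ℕ → k[X]
  | 0 => C (a 0) * X ^ p
  | i + 1 => cyclicPoly p a i ^ p + C (a (i + 1)) * X ^ p

open Polynomial in
theorem natDegree_cyclicPoly {a : ℕ → k} (ha : a 0 ≠ 0) (i : ℕ) :
    (cyclicPoly p a i).natDegree = p ^ (i + 1) := by
  have hp := (Fact.out : p.Prime).one_lt
  induction i with
  | zero => rw [cyclicPoly, natDegree_C_mul_X_pow _ _ ha, zero_add, pow_one]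
  | succ i ih =>
    have h1 : (cyclicPoly p a i ^ p).natDegree = p ^ (i + 1 + 1) := by
      rw [natDegree_pow, ih, ← pow_succ']
    rw [cyclicPoly, natDegree_add_eq_left_of_natDegree_lt, h1]
    rw [h1]
    refine (natDegree_C_mul_X_pow_le _ _).trans_lt ?_
    conv_lhs => rw [← pow_one p]
    exact Nat.pow_lt_pow_right hp (by omega)

open Polynomial in
theorem X_pow_dvd_cyclicPoly (a : ℕ → k) (i : ℕ) : X ^ p ∣ cyclicPoly p a i := by
  have hp := (Fact.out : p.Prime).one_lt
  induction i with
  | zero => exact dvd_mul_left _ _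
  | succ i ih =>
    exact dvd_add (pow_dvd_pow_of_dvd ((dvd_pow_self X (by omega)).trans ih) p) (dvd_mul_left _ _)

open Polynomial in
-- The polynomial is `X² g` with `g ≠ 0`. A root of `X g - 1` is nonzero and satisfies `c² g(c) =
-- c`.
theorem exists_eval_cyclicPoly {a : ℕ → k} (ha : a 0 ≠ 0) (i : ℕ) :
    ∃ c : k, c ≠ 0 ∧ (cyclicPoly p a i).eval c = c := by
  have hp := (Fact.out : p.Prime).two_le
  obtain ⟨g, hg⟩ := (pow_dvd_pow X hp).trans (X_pow_dvd_cyclicPoly (p := p) a i)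
  have hg0 : g ≠ 0 := by
    rintro rfl
    have := natDegree_cyclicPoly (p := p) ha i
    rw [hg, mul_zero, natDegree_zero] at this
    exact (pow_ne_zero (i + 1) (Fact.out : p.Prime).ne_zero) this.symm
  obtain ⟨c, hc⟩ := IsAlgClosed.exists_root (X * g - 1) (by
    rw [← C_1]
    refine fun h => absurd (natDegree_eq_of_degree_eq_some h) ?_
    rw [natDegree_sub_C, natDegree_X_mul hg0]
    simp)
  have h1 : c * g.eval c = 1 := by
    simpa [IsRoot, sub_eq_zero] using hc
  refine ⟨c, fun h0 => by simp [h0] at h1, ?_⟩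
  rw [hg, eval_mul, eval_pow, eval_X, pow_two, mul_assoc, h1, mul_one]

open Polynomial in
theorem exists_artinSchreier (a : k) : ∃ b : k, b ^ p - b = a := by
  have hp := (Fact.out : p.Prime).one_lt
  obtain ⟨b, hb⟩ := IsAlgClosed.exists_root (X ^ p + -(X + C a)) (by
    rw [degree_add_eq_left_of_degree_lt]
    · rw [degree_X_pow]
      exact_mod_cast (Fact.out : p.Prime).ne_zero
    · rw [degree_neg, degree_X_add_C, degree_X_pow]
      exact_mod_cast hp)
  refine ⟨b, ?_⟩
  have : b ^ p + -(b + a) = 0 := by simpa [IsRoot] using hb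
  linear_combination this

variable {V : Type*} [AddCommGroup V] [Module k V]

/-- Let `s + 1` be minimal such that `F^(s+1) x₀` is a combination `∑ a_i F^i x₀` of the earlier
iterates. Minimality, injectivity and perfectness of `k` give `a_0 ≠ 0`. For `∑ b_i F^i x₀` to be
fixed means `b_0 = a_0 b_s^p` and `b_(i+1) = b_i^p + a_(i+1) b_s^p`. All `b_i` are then polynomials
in `c = b_s`, and the condition left is that of `exists_eval_cyclicPoly`. -/
theorem exists_fixed_vector [Module.Finite k V] [Nontrivial V] (F : V →ₛₗ[frobenius k p] V)
    (hF : Function.Injective F) : ∃ x, x ≠ 0 ∧ F x = x := by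
  classical
  obtain ⟨x₀, hx₀⟩ := exists_ne (0 : V)
  let e : ℕ → V := fun i => F^[i] x₀
  have he : ∀ i, F (e i) = e (i + 1) := fun i => (Function.iterate_succ_apply' F i x₀).symm
  let P : ℕ → Prop := fun r => ∃ a : ℕ → k, e r = ∑ i ∈ range r, a i • e i
  have hP : ∃ r, P r := by
    by_contra! hno
    have hli : ∀ N, LinearIndependent k fun i : Fin N => e i := by
      intro N
      induction N with
      | zero => exact linearIndependent_empty_type
      | succ N ih =>
        refine linearIndependent_finSucc'.2 ⟨ih, fun hmem => hno N ?_⟩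
        obtain ⟨c, hc⟩ := (Submodule.mem_span_range_iff_exists_fun _).1 hmem
        refine ⟨fun i => if h : i < N then c ⟨i, h⟩ else 0, ?_⟩
        rw [Finset.sum_range]
        simpa [Fin.init] using hc.symm
    have := (hli (Module.finrank k V + 1)).fintype_card_le_finrank
    simp at this
  obtain ⟨a, ha⟩ : P (Nat.find hP) := Nat.find_spec hP
  have hmin : ∀ m < Nat.find hP, ¬ P m := fun m hm => Nat.find_min hP hm
  obtain ⟨s, hs⟩ : ∃ s, Nat.find hP = s + 1 := by
    refine Nat.exists_eq_succ_of_ne_zero fun h0 => hx₀ ?_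
    rw [h0] at ha
    simpa [e] using ha
  rw [hs] at ha hmin
  have ha0 : a 0 ≠ 0 := by
    intro h0
    refine hmin s (Nat.lt_succ_self s) ?_
    choose r hr using fun i => (frobeniusEquiv k p).surjective (a (i + 1))
    refine ⟨r, hF ?_⟩
    rw [he, ha, Finset.sum_range_succ', h0, zero_smul, add_zero, map_sum]
    refine Finset.sum_congr rfl fun i _ => ?_
    rw [map_smulₛₗ, he, ← hr]
    rfl
  obtain ⟨c, hc0, hc⟩ := exists_eval_cyclicPoly (p := p) ha0 s
  let b : ℕ → k := fun i => (cyclicPoly p a i).eval c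
  have hb0 : b 0 = a 0 * c ^ p := by simp [b, cyclicPoly]
  have hbs : ∀ i, b (i + 1) = b i ^ p + a (i + 1) * c ^ p := fun i => by simp [b, cyclicPoly]
  refine ⟨∑ i ∈ range (s + 1), b i • e i, fun h0 => ?_, ?_⟩
  · refine hmin s (Nat.lt_succ_self s) ⟨fun i => - (c⁻¹ * b i), ?_⟩
    rw [Finset.sum_range_succ, show b s = c from hc] at h0
    have h1 := congrArg (c⁻¹ • ·) (eq_neg_of_add_eq_zero_right h0)
    simp only [smul_smul, inv_mul_cancel₀ hc0, one_smul, smul_neg, Finset.smul_sum] at h1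
    rw [h1, ← Finset.sum_neg_distrib]
    simp only [neg_smul]
  · rw [map_sum, Finset.sum_range_succ]
    simp only [map_smulₛₗ, he]
    rw [show b s = c from hc, ha, Finset.sum_range_succ', Finset.sum_range_succ' (fun i => b i • e i),
      hb0, smul_add, Finset.smul_sum, ← add_assoc, ← Finset.sum_add_distrib, smul_smul, frobenius_def,
      mul_comm (c ^ p)]
    congr 1
    refine Finset.sum_congr rfl fun i _ => ?_
    rw [hbs, add_smul, smul_smul, frobenius_def, mul_comm (c ^ p)]

/-- Let `W₀` be the span of the fixed vectors. As `F(W₀) = W₀`, Frobenius is injective on the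
quotient, which, if nonzero, has a nonzero fixed vector. The map `F - 1` is onto on `W₀` by
Artin–Schreier, so a lift of this vector can be corrected to a fixed one, which would lie in `W₀`.
-/
theorem span_fixed_eq_top [Module.Finite k V] (F : V →ₛₗ[frobenius k p] V)
    (hF : Function.Injective F) : Submodule.span k {x | F x = x} = ⊤ := by
  by_contra hne
  set W₀ := Submodule.span k {x | F x = x} with hW₀
  have hstab : W₀ ≤ W₀.comap F := by
    rw [hW₀, Submodule.span_le]
    intro x hx
    change F x ∈ Submodule.span k _
    rw [show F x = x from hx]
    exact Submodule.subset_span hx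
  have hsurj : ∀ w ∈ W₀, ∃ w' ∈ W₀, F w' = w := by
    intro w hw
    induction hw using Submodule.closure_induction with
    | zero => exact ⟨0, zero_mem _, map_zero _⟩
    | add x y _ _ hx hy =>
      obtain ⟨x', hx', rfl⟩ := hx
      obtain ⟨y', hy', rfl⟩ := hy
      exact ⟨x' + y', add_mem hx' hy', map_add _ _ _⟩
    | smul_mem a x hx =>
      obtain ⟨b, rfl⟩ := (frobeniusEquiv k p).surjective a
      refine ⟨b • x, Submodule.smul_mem _ _ (Submodule.subset_span hx), ?_⟩
      rw [map_smulₛₗ, show F x = x from hx]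
      rfl
  have hAS : ∀ w ∈ W₀, ∃ w' ∈ W₀, F w' - w' = w := by
    intro w hw
    induction hw using Submodule.closure_induction with
    | zero => exact ⟨0, zero_mem _, by simp⟩
    | add x y _ _ hx hy =>
      obtain ⟨x', hx', rfl⟩ := hx
      obtain ⟨y', hy', rfl⟩ := hy
      exact ⟨x' + y', add_mem hx' hy', by rw [map_add]; abel⟩
    | smul_mem a x hx =>
      obtain ⟨b, rfl⟩ := exists_artinSchreier (p := p) a
      refine ⟨b • x, Submodule.smul_mem _ _ (Submodule.subset_span hx), ?_⟩
      rw [map_smulₛₗ, show F x = x from hx, sub_smul, frobenius_def]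
  have : Nontrivial (V ⧸ W₀) := Submodule.Quotient.nontrivial_iff.2 hne
  have hinj : Function.Injective (W₀.mapQ W₀ F hstab) := by
    rw [injective_iff_map_eq_zero]
    intro z hz
    obtain ⟨x, rfl⟩ := Submodule.Quotient.mk_surjective _ z
    rw [Submodule.mapQ_apply, Submodule.Quotient.mk_eq_zero] at hz
    obtain ⟨w, hw, hFw⟩ := hsurj _ hz
    rw [Submodule.Quotient.mk_eq_zero, ← hF hFw]
    exact hw
  obtain ⟨z, hz0, hz⟩ := exists_fixed_vector _ hinj
  obtain ⟨x, rfl⟩ := Submodule.Quotient.mk_surjective _ z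
  rw [Submodule.mapQ_apply, Submodule.Quotient.eq] at hz
  obtain ⟨w, hw, hFw⟩ := hAS _ hz
  refine hz0 ((Submodule.Quotient.mk_eq_zero _).2 ?_)
  have h1 : x - w ∈ W₀ := Submodule.subset_span (by
    change F (x - w) = x - w
    rw [map_sub]
    have : F x - x = F w - w := hFw.symm
    rw [sub_eq_sub_iff_add_eq_add] at this ⊢
    rw [this, add_comm])
  have := add_mem h1 hw
  rwa [sub_add_cancel] at this

variable {ι : Type*} [Fintype ι] [DecidableEq ι]

/-- Lang's theorem for `GL_n` over an algebraically closed field of characteristic `p`. -/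
theorem exists_lang_field (M : Matrix ι ι k) (hM : IsUnit M.det) :
    ∃ B : Matrix ι ι k, IsUnit B.det ∧ M * B.map (frobenius k p) = B := by
  let F : (ι → k) →ₛₗ[frobenius k p] (ι → k) :=
    { toFun := fun x => M.mulVec fun i => frobenius k p (x i)
      map_add' := fun x y => by
        rw [← Matrix.mulVec_add]
        congr 1
        funext i
        exact map_add _ _ _
      map_smul' := fun c x => by
        rw [← Matrix.mulVec_smul]
        congr 1
        funext i
        exact map_mul _ _ _ }
  have hF : Function.Injective F := by
    intro x y hxy
    have h1 := Matrix.mulVec_injective_iff_isUnit.2 ((Matrix.isUnit_iff_isUnit_det M).2 hM) hxy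
    exact funext fun i => frobenius_inj k p (congrFun h1 i)
  obtain ⟨b, hb, hspan, hli⟩ := exists_linearIndependent k {x : ι → k | F x = x}
  rw [span_fixed_eq_top F hF] at hspan
  let β := Module.Basis.mk hli (by rw [Subtype.range_coe, hspan])
  have : Fintype b := FiniteDimensional.fintypeBasisIndex β
  let ε : ι ≃ b := Fintype.equivOfCardEq (by
    rw [← Module.finrank_eq_card_basis β, Module.finrank_fintype_fun_eq_card])
  let B : Matrix ι ι k := Matrix.of fun i j => (ε j : ι → k) i
  refine ⟨B, ?_, ?_⟩
  · rw [← Matrix.isUnit_iff_isUnit_det, ← Matrix.linearIndependent_cols_iff_isUnit]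
    exact hli.comp ε ε.injective
  · refine Matrix.ext fun i j => ?_
    have h1 : F (ε j : ι → k) = ε j := hb (ε j).2
    exact congrFun h1 i

end LangField

/-! ### Lang's theorem over the Witt vectors. -/

section LangWitt

variable {p : ℕ} [Fact p.Prime] {k : Type v} [Field k] [CharP k p]

theorem p_dvd_iff_constantCoeff [PerfectRing k p] {w : W p k} :
    (p : W p k) ∣ w ↔ WittVector.constantCoeff w = 0 := by
  constructor
  · rintro ⟨v, rfl⟩
    rw [map_mul, map_natCast, CharP.cast_eq_zero, zero_mul]
  · intro h
    by_contra h1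
    have h2 := (isUnit_W_iff.2 h1).map (WittVector.constantCoeff (p := p) (R := k))
    rw [h] at h2
    exact not_isUnit_zero h2

theorem constantCoeff_frobenius_W (w : W p k) :
    WittVector.constantCoeff (WittVector.frobenius w) = (frobenius k p) (WittVector.constantCoeff w) :=
  WittVector.coeff_frobenius_charP p w 0

theorem constantCoeff_W_surjective (x : k) : ∃ w : W p k, WittVector.constantCoeff w = x :=
  ⟨WittVector.teichmuller p x, WittVector.teichmuller_coeff_zero p x⟩

variable [IsAlgClosed k] {ι : Type*} [Fintype ι] [DecidableEq ι]

/-- Lang's theorem for `GL_n` over the Witt vectors. -/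
theorem exists_lang_witt (M : Matrix ι ι (W p k)) (hM : IsUnit M.det) :
    ∃ B : Matrix ι ι (W p k), IsUnit B.det ∧ M * B.map WittVector.frobenius = B := by
  let c : W p k →+* k := WittVector.constantCoeff
  obtain ⟨B₁, hB₁, hMB₁⟩ := exists_lang_field (p := p) (c.mapMatrix M) (by
    rw [← RingHom.map_det]
    exact hM.map c)
  have hcσ : ∀ Y : Matrix ι ι (W p k), c.mapMatrix (Y.map WittVector.frobenius) =
      (c.mapMatrix Y).map (frobenius k p) := fun Y =>
    Matrix.ext fun i j => constantCoeff_frobenius_W (Y i j)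
  have hlift : ∀ Y : Matrix ι ι k, ∃ Z : Matrix ι ι (W p k), c.mapMatrix Z = Y := fun Y => by
    choose Z hZ using fun i j => constantCoeff_W_surjective (p := p) (Y i j)
    exact ⟨Matrix.of Z, Matrix.ext fun i j => hZ i j⟩
  have hdvd : ∀ Y : Matrix ι ι (W p k), c.mapMatrix Y = 0 → ∀ i j, (p : W p k) ∣ Y i j :=
    fun Y h i j => p_dvd_iff_constantCoeff.2 (congrFun (congrFun h i) j)
  -- A correction `p^s Z` with `Z ≡ B₁ y` is sought, where `B₁` is the solution modulo `p`. Because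
  -- `M B₁^σ = B₁`, the condition modulo `p` decouples into Artin–Schreier equations for the entries
  -- of `y`.
  have hstep : ∀ (s : ℕ) (Y : Matrix ι ι (W p k)),
      (∀ i j, (p : W p k) ^ s ∣ (M * Y.map WittVector.frobenius - Y) i j) →
      ∃ Y' : Matrix ι ι (W p k), (∀ i j, (p : W p k) ^ s ∣ Y' i j - Y i j) ∧
        ∀ i j, (p : W p k) ^ (s + 1) ∣ (M * Y'.map WittVector.frobenius - Y') i j := by
    intro s Y hY
    choose e he using hY
    have hE : M * Y.map WittVector.frobenius - Y = (p : W p k) ^ s • Matrix.of e :=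
      Matrix.ext fun i j => he i j
    choose y hy using fun i j => exists_artinSchreier (p := p)
      ((- (B₁⁻¹ * c.mapMatrix (Matrix.of e))) i j)
    have hy' : (Matrix.of y).map (frobenius k p) - Matrix.of y =
        - (B₁⁻¹ * c.mapMatrix (Matrix.of e)) := Matrix.ext fun i j => hy i j
    obtain ⟨Z, hZ⟩ := hlift (B₁ * Matrix.of y)
    have h1 : c.mapMatrix (Matrix.of e + (M * Z.map WittVector.frobenius - Z)) = 0 := by
      rw [map_add, map_sub, map_mul, hcσ, hZ, Matrix.map_mul, ← Matrix.mul_assoc, hMB₁,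
        ← Matrix.mul_sub, hy', Matrix.mul_neg, ← Matrix.mul_assoc, Matrix.mul_nonsing_inv _ hB₁,
        Matrix.one_mul, add_neg_cancel]
    refine ⟨Y + (p : W p k) ^ s • Z, fun i j => ?_, fun i j => ?_⟩
    · rw [Matrix.add_apply, add_sub_cancel_left]
      exact dvd_mul_right _ _
    · have h2 : M * (Y + (p : W p k) ^ s • Z).map WittVector.frobenius - (Y + (p : W p k) ^ s • Z) =
          (p : W p k) ^ s • (Matrix.of e + (M * Z.map WittVector.frobenius - Z)) := by
        have h3 : (Y + (p : W p k) ^ s • Z).map WittVector.frobenius =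
            Y.map WittVector.frobenius + (p : W p k) ^ s • Z.map WittVector.frobenius :=
          Matrix.ext fun i j => by
            simp [map_add, map_mul, map_pow]
        rw [h3, Matrix.mul_add, Matrix.mul_smul, smul_add, ← hE, smul_sub]
        abel
      rw [h2, pow_succ]
      exact mul_dvd_mul_left _ (hdvd _ h1 i j)
  choose! Φ hΦ hΦ' using hstep
  obtain ⟨B₀, hB₀⟩ := hlift B₁
  let S : ℕ → Matrix ι ι (W p k) := fun r => Nat.rec B₀ (fun r Y => Φ (r + 1) Y) r
  have hS : ∀ r i j, (p : W p k) ^ (r + 1) ∣ (M * (S r).map WittVector.frobenius - S r) i j := by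
    intro r
    induction r with
    | zero =>
      intro i j
      rw [zero_add, pow_one]
      refine hdvd _ ?_ i j
      change c.mapMatrix (M * B₀.map WittVector.frobenius - B₀) = 0
      rw [map_sub, map_mul, hcσ, hB₀, hMB₁, sub_self]
    | succ r ih => exact hΦ' (r + 1) (S r) ih
  choose L hL using fun i j => W_exists_limit (fun r => S r i j) fun r =>
    (pow_dvd_pow _ (Nat.le_succ r)).trans (hΦ (r + 1) (S r) (hS r) i j)
  refine ⟨Matrix.of L, ?_, ?_⟩
  · have h1 : c.mapMatrix (Matrix.of L) = B₁ := by
      rw [← hB₀]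
      refine Matrix.ext fun i j => ?_
      have h2 := hL i j 1
      have h3 : (p : W p k) ^ 1 ∣ S 1 i j - S 0 i j := hΦ 1 (S 0) (hS 0) i j
      rw [pow_one] at h2 h3
      have h4 : (p : W p k) ∣ L i j - B₀ i j := by
        have := dvd_add h2 h3
        rwa [sub_add_sub_cancel] at this
      rw [p_dvd_iff_constantCoeff, map_sub, sub_eq_zero] at h4
      exact h4
    have h2 : c (Matrix.of L).det ≠ 0 := by
      rw [RingHom.map_det, h1]
      exact hB₁.ne_zero
    rw [isUnit_W_iff, p_dvd_iff_constantCoeff]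
    exact h2
  · refine sub_eq_zero.1 (Matrix.ext fun i j => W_eq_zero_of_forall_dvd fun r => ?_)
    have h1 : (M * (Matrix.of L).map WittVector.frobenius - Matrix.of L) i j =
        (M * (S r).map WittVector.frobenius - S r) i j +
        (∑ l, M i l * WittVector.frobenius (L l j - S r l j) - (L i j - S r i j)) := by
      simp only [Matrix.sub_apply, Matrix.mul_apply, Matrix.map_apply, Matrix.of_apply, map_sub,
        mul_sub, Finset.sum_sub_distrib]
      ring
    rw [h1]
    refine dvd_add ((pow_dvd_pow _ (Nat.le_succ r)).trans (hS r i j)) (dvd_sub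
      (Finset.dvd_sum fun l _ => (p_pow_dvd_frobenius.2 (hL l j r)).mul_left _) (hL i j r))

end LangWitt

end CY3

end

noncomputable section

namespace CY3

open Finset

/-! ### Frobenius-semilinear systems over power series, solved `t`-adically. -/

section TAdic

variable {n : ℕ} {R : Type*} [CommRing R]

/-- A `t`-adic contraction of `R[[t]]^ι` has a fixed point. -/
theorem exists_fixed_point_tadic {ι : Type*}
    (Φ : (ι → MvPowerSeries (Fin n) R) → ι → MvPowerSeries (Fin n) R)
    (hΦ : ∀ N X Y, (∀ i (d : Fin n →₀ ℕ), d.degree < N →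
        MvPowerSeries.coeff d (X i) = MvPowerSeries.coeff d (Y i)) →
      ∀ i (d : Fin n →₀ ℕ), d.degree < N + 1 →
        MvPowerSeries.coeff d (Φ X i) = MvPowerSeries.coeff d (Φ Y i)) : ∃ X, Φ X = X := by
  let X : ι → MvPowerSeries (Fin n) R := fun i =>
    mkSeries fun d => MvPowerSeries.coeff d (Φ^[d.degree + 1] 0 i)
  have h1 : ∀ N i (d : Fin n →₀ ℕ), d.degree < N →
      MvPowerSeries.coeff d (Φ^[N + 1] 0 i) = MvPowerSeries.coeff d (Φ^[N] 0 i) := by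
    intro N
    induction N with
    | zero => exact fun i d hd => absurd hd (Nat.not_lt_zero _)
    | succ N ih =>
      intro i d hd
      rw [Function.iterate_succ_apply' Φ (N + 1), Function.iterate_succ_apply' Φ N]
      refine hΦ N _ _ (fun i d hd => ?_) i d hd
      rw [← ih i d hd, Function.iterate_succ_apply']
  have h2 : ∀ N i (d : Fin n →₀ ℕ), d.degree < N →
      MvPowerSeries.coeff d (X i) = MvPowerSeries.coeff d (Φ^[N] 0 i) := by
    intro N i d hd
    obtain ⟨e, rfl⟩ := Nat.exists_eq_add_of_le (Nat.succ_le_of_lt hd)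
    rw [coeff_mkSeries]
    induction e with
    | zero => rfl
    | succ e ih =>
      rw [ih (by omega), ← h1 _ i d (by omega)]
      rfl
  refine ⟨X, funext fun i => MvPowerSeries.ext fun d => ?_⟩
  rw [hΦ d.degree X (Φ^[d.degree] 0) (fun i d' hd' => h2 _ i d' hd') i d (Nat.lt_succ_self _),
    h2 (d.degree + 1) i d (Nat.lt_succ_self _), Function.iterate_succ_apply']

variable {p : ℕ} [Fact p.Prime]

/-- The standard Frobenius multiplies degrees by `p ≥ 2`, so it improves agreement below degree `N`
by at least one, provided the constant terms already agree. This is the role of `0 < N`. -/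
theorem coeff_frobSeries_congr (s : R →+* R) {N : ℕ} (hN : 0 < N) {X Y : MvPowerSeries (Fin n) R}
    (h : ∀ d : Fin n →₀ ℕ, d.degree < N → MvPowerSeries.coeff d X = MvPowerSeries.coeff d Y)
    {d : Fin n →₀ ℕ} (hd : d.degree < N + 1) :
    MvPowerSeries.coeff d (frobSeries p n s X) = MvPowerSeries.coeff d (frobSeries p n s Y) := by
  by_cases hd' : ∃ e, d = p • e
  · obtain ⟨e, rfl⟩ := hd'
    rw [coeff_frobSeries_smul, coeff_frobSeries_smul, h e]
    have hp := (Fact.out : p.Prime).two_le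
    rw [map_nsmul, smul_eq_mul] at hd
    nlinarith
  · push Not at hd'
    rw [coeff_frobSeries_eq_zero _ hd', coeff_frobSeries_eq_zero _ hd']

variable {ι : Type*} [Fintype ι]

theorem coeff_sum_mul_frobSeries_congr (s : R →+* R) (G : ι → ι → MvPowerSeries (Fin n) R) {N : ℕ}
    (hN : 0 < N) {X Y : ι → MvPowerSeries (Fin n) R}
    (h : ∀ i (d : Fin n →₀ ℕ), d.degree < N →
      MvPowerSeries.coeff d (X i) = MvPowerSeries.coeff d (Y i)) (i : ι)
    {d : Fin n →₀ ℕ} (hd : d.degree < N + 1) :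
    MvPowerSeries.coeff d (∑ j, G i j * frobSeries p n s (X j)) =
      MvPowerSeries.coeff d (∑ j, G i j * frobSeries p n s (Y j)) := by
  classical
  rw [map_sum, map_sum]
  refine Finset.sum_congr rfl fun j _ => ?_
  rw [MvPowerSeries.coeff_mul, MvPowerSeries.coeff_mul]
  refine Finset.sum_congr rfl fun x hx => ?_
  rw [coeff_frobSeries_congr s hN (h j)]
  have := congrArg Finsupp.degree (Finset.HasAntidiagonal.mem_antidiagonal.1 hx)
  rw [map_add] at this
  omega

/-- The equation `X = G ψ(X)` has a solution with prescribed admissible constant terms. -/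
theorem exists_frobSeries_fixed (s : R →+* R) (G : ι → ι → MvPowerSeries (Fin n) R) (x : ι → R)
    (hx : ∀ i, x i = ∑ j, MvPowerSeries.constantCoeff (G i j) * s (x j)) :
    ∃ X : ι → MvPowerSeries (Fin n) R, (∀ i, X i = ∑ j, G i j * frobSeries p n s (X j)) ∧
      ∀ i, MvPowerSeries.constantCoeff (X i) = x i := by
  classical
  -- The constant terms are frozen at `x`; only then is the map a contraction, as `X ↦ G ψ(X)` does
  -- not improve agreement in degree zero.
  obtain ⟨X, hX⟩ := exists_fixed_point_tadic (fun X i =>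
      (mkSeries fun d => if d = 0 then x i else
        MvPowerSeries.coeff d (∑ j, G i j * frobSeries p n s (X j)) : MvPowerSeries (Fin n) R)) (by
    intro N X Y h i d hd
    rw [coeff_mkSeries, coeff_mkSeries]
    split_ifs with hd0
    · rfl
    · have h1 : d.degree ≠ 0 := fun h0 => hd0 ((Finsupp.degree_eq_zero_iff d).1 h0)
      exact coeff_sum_mul_frobSeries_congr s G (by omega) h i hd)
  have h0 : ∀ i, MvPowerSeries.constantCoeff (X i) = x i := fun i => by
    rw [← MvPowerSeries.coeff_zero_eq_constantCoeff_apply, ← congrFun hX i, coeff_mkSeries, if_pos rfl]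
  refine ⟨X, fun i => MvPowerSeries.ext fun d => ?_, h0⟩
  by_cases hd : d = 0
  · subst hd
    rw [MvPowerSeries.coeff_zero_eq_constantCoeff_apply,
      MvPowerSeries.coeff_zero_eq_constantCoeff_apply, h0, map_sum, hx]
    exact Finset.sum_congr rfl fun j _ => by rw [map_mul, constantCoeff_frobSeries, h0]
  · conv_lhs => rw [← hX]
    rw [coeff_mkSeries, if_neg hd]

theorem eq_zero_of_frobSeries_fixed (s : R →+* R) (G : ι → ι → MvPowerSeries (Fin n) R)
    {X : ι → MvPowerSeries (Fin n) R} (hX : ∀ i, X i = ∑ j, G i j * frobSeries p n s (X j))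
    (h0 : ∀ i, MvPowerSeries.constantCoeff (X i) = 0) (i : ι) : X i = 0 := by
  have key : ∀ N i (d : Fin n →₀ ℕ), d.degree < N + 1 → MvPowerSeries.coeff d (X i) = 0 := by
    intro N
    induction N with
    | zero =>
      intro i d hd
      rw [(Finsupp.degree_eq_zero_iff d).1 (by omega)]
      exact h0 i
    | succ N ih =>
      intro i d hd
      rw [hX, coeff_sum_mul_frobSeries_congr (Y := 0) s G (Nat.succ_pos N)
        (fun i d hd => by rw [ih i d hd, Pi.zero_apply, map_zero]) i hd]
      simp
  refine MvPowerSeries.ext fun d => ?_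
  rw [map_zero]
  exact key d.degree i d (Nat.lt_succ_self _)

end TAdic

/-! ### Lang's theorem over `W[[t]]`. -/

section LangSeries

variable {p : ℕ} [Fact p.Prime] {k : Type v} [Field k] [CharP k p] [IsAlgClosed k] {n : ℕ}
  {ι : Type*} [Fintype ι] [DecidableEq ι]

/-- Lang's theorem for `GL_n` over `W[[t]]`. -/
theorem exists_lang (M : Matrix ι ι (A p k n)) (hM : IsUnit M.det) :
    ∃ B : Matrix ι ι (A p k n), IsUnit B.det ∧
      M * B.map (FrobLift.std p k n).toRingHom = B := by
  obtain ⟨B₀, hB₀, hMB₀⟩ := exists_lang_witt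
    ((MvPowerSeries.constantCoeff (σ := Fin n) (R := W p k)).mapMatrix M) (by
      rw [← RingHom.map_det]
      exact hM.map _)
  choose B hB hB0 using fun j => exists_frobSeries_fixed (p := p) (n := n)
    (WittVector.frobenius (p := p) (R := k)) (fun i l => M i l) (fun i => B₀ i j) (fun i => by
      conv_lhs => rw [← hMB₀]
      rfl)
  refine ⟨Matrix.of fun i j => B j i, ?_, Matrix.ext fun i j => (hB j i).symm⟩
  rw [MvPowerSeries.isUnit_iff_constantCoeff, RingHom.map_det]
  convert hB₀ using 2
  exact Matrix.ext fun i j => hB0 j i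

theorem exists_lang_one {c : A p k n} (hc : IsUnit c) :
    ∃ β : A p k n, IsUnit β ∧ c * (FrobLift.std p k n).toRingHom β = β := by
  obtain ⟨B, hB, h⟩ := exists_lang (Matrix.of fun _ _ : Unit => c) (by simpa using hc)
  refine ⟨B () (), by simpa using hB, ?_⟩
  have := congrFun (congrFun h ()) ()
  simpa [Matrix.mul_apply] using this

end LangSeries

/-! ### A bigraded basis on which Frobenius is standard modulo lower slopes. -/

section GoodBasis

variable {p : ℕ} [Fact p.Prime] {k : Type v} [Field k] [CharP k p] [IsAlgClosed k] {n : ℕ}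
  {H : Type u} [AddCommGroup H] [Module (A p k n) H]

namespace OrdinaryCY3Crystal

variable {E : OrdinaryCY3Crystal p k n n H} {U : ℕ → Submodule (A p k n) H}
  {u : Module.Basis (Idx n) (A p k n) H}

theorem IsBigraded.mem (hu : E.IsBigraded U u) (a : Idx n) : u a ∈ U a.deg ⊓ E.Fil a.deg := by
  constructor
  · refine (hu.slope _ _).2 fun b hb => ?_
    rw [u.repr_self, Finsupp.single_eq_of_ne]
    rintro rfl
    exact lt_irrefl _ hb
  · refine (hu.fil _ _).2 fun b hb => ?_
    rw [u.repr_self, Finsupp.single_eq_of_ne]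
    rintro rfl
    exact lt_irrefl _ hb

theorem IsBigraded.isAdapted (hu : E.IsBigraded U u) : E.IsAdapted u :=
  ⟨fun a => (hu.mem a).2, hu.fil, fun a b _ => hu.gram a b⟩

theorem IsBigraded.mem_prev_iff (hu : E.IsBigraded U u) {i : ℕ} {x : H} :
    x ∈ prev U i ↔ ∀ a : Idx n, i ≤ a.deg → u.repr x a = 0 := by
  cases i with
  | zero =>
    rw [prev, Submodule.mem_bot]
    refine ⟨fun h a _ => by rw [h, map_zero, Finsupp.zero_apply], fun h => ?_⟩
    exact (LinearEquiv.map_eq_zero_iff u.repr).1 (Finsupp.ext fun a => h a (Nat.zero_le _))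
  | succ i => exact hu.slope i x

theorem form_eq_of_gram (hg : ∀ a b, E.form (u a) (u b) = CY3.gram (A p k n) n a b) (x y : H) :
    E.form x y = - (u.repr x Idx.i0 * u.repr y Idx.i3) +
      (∑ i, u.repr x (Idx.i1 i) * u.repr y (Idx.i2 i) -
      ∑ i, u.repr x (Idx.i2 i) * u.repr y (Idx.i1 i)) +
      u.repr x Idx.i3 * u.repr y Idx.i0 := by
  have h1 : E.form x y = ∑ a, ∑ b, u.repr x a * (u.repr y b * CY3.gram (A p k n) n a b) := by
    conv_lhs => rw [← u.sum_repr x, ← u.sum_repr y]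
    simp only [map_sum, LinearMap.sum_apply, map_smul, LinearMap.smul_apply, smul_eq_mul, hg]
    conv_rhs => rw [Finset.sum_comm]
    simp only [Finset.mul_sum]
    exact Finset.sum_congr rfl fun a _ => Finset.sum_congr rfl fun b _ => mul_left_comm _ _ _
  rw [h1]
  simp only [Fintype.sum_sum_type, Finset.univ_unique, Finset.sum_singleton]
  simp [CY3.gram, Finset.sum_neg_distrib]
  ring

/-- The block diagonal matrix with blocks `β, B, B⁻ᵀ, β⁻¹`. -/
def twist {R : Type*} (β β' : R) [Zero R] (B B' : Matrix (Fin n) (Fin n) R) :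
    Matrix (Idx n) (Idx n) R
  | Sum.inl _, Sum.inl _ => β
  | Sum.inr (Sum.inl i), Sum.inr (Sum.inl j) => B i j
  | Sum.inr (Sum.inr (Sum.inl i)), Sum.inr (Sum.inr (Sum.inl j)) => B' i j
  | Sum.inr (Sum.inr (Sum.inr _)), Sum.inr (Sum.inr (Sum.inr _)) => β'
  | _, _ => 0

theorem twist_eq_zero {R : Type*} [Zero R] {β β' : R} {B B' : Matrix (Fin n) (Fin n) R} {a b : Idx n}
    (h : a.deg ≠ b.deg) : twist β β' B B' a b = 0 := by
  rcases a with (_ | _ | _ | _) <;> rcases b with (_ | _ | _ | _) <;>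
    simp_all [twist, Idx.deg]

/-- A bigraded basis on whose graded pieces the standard Frobenius is standard. -/
theorem IsSlopeFlag.exists_good_basis (hp : 3 < p) (hKS : Function.Bijective E.kodairaSpencer)
    (hU : E.IsSlopeFlag U) : ∃ e : Module.Basis (Idx n) (A p k n) H, E.IsBigraded U e ∧
      ∀ b, E.F (FrobLift.std p k n) (e b) - (p : A p k n) ^ b.deg • e b ∈ prev U b.deg := by
  obtain ⟨u, hu⟩ := hU.exists_basis hp hKS
  obtain ⟨Q, hQ, hQg⟩ := hu.isAdapted.exists_div hp (FrobLift.std p k n)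
  have hQ0 : ∀ a b : Idx n, b.deg < a.deg → u.repr (Q b) a = 0 := fun a b hab => by
    have h2 := (hu.slope b.deg _).1 (hU.F_mem _ (FrobLift.std p k n) _ (hu.mem b).1) a hab
    rw [hQ, map_smul, Finsupp.smul_apply, smul_eq_mul] at h2
    exact (mul_eq_zero.1 h2).resolve_left (pow_ne_zero _ p_ne_zero_A)
  set c₀ := u.repr (Q Idx.i0) Idx.i0 with hc₀
  set c₃ := u.repr (Q Idx.i3) Idx.i3 with hc₃
  set C₁ : Matrix (Fin n) (Fin n) (A p k n) := Matrix.of fun i j => u.repr (Q (Idx.i1 j)) (Idx.i1 i) with hC₁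
  set C₂ : Matrix (Fin n) (Fin n) (A p k n) := Matrix.of fun i j => u.repr (Q (Idx.i2 j)) (Idx.i2 i) with hC₂
  -- Compatibility of Frobenius with the form makes the diagonal blocks dual in pairs, degrees 0
  -- with 3 and 1 with 2. They are therefore invertible, and it suffices to trivialise two of them.
  have hc : c₀ * c₃ = 1 := by
    have h1 : E.form (Q Idx.i0) (Q Idx.i3) = -1 := hQg Idx.i0 Idx.i3 le_rfl
    rw [form_eq_of_gram hu.gram] at h1
    simp only [hQ0 _ Idx.i0 (show (Idx.i0 : Idx n).deg < Idx.i3.deg by simp [Idx.deg]),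
      fun i => hQ0 _ Idx.i0 (show (Idx.i0 : Idx n).deg < (Idx.i1 i).deg by simp [Idx.deg]),
      fun i => hQ0 _ Idx.i0 (show (Idx.i0 : Idx n).deg < (Idx.i2 i).deg by simp [Idx.deg]),
      zero_mul, Finset.sum_const_zero, sub_zero, add_zero] at h1
    exact neg_inj.1 h1
  have hC : C₁.transpose * C₂ = 1 := by
    refine Matrix.ext fun i j => ?_
    have h1 : E.form (Q (Idx.i1 i)) (Q (Idx.i2 j)) = if i = j then 1 else 0 :=
      hQg (Idx.i1 i) (Idx.i2 j) le_rfl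
    rw [form_eq_of_gram hu.gram] at h1
    simp only [hQ0 _ (Idx.i1 i) (show (Idx.i1 i).deg < (Idx.i3 : Idx n).deg by simp [Idx.deg]),
      hQ0 _ (Idx.i2 j) (show (Idx.i2 j).deg < (Idx.i3 : Idx n).deg by simp [Idx.deg]),
      fun l => hQ0 _ (Idx.i1 i) (show (Idx.i1 i).deg < (Idx.i2 l).deg by simp [Idx.deg]),
      mul_zero, zero_mul, Finset.sum_const_zero, sub_zero, add_zero, neg_zero, zero_add] at h1
    rw [Matrix.mul_apply, Matrix.one_apply]
    exact h1
  -- Lang's theorem trivialises the blocks of degrees 0 and 1. Using the contragredient change of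
  -- basis in degrees 2 and 3 keeps the Gram matrix and trivialises those blocks by duality.
  obtain ⟨β, ⟨β, rfl⟩, hβ⟩ := exists_lang_one (IsUnit.of_mul_eq_one _ hc)
  have hC₁u : IsUnit C₁.det := by
    rw [← Matrix.det_transpose]
    exact Matrix.isUnit_det_of_right_inverse hC
  obtain ⟨B, hB, hCB⟩ := exists_lang C₁ hC₁u
  set ψ := (FrobLift.std p k n).toRingHom with hψ
  set B' := B⁻¹.transpose with hB'
  set β' : A p k n := ((β⁻¹ : (A p k n)ˣ) : A p k n) with hβ'
  have hββ' : (β : A p k n) * β' = 1 := β.mul_inv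
  have hBB' : B.transpose * B' = 1 := by
    rw [hB', ← Matrix.transpose_mul, Matrix.nonsing_inv_mul _ hB, Matrix.transpose_one]
  have hβ'F : c₃ * ψ β' = β' := by
    have h1 : ψ β * ψ β' = 1 := by rw [← map_mul, hββ', map_one]
    calc c₃ * ψ β' = (β * β') * (c₃ * ψ β') := by rw [hββ', one_mul]
      _ = (c₀ * ψ β) * β' * (c₃ * ψ β') := by rw [hβ]
      _ = (c₀ * c₃) * (ψ β * ψ β') * β' := by ring
      _ = β' := by rw [hc, h1, one_mul, one_mul]
  have hB'F : C₂ * B'.map ψ = B' := by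
    have h1 : (B.map ψ).transpose * B'.map ψ = 1 := by
      rw [show (B.map ψ).transpose = B.transpose.map ψ from rfl, ← Matrix.map_mul, hBB',
        Matrix.map_one ψ (map_zero _) (map_one _)]
    have h2 : B'.map ψ * (B.map ψ).transpose = 1 := mul_eq_one_comm.1 h1
    have h3 : C₂ * C₁.transpose = 1 := mul_eq_one_comm.1 hC
    have h4 : B.transpose = (B.map ψ).transpose * C₁.transpose := by
      rw [← Matrix.transpose_mul, hCB]
    have h5 : C₂ * B'.map ψ * B.transpose = 1 := by
      rw [h4, Matrix.mul_assoc, ← Matrix.mul_assoc (B'.map ψ), h2, Matrix.one_mul, h3]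
    calc C₂ * B'.map ψ = C₂ * B'.map ψ * (B.transpose * B') := by rw [hBB', Matrix.mul_one]
      _ = B' := by rw [← Matrix.mul_assoc, h5, Matrix.one_mul]
  set S := twist (β : A p k n) β' B B' with hS
  let e : Idx n → H := fun b => ∑ a, S a b • u a
  have hrepr : ∀ a b, u.repr (e b) a = S a b := fun a b => by
    simp only [e]
    rw [u.repr_sum_self]
  have hmem : ∀ a, e a ∈ U a.deg ⊓ E.Fil a.deg := fun a => sum_mem fun c _ => by
    by_cases hca : c.deg = a.deg
    · rw [← hca]
      exact Submodule.smul_mem _ _ (hu.mem c)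
    · rw [hS, twist_eq_zero hca, zero_smul]
      exact zero_mem _
  have hgram : ∀ a b, E.form (e a) (e b) = CY3.gram (A p k n) n a b := by
    have hBB1 : ∀ i j, ∑ l, B l i * B' l j = if i = j then 1 else 0 := fun i j => by
      rw [← Matrix.one_apply, ← hBB', Matrix.mul_apply]
      rfl
    have hBB2 : ∀ i j, ∑ l, B' l i * B l j = if i = j then 1 else 0 := fun i j => by
      rw [← if_congr (eq_comm (a := j)) rfl rfl, ← hBB1]
      exact Finset.sum_congr rfl fun l _ => mul_comm _ _
    intro a b
    rw [form_eq_of_gram hu.gram]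
    simp only [hrepr]
    rcases a with (_ | i | i | _) <;> rcases b with (_ | j | j | _) <;>
      simp [hS, twist, CY3.gram, hββ', mul_comm β' (β : A p k n), hBB1, hBB2, apply_ite]
  have hspan : ⊤ ≤ Submodule.span (A p k n) (Set.range e) := by
    have h0 : u Idx.i0 = β' • e Idx.i0 := by
      refine u.ext_elem fun c => ?_
      rw [map_smul, Finsupp.smul_apply, hrepr, u.repr_self, smul_eq_mul]
      rcases c with (_ | i | i | _) <;>
        simp [hS, twist, mul_comm β' (β : A p k n), hββ']
    have h3 : u Idx.i3 = (β : A p k n) • e Idx.i3 := by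
      refine u.ext_elem fun c => ?_
      rw [map_smul, Finsupp.smul_apply, hrepr, u.repr_self, smul_eq_mul]
      rcases c with (_ | i | i | _) <;>
        simp [hS, twist, hββ']
    have hBB3 : ∀ i j, ∑ l, B' i l * B j l = if i = j then 1 else 0 := fun i j => by
      rw [← Matrix.one_apply, ← mul_eq_one_comm.1 hBB', Matrix.mul_apply]
      rfl
    have h1 : ∀ i, u (Idx.i1 i) = ∑ j, B' i j • e (Idx.i1 j) := fun i => by
      refine u.ext_elem fun c => ?_
      simp only [map_sum, map_smul, Finsupp.finsetSum_apply, Finsupp.smul_apply, hrepr,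
        u.repr_self, smul_eq_mul]
      rcases c with (_ | l | l | _) <;>
        simp [hS, twist, Finsupp.single_apply, hBB3]
    have h2 : ∀ i, u (Idx.i2 i) = ∑ j, B i j • e (Idx.i2 j) := fun i => by
      refine u.ext_elem fun c => ?_
      simp only [map_sum, map_smul, Finsupp.finsetSum_apply, Finsupp.smul_apply, hrepr,
        u.repr_self, smul_eq_mul]
      rcases c with (_ | l | l | _) <;>
        simp [hS, twist, Finsupp.single_apply, hBB3, mul_comm (B _ _), eq_comm]
    rw [← u.span_eq, Submodule.span_le]
    have hsub : ∀ a, e a ∈ Submodule.span (A p k n) (Set.range e) := fun a =>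
      Submodule.subset_span ⟨a, rfl⟩
    rintro _ ⟨(_ | i | i | _), rfl⟩
    · exact h0 ▸ Submodule.smul_mem _ _ (hsub _)
    · exact h1 i ▸ sum_mem fun j _ => Submodule.smul_mem _ _ (hsub _)
    · exact h2 i ▸ sum_mem fun j _ => Submodule.smul_mem _ _ (hsub _)
    · exact h3 ▸ Submodule.smul_mem _ _ (hsub _)
  obtain ⟨b, hb, hbU⟩ := hU.exists_isBigraded hmem hgram hspan
  refine ⟨b, hbU, fun a => ?_⟩
  rw [hb, hu.mem_prev_iff]
  intro c hc
  have hF : E.F (FrobLift.std p k n) (e a) = ∑ d, (ψ (S d a) * (p : A p k n) ^ d.deg) • Q d := by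
    simp only [e]
    rw [map_sum]
    refine Finset.sum_congr rfl fun d _ => ?_
    rw [LinearMap.map_smulₛₗ, hQ, smul_smul]
  rw [hF, map_sub, map_sum, Finsupp.sub_apply, Finsupp.finsetSum_apply, map_smul,
    Finsupp.smul_apply, hrepr, smul_eq_mul, sub_eq_zero]
  have hS0 : ∀ d : Idx n, d.deg ≠ a.deg → ψ (S d a) = 0 := fun d hd => by
    rw [hS, twist_eq_zero hd, map_zero]
  have h1 : ∑ d, (u.repr ((ψ (S d a) * (p : A p k n) ^ d.deg) • Q d)) c =
      (p : A p k n) ^ a.deg * ∑ d, u.repr (Q d) c * ψ (S d a) := by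
    rw [Finset.mul_sum]
    refine Finset.sum_congr rfl fun d _ => ?_
    rw [map_smul, Finsupp.smul_apply, smul_eq_mul]
    by_cases hd : d.deg = a.deg
    · rw [hd]
      ring
    · rw [hS0 d hd]
      ring
  rw [h1]
  congr 1
  rcases hc.eq_or_lt with hc | hc
  · have hCB' : ∀ i j, ∑ l, C₁ i l * ψ (B l j) = B i j := fun i j => congrFun (congrFun hCB i) j
    have hBF' : ∀ i j, ∑ l, C₂ i l * ψ (B' l j) = B' i j := fun i j => congrFun (congrFun hB'F i) j
    rcases a with (_ | i | i | _) <;> rcases c with (_ | l | l | _) <;>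
      simp only [Idx.deg, reduceCtorEq, OfNat.ofNat_ne_zero, OfNat.ofNat_ne_one, zero_ne_one,
        one_ne_zero, Nat.reduceEqDiff] at hc
    · simpa [hS, twist] using hβ
    · simpa [hS, twist, hC₁] using hCB' l i
    · simpa [hS, twist, hC₂] using hBF' l i
    · simpa [hS, twist] using hβ'F
  · rw [hS, twist_eq_zero hc.ne']
    refine Finset.sum_eq_zero fun d _ => ?_
    by_cases hd : d.deg = a.deg
    · rw [hQ0 c d (hd ▸ hc), zero_mul]
    · rw [hS0 d hd, mul_zero]

end OrdinaryCY3Crystal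

end GoodBasis

end CY3

end

noncomputable section

namespace CY3

open Finset

/-! ### Derivatives of power series and of horizontal functionals. -/

section Derivative

variable {p : ℕ} [Fact p.Prime] {n : ℕ}

theorem pderiv_frobSeries {R : Type*} [CommRing R] (s : R →+* R) (j : Fin n)
    (f : MvPowerSeries (Fin n) R) :
    MvPowerSeries.pderiv R j (frobSeries p n s f) =
      (p : MvPowerSeries (Fin n) R) * MvPowerSeries.X j ^ (p - 1) *
        frobSeries p n s (MvPowerSeries.pderiv R j f) := by
  classical
  have hp := (Fact.out : p.Prime).pos
  refine MvPowerSeries.ext fun d => ?_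
  rw [MvPowerSeries.coeff_pderiv, mul_assoc, ← map_natCast (MvPowerSeries.C (σ := Fin n) (R := R)) p,
    MvPowerSeries.coeff_C_mul, MvPowerSeries.X_pow_eq, MvPowerSeries.coeff_monomial_mul, one_mul]
  by_cases h : ∃ m, d + Finsupp.single j 1 = p • m
  · obtain ⟨m, hm⟩ := h
    have hmj : d j + 1 = p * m j := by simpa using DFunLike.congr_fun hm j
    have hm0 : 1 ≤ m j := by
      by_contra h0
      rw [Nat.lt_one_iff.1 (not_le.1 h0)] at hmj
      omega
    obtain ⟨m', rfl⟩ : ∃ m', m = m' + Finsupp.single j 1 :=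
      ⟨m - Finsupp.single j 1, (tsub_add_cancel_of_le (Finsupp.single_le_iff.2 hm0)).symm⟩
    have hd : d = p • m' + Finsupp.single j (p - 1) := by
      refine Finsupp.ext fun i => ?_
      have := DFunLike.congr_fun hm i
      by_cases hij : i = j
      · subst hij
        simp only [Finsupp.add_apply, Finsupp.smul_apply, Finsupp.single_eq_same, smul_eq_mul] at this ⊢
        rw [mul_add] at this
        omega
      · simpa [Finsupp.single_apply, Ne.symm hij] using this
    rw [hm, coeff_frobSeries_smul, if_pos (hd ▸ le_add_self), hd, add_tsub_cancel_right,
      coeff_frobSeries_smul, MvPowerSeries.coeff_pderiv]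
    have h1 : ((p • m' + Finsupp.single j (p - 1)) j : R) + 1 = p * ((m' j : R) + 1) := by
      rw [hd] at hmj
      have := congrArg (Nat.cast (R := R)) hmj
      simpa using this
    rw [h1, map_mul, map_add, map_natCast, map_one]
    ring
  · push Not at h
    rw [coeff_frobSeries_eq_zero _ h, zero_mul]
    split_ifs with hle
    · rw [coeff_frobSeries_eq_zero, mul_zero]
      intro m hm
      refine h (m + Finsupp.single j 1) ?_
      rw [smul_add, ← hm, Finsupp.smul_single, smul_eq_mul, mul_one,
        show Finsupp.single j p = Finsupp.single j (p - 1) + Finsupp.single j 1 by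
          rw [← Finsupp.single_add, Nat.sub_add_cancel hp], ← add_assoc, tsub_add_cancel_of_le hle]
    · rw [mul_zero]

variable {k : Type v} [Field k]

theorem pderiv_incl (j : Fin n) (a : A p k n) :
    MvPowerSeries.pderiv (K p k) j (incl p k n a) =
      incl p k n (MvPowerSeries.pderiv (W p k) j a) := by
  refine MvPowerSeries.ext fun d => ?_
  rw [MvPowerSeries.coeff_pderiv, coeff_incl, coeff_incl, MvPowerSeries.coeff_pderiv, map_mul,
    map_add, map_natCast, map_one]

/-- The iterated derivatives along a connection, read off on coefficients. -/
theorem coeff_Dpow {H : Type u} [AddCommGroup H] [Module (A p k n) H] (E : Crystal p k n H)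
    {g : H →+ KA p k n} (hg : ∀ j x, MvPowerSeries.pderiv (K p k) j (g x) = g (E.D j x))
    (m d : Fin n →₀ ℕ) (x : H) :
    MvPowerSeries.coeff d (g (E.Dpow m x)) =
      (∏ j, ((d j + m j).descFactorial (m j) : K p k)) * MvPowerSeries.coeff (d + m) (g x) := by
  classical
  have hpow : ∀ (j : Fin n) (a : ℕ) (d : Fin n →₀ ℕ) (x : H),
      MvPowerSeries.coeff d (g ((E.D j ^ a) x)) = ((d j + a).descFactorial a : K p k) *
        MvPowerSeries.coeff (d + Finsupp.single j a) (g x) := by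
    intro j a
    induction a with
    | zero => intro d x; simp
    | succ a ih =>
      intro d x
      rw [pow_succ, AddMonoid.End.coe_mul, Function.comp_apply, ih, ← hg,
        MvPowerSeries.coeff_pderiv, add_assoc, ← Finsupp.single_add, ← add_assoc (d j),
        Nat.succ_descFactorial_succ]
      simp only [Finsupp.add_apply, Finsupp.single_eq_same]
      push_cast
      ring
  have hlist : ∀ (l : List (Fin n)) (hl : l.Nodup) (d : Fin n →₀ ℕ) (x : H),
      MvPowerSeries.coeff d (g ((l.map fun j => E.D j ^ m j).prod x)) =
        (l.map fun j => ((d j + m j).descFactorial (m j) : K p k)).prod *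
          MvPowerSeries.coeff (d + (l.map fun j => Finsupp.single j (m j)).sum) (g x) := by
    intro l
    induction l with
    | nil => intro _ d x; simp
    | cons j l ih =>
      intro hl d x
      rw [List.map_cons, List.prod_cons, AddMonoid.End.coe_mul, Function.comp_apply, hpow, ih hl.of_cons,
        List.map_cons, List.prod_cons, List.map_cons, List.sum_cons, ← add_assoc, ← mul_assoc]
      congr 2
      refine congrArg List.prod (List.map_congr_left fun i hi => ?_)
      have : i ≠ j := fun h => (List.nodup_cons.1 hl).1 (h ▸ hi)
      simp [this.symm]
  rw [Crystal.Dpow, List.ofFn_eq_map, hlist _ (List.nodup_finRange n), ← List.ofFn_eq_map,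
    ← List.ofFn_eq_map, List.prod_ofFn, List.sum_ofFn]
  congr 3
  refine Finsupp.ext fun i => ?_
  simp

end Derivative

/-! ### Logarithmic growth of denominators. -/

section Growth

variable {p : ℕ} [Fact p.Prime] {k : Type v} [Field k] [CharP k p] [PerfectRing k p] {n : ℕ}

/-- The denominators of the coefficients grow logarithmically. -/
def LogGrowth (f : KA p k n) : Prop :=
  ∀ (L : ℕ) (d : Fin n →₀ ℕ), d.degree < p ^ L →
    (p : K p k) ^ (3 * L) * MvPowerSeries.coeff d f ∈ lat p k 0

/-- Each use of the equation replaces a coefficient of degree `|d|` by coefficients of degree at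
most `|d| / p` and costs at most `p³`. About `log_p |d|` uses lead to the constant term. -/
theorem logGrowth_of_fixed {ι : Type*} [Fintype ι] {X : ι → KA p k n} {G : ι → ι → KA p k n}
    (hX : ∀ i, X i = ∑ j, G i j * psiK p k n (X j))
    (hG : ∀ i j d, (p : K p k) ^ 3 * MvPowerSeries.coeff d (G i j) ∈ lat p k 0)
    (h0 : ∀ i, MvPowerSeries.constantCoeff (X i) ∈ lat p k 0) (i : ι) : LogGrowth (X i) := by
  classical
  intro L
  induction L generalizing i with
  | zero =>
    intro d hd
    obtain rfl := (Finsupp.degree_eq_zero_iff d).1 (by simpa using hd)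
    simpa using h0 i
  | succ L ih =>
    intro d hd
    rw [hX, map_sum, Finset.mul_sum]
    refine sum_mem fun j _ => ?_
    rw [MvPowerSeries.coeff_mul, Finset.mul_sum]
    refine sum_mem fun x hx => ?_
    by_cases h : ∃ e, x.2 = p • e
    · obtain ⟨e, he⟩ := h
      rw [he, coeff_frobSeries_smul, show ∀ a b : K p k, (p : K p k) ^ (3 * (L + 1)) * (a * b) =
        ((p : K p k) ^ 3 * a) * ((p : K p k) ^ (3 * L) * b) by intros; ring]
      refine mul_mem_lat_of_integral (hG _ _ _) ?_
      have h1 : sigK p k ((p : K p k) ^ (3 * L) * MvPowerSeries.coeff e (X j)) ∈ lat p k 0 := by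
        refine sigK_mem_lat.2 (ih j e ?_)
        have h2 := congrArg Finsupp.degree (Finset.HasAntidiagonal.mem_antidiagonal.1 hx)
        rw [map_add, he, map_nsmul, smul_eq_mul] at h2
        rw [pow_succ'] at hd
        exact lt_of_mul_lt_mul_left ((by omega : p * e.degree ≤ d.degree).trans_lt hd) (Nat.zero_le p)
      rwa [map_mul, map_pow, map_natCast] at h1
    · push Not at h
      rw [coeff_frobSeries_eq_zero _ h, mul_zero, mul_zero]
      exact zero_mem _

theorem LogGrowth.constantCoeff_mem {f : KA p k n} (hf : LogGrowth f) :
    MvPowerSeries.constantCoeff f ∈ lat p k 0 := by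
  simpa using hf 0 0 (by simp)

/-- With `L = log_p |d|`, the denominator is at most `p^(3(L+1))`, while `|d| ≥ p^L ≥ 4L + 1`. For
`L ≥ r + 2` this leaves `|d| - r ≥ 3(L + 1)`. -/
theorem LogGrowth.exists_bound (hp : 3 < p) {f : KA p k n} (hf : LogGrowth f) (r : ℕ) :
    ∃ N, ∀ d : Fin n →₀ ℕ, N ≤ d.degree → r ≤ d.degree ∧
      (p : K p k) ^ (d.degree - r) * MvPowerSeries.coeff d f ∈ lat p k 0 := by
  have hpow : ∀ L, r + 2 ≤ L → 4 * L + 1 ≤ p ^ L := by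
    intro L hL
    have h1 : 4 * L + 1 ≤ 4 ^ L := by
      obtain ⟨m, rfl⟩ := Nat.exists_eq_add_of_le' ((by omega : 2 ≤ r + 2).trans hL)
      clear hL
      induction m with
      | zero => norm_num
      | succ m ih => rw [add_right_comm, pow_succ]; omega
    exact h1.trans (Nat.pow_le_pow_left hp L)
  refine ⟨p ^ (r + 2), fun d hd => ?_⟩
  have hd0 : d.degree ≠ 0 := fun h => by
    rw [h] at hd
    exact absurd hd (not_le.2 (pow_pos (Fact.out : p.Prime).pos _))
  have h1 : r + 2 ≤ Nat.log p d.degree := Nat.le_log_of_pow_le (by omega) hd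
  have h2 := hpow _ h1
  have h3 := Nat.pow_log_le_self p hd0
  have h4 := hf (Nat.log p d.degree + 1) d (Nat.lt_pow_succ_log_self (by omega) _)
  refine ⟨by omega, ?_⟩
  obtain ⟨e, he⟩ := Nat.exists_eq_add_of_le
    (by omega : 3 * (Nat.log p d.degree + 1) ≤ d.degree - r)
  rw [he, add_comm, pow_add, mul_assoc]
  exact lat_anti (Nat.zero_le _) (mul_mem_lat (p_pow_mem_lat e) h4)

end Growth

end CY3

end

noncomputable section

namespace CY3

open Finset

theorem gram_map {R S : Type*} [CommRing R] [CommRing S] (f : R →+* S) (n : ℕ) :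
    (gram R n).map f = gram S n := by
  refine Matrix.ext fun a b => ?_
  rcases a with (_ | i | i | _) <;> rcases b with (_ | j | j | _) <;>
    simp [gram, apply_ite f]

theorem gram_mul_gram (R : Type*) [CommRing R] (n : ℕ) : gram R n * gram R n = -1 := by
  refine Matrix.ext fun a b => ?_
  rw [Matrix.mul_apply]
  simp only [Fintype.sum_sum_type, Finset.univ_unique, Finset.sum_singleton]
  rcases a with (_ | i | i | _) <;> rcases b with (_ | j | j | _) <;>
    simp [gram, Matrix.one_apply]
  split_ifs <;> simp

/-! ### Construction of the period matrix for the standard Frobenius. -/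

section Period

variable {p : ℕ} [Fact p.Prime] {k : Type v} [Field k] [CharP k p] [IsAlgClosed k] {n : ℕ}
  {H : Type u} [AddCommGroup H] [Module (A p k n) H]

/-- A triangular `σ`-semilinear system over `W` has a unitriangular solution. -/
theorem W_exists_row {ι : Type*} [Fintype ι] [DecidableEq ι] (deg : ι → ℕ) (R : ι → ι → W p k)
    (hR : ∀ c b, deg b < deg c → R c b = 0)
    (hR1 : ∀ c b, deg b = deg c → R c b = if c = b then 1 else 0) (a : ι) :
    ∃ x : ι → W p k, (∀ b, deg b < deg a → x b = 0) ∧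
      (∀ b, deg b = deg a → x b = if a = b then 1 else 0) ∧
      ∀ b, (p : W p k) ^ deg b * ∑ c, x c * R c b = (p : W p k) ^ deg a * WittVector.frobenius (x b) := by
  -- Entries of degree up to that of `a` are prescribed. The others must satisfy `σ(x_b) = p^(deg b
  -- - deg a) ∑ x_c R_cb`, a contraction because the exponent is positive.
  obtain ⟨x, hx⟩ := exists_fixed_point (fun (x : ι → W p k) b =>
      if deg b < deg a then 0 else if deg b = deg a then if a = b then 1 else 0 else
      (WittVector.frobeniusEquiv p k).symm ((p : W p k) ^ (deg b - deg a) * ∑ c, x c * R c b)) (by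
    intro s x y hxy b
    split_ifs with h1 h2
    · simp
    · simp
    · simp
    rw [← map_sub, ← mul_sub, ← Finset.sum_sub_distrib]
    have h3 : (p : W p k) ^ (s + 1) ∣ (p : W p k) ^ (deg b - deg a) *
        ∑ c, (x c * R c b - y c * R c b) := by
      rw [pow_succ']
      refine mul_dvd_mul (dvd_pow_self _ (by omega)) (Finset.dvd_sum fun c _ => ?_)
      rw [← sub_mul]
      exact (hxy c).mul_right _
    rw [← p_pow_dvd_frobenius]
    convert h3 using 1
    exact (WittVector.frobeniusEquiv p k).apply_symm_apply _)
  have h0 : ∀ b, deg b < deg a → x b = 0 := fun b hb => by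
    rw [← hx]
    exact if_pos hb
  have h1 : ∀ b, deg b = deg a → x b = if a = b then 1 else 0 := fun b hb => by
    rw [← hx]
    dsimp only
    rw [if_neg (by omega), if_pos hb]
  refine ⟨x, h0, h1, fun b => ?_⟩
  rcases lt_trichotomy (deg b) (deg a) with hb | hb | hb
  · rw [h0 b hb, map_zero, mul_zero, Finset.sum_eq_zero, mul_zero]
    intro c _
    by_cases hc : deg b < deg c
    · rw [hR c b hc, mul_zero]
    · rw [h0 c (by omega), zero_mul]
  · rw [hb]
    congr 1
    rw [h1 b hb, apply_ite WittVector.frobenius, map_one, map_zero]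
    rw [Finset.sum_eq_single a]
    · rw [h1 a rfl, if_pos rfl, one_mul, hR1 a b hb]
    · intro c _ hca
      rcases lt_trichotomy (deg c) (deg a) with hc | hc | hc
      · rw [h0 c hc, zero_mul]
      · rw [h1 c hc, if_neg hca.symm, zero_mul]
      · rw [hR c b (by omega), mul_zero]
    · exact fun h => absurd (Finset.mem_univ _) h
  · have h2 : WittVector.frobenius (x b) =
        (p : W p k) ^ (deg b - deg a) * ∑ c, x c * R c b := by
      conv_lhs => rw [← hx]
      dsimp only
      rw [if_neg (by omega), if_neg (by omega)]
      exact (WittVector.frobeniusEquiv p k).apply_symm_apply _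
    rw [h2, ← mul_assoc, ← pow_add, Nat.add_sub_cancel' hb.le]

theorem p_ne_zero_KA : (p : KA p k n) ≠ 0 := by
  rw [← map_natCast (incl p k n) p, ← map_zero (incl p k n)]
  exact incl_injective.ne p_ne_zero_A

theorem eq_zero_of_psiK_eq {r s : ℕ} (hrs : r ≤ s) {X : KA p k n}
    (h : (p : KA p k n) ^ r * X = (p : KA p k n) ^ s * psiK p k n X)
    (h0 : MvPowerSeries.constantCoeff X = 0) : X = 0 := by
  obtain ⟨m, rfl⟩ := Nat.exists_eq_add_of_le hrs
  rw [pow_add, mul_assoc] at h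
  have h1 := mul_left_cancel₀ (pow_ne_zero r p_ne_zero_KA) h
  exact eq_zero_of_frobSeries_fixed (p := p) (sigK p k) (fun _ _ : Unit => (p : KA p k n) ^ m)
    (X := fun _ => X) (fun _ => by simpa using h1) (fun _ => h0) ()

namespace OrdinaryCY3Crystal

variable {E : OrdinaryCY3Crystal p k n n H} {U : ℕ → Submodule (A p k n) H}
  {e : Module.Basis (Idx n) (A p k n) H}

variable (E) in
/-- The matrix of the standard Frobenius. -/
def frobMatrix (e : Module.Basis (Idx n) (A p k n) H) : Matrix (Idx n) (Idx n) (A p k n) :=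
  Matrix.of fun a b => e.repr (E.F (FrobLift.std p k n) (e b)) a

variable (E) in
/-- A bigraded basis on which the standard Frobenius is standard up to lower terms. -/
structure IsNormalised (U : ℕ → Submodule (A p k n) H)
    (e : Module.Basis (Idx n) (A p k n) H) : Prop where
  flag : E.IsSlopeFlag U
  bigraded : E.IsBigraded U e
  frob : ∀ b, E.F (FrobLift.std p k n) (e b) - (p : A p k n) ^ b.deg • e b ∈ prev U b.deg

theorem form_eq_sum (hg : ∀ a b, E.form (e a) (e b) = gram (A p k n) n a b) (x y : H) :
    E.form x y = ∑ a, ∑ b, e.repr x a * gram (A p k n) n a b * e.repr y b := by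
  conv_lhs => rw [← e.sum_repr x, ← e.sum_repr y]
  simp only [map_sum, LinearMap.sum_apply, map_smul, LinearMap.smul_apply, smul_eq_mul, hg]
  rw [Finset.sum_comm]
  simp only [Finset.mul_sum]
  exact Finset.sum_congr rfl fun a _ => Finset.sum_congr rfl fun b _ => by ring

theorem frobMatrix_gram (hg : ∀ a b, E.form (e a) (e b) = gram (A p k n) n a b) :
    (E.frobMatrix e).transpose * gram (A p k n) n * E.frobMatrix e =
      (p : A p k n) ^ 3 • gram (A p k n) n := by
  refine Matrix.ext fun a b => ?_
  have h := E.form_F (FrobLift.std p k n) (e a) (e b)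
  rw [form_eq_sum hg, hg] at h
  have h2 : (FrobLift.std p k n).toRingHom (gram (A p k n) n a b) = gram (A p k n) n a b :=
    congrFun (congrFun (gram_map (FrobLift.std p k n).toRingHom n) a) b
  rw [h2] at h
  rw [Matrix.smul_apply, smul_eq_mul, ← h, Matrix.mul_apply, Finset.sum_comm]
  refine Finset.sum_congr rfl fun d _ => ?_
  rw [Matrix.mul_apply, Finset.sum_mul]
  rfl

theorem IsNormalised.frobMatrix_eq (hN : E.IsNormalised U e) (hp : 3 < p) :
    ∃ R : Matrix (Idx n) (Idx n) (A p k n), (∀ a b, E.frobMatrix e a b = (p : A p k n) ^ b.deg * R a b) ∧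
      (∀ a b : Idx n, b.deg < a.deg → R a b = 0) ∧
      ∀ a b : Idx n, b.deg = a.deg → R a b = if a = b then 1 else 0 := by
  choose y hy using fun b : Idx n => mem_pPow.1 (E.F_mem hp E.divisible (FrobLift.std p k n)
    b.deg_le_three (hN.bigraded.mem b).2)
  have hM : ∀ a b, E.frobMatrix e a b = (p : A p k n) ^ b.deg * e.repr (y b) a := fun a b => by
    rw [frobMatrix, Matrix.of_apply, ← hy, map_smul, Finsupp.smul_apply, smul_eq_mul]
  have h1 : ∀ a b : Idx n, b.deg ≤ a.deg → e.repr (y b) a = if a = b then 1 else 0 := fun a b hab => by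
    have h := hN.bigraded.mem_prev_iff.1 (hN.frob b) a hab
    rw [← hy, ← smul_sub, map_smul, Finsupp.smul_apply, smul_eq_mul] at h
    have h2 := (mul_eq_zero.1 h).resolve_left (pow_ne_zero _ p_ne_zero_A)
    rw [map_sub, Finsupp.sub_apply, sub_eq_zero] at h2
    rw [h2, e.repr_self, Finsupp.single_apply]
    exact if_congr eq_comm rfl rfl
  refine ⟨Matrix.of fun a b => e.repr (y b) a, hM, fun a b hab => ?_, fun a b hab => h1 a b hab.le⟩
  rw [Matrix.of_apply, h1 a b hab.le, if_neg]
  rintro rfl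
  exact lt_irrefl _ hab

variable (E) in
/-- The matrix `𝒯` has horizontal rows, which are eigenvectors of the standard Frobenius. -/
structure IsPeriod (e : Module.Basis (Idx n) (A p k n) H) (T : Matrix (Idx n) (Idx n) (KA p k n)) :
    Prop where
  eq_zero : ∀ a b : Idx n, b.deg < a.deg → T a b = 0
  eq_one : ∀ a b : Idx n, b.deg = a.deg → T a b = if a = b then 1 else 0
  frob : T * (E.frobMatrix e).map (incl p k n) =
    Matrix.diagonal (fun a : Idx n => (p : KA p k n) ^ a.deg) * T.map (psiK p k n)
  growth : ∀ a b, LogGrowth (T a b)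

/-- The inverse of the matrix of the standard Frobenius, up to `p³`. -/
theorem exists_mul_frobMatrix (hg : ∀ a b, E.form (e a) (e b) = gram (A p k n) n a b) :
    ∃ L : Matrix (Idx n) (Idx n) (A p k n), L * E.frobMatrix e = (p : A p k n) ^ 3 • 1 := by
  refine ⟨-(gram (A p k n) n * (E.frobMatrix e).transpose * gram (A p k n) n), ?_⟩
  rw [neg_mul, Matrix.mul_assoc, Matrix.mul_assoc, ← Matrix.mul_assoc _ (gram (A p k n) n),
    frobMatrix_gram hg, Matrix.mul_smul, gram_mul_gram, smul_neg, neg_neg]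

theorem exists_inv_frobMatrix (hg : ∀ a b, E.form (e a) (e b) = gram (A p k n) n a b) :
    ∃ G : Matrix (Idx n) (Idx n) (KA p k n), G * (E.frobMatrix e).map (incl p k n) = 1 ∧
      (E.frobMatrix e).map (incl p k n) * G = 1 ∧
      ∀ a b d, (p : K p k) ^ 3 * MvPowerSeries.coeff d (G a b) ∈ lat p k 0 := by
  obtain ⟨L, hL⟩ := exists_mul_frobMatrix hg
  have hp0 := pow_ne_zero 3 (p_ne_zero_K (p := p) (k := k))
  have h1 : ((MvPowerSeries.C ((p : K p k) ^ 3)⁻¹ : KA p k n) • L.map (incl p k n)) *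
      (E.frobMatrix e).map (incl p k n) = 1 := by
    rw [Matrix.smul_mul, ← Matrix.map_mul, hL]
    refine Matrix.ext fun a b => ?_
    rw [Matrix.smul_apply, Matrix.map_apply, Matrix.smul_apply, smul_eq_mul, smul_eq_mul, map_mul,
      map_pow, map_natCast, ← mul_assoc, ← map_natCast (MvPowerSeries.C (σ := Fin n) (R := K p k)) p,
      ← map_pow, ← map_mul, inv_mul_cancel₀ hp0, map_one, one_mul, Matrix.one_apply,
      Matrix.one_apply, apply_ite (incl p k n), map_one, map_zero]
  refine ⟨_, h1, mul_eq_one_comm.1 h1, fun a b d => ?_⟩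
  rw [Matrix.smul_apply, smul_eq_mul, MvPowerSeries.coeff_C_mul, ← mul_assoc, mul_inv_cancel₀ hp0,
    one_mul]
  exact coeff_incl_mem_lat d

/-- With `G` the inverse of the matrix `M` of Frobenius, row `a` must solve `X = p^(deg a) ψ(X) G`.
Its constant terms come from `W_exists_row`, the rest from the `t`-adic iteration. The denominators
of `G` are at most `p³`, by duality, which gives the growth. -/
theorem IsNormalised.exists_isPeriod (hN : E.IsNormalised U e) (hp : 3 < p) :
    ∃ T, E.IsPeriod e T := by
  classical
  obtain ⟨R, hR, hR0, hR1⟩ := hN.frobMatrix_eq hp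
  obtain ⟨G, hGM, hMG, hG⟩ := exists_inv_frobMatrix hN.bigraded.gram
  set M := (E.frobMatrix e).map (incl p k n) with hM
  have hMR : ∀ a b, MvPowerSeries.constantCoeff (M a b) = (p : K p k) ^ b.deg *
      algebraMap (W p k) (K p k) (MvPowerSeries.constantCoeff (R a b)) := fun a b => by
    rw [hM, Matrix.map_apply, hR, map_mul, map_pow, map_natCast, map_mul, map_pow, map_natCast,
      ← MvPowerSeries.coeff_zero_eq_constantCoeff_apply, coeff_incl,
      MvPowerSeries.coeff_zero_eq_constantCoeff_apply]
  choose x hx0 hx1 hx using fun a => W_exists_row Idx.deg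
    (fun c b => MvPowerSeries.constantCoeff (R c b))
    (fun c b h => by rw [hR0 c b h, map_zero])
    (fun c b h => by rw [hR1 c b h, apply_ite MvPowerSeries.constantCoeff, map_one, map_zero]) a
  have hx' : ∀ a b, ∑ c, algebraMap (W p k) (K p k) (x a c) * MvPowerSeries.constantCoeff (M c b) =
      (p : K p k) ^ a.deg * sigK p k (algebraMap (W p k) (K p k) (x a b)) := fun a b => by
    have := congrArg (algebraMap (W p k) (K p k)) (hx a b)
    rw [map_mul, map_mul, map_pow, map_pow, map_natCast, ← sigK_algebraMap, map_sum,
      Finset.mul_sum] at this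
    rw [← this]
    refine Finset.sum_congr rfl fun c _ => ?_
    rw [hMR, map_mul]
    ring
  choose X hX hX0 using fun a : Idx n => exists_frobSeries_fixed (p := p) (n := n) (sigK p k)
    (fun b c => (p : KA p k n) ^ a.deg * G c b)
    (fun b => algebraMap (W p k) (K p k) (x a b)) (fun b => by
      have hMG0 : ∀ c b, ∑ d, MvPowerSeries.constantCoeff (M c d) * MvPowerSeries.constantCoeff (G d b) =
          if c = b then 1 else 0 := fun c b => by
        have := congrArg MvPowerSeries.constantCoeff (congrFun (congrFun hMG c) b)
        rw [Matrix.mul_apply, map_sum, Matrix.one_apply, apply_ite MvPowerSeries.constantCoeff,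
          map_one, map_zero] at this
        simpa only [map_mul] using this
      calc algebraMap (W p k) (K p k) (x a b)
          = ∑ c, algebraMap (W p k) (K p k) (x a c) * ∑ d, MvPowerSeries.constantCoeff (M c d) *
              MvPowerSeries.constantCoeff (G d b) := by simp [hMG0]
        _ = ∑ d, (∑ c, algebraMap (W p k) (K p k) (x a c) * MvPowerSeries.constantCoeff (M c d)) *
              MvPowerSeries.constantCoeff (G d b) := by
            simp only [Finset.mul_sum, Finset.sum_mul]
            rw [Finset.sum_comm]
            exact Finset.sum_congr rfl fun _ _ => Finset.sum_congr rfl fun _ _ => by ring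
        _ = _ := by
            refine Finset.sum_congr rfl fun d _ => ?_
            rw [hx', map_mul, map_pow, map_natCast]
            ring)
  have hXM : ∀ a b, ∑ c, X a c * M c b = (p : KA p k n) ^ a.deg * psiK p k n (X a b) := fun a b => by
    have hGM' : ∀ d b, ∑ c, G d c * M c b = if d = b then 1 else 0 := fun d b => by
      rw [← Matrix.one_apply, ← hGM, Matrix.mul_apply]
    calc ∑ c, X a c * M c b = ∑ c, (∑ d, (p : KA p k n) ^ a.deg * G d c * psiK p k n (X a d)) * M c b :=
          Finset.sum_congr rfl fun c _ => by rw [← hX a c]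
      _ = ∑ d, (p : KA p k n) ^ a.deg * psiK p k n (X a d) * ∑ c, G d c * M c b := by
          simp only [Finset.mul_sum, Finset.sum_mul]
          rw [Finset.sum_comm]
          exact Finset.sum_congr rfl fun _ _ => Finset.sum_congr rfl fun _ _ => by ring
      _ = _ := by simp [hGM']
  have hM0 : ∀ a b : Idx n, b.deg < a.deg → M a b = 0 := fun a b h => by
    rw [hM, Matrix.map_apply, hR, hR0 a b h, mul_zero, map_zero]
  have hM1 : ∀ a b : Idx n, b.deg = a.deg → M a b = if a = b then (p : KA p k n) ^ b.deg else 0 := fun a b h => by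
    rw [hM, Matrix.map_apply, hR, hR1 a b h, mul_ite, mul_zero, mul_one, apply_ite (incl p k n),
      map_zero, map_pow, map_natCast]
  -- Unitriangularity is prescribed only for the constant terms. By induction on the degree of the
  -- column, an entry below the diagonal satisfies `p^(deg b) X = p^(deg a) ψ(X)` with zero constant
  -- term, so it vanishes.
  have hzero : ∀ (i : ℕ) (a b : Idx n), b.deg < i → b.deg < a.deg → X a b = 0 := by
    intro i
    induction i with
    | zero => exact fun a b h => absurd h (Nat.not_lt_zero _)
    | succ i ih =>
      intro a b hb hba
      refine eq_zero_of_psiK_eq hba.le ?_ (by rw [hX0, hx0 a b hba, map_zero])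
      rw [← hXM, Finset.sum_eq_single b]
      · rw [hM1 b b rfl, if_pos rfl, mul_comm]
      · intro c _ hcb
        rcases lt_trichotomy c.deg b.deg with h | h | h
        · rw [ih a c (by omega) (by omega), zero_mul]
        · rw [hM1 c b h.symm, if_neg hcb, mul_zero]
        · rw [hM0 c b h, mul_zero]
      · exact fun h => absurd (Finset.mem_univ _) h
  refine ⟨Matrix.of X, fun a b h => hzero _ a b (Nat.lt_succ_self _) h, fun a b h => ?_,
    Matrix.ext fun a b => ?_, fun a b => ?_⟩
  · have h1 : X a b - (if a = b then 1 else 0) = 0 := by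
      refine eq_zero_of_psiK_eq (le_refl a.deg) ?_ ?_
      · have h2 := hXM a b
        rw [Finset.sum_eq_single b] at h2
        · rw [hM1 b b rfl, if_pos rfl, mul_comm, h] at h2
          rw [map_sub, mul_sub, mul_sub, h2, apply_ite (psiK p k n), map_one, map_zero]
        · intro c _ hcb
          rcases lt_trichotomy c.deg b.deg with h' | h' | h'
          · rw [hzero _ a c (Nat.lt_succ_self _) (by omega), zero_mul]
          · rw [hM1 c b h'.symm, if_neg hcb, mul_zero]
          · rw [hM0 c b h', mul_zero]
        · exact fun h => absurd (Finset.mem_univ _) h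
      · rw [map_sub, hX0, hx1 a b h]
        split_ifs <;> simp
    exact sub_eq_zero.1 h1
  · rw [Matrix.mul_apply, Matrix.diagonal_mul, Matrix.map_apply]
    exact hXM a b
  · refine logGrowth_of_fixed (hX a) (fun b c d => ?_) (fun b => ?_) b
    · rw [← map_natCast (MvPowerSeries.C (σ := Fin n) (R := K p k)) p, ← map_pow,
        MvPowerSeries.coeff_C_mul, mul_left_comm]
      exact mul_mem_lat_of_integral (lat_anti (Nat.zero_le _) (p_pow_mem_lat _)) (hG c b d)
    · rw [hX0]
      exact algebraMap_mem_lat _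

end OrdinaryCY3Crystal

end Period

end CY3

end

noncomputable section

namespace CY3

open Finset

theorem gram_eq_zero {R : Type*} [CommRing R] {n : ℕ} {a b : Idx n} (h : a.deg + b.deg ≠ 3) :
    gram R n a b = 0 := by
  rcases a with (_ | i | i | _) <;> rcases b with (_ | j | j | _) <;> simp_all [gram, Idx.deg]

/-- Frobenius compatibility of the defect of orthogonality. -/
theorem orthogonality_defect {R ι : Type*} [CommRing R] [Fintype ι] [DecidableEq ι] (ψ : R →+* R)
    {T M P g G : Matrix ι ι R} {c : R} (hTM : T * M = P * T.map ψ)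
    (hM : M.transpose * g * M = c • g) (hP : P.transpose * g * P = c • g) (hg : g.map ψ = g)
    (hMG : M * G = 1) :
    M.transpose * (T.transpose * g * T - g) * M = c • (T.transpose * g * T - g).map ψ ∧
      T.transpose * g * T - g =
        c • (G.transpose * (T.transpose * g * T - g).map ψ * G) := by
  have h1 : (T.transpose * g * T).map ψ = (T.map ψ).transpose * g * T.map ψ := by
    rw [Matrix.map_mul, Matrix.map_mul, hg]
    rfl
  have h2 : M.transpose * T.transpose = (T.map ψ).transpose * P.transpose := by
    rw [← Matrix.transpose_mul, hTM, Matrix.transpose_mul]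
  have h3 : M.transpose * (T.transpose * g * T - g) * M =
      c • (T.transpose * g * T - g).map ψ := by
    calc M.transpose * (T.transpose * g * T - g) * M
        = (M.transpose * T.transpose) * g * (T * M) - M.transpose * g * M := by
          rw [Matrix.mul_sub, Matrix.sub_mul]
          simp only [Matrix.mul_assoc]
      _ = (T.map ψ).transpose * (P.transpose * g * P) * T.map ψ - c • g := by
          rw [h2, hTM, hM]
          simp only [Matrix.mul_assoc]
      _ = _ := by
          rw [hP, Matrix.mul_smul, Matrix.smul_mul, ← smul_sub, ← h1, Matrix.map_sub ψ (map_sub ψ), hg]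
  refine ⟨h3, ?_⟩
  have h4 : G.transpose * M.transpose = 1 := by
    rw [← Matrix.transpose_mul, hMG, Matrix.transpose_one]
  calc T.transpose * g * T - g
      = (G.transpose * M.transpose) * (T.transpose * g * T - g) * (M * G) := by
        rw [h4, hMG, Matrix.one_mul, Matrix.mul_one]
    _ = G.transpose * (M.transpose * (T.transpose * g * T - g) * M) * G := by
        simp only [Matrix.mul_assoc]
    _ = _ := by rw [h3, Matrix.mul_smul, Matrix.smul_mul]

/-- A nonzero Gram entry `(d, c)` has total degree `3`, and triangularity requires `deg d ≤ deg a`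
and `deg c ≤ deg b`. When `deg a + deg b ≤ 3`, only diagonal blocks can contribute. -/
theorem transpose_gram_mul_apply {R : Type*} [CommRing R] {n : ℕ} {T : Matrix (Idx n) (Idx n) R}
    (h0 : ∀ a b : Idx n, b.deg < a.deg → T a b = 0)
    (h1 : ∀ a b : Idx n, b.deg = a.deg → T a b = if a = b then 1 else 0) {a b : Idx n}
    (hab : a.deg + b.deg ≤ 3) : (T.transpose * gram R n * T) a b = gram R n a b := by
  have key : ∀ c d, T d a * gram R n d c * T c b =
      (if d = a then 1 else 0) * gram R n d c * (if c = b then 1 else 0) := by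
    intro c d
    by_cases hcd : d.deg + c.deg = 3
    · rcases lt_or_ge a.deg d.deg with h | h
      · rw [h0 d a h, if_neg (by rintro rfl; exact lt_irrefl _ h), zero_mul, zero_mul, zero_mul]
      rcases lt_or_ge b.deg c.deg with h' | h'
      · rw [h0 c b h', if_neg (show c ≠ b by rintro rfl; exact lt_irrefl _ h'), mul_zero, mul_zero]
      · rw [h1 d a (by omega), h1 c b (by omega)]
    · rw [gram_eq_zero hcd]
      simp
  rw [Matrix.mul_apply]
  simp only [Matrix.mul_apply, Finset.sum_mul, Matrix.transpose_apply, key]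
  simp

/-! ### Horizontality and orthogonality of the period matrix. -/

section Period

variable {p : ℕ} [Fact p.Prime] {k : Type v} [Field k] [CharP k p] [IsAlgClosed k] {n : ℕ}
  {H : Type u} [AddCommGroup H] [Module (A p k n) H]

/-- The functional on `H` with coordinates `v` in the dual basis. -/
def rowFunctional (e : Module.Basis (Idx n) (A p k n) H) (v : Idx n → KA p k n) : H →+ KA p k n where
  toFun x := ∑ c, v c * incl p k n (e.repr x c)
  map_zero' := by simp
  map_add' x y := by
    rw [← Finset.sum_add_distrib]
    refine Finset.sum_congr rfl fun c _ => ?_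
    rw [map_add, Finsupp.add_apply, map_add, mul_add]

theorem rowFunctional_apply (e : Module.Basis (Idx n) (A p k n) H) (v : Idx n → KA p k n) (x : H) :
    rowFunctional e v x = ∑ c, v c * incl p k n (e.repr x c) := rfl

theorem rowFunctional_smul (e : Module.Basis (Idx n) (A p k n) H) (v : Idx n → KA p k n)
    (a : A p k n) (x : H) : rowFunctional e v (a • x) = incl p k n a * rowFunctional e v x := by
  rw [rowFunctional_apply, rowFunctional_apply, Finset.mul_sum]
  refine Finset.sum_congr rfl fun c _ => ?_
  rw [map_smul, Finsupp.smul_apply, smul_eq_mul, map_mul]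
  ring

theorem rowFunctional_basis (e : Module.Basis (Idx n) (A p k n) H) (v : Idx n → KA p k n)
    (b : Idx n) : rowFunctional e v (e b) = v b := by
  rw [rowFunctional_apply, Finset.sum_eq_single b]
  · simp
  · intro c _ hc
    rw [e.repr_self, Finsupp.single_eq_of_ne hc, map_zero, mul_zero]
  · exact fun h => absurd (Finset.mem_univ _) h

namespace OrdinaryCY3Crystal

variable {E : OrdinaryCY3Crystal p k n n H} {U : ℕ → Submodule (A p k n) H}
  {e : Module.Basis (Idx n) (A p k n) H} {T : Matrix (Idx n) (Idx n) (KA p k n)}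

theorem repr_F (φ : FrobLift p k n) (x : H) (a : Idx n) :
    e.repr (E.F φ x) a = ∑ b, φ.toRingHom (e.repr x b) * e.repr (E.F φ (e b)) a := by
  conv_lhs => rw [← e.sum_repr x]
  rw [map_sum, map_sum, Finsupp.finsetSum_apply]
  refine Finset.sum_congr rfl fun b _ => ?_
  rw [LinearMap.map_smulₛₗ, map_smul, Finsupp.smul_apply, smul_eq_mul]

theorem IsPeriod.row_F (hT : E.IsPeriod e T) (a : Idx n) (x : H) :
    rowFunctional e (T a) (E.F (FrobLift.std p k n) x) =
      (p : KA p k n) ^ a.deg * psiK p k n (rowFunctional e (T a) x) := by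
  have hTM : ∀ b, ∑ c, T a c * incl p k n (e.repr (E.F (FrobLift.std p k n) (e b)) c) =
      (p : KA p k n) ^ a.deg * psiK p k n (T a b) := fun b => by
    have := congrFun (congrFun hT.frob a) b
    rwa [Matrix.mul_apply, Matrix.diagonal_mul, Matrix.map_apply] at this
  rw [rowFunctional_apply, rowFunctional_apply]
  have h1 : ∀ c, T a c * incl p k n (e.repr (E.F (FrobLift.std p k n) x) c) =
      ∑ b, psiK p k n (incl p k n (e.repr x b)) *
        (T a c * incl p k n (e.repr (E.F (FrobLift.std p k n) (e b)) c)) := fun c => by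
    rw [repr_F, map_sum, Finset.mul_sum]
    refine Finset.sum_congr rfl fun b _ => ?_
    rw [map_mul, FrobLift.std_apply, incl_frobSeries]
    ring
  simp only [h1]
  rw [Finset.sum_comm]
  simp only [← Finset.mul_sum, hTM]
  rw [map_sum, Finset.mul_sum]
  refine Finset.sum_congr rfl fun b _ => ?_
  rw [map_mul]
  ring

/-- A row vector compatible with the standard Frobenius up to a factor without constant term
vanishes. -/
theorem eq_zero_of_row_F (hg : ∀ a b, E.form (e a) (e b) = gram (A p k n) n a b)
    {Y : Idx n → KA p k n} (c : KA p k n)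
    (hY : ∀ b, ∑ d, Y d * incl p k n (E.frobMatrix e d b) = c * psiK p k n (Y b))
    (h0 : MvPowerSeries.constantCoeff c = 0) (b : Idx n) : Y b = 0 := by
  obtain ⟨G, -, hMG, -⟩ := exists_inv_frobMatrix hg
  have hMG' : ∀ d b, ∑ l, incl p k n (E.frobMatrix e d l) * G l b = if d = b then 1 else 0 := fun d b => by
    rw [← Matrix.one_apply, ← hMG, Matrix.mul_apply]
    rfl
  have h1 : ∀ b, Y b = ∑ l, (c * G l b) * psiK p k n (Y l) := fun b => by
    calc Y b = ∑ d, Y d * ∑ l, incl p k n (E.frobMatrix e d l) * G l b := by simp [hMG']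
      _ = ∑ l, (∑ d, Y d * incl p k n (E.frobMatrix e d l)) * G l b := by
          simp only [Finset.mul_sum, Finset.sum_mul]
          rw [Finset.sum_comm]
          exact Finset.sum_congr rfl fun _ _ => Finset.sum_congr rfl fun _ _ => by ring
      _ = _ := Finset.sum_congr rfl fun l _ => by rw [hY]; ring
  refine eq_zero_of_frobSeries_fixed (p := p) (sigK p k) (fun b l => c * G l b) h1 (fun b => ?_) b
  rw [h1, map_sum]
  refine Finset.sum_eq_zero fun l _ => ?_
  rw [map_mul, map_mul, h0, zero_mul, zero_mul]

/-- The defect `Y = ∂_j ∘ f - f ∘ D_j` is `A`-linear. Horizontality of Frobenius gives `Y ∘ F = p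
t_j^(p-1) p^(deg a) ψ(Y)`. The factor has no constant term, so uniqueness forces `Y = 0`. -/
theorem IsPeriod.row_D (hT : E.IsPeriod e T)
    (hg : ∀ a b, E.form (e a) (e b) = gram (A p k n) n a b) (a : Idx n) (j : Fin n) (x : H) :
    MvPowerSeries.pderiv (K p k) j (rowFunctional e (T a) x) = rowFunctional e (T a) (E.D j x) := by
  set f := rowFunctional e (T a) with hf
  have hsmul : ∀ (c : A p k n) x, f (c • x) = incl p k n c * f x := rowFunctional_smul e (T a)
  let Y : H → KA p k n := fun x => MvPowerSeries.pderiv (K p k) j (f x) - f (E.D j x)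
  have hYadd : ∀ x y, Y (x + y) = Y x + Y y := fun x y => by
    simp only [Y, map_add]
    ring
  have hYsmul : ∀ (c : A p k n) x, Y (c • x) = incl p k n c * Y x := fun c x => by
    simp only [Y, E.leibniz, map_add, hsmul, Derivation.leibniz, smul_eq_mul, pderiv_incl]
    ring
  have hYsum : ∀ x, Y x = ∑ b, Y (e b) * incl p k n (e.repr x b) := fun x => by
    have h1 : ∀ s : Finset (Idx n), Y (∑ b ∈ s, e.repr x b • e b) =
        ∑ b ∈ s, Y (e b) * incl p k n (e.repr x b) := fun s => by
      classical
      induction s using Finset.induction_on with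
      | empty => simp [Y]
      | insert b s hb ih =>
        rw [Finset.sum_insert hb, Finset.sum_insert hb, hYadd, ih, hYsmul, mul_comm]
    conv_lhs => rw [← e.sum_repr x]
    exact h1 _
  have hp1 := (Fact.out : p.Prime).one_lt
  set c : KA p k n := (p : KA p k n) * MvPowerSeries.X j ^ (p - 1) with hc
  have hYF : ∀ x, Y (E.F (FrobLift.std p k n) x) =
      (c * (p : KA p k n) ^ a.deg) * psiK p k n (Y x) := fun x => by
    have h1 : E.D j (E.F (FrobLift.std p k n) x) =
        ((p : A p k n) * MvPowerSeries.X j ^ (p - 1)) • E.F (FrobLift.std p k n) (E.D j x) := by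
      rw [E.horizontal, Finset.sum_eq_single j]
      · rw [FrobLift.std_apply, frobSeries_X, MvPowerSeries.pderiv_pow, MvPowerSeries.pderiv_X_self,
          mul_one]
      · intro i _ hij
        rw [FrobLift.std_apply, frobSeries_X, MvPowerSeries.pderiv_pow,
          MvPowerSeries.pderiv_X_of_ne hij, mul_zero, zero_smul]
      · exact fun h => absurd (Finset.mem_univ _) h
    simp only [Y]
    rw [h1, hsmul, hf, hT.row_F, hT.row_F, ← hf, Derivation.leibniz, pderiv_frobSeries]
    have hinc : incl p k n ((p : A p k n) * MvPowerSeries.X j ^ (p - 1)) = c := by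
      rw [map_mul (incl p k n), map_pow (incl p k n), incl_X, map_natCast (incl p k n)]
    rw [hinc, map_sub, ← hc]
    have h2 : MvPowerSeries.pderiv (K p k) j ((p : KA p k n) ^ a.deg) = 0 := by
      rw [← map_natCast (MvPowerSeries.C (σ := Fin n) (R := K p k)) p, ← map_pow,
        MvPowerSeries.pderiv_C]
    rw [h2, smul_zero, add_zero, smul_eq_mul]
    ring
  have hY0 : ∀ b, Y (e b) = 0 := eq_zero_of_row_F hg (c * (p : KA p k n) ^ a.deg) (fun b => by
    rw [← hYF, hYsum (E.F (FrobLift.std p k n) (e b))]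
    rfl) (by
    rw [hc, map_mul, map_mul, map_pow, MvPowerSeries.constantCoeff_X, zero_pow (by omega), mul_zero,
      zero_mul])
  refine sub_eq_zero.1 ((hYsum x).trans ?_)
  simp [hY0]

/-- The defect `Y = 𝒯ᵀ g 𝒯 - g` satisfies `Mᵀ Y M = p³ ψ(Y)`, so it vanishes as soon as its constant
terms do. Triangularity handles the entries of total degree at most `3`; the others are handled
`p`-adically. -/
theorem IsPeriod.gram_eq (hT : E.IsPeriod e T) (hN : E.IsNormalised U e) (hp : 3 < p) :
    T.transpose * gram (KA p k n) n * T = gram (KA p k n) n := by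
  obtain ⟨G, -, hMG, -⟩ := exists_inv_frobMatrix hN.bigraded.gram
  have hMg : ((E.frobMatrix e).map (incl p k n)).transpose * gram (KA p k n) n *
      (E.frobMatrix e).map (incl p k n) = (p : KA p k n) ^ 3 • gram (KA p k n) n := by
    have h1 := congrArg (fun m : Matrix _ _ _ => m.map (incl p k n)) (frobMatrix_gram hN.bigraded.gram)
    simp only [Matrix.map_mul] at h1
    rw [gram_map] at h1
    refine Eq.trans h1 (Matrix.ext fun a b => ?_)
    rw [Matrix.map_apply, Matrix.smul_apply, Matrix.smul_apply, smul_eq_mul, smul_eq_mul, map_mul,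
      map_pow, map_natCast, ← gram_map (incl p k n), Matrix.map_apply]
  have hPg : (Matrix.diagonal fun a : Idx n => (p : KA p k n) ^ a.deg).transpose *
      gram (KA p k n) n * (Matrix.diagonal fun a : Idx n => (p : KA p k n) ^ a.deg) =
      (p : KA p k n) ^ 3 • gram (KA p k n) n := by
    refine Matrix.ext fun a b => ?_
    rw [Matrix.diagonal_transpose, Matrix.mul_diagonal, Matrix.diagonal_mul, Matrix.smul_apply,
      smul_eq_mul]
    by_cases hab : a.deg + b.deg = 3
    · rw [← hab, pow_add]
      ring
    · rw [gram_eq_zero hab, mul_zero, mul_zero, zero_mul]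
  obtain ⟨hYM, hYG⟩ := orthogonality_defect (psiK p k n) hT.frob hMg hPg (gram_map _ n) hMG
  have hYdeg : ∀ a b : Idx n, a.deg + b.deg ≤ 3 →
      (T.transpose * gram (KA p k n) n * T - gram (KA p k n) n) a b = 0 := fun a b hab => by
    rw [Matrix.sub_apply, transpose_gram_mul_apply hT.eq_zero hT.eq_one hab, sub_self]
  generalize hY : T.transpose * gram (KA p k n) n * T - gram (KA p k n) n = Y at hYM hYG hYdeg
  set M := (E.frobMatrix e).map (incl p k n) with hM
  obtain ⟨R, hR, -, -⟩ := hN.frobMatrix_eq hp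
  have hMlat : ∀ a b, MvPowerSeries.constantCoeff (M a b) ∈ lat p k b.deg := fun a b => by
    rw [hM, Matrix.map_apply, hR, ← MvPowerSeries.coeff_zero_eq_constantCoeff_apply, coeff_incl,
      algebraMap_mem_lat_iff, MvPowerSeries.coeff_zero_eq_constantCoeff_apply, map_mul, map_pow,
      map_natCast]
    exact dvd_mul_right _ _
  have hglat : ∀ a b, MvPowerSeries.constantCoeff (gram (KA p k n) n a b) ∈ lat p k 0 := fun a b => by
    rw [← gram_map (incl p k n), Matrix.map_apply,
      ← MvPowerSeries.coeff_zero_eq_constantCoeff_apply]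
    exact coeff_incl_mem_lat _
  -- For total degree at least `4` the columns of `M` supply `p^(deg a + deg b)`, one power more
  -- than the `p³` on the other side. The constant terms are therefore infinitely divisible by `p`.
  have hYlat : ∀ r a b, MvPowerSeries.constantCoeff (Y a b) ∈ lat p k r := by
    intro r
    induction r with
    | zero =>
      intro a b
      rw [← hY, Matrix.sub_apply, map_sub, Matrix.mul_apply, map_sum]
      refine sub_mem (sum_mem fun c _ => ?_) (hglat a b)
      rw [map_mul, Matrix.mul_apply, map_sum]
      refine mul_mem_lat_of_integral (sum_mem fun d _ => ?_) (hT.growth c b).constantCoeff_mem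
      rw [map_mul]
      exact mul_mem_lat_of_integral (hT.growth d a).constantCoeff_mem (hglat _ _)
    | succ r ih =>
      intro a b
      by_cases hab : a.deg + b.deg ≤ 3
      · rw [hYdeg a b hab, map_zero]
        exact zero_mem _
      · have h1 := congrArg MvPowerSeries.constantCoeff (congrFun (congrFun hYM a) b)
        rw [Matrix.smul_apply, smul_eq_mul, map_mul, Matrix.map_apply, constantCoeff_frobSeries,
          map_pow, map_natCast] at h1
        rw [← sigK_mem_lat, ← p_pow_mul_mem_lat (s := 3), ← h1, Matrix.mul_apply, map_sum]
        refine sum_mem fun c _ => ?_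
        rw [map_mul, Matrix.mul_apply, map_sum]
        refine lat_anti (by omega : r + 1 + 3 ≤ (a.deg + r) + b.deg) (mul_mem_lat (sum_mem fun d _ => ?_) (hMlat c b))
        rw [map_mul]
        exact mul_mem_lat (hMlat d a) (ih d c)
  have hY0 : ∀ x : Idx n × Idx n, Y x.1 x.2 = 0 :=
    eq_zero_of_frobSeries_fixed (p := p) (sigK p k)
      (fun x y : Idx n × Idx n => (p : KA p k n) ^ 3 * G y.1 x.1 * G y.2 x.2)
      (X := fun x => Y x.1 x.2) (fun x => by
        conv_lhs => rw [hYG]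
        rw [Matrix.smul_apply, smul_eq_mul, Matrix.mul_apply, Fintype.sum_prod_type,
          Finset.sum_comm, Finset.mul_sum]
        refine Finset.sum_congr rfl fun c _ => ?_
        rw [Matrix.mul_apply, Finset.sum_mul, Finset.mul_sum]
        refine Finset.sum_congr rfl fun d _ => ?_
        rw [Matrix.transpose_apply, Matrix.map_apply]
        ring) (fun x => K_eq_zero_of_forall_mem_lat fun r => hYlat r _ _)
  exact sub_eq_zero.1 (hY.trans (Matrix.ext fun a b => hY0 (a, b)))

end OrdinaryCY3Crystal

end Period

end CY3

end

noncomputable section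

namespace CY3

open Finset

/-! ### Unitriangular matrices preserving the Gram matrix have the required product form. -/

section Factor

variable {R : Type*} [CommRing R] {n : ℕ}

/-- The product of the two factors of the period matrix. -/
def periodMatrix (τ : Fin n → R) (σ : Fin n → R) (c : Matrix (Fin n) (Fin n) R) (z : R) :
    Matrix (Idx n) (Idx n) R
  | Sum.inl _, Sum.inl _ => 1
  | Sum.inl _, Sum.inr (Sum.inl j) => τ j
  | Sum.inl _, Sum.inr (Sum.inr (Sum.inl j)) => -σ j + ∑ l, τ l * c l j
  | Sum.inl _, Sum.inr (Sum.inr (Sum.inr _)) => z + ∑ l, τ l * σ l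
  | Sum.inr (Sum.inl i), Sum.inr (Sum.inl j) => if i = j then 1 else 0
  | Sum.inr (Sum.inl i), Sum.inr (Sum.inr (Sum.inl j)) => c i j
  | Sum.inr (Sum.inl i), Sum.inr (Sum.inr (Sum.inr _)) => σ i
  | Sum.inr (Sum.inr (Sum.inl i)), Sum.inr (Sum.inr (Sum.inl j)) => if i = j then 1 else 0
  | Sum.inr (Sum.inr (Sum.inl i)), Sum.inr (Sum.inr (Sum.inr _)) => τ i
  | Sum.inr (Sum.inr (Sum.inr _)), Sum.inr (Sum.inr (Sum.inr _)) => 1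
  | _, _ => 0

theorem leftFactor_mul_rightFactor (τ : Fin n → R) (σ : Fin n → R) (c : Matrix (Fin n) (Fin n) R)
    (z : R) : leftFactor τ * rightFactor σ c z = periodMatrix τ σ c z := by
  refine Matrix.ext fun a b => ?_
  rw [Matrix.mul_apply]
  simp only [Fintype.sum_sum_type, Finset.univ_unique, Finset.sum_singleton]
  rcases a with (_ | i | i | _) <;> rcases b with (_ | j | j | _) <;>
    simp [leftFactor, rightFactor, periodMatrix]

theorem isUnit_det_leftFactor_mul_rightFactor (τ : Fin n → R) (σ : Fin n → R)
    (c : Matrix (Fin n) (Fin n) R) (z : R) : IsUnit (leftFactor τ * rightFactor σ c z).det := by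
  have h1 : leftFactor τ * leftFactor (-τ) = 1 := by
    refine Matrix.ext fun a b => ?_
    rw [Matrix.mul_apply]
    simp only [Fintype.sum_sum_type, Finset.univ_unique, Finset.sum_singleton]
    rcases a with (_ | i | i | _) <;> rcases b with (_ | j | j | _) <;>
      simp [leftFactor, Matrix.one_apply]
  have h2 : rightFactor σ c z * rightFactor (-σ) (-c) (-z) = 1 := by
    refine Matrix.ext fun a b => ?_
    rw [Matrix.mul_apply]
    simp only [Fintype.sum_sum_type, Finset.univ_unique, Finset.sum_singleton]
    rcases a with (_ | i | i | _) <;> rcases b with (_ | j | j | _) <;>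
      simp [rightFactor, Matrix.one_apply]
  rw [Matrix.det_mul]
  exact (Matrix.isUnit_det_of_right_inverse h1).mul (Matrix.isUnit_det_of_right_inverse h2)

/-- Orthogonality of the last column with the columns of degrees 1 and 2 expresses the first row
through the other entries. `Z` is the corner entry minus the term `∑ τ_l σ_l` created by the
product. -/
theorem eq_periodMatrix {T : Matrix (Idx n) (Idx n) R}
    (h0 : ∀ a b : Idx n, b.deg < a.deg → T a b = 0)
    (h1 : ∀ a b : Idx n, b.deg = a.deg → T a b = if a = b then 1 else 0)
    (hg : T.transpose * gram R n * T = gram R n) :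
    T = periodMatrix (fun i => T (Idx.i2 i) Idx.i3) (fun i => T (Idx.i1 i) Idx.i3)
      (Matrix.of fun i j => T (Idx.i1 i) (Idx.i2 j))
      (T Idx.i0 Idx.i3 - ∑ l, T (Idx.i2 l) Idx.i3 * T (Idx.i1 l) Idx.i3) := by
  have hsum : ∀ a b, ∑ c, ∑ d, T d a * gram R n d c * T c b = gram R n a b := fun a b => by
    conv_rhs => rw [← hg]
    simp only [Matrix.mul_apply, Finset.sum_mul, Matrix.transpose_apply]
  have h00 : T Idx.i0 Idx.i0 = 1 := by rw [h1 _ _ rfl, if_pos rfl]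
  have h33 : T Idx.i3 Idx.i3 = 1 := by rw [h1 _ _ rfl, if_pos rfl]
  have h11 : ∀ i j, T (Idx.i1 i) (Idx.i1 j) = if i = j then 1 else 0 := fun i j => by
    simpa using h1 (Idx.i1 i) (Idx.i1 j) rfl
  have h22 : ∀ i j, T (Idx.i2 i) (Idx.i2 j) = if i = j then 1 else 0 := fun i j => by
    simpa using h1 (Idx.i2 i) (Idx.i2 j) rfl
  have h10 : ∀ i, T (Idx.i1 i) Idx.i0 = 0 := fun i => h0 _ _ (by simp [Idx.deg])
  have h20 : ∀ i, T (Idx.i2 i) Idx.i0 = 0 := fun i => h0 _ _ (by simp [Idx.deg])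
  have h30 : T Idx.i3 Idx.i0 = 0 := h0 _ _ (by simp [Idx.deg])
  have h21 : ∀ i j, T (Idx.i2 i) (Idx.i1 j) = 0 := fun i j => h0 _ _ (by simp [Idx.deg])
  have h31 : ∀ j, T Idx.i3 (Idx.i1 j) = 0 := fun j => h0 _ _ (by simp [Idx.deg])
  have h32 : ∀ j, T Idx.i3 (Idx.i2 j) = 0 := fun j => h0 _ _ (by simp [Idx.deg])
  have ha : ∀ j, T Idx.i0 (Idx.i1 j) = T (Idx.i2 j) Idx.i3 := fun j => by
    have h := hsum (Idx.i1 j) Idx.i3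
    simp only [Fintype.sum_sum_type, Finset.univ_unique, Finset.sum_singleton, PUnit.default_eq_unit,
      h21, h31, h11, h33] at h
    simp [gram] at h
    linear_combination -h
  have hb : ∀ j, T Idx.i0 (Idx.i2 j) =
      - T (Idx.i1 j) Idx.i3 + ∑ l, T (Idx.i2 l) Idx.i3 * T (Idx.i1 l) (Idx.i2 j) := fun j => by
    have h := hsum (Idx.i2 j) Idx.i3
    simp only [Fintype.sum_sum_type, Finset.univ_unique, Finset.sum_singleton, PUnit.default_eq_unit,
      h22, h32, h33] at h
    simp [gram] at h
    simp only [mul_comm (T (Idx.i2 _) Idx.i3)]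
    linear_combination -h
  refine Matrix.ext fun a b => ?_
  rcases a with (_ | i | i | _) <;> rcases b with (_ | j | j | _) <;>
    simp only [periodMatrix, Matrix.of_apply, h00, h33, h11, h22, h10, h20, h30, h21, h31, h32, ha, hb,
      sub_add_cancel]

end Factor

/-! ### Extension of sums by zero and the multinomial expansion. -/

section Sums

variable {p : ℕ} [Fact p.Prime] {k : Type v} [Field k] [CharP k p] [PerfectRing k p] {n : ℕ}

theorem HS.of_injective {ι κ : Type*} {f : ι → K p k} {g : K p k} (i : κ → ι)
    (hi : Function.Injective i) (h : HS (fun j => f (i j)) g) (h0 : ∀ x, x ∉ Set.range i → f x = 0) :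
    HS f g := by
  classical
  intro r
  obtain ⟨S, hS⟩ := h r
  refine ⟨S.image i, fun S' hS' => ?_⟩
  have h1 := hS (S'.preimage i hi.injOn) fun j hj =>
    Finset.mem_preimage.2 (hS' (Finset.mem_image_of_mem i hj))
  rwa [Finset.sum_preimage i S' hi.injOn f fun x _ hx => h0 x hx] at h1

/-- The multinomial expansion of `∏ (u_j + v_j)^{d_j}`. -/
theorem hs_multinomial (u v : Fin n → KA p k n) (d D : Fin n →₀ ℕ) :
    HS (fun m : Fin n →₀ ℕ => MvPowerSeries.coeff D
      ((∏ j, ((d j).choose (m j) : KA p k n)) * (∏ j, u j ^ m j * v j ^ (d j - m j))))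
      (MvPowerSeries.coeff D (∏ j, (u j + v j) ^ d j)) := by
  classical
  have h1 : ∏ j, (u j + v j) ^ d j = ∑ m ∈ (Fintype.piFinset fun j => range (d j + 1)).map
      Finsupp.equivFunOnFinite.symm.toEmbedding,
      (∏ j, ((d j).choose (m j) : KA p k n)) * (∏ j, u j ^ m j * v j ^ (d j - m j)) := by
    rw [Finset.sum_map]
    simp only [add_pow, Finset.prod_univ_sum]
    refine Finset.sum_congr rfl fun m _ => ?_
    rw [← Finset.prod_mul_distrib]
    refine Finset.prod_congr rfl fun j _ => ?_
    exact mul_comm _ _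
  rw [h1, map_sum]
  refine hs_of_finite _ fun m hm => ?_
  have h2 : ∃ j, d j < m j := by
    by_contra hcon
    push Not at hcon
    refine hm (Finset.mem_map.2 ⟨m, Fintype.mem_piFinset.2 fun j => ?_, ?_⟩)
    · exact Finset.mem_range.2 (Nat.lt_succ_of_le (hcon j))
    · exact Finsupp.equivFunOnFinite.symm_apply_apply m
  obtain ⟨j, hj⟩ := h2
  rw [Finset.prod_eq_zero (Finset.mem_univ j) (by rw [Nat.choose_eq_zero_of_lt hj, Nat.cast_zero]),
    zero_mul, map_zero]

end Sums

end CY3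

end

noncomputable section

namespace CY3

open Finset

/-! ### From the standard lift to an arbitrary lift of Frobenius. -/

section MapsTo

variable {p : ℕ} [Fact p.Prime] {k : Type v} [Field k] [CharP k p] [PerfectRing k p] {n : ℕ}

theorem prod_X_pow_pow (e : Fin n →₀ ℕ) : ∏ j, incl p k n ((FrobLift.std p k n).toRingHom
    (MvPowerSeries.X j)) ^ e j = MvPowerSeries.monomial (p • e) (1 : K p k) := by
  rw [← map_one (sigK p k), ← frobSeries_monomial, MvPowerSeries.monomial_eq', map_mul, frobSeries_C,
    Finsupp.prod_fintype _ _ (fun i => pow_zero _), map_prod, map_one, map_one, one_mul]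
  simp only [map_pow, frobSeries_X, FrobLift.std_apply, incl_X]

variable {H : Type u} [AddCommGroup H] [Module (A p k n) H]

/-- A horizontal functional which is an eigenvector of the standard Frobenius is an eigenvector of
every Frobenius. -/
theorem mapsTo_of_functional (E : FCrystal p k n H) (hp : 3 < p) {g : H →+ KA p k n} {r : ℕ}
    (hsmul : ∀ (a : A p k n) x, g (a • x) = incl p k n a * g x)
    (hD : ∀ j x, MvPowerSeries.pderiv (K p k) j (g x) = g (E.D j x))
    (hF : ∀ x, g (E.F (FrobLift.std p k n) x) = (p : KA p k n) ^ r * psiK p k n (g x))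
    (hcont : ∀ d, ∃ N, ∀ x, (p : K p k) ^ N * MvPowerSeries.coeff d (g x) ∈ lat p k 0)
    {x : H} (hx : LogGrowth (g x)) (φ : FrobLift p k n) :
    φ.MapsTo (g x) (MvPowerSeries.C ((p : K p k) ^ r)⁻¹ * g (E.F φ x)) := by
  classical
  obtain ⟨c, -, -, hc, hT⟩ := E.exists_taylor hp φ (FrobLift.std p k n)
  choose δ hδ using fun j : Fin n => φ.dvd_X_sub_X (FrobLift.std p k n) (MvPowerSeries.X j)
  set v : Fin n → KA p k n := fun j => incl p k n ((FrobLift.std p k n).toRingHom (MvPowerSeries.X j)) with hv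
  set u : Fin n → KA p k n := fun j => incl p k n (φ.toRingHom (MvPowerSeries.X j) -
    (FrobLift.std p k n).toRingHom (MvPowerSeries.X j)) with hu
  have huv : ∀ j, incl p k n (φ.toRingHom (MvPowerSeries.X j)) = u j + v j := fun j => by
    rw [hu, hv, ← map_add, sub_add_cancel]
  have hcu : ∀ m : Fin n →₀ ℕ, (∏ j, ((m j).factorial : KA p k n)) * incl p k n (c m) =
      ∏ j, u j ^ m j := fun m => by
    have := congrArg (incl p k n) (hc m)
    simpa only [map_mul, map_prod, map_pow, map_natCast] using this
  rw [FrobLift.mapsTo_iff, SubstHas, padicHasSum_iff]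
  intro D
  -- With `v = t^p` and `u = φ(t) - t^p`, the monomial `φ(t)^d = (u + v)^d` is expanded binomially.
  -- Summed over `m`, the array gives the `d`-th term of the series for `φ(g x)`; summed over `d`,
  -- it gives the `m`-th Taylor term of `g (F φ x)` up to the factor `p^r`.
  let f : (Fin n →₀ ℕ) × (Fin n →₀ ℕ) → K p k := fun y => sigK p k (MvPowerSeries.coeff y.2 (g x)) *
    MvPowerSeries.coeff D ((∏ j, ((y.2 j).choose (y.1 j) : KA p k n)) *
      (∏ j, u j ^ y.1 j * v j ^ (y.2 j - y.1 j)))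
  have hf0 : ∀ m d : Fin n →₀ ℕ, ¬ m ≤ d → f (m, d) = 0 := fun m d hmd => by
    rw [Finsupp.le_def] at hmd
    push Not at hmd
    obtain ⟨j, hj⟩ := hmd
    simp only [f]
    rw [Finset.prod_eq_zero (Finset.mem_univ j) (by rw [Nat.choose_eq_zero_of_lt hj, Nat.cast_zero]),
      zero_mul, map_zero, mul_zero]
  have hprod : ∀ m e : Fin n →₀ ℕ, ∏ j, u j ^ m j * v j ^ ((e + m) j - m j) =
      (∏ j, u j ^ m j) * ∏ j, v j ^ e j := fun m e => by
    rw [← Finset.prod_mul_distrib]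
    simp only [Finsupp.add_apply, Nat.add_sub_cancel]
  have hpm : ∀ m e : Fin n →₀ ℕ, ∏ j, u j ^ m j * v j ^ ((e + m) j - m j) = MvPowerSeries.C ((p : K p k) ^ m.degree) *
      (incl p k n (∏ j, δ j ^ m j) * MvPowerSeries.monomial (p • e) (1 : K p k)) := fun m e => by
    rw [hprod, hv, prod_X_pow_pow, ← mul_assoc]
    congr 1
    simp only [hu, hδ, map_mul, mul_pow, Finset.prod_mul_distrib, map_prod, map_pow, map_natCast]
    rw [Finset.prod_pow_eq_pow_sum, Finsupp.degree_eq_sum]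
  -- Put `d = e + m`. The entry carries `p^|m|` from `u^m` and the monomial `t^(pe)`, so at the
  -- coefficient `D` only `|e| ≤ |D|` matters and `|m| ≥ |d| - |D|`. This beats the logarithmic
  -- denominators of `g x`.
  have hnull : Null f := by
    intro s
    obtain ⟨N, hN⟩ := hx.exists_bound hp (s + D.degree)
    refine ((Finsupp.finite_of_degree_le N).prod (Finsupp.finite_of_degree_le N)).subset ?_
    rintro ⟨m, d⟩ hmd
    by_contra hcon
    refine hmd ?_
    change f (m, d) ∈ lat p k s
    by_cases hle : m ≤ d
    swap
    · rw [hf0 m d hle]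
      exact zero_mem _
    obtain ⟨e, rfl⟩ : ∃ e, d = e + m := ⟨d - m, (tsub_add_cancel_of_le hle).symm⟩
    have hd : N ≤ (e + m).degree := by
      by_contra hlt
      refine hcon ⟨?_, ?_⟩
      · change m.degree ≤ N
        rw [map_add] at hlt
        omega
      · change (e + m).degree ≤ N
        omega
    obtain ⟨hd1, hd2⟩ := hN _ hd
    have hch : ∏ j, (((e + m) j).choose (m j) : KA p k n) =
        MvPowerSeries.C ((∏ j, ((e + m) j).choose (m j) : ℕ) : K p k) := by
      rw [map_natCast, Nat.cast_prod]
    simp only [f]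
    rw [hpm, hch, MvPowerSeries.coeff_C_mul, MvPowerSeries.coeff_C_mul,
      MvPowerSeries.coeff_mul_monomial]
    split_ifs with hD'
    · have h1 : p * e.degree ≤ D.degree := by
        rw [← smul_eq_mul, ← map_nsmul]
        exact Finsupp.degree_mono hD'
      have h2 : e.degree ≤ D.degree := (Nat.le_mul_of_pos_left _ (Fact.out : p.Prime).pos).trans h1
      rw [map_add] at hd1
      obtain ⟨l, hl⟩ := Nat.exists_eq_add_of_le
        (show (e + m).degree - (s + D.degree) + s ≤ m.degree by rw [map_add]; omega)
      have h3 := sigK_mem_lat.2 hd2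
      rw [map_mul, map_pow, map_natCast] at h3
      rw [hl, mul_one, show ∀ a b w w' : K p k, a * (b * ((p : K p k) ^ ((e + m).degree - (s + D.degree) + s + l) * w)) =
        ((p : K p k) ^ ((e + m).degree - (s + D.degree)) * a) * (b * ((p : K p k) ^ (s + l) * w)) by
          intros; ring]
      · refine mul_mem_lat_of_integral h3 (mul_mem_lat_of_integral (natCast_mem_lat _) ?_)
        refine lat_anti (Nat.le_add_right s l) ?_
        rw [mul_comm]
        exact mul_mem_lat_of_integral (coeff_incl_mem_lat _) (p_pow_mem_lat _)
      · exact 0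
    · rw [mul_zero, mul_zero, mul_zero]
      exact zero_mem _
  -- Rows: applying `D^m` multiplies coefficients by falling factorials, which equal binomials times
  -- the `m!` in the denominator of the Taylor coefficient. The sum of the rows converges by the
  -- Taylor formula.
  refine hs_fubini hnull (R := fun m => MvPowerSeries.coeff D
    (incl p k n (c m) * psiK p k n (g (E.Dpow m x)))) (fun m => ?_) (fun d => ?_) ?_
  · refine HS.of_injective (fun e => e + m) (add_left_injective m) ?_ fun d hd => hf0 m d fun hle =>
      hd ⟨d - m, tsub_add_cancel_of_le hle⟩
    have h1 : HS (fun e : Fin n →₀ ℕ => MvPowerSeries.coeff D (incl p k n (c m) *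
        (MvPowerSeries.C (sigK p k (MvPowerSeries.coeff e (g (E.Dpow m x)))) *
          ∏ j, incl p k n ((FrobLift.std p k n).toRingHom (MvPowerSeries.X j)) ^ e j))) _ :=
      padicHasSum_iff.1 (PadicHasSum.mul_left
      (FrobLift.std_mapsTo (g (E.Dpow m x))) (incl p k n (c m))) D
    convert h1 using 2 with e
    simp only [f]
    have hcast : ∏ j, (((e + m) j).choose (m j) : KA p k n) * (((m j).factorial : ℕ) : KA p k n) =
        MvPowerSeries.C (∏ j, ((e j + m j).descFactorial (m j) : K p k)) := by
      rw [map_prod]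
      refine Finset.prod_congr rfl fun j _ => ?_
      rw [map_natCast, Nat.descFactorial_eq_factorial_mul_choose, Nat.cast_mul, mul_comm]
      rfl
    rw [coeff_Dpow E.toCrystal hD, hprod, ← hcu, map_mul (sigK p k), map_prod (sigK p k)]
    simp only [map_natCast (sigK p k)]
    rw [map_mul MvPowerSeries.C, ← hcast, Finset.prod_mul_distrib, ← MvPowerSeries.coeff_C_mul]
    congr 1
    simp only [hv]
    ring
  · simp only [f]
    rw [MvPowerSeries.coeff_C_mul]
    simp only [huv]
    exact (hs_multinomial u v d D).mul_left _
  · have h1 : HS (fun m => MvPowerSeries.coeff D (g (c m • E.F (FrobLift.std p k n) (E.Dpow m x))))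
        (MvPowerSeries.coeff D (g (E.F φ x))) := by
      intro s
      obtain ⟨N, hN⟩ := hcont D
      obtain ⟨S, hS⟩ := hT x (s + N)
      refine ⟨S, fun S' hS' => ?_⟩
      obtain ⟨y, hy⟩ := mem_pPow.1 (hS S' hS')
      rw [← map_sum, ← map_sum, ← map_sub, ← map_sub, ← hy, hsmul, map_pow, map_natCast,
        ← map_natCast (MvPowerSeries.C (σ := Fin n) (R := K p k)) p, ← map_pow,
        MvPowerSeries.coeff_C_mul, pow_add, mul_assoc]
      simpa using mul_mem_lat (p_pow_mem_lat s) (hN y)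
    have h2 := h1.mul_left ((p : K p k) ^ r)⁻¹
    rw [MvPowerSeries.coeff_C_mul]
    convert h2 using 2 with m
    rw [hsmul, hF, mul_left_comm, ← map_natCast (MvPowerSeries.C (σ := Fin n) (R := K p k)) p,
      ← map_pow, MvPowerSeries.coeff_C_mul, ← mul_assoc,
      inv_mul_cancel₀ (pow_ne_zero _ p_ne_zero_K), one_mul]

end MapsTo

end CY3

end

noncomputable section

namespace CY3

open Finset

/-! ### Constant unit `F`-crystals, modelled on a fixed horizontal vector. -/

section Constant

variable {p : ℕ} [Fact p.Prime] {k : Type v} [Field k] [CharP k p] [PerfectRing k p] {n : ℕ}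

theorem Crystal.map_Dpow {V H : Type u} [AddCommGroup V] [Module (A p k n) V] [AddCommGroup H]
    [Module (A p k n) H] (E' : Crystal p k n V) (E : Crystal p k n H) (f : V →+ H)
    (hf : ∀ j x, f (E'.D j x) = E.D j (f x)) (m : Fin n →₀ ℕ) (x : V) :
    f (E'.Dpow m x) = E.Dpow m (f x) := by
  have hpow : ∀ (j : Fin n) (a : ℕ) (x : V), f ((E'.D j ^ a) x) = (E.D j ^ a) (f x) := by
    intro j a
    induction a with
    | zero => exact fun x => rfl
    | succ a ih =>
      intro x
      rw [pow_succ, pow_succ, AddMonoid.End.coe_mul, AddMonoid.End.coe_mul, Function.comp_apply,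
        Function.comp_apply, ih, hf]
  have hlist : ∀ (l : List (Fin n)) (x : V), f ((l.map fun j => E'.D j ^ m j).prod x) =
      (l.map fun j => E.D j ^ m j).prod (f x) := by
    intro l
    induction l with
    | nil => exact fun x => rfl
    | cons j l ih =>
      intro x
      rw [List.map_cons, List.map_cons, List.prod_cons, List.prod_cons, AddMonoid.End.coe_mul,
        AddMonoid.End.coe_mul, Function.comp_apply, Function.comp_apply, hpow, ih]
  rw [Crystal.Dpow, Crystal.Dpow, List.ofFn_eq_map, List.ofFn_eq_map]
  exact hlist _ x

variable {V : Type u} [AddCommGroup V] [Module (A p k n) V] {ι : Type} [Fintype ι]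

/-- The coordinatewise derivative. -/
def basisD (b : Module.Basis ι (A p k n) V) (j : Fin n) : AddMonoid.End V where
  toFun x := ∑ a, MvPowerSeries.pderiv (W p k) j (b.repr x a) • b a
  map_zero' := by simp
  map_add' x y := by
    rw [← Finset.sum_add_distrib]
    refine Finset.sum_congr rfl fun a _ => ?_
    rw [map_add, Finsupp.add_apply, map_add, add_smul]

theorem repr_basisD (b : Module.Basis ι (A p k n) V) (j : Fin n) (x : V) (a : ι) :
    b.repr (basisD b j x) a = MvPowerSeries.pderiv (W p k) j (b.repr x a) := by
  change b.repr (∑ a, MvPowerSeries.pderiv (W p k) j (b.repr x a) • b a) a = _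
  rw [b.repr_sum_self]

/-- The coordinatewise action of a ring endomorphism. -/
def basisF (b : Module.Basis ι (A p k n) V) (φ : A p k n →+* A p k n) : V →ₛₗ[φ] V where
  toFun x := ∑ a, φ (b.repr x a) • b a
  map_add' x y := by
    rw [← Finset.sum_add_distrib]
    refine Finset.sum_congr rfl fun a _ => ?_
    rw [map_add, Finsupp.add_apply, map_add, add_smul]
  map_smul' c x := by
    rw [Finset.smul_sum]
    refine Finset.sum_congr rfl fun a _ => ?_
    rw [map_smul, Finsupp.smul_apply, smul_eq_mul, map_mul, smul_smul]

theorem repr_basisF (b : Module.Basis ι (A p k n) V) (φ : A p k n →+* A p k n) (x : V) (a : ι) :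
    b.repr (basisF b φ x) a = φ (b.repr x a) := by
  change b.repr (∑ a, φ (b.repr x a) • b a) a = _
  rw [b.repr_sum_self]

theorem mem_pPow_of_repr (b : Module.Basis ι (A p k n) V) {r : ℕ} {x : V}
    (h : ∀ a, (p : A p k n) ^ r ∣ b.repr x a) : x ∈ pPow p k n V r := by
  choose c hc using h
  refine mem_pPow.2 ⟨∑ a, c a • b a, b.ext_elem fun a => ?_⟩
  rw [map_smul, Finsupp.smul_apply, b.repr_sum_self, smul_eq_mul, hc]

variable {H : Type u} [AddCommGroup H] [Module (A p k n) H]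

/-- A vector generating a constant sub-`F`-crystal of rank one. -/
structure FCrystal.IsConstant (E : FCrystal p k n H) (e₀ : H) : Prop where
  D_eq : ∀ j, E.D j e₀ = 0
  F_eq : ∀ φ, E.F φ e₀ = e₀
  dvd : ∀ (a : A p k n) r, a • e₀ ∈ pPow p k n H r → (p : A p k n) ^ r ∣ a

variable {E : FCrystal p k n H} {e₀ : H}

theorem FCrystal.IsConstant.D_smul (h : E.IsConstant e₀) (j : Fin n) (a : A p k n) :
    E.D j (a • e₀) = MvPowerSeries.pderiv (W p k) j a • e₀ := by
  rw [E.leibniz, h.D_eq, smul_zero, add_zero]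

theorem FCrystal.IsConstant.F_smul (h : E.IsConstant e₀) (φ : FrobLift p k n) (a : A p k n) :
    E.F φ (a • e₀) = φ.toRingHom a • e₀ := by
  rw [LinearMap.map_smulₛₗ, h.F_eq]

theorem FCrystal.IsConstant.eq (h : E.IsConstant e₀) {a b : A p k n} (hab : a • e₀ = b • e₀) :
    a = b := by
  refine sub_eq_zero.1 (A_eq_zero_of_forall_dvd fun r => h.dvd _ r ?_)
  rw [sub_smul, hab, sub_self]
  exact zero_mem _

/-- The crystal with a horizontal basis. -/
def FCrystal.IsConstant.crystal (h : E.IsConstant e₀) (b : Module.Basis ι (A p k n) V) :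
    Crystal p k n V where
  free := Module.Free.of_basis b
  finite := Module.Finite.of_basis b
  D := basisD b
  leibniz j a x := b.ext_elem fun i => by
    rw [repr_basisD, map_add, Finsupp.add_apply, map_smul, map_smul, map_smul, Finsupp.smul_apply,
      Finsupp.smul_apply, Finsupp.smul_apply, repr_basisD, smul_eq_mul, smul_eq_mul, smul_eq_mul,
      Derivation.leibniz, smul_eq_mul, smul_eq_mul]
    ring
  integrable i j x := b.ext_elem fun a => by
    rw [repr_basisD, repr_basisD, repr_basisD, repr_basisD]
    refine h.eq ?_
    rw [← h.D_smul, ← h.D_smul, ← h.D_smul, ← h.D_smul, E.integrable]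
  -- The map `a ↦ a • e₀` intertwines `∂_j` with `D_j` and detects divisibility by `p`, so
  -- nilpotency of each coordinate is inherited from `H`. Horizontality and the Taylor formula of
  -- `fCrystal` are transported in the same way.
  nilpotent j r := by
    obtain ⟨M, hM⟩ := E.nilpotent j r
    refine ⟨M, fun m hm x => mem_pPow_of_repr b fun a => h.dvd _ _ ?_⟩
    have key : ∀ m, b.repr ((basisD b j ^ m) x) a • e₀ = (E.D j ^ m) (b.repr x a • e₀) := by
      intro m
      induction m with
      | zero => rfl
      | succ m ih =>
        rw [pow_succ', pow_succ', AddMonoid.End.coe_mul, AddMonoid.End.coe_mul, Function.comp_apply,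
          Function.comp_apply, repr_basisD, ← h.D_smul, ih]
    rw [key]
    exact hM m hm _

/-- The unit `F`-crystal with a horizontal basis fixed by Frobenius. -/
def FCrystal.IsConstant.fCrystal (h : E.IsConstant e₀) (b : Module.Basis ι (A p k n) V) :
    FCrystal p k n V where
  toCrystal := h.crystal b
  F φ := basisF b φ.toRingHom
  horizontal φ i x := b.ext_elem fun a => by
    change b.repr (basisD b i (basisF b φ.toRingHom x)) a =
      b.repr (∑ j, MvPowerSeries.pderiv (W p k) i (φ.toRingHom (MvPowerSeries.X j)) •
        basisF b φ.toRingHom (basisD b j x)) a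
    rw [repr_basisD, repr_basisF, map_sum, Finsupp.finsetSum_apply]
    refine h.eq ?_
    rw [← h.D_smul, ← h.F_smul, E.horizontal, Finset.sum_smul]
    refine Finset.sum_congr rfl fun j _ => ?_
    rw [h.D_smul, h.F_smul, map_smul, Finsupp.smul_apply, repr_basisF, repr_basisD, smul_smul,
      smul_eq_mul]
  taylor φ ψ := by
    classical
    obtain ⟨c, hc, hF⟩ := E.taylor φ ψ
    refine ⟨c, hc, fun x r => ?_⟩
    choose S hS using fun a => hF (b.repr x a • e₀) r
    refine ⟨Finset.univ.biUnion S, fun S' hS' => mem_pPow_of_repr b fun a => h.dvd _ _ ?_⟩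
    have h1 := hS a S' ((Finset.subset_biUnion_of_mem S (Finset.mem_univ a)).trans hS')
    let f : V →+ H :=
      { toFun := fun x => b.repr x a • e₀
        map_zero' := by simp
        map_add' := fun x y => by rw [map_add, Finsupp.add_apply, add_smul] }
    have hf : ∀ m, b.repr ((h.crystal b).Dpow m x) a • e₀ = E.Dpow m (b.repr x a • e₀) := fun m =>
      Crystal.map_Dpow (h.crystal b) E.toCrystal f (fun j x => by
        change b.repr (basisD b j x) a • e₀ = E.D j (b.repr x a • e₀)
        rw [repr_basisD, h.D_smul]) m x
    convert h1 using 1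
    rw [map_sub, Finsupp.sub_apply, sub_smul, map_sum, Finsupp.finsetSum_apply, Finset.sum_smul,
      repr_basisF, h.F_smul]
    congr 1
    refine Finset.sum_congr rfl fun m _ => ?_
    rw [map_smul, Finsupp.smul_apply, repr_basisF, smul_eq_mul, ← hf, h.F_smul, smul_smul]
  isogeny φ := ⟨0, fun x _ => by
    classical
    rw [← b.sum_repr x]
    refine sum_mem fun a _ => Submodule.smul_mem _ _ (Submodule.subset_span ⟨b a, ?_⟩)
    refine b.ext_elem fun i => ?_
    rw [repr_basisF, b.repr_self, Finsupp.single_apply]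
    split_ifs <;> simp⟩

theorem FCrystal.IsConstant.isUnit (h : E.IsConstant e₀) (b : Module.Basis ι (A p k n) V) :
    (h.fCrystal b).IsUnit := fun φ => by
  classical
  rw [eq_top_iff]
  intro x _
  rw [← b.sum_repr x]
  refine sum_mem fun a _ => Submodule.smul_mem _ _ (Submodule.subset_span ⟨b a, ?_⟩)
  change basisF b φ.toRingHom (b a) = b a
  refine b.ext_elem fun i => ?_
  rw [repr_basisF, b.repr_self, Finsupp.single_apply]
  split_ifs <;> simp

end Constant

end CY3

end

noncomputable section

namespace CY3

open Finset

/-! ### The slope filtration and the existence of frames. -/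

section Frames

variable {p : ℕ} [Fact p.Prime] {k : Type v} [Field k] [CharP k p] [IsAlgClosed k] {n : ℕ}
  {H : Type u} [AddCommGroup H] [Module (A p k n) H]

namespace OrdinaryCY3Crystal

variable {E : OrdinaryCY3Crystal p k n n H} {U : ℕ → Submodule (A p k n) H}
  {e : Module.Basis (Idx n) (A p k n) H} {T : Matrix (Idx n) (Idx n) (KA p k n)}

theorem IsSlopeFlag.D_mem_prev (hU : E.IsSlopeFlag U) (i : ℕ) (j : Fin n) {x : H}
    (hx : x ∈ prev U i) : E.D j x ∈ prev U i := by
  cases i with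
  | zero =>
    rw [prev, Submodule.mem_bot] at hx ⊢
    rw [hx, map_zero]
  | succ i => exact hU.D_mem i j x hx

theorem IsSlopeFlag.F_mem_prev (hU : E.IsSlopeFlag U) (i : ℕ) (φ : FrobLift p k n) {x : H}
    (hx : x ∈ prev U i) : E.F φ x ∈ prev U i := by
  cases i with
  | zero =>
    rw [prev, Submodule.mem_bot] at hx ⊢
    rw [hx, map_zero]
  | succ i => exact hU.F_mem i φ x hx

/-- The connection is trivial on the graded pieces. -/
theorem IsPeriod.D_mem_prev (hT : E.IsPeriod e T) (hN : E.IsNormalised U e) (j : Fin n) (b : Idx n) :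
    E.D j (e b) ∈ prev U b.deg := by
  rw [hN.bigraded.mem_prev_iff]
  intro a hab
  have hU := (hN.bigraded.slope b.deg _).1 (hN.flag.D_mem _ j _ (hN.bigraded.mem b).1)
  rcases hab.lt_or_eq with h | h
  · exact hU a h
  -- In equal degrees `T a b` is constant. Triangularity leaves only the coordinate `a` of `D_j (e
  -- b)` in this row, so that coordinate is its derivative, zero.
  have h1 := hT.row_D hN.bigraded.gram a j (e b)
  rw [rowFunctional_basis, hT.eq_one a b h, rowFunctional_apply, Finset.sum_eq_single a,
    hT.eq_one a a rfl, if_pos rfl, one_mul] at h1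
  · refine incl_injective ?_
    rw [← h1, map_zero]
    split_ifs
    · rw [← map_one MvPowerSeries.C, MvPowerSeries.pderiv_C]
    · rw [map_zero]
  · intro c _ hca
    rcases lt_trichotomy c.deg a.deg with hc | hc | hc
    · rw [hT.eq_zero a c hc, zero_mul]
    · rw [hT.eq_one a c hc, if_neg hca.symm, zero_mul]
    · rw [hU c (by omega), map_zero, mul_zero]
  · exact fun h => absurd (Finset.mem_univ _) h

/-- Every Frobenius is standard on the graded pieces. -/
theorem IsPeriod.F_mem_prev (hT : E.IsPeriod e T) (hN : E.IsNormalised U e) (φ : FrobLift p k n)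
    (b : Idx n) : E.F φ (e b) - (p : A p k n) ^ b.deg • e b ∈ prev U b.deg := by
  classical
  have := E.finite
  obtain ⟨c, hc, hF⟩ := E.taylor φ (FrobLift.std p k n)
  have hc0 : c 0 = 1 := by simpa using hc 0
  have h1 : E.F φ (e b) - E.F (FrobLift.std p k n) (e b) ∈ prev U b.deg := by
    refine mem_closure_iff_aux fun r => ?_
    obtain ⟨S, hS⟩ := hF (e b) r
    have h2 := hS (insert 0 S) (Finset.subset_insert _ _)
    rw [← Finset.add_sum_erase _ _ (Finset.mem_insert_self 0 S), hc0, one_smul, E.Dpow_zero,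
      ← sub_sub] at h2
    refine Submodule.mem_sup.2 ⟨_, sum_mem fun m hm => ?_, _, h2, add_sub_cancel _ _⟩
    refine Submodule.smul_mem _ _ (hN.flag.F_mem_prev _ _ ?_)
    have hm0 : m.degree ≠ 0 := fun h =>
      (Finset.ne_of_mem_erase hm) ((Finsupp.degree_eq_zero_iff m).1 h)
    refine E.Dpow_mem (fun i => if i = 0 then (prev U b.deg : Set H) else
      insert (e b) (prev U b.deg : Set H)) (fun i j x hx => ?_) m 0 _ ?_
    · rw [if_neg (Nat.succ_ne_zero i)] at hx
      have h3 : E.D j x ∈ prev U b.deg := by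
        rcases hx with rfl | hx
        · exact hT.D_mem_prev hN j b
        · exact hN.flag.D_mem_prev _ j hx
      split_ifs
      · exact h3
      · exact Or.inr h3
    · rw [zero_add, if_neg hm0]
      exact Or.inl rfl
  have := add_mem h1 (hN.frob b)
  rwa [sub_add_sub_cancel] at this

theorem IsPeriod.isConstant (hT : E.IsPeriod e T) (hN : E.IsNormalised U e) :
    E.IsConstant (e Idx.i0) where
  D_eq j := (Submodule.mem_bot _).1 (hT.D_mem_prev hN j Idx.i0)
  F_eq φ := by
    have := (Submodule.mem_bot _).1 (hT.F_mem_prev hN φ Idx.i0)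
    rwa [show (Idx.i0 : Idx n).deg = 0 from rfl, pow_zero, one_smul, sub_eq_zero] at this
  dvd a r h := by
    obtain ⟨y, hy⟩ := mem_pPow.1 h
    have := congrArg (fun z => e.repr z Idx.i0) hy
    simp only [map_smul, Finsupp.smul_apply, e.repr_self, Finsupp.single_eq_same, smul_eq_mul,
      mul_one] at this
    exact ⟨_, this.symm⟩

theorem IsBigraded.span_eq (he : E.IsBigraded U e) (i : ℕ) :
    Submodule.span (A p k n) (Set.range fun a : {a : Idx n // a.deg ≤ i} => e a) = U i := by
  refine le_antisymm (Submodule.span_le.2 ?_) fun x hx => ?_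
  · rintro _ ⟨⟨a, ha⟩, rfl⟩
    refine (he.slope i _).2 fun c hc => ?_
    rw [e.repr_self, Finsupp.single_eq_of_ne]
    rintro rfl
    omega
  · have hsub : ∀ a : Idx n, ¬ i < a.deg → e a ∈
        Submodule.span (A p k n) (Set.range fun a : {a : Idx n // a.deg ≤ i} => e a) :=
      fun a ha => Submodule.subset_span ⟨⟨a, not_lt.1 ha⟩, rfl⟩
    exact mem_of_repr_eq_zero hsub ((he.slope i x).1 hx)

theorem IsBigraded.mem_of_le (he : E.IsBigraded U e) {a : Idx n} {i : ℕ} (h : a.deg ≤ i) :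
    e a ∈ U i := by
  rw [← he.span_eq]
  exact Submodule.subset_span ⟨⟨a, h⟩, rfl⟩

theorem IsNormalised.repr_F (hN : E.IsNormalised U e) (hT : E.IsPeriod e T) {i : ℕ} {x : H}
    (hx : x ∈ U i) {a : Idx n} (ha : a.deg = i) (φ : FrobLift p k n) :
    e.repr (E.F φ x) a = (p : A p k n) ^ i * φ.toRingHom (e.repr x a) := by
  rw [OrdinaryCY3Crystal.repr_F, Finset.sum_eq_single a]
  · have h := hN.bigraded.mem_prev_iff.1 (hT.F_mem_prev hN φ a) a le_rfl
    rw [map_sub, Finsupp.sub_apply, map_smul, Finsupp.smul_apply, e.repr_self, Finsupp.single_eq_same,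
      sub_eq_zero, smul_eq_mul, mul_one, ha] at h
    rw [h, mul_comm]
  · intro b _ hba
    by_cases hb : b.deg ≤ i
    · have h := hN.bigraded.mem_prev_iff.1 (hT.F_mem_prev hN φ b) a (by omega)
      rw [map_sub, Finsupp.sub_apply, map_smul, Finsupp.smul_apply, e.repr_self,
        Finsupp.single_eq_of_ne hba.symm, smul_zero, sub_zero] at h
      rw [h, mul_zero]
    · rw [(hN.bigraded.slope i x).1 hx b (by omega), map_zero, zero_mul]
  · exact fun h => absurd (Finset.mem_univ _) h

theorem IsNormalised.repr_D (hN : E.IsNormalised U e) (hT : E.IsPeriod e T) {i : ℕ} {x : H}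
    (hx : x ∈ U i) {a : Idx n} (ha : a.deg = i) (j : Fin n) :
    e.repr (E.D j x) a = MvPowerSeries.pderiv (W p k) j (e.repr x a) := by
  conv_lhs => rw [← e.sum_repr x]
  rw [map_sum, map_sum, Finsupp.finsetSum_apply, Finset.sum_eq_single a]
  · rw [E.leibniz, map_add, Finsupp.add_apply, map_smul, map_smul, Finsupp.smul_apply,
      Finsupp.smul_apply, e.repr_self, Finsupp.single_eq_same,
      hN.bigraded.mem_prev_iff.1 (hT.D_mem_prev hN j a) a le_rfl, smul_zero, add_zero, smul_eq_mul,
      mul_one]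
  · intro b _ hba
    by_cases hb : b.deg ≤ i
    · rw [E.leibniz, map_add, Finsupp.add_apply, map_smul, map_smul, Finsupp.smul_apply,
        Finsupp.smul_apply, e.repr_self, Finsupp.single_eq_of_ne hba.symm,
        hN.bigraded.mem_prev_iff.1 (hT.D_mem_prev hN j b) a (by omega), smul_zero, smul_zero,
        add_zero]
    · rw [(hN.bigraded.slope i x).1 hx b (by omega), zero_smul, map_zero, map_zero,
        Finsupp.zero_apply]
  · exact fun h => absurd (Finset.mem_univ _) h

/-- `F(e b) = p^(deg b) f b` with `f` unitriangular, so all `e b` of degree at most `i` become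
Frobenius images after multiplication by `p^i`. Conversely, if `p^i y` is in the image, then `p³`
divides `⟨p^i y, p^(deg b) f b⟩`. Hence `⟨y, e b⟩ ≡ 0` modulo `p` for `i + deg b < 3`, and these
pairings are the coordinates of `y` of degree above `i`, up to sign. -/
theorem IsNormalised.red_eq (hN : E.IsNormalised U e) (hp : 3 < p) (φ : FrobLift p k n) (i : ℕ) :
    red (U i) = E.conjFil φ i := by
  rw [E.conjFil_eq hp φ (FrobLift.std p k n)]
  obtain ⟨R, hR, hR0, hR1⟩ := hN.frobMatrix_eq hp
  set N := (Submodule.span (A p k n) (Set.range (E.F (FrobLift.std p k n)))).comap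
    (((p : A p k n) ^ i) • (LinearMap.id : H →ₗ[A p k n] H)) with hNdef
  have hmemN : ∀ y, y ∈ N ↔ (p : A p k n) ^ i • y ∈
      Submodule.span (A p k n) (Set.range (E.F (FrobLift.std p k n))) := fun y => Iff.rfl
  let f : Idx n → H := fun b => ∑ a, R a b • e a
  have hF : ∀ b, E.F (FrobLift.std p k n) (e b) = (p : A p k n) ^ b.deg • f b := fun b => by
    refine e.ext_elem fun a => ?_
    rw [map_smul, Finsupp.smul_apply, smul_eq_mul]
    simp only [f]
    rw [e.repr_sum_self, ← hR]
    rfl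
  have hf : ∀ b, f b = e b + ∑ a ∈ univ.filter (fun a : Idx n => a.deg < b.deg), R a b • e a := fun b => by
    classical
    simp only [f]
    rw [Finset.sum_filter, ← Finset.add_sum_erase _ _ (Finset.mem_univ b), hR1 b b rfl, if_pos rfl,
      one_smul, ← Finset.add_sum_erase (univ) _ (Finset.mem_univ b), if_neg (lt_irrefl _), zero_add]
    congr 1
    refine Finset.sum_congr rfl fun a ha => ?_
    have hab := Finset.ne_of_mem_erase ha
    rcases lt_trichotomy a.deg b.deg with h | h | h
    · rw [if_pos h]
    · rw [hR1 a b h.symm, if_neg hab, zero_smul, if_neg h.not_lt]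
    · rw [hR0 a b h, zero_smul, if_neg h.not_gt]
  have hle : U i ≤ N := by
    rw [← hN.bigraded.span_eq, Submodule.span_le]
    rintro _ ⟨⟨b, hb⟩, rfl⟩
    have key : ∀ m, ∀ b : Idx n, b.deg < m → b.deg ≤ i → e b ∈ N := by
      intro m
      induction m with
      | zero => exact fun b h => absurd h (Nat.not_lt_zero _)
      | succ m ih =>
        intro b hbm hbi
        rw [show e b = f b - ∑ a ∈ univ.filter (fun a : Idx n => a.deg < b.deg), R a b • e a by
          rw [hf, add_sub_cancel_right]]
        refine sub_mem ?_ (sum_mem fun a ha => N.smul_mem _ ?_)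
        · rw [hmemN, ← Nat.sub_add_cancel hbi, pow_add, mul_smul, ← hF]
          exact Submodule.smul_mem _ _ (Submodule.subset_span ⟨_, rfl⟩)
        · have := (Finset.mem_filter.1 ha).2
          exact ih a (by omega) (by omega)
    exact key _ b (Nat.lt_succ_self _) hb
  refine le_antisymm (Submodule.map_mono hle) ?_
  rintro _ ⟨y, hy, rfl⟩
  rw [mem_red]
  have hform : ∀ m, ∀ b : Idx n, b.deg < m → i + b.deg < 3 → (p : A p k n) ∣ E.form y (e b) := by
    intro m
    induction m with
    | zero => exact fun b h => absurd h (Nat.not_lt_zero _)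
    | succ m ih =>
      intro b hbm hbi
      have h1 : (p : A p k n) ^ 3 ∣ E.form ((p : A p k n) ^ i • y) ((p : A p k n) ^ b.deg • f b) := by
        have h2 : ∀ z ∈ Submodule.span (A p k n) (Set.range (E.F (FrobLift.std p k n))),
            (p : A p k n) ^ 3 ∣ E.form z ((p : A p k n) ^ b.deg • f b) := by
          intro z hz
          induction hz using Submodule.span_induction with
          | mem z hz =>
            obtain ⟨z, rfl⟩ := hz
            rw [← hF, E.form_F]
            exact dvd_mul_right _ _
          | zero => simp
          | add z w _ _ hz hw =>
            rw [map_add, LinearMap.add_apply]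
            exact dvd_add hz hw
          | smul c z _ hz =>
            rw [map_smul E.form, LinearMap.smul_apply, smul_eq_mul]
            exact hz.mul_left c
        exact h2 _ hy
      have h3 : (p : A p k n) ∣ E.form y (f b) := by
        rw [map_smul, map_smul, LinearMap.smul_apply, smul_eq_mul, smul_eq_mul, ← mul_assoc, ← pow_add,
          show 3 = (b.deg + i) + (3 - (i + b.deg)) by omega, pow_add] at h1
        exact (dvd_pow_self _ (by omega)).trans
          ((mul_dvd_mul_iff_left (pow_ne_zero _ p_ne_zero_A)).1 h1)
      rw [hf, map_add, map_sum] at h3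
      refine (dvd_add_left (Finset.dvd_sum fun a ha => ?_)).1 h3
      have := (Finset.mem_filter.1 ha).2
      rw [map_smul, smul_eq_mul]
      exact (ih a (by omega) (by omega)).mul_left _
  have hrepr : ∀ a : Idx n, i < a.deg → (p : A p k n) ∣ e.repr y a := by
    have h0 : ∀ b : Idx n, i + b.deg < 3 → (p : A p k n) ∣ E.form y (e b) := fun b =>
      hform _ b (Nat.lt_succ_self _)
    simp only [form_eq_of_gram hN.bigraded.gram] at h0
    intro a ha
    rcases a with (_ | j | j | _)
    · exact absurd ha (Nat.not_lt_zero _)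
    · have := h0 (Idx.i2 j) (by simp [Idx.deg] at ha ⊢; omega)
      simpa [Finsupp.single_apply] using this
    · have := h0 (Idx.i1 j) (by simp [Idx.deg] at ha ⊢; omega)
      simpa [Finsupp.single_apply] using this
    · have := h0 Idx.i0 (by simp [Idx.deg] at ha ⊢; omega)
      simpa [Finsupp.single_apply] using this
  rw [← e.sum_repr y]
  refine sum_mem fun a _ => ?_
  by_cases ha : a.deg ≤ i
  · exact Submodule.mem_sup_left (Submodule.smul_mem _ _ (hN.bigraded.mem_of_le ha))
  · refine Submodule.mem_sup_right ?_
    have := smul_mem_pPow (r := 1) (s := 0) (x := e a) (by simpa using hrepr a (not_le.1 ha)) (mem_pPow_zero _)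
    simpa using this

theorem IsNormalised.isSlopeFiltration (hN : E.IsNormalised U e) (hT : E.IsPeriod e T) (hp : 3 < p) :
    E.IsSlopeFiltration U where
  free i := by
    rw [← hN.bigraded.span_eq]
    exact Module.Free.of_basis (Module.Basis.span
      (e.linearIndependent.comp _ Subtype.val_injective))
  mono i := hN.flag.mono _ _ (Nat.le_succ i)
  D_mem := hN.flag.D_mem
  F_mem := hN.flag.F_mem
  red_eq φ i := hN.red_eq hp φ i
  saturated i x hx := by
    rw [hN.bigraded.slope] at hx ⊢
    intro a ha
    have := hx a ha
    rw [map_smul, Finsupp.smul_apply, smul_eq_mul] at this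
    exact (mul_eq_zero.1 this).resolve_left p_ne_zero_A
  -- The graded piece is the span of the basis vectors of degree `i`, with the constant crystal
  -- structure modelled on `A e_0 ⊂ H`. The projection is compatible with it because `∇` and all
  -- Frobenii are standard modulo lower slopes.
  graded i := by
    classical
    let v : {a : Idx n // a.deg = i} → H := fun a => e a
    let b := Module.Basis.span (v := v) (e.linearIndependent.comp _ Subtype.val_injective)
    let π : U i →ₗ[A p k n] Submodule.span (A p k n) (Set.range v) :=
      { toFun := fun x => ∑ a, e.repr (x : H) a.1 • b a
        map_add' := fun x y => by
          rw [← Finset.sum_add_distrib]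
          refine Finset.sum_congr rfl fun a _ => ?_
          rw [Submodule.coe_add, map_add, Finsupp.add_apply, add_smul]
        map_smul' := fun c x => by
          rw [Finset.smul_sum]
          refine Finset.sum_congr rfl fun a _ => ?_
          rw [Submodule.coe_smul, map_smul, Finsupp.smul_apply, smul_smul, smul_eq_mul,
            RingHom.id_apply] }
    have hπ : ∀ x a, b.repr (π x) a = e.repr (x : H) a.1 := fun x a => by
      change b.repr (∑ a, e.repr (x : H) a.1 • b a) a = _
      rw [b.repr_sum_self]
    have hc := hT.isConstant hN
    refine ⟨_, inferInstance, inferInstance, hc.fCrystal b, π, hc.isUnit b, fun y => ?_, ?_,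
      fun j x => b.ext_elem fun a => ?_, fun φ x => b.ext_elem fun a => ?_⟩
    · refine ⟨⟨∑ a, b.repr y a • e a.1, sum_mem fun a _ => Submodule.smul_mem _ _
        (hN.bigraded.mem_of_le a.2.le)⟩, b.ext_elem fun a => ?_⟩
      rw [hπ, map_sum, Finsupp.finsetSum_apply, Finset.sum_eq_single a]
      · simp
      · intro c _ hca
        rw [map_smul, Finsupp.smul_apply, e.repr_self, Finsupp.single_eq_of_ne (fun h =>
          hca (Subtype.ext h).symm), smul_zero]
      · exact fun h => absurd (Finset.mem_univ _) h
    · refine Submodule.ext fun x => ?_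
      rw [LinearMap.mem_ker, Submodule.submoduleOf, Submodule.mem_comap, hN.bigraded.mem_prev_iff,
        ← LinearEquiv.map_eq_zero_iff b.repr]
      constructor
      · intro h a ha
        rcases ha.lt_or_eq with ha | ha
        · exact (hN.bigraded.slope i _).1 x.2 a ha
        · exact (hπ x ⟨a, ha.symm⟩).symm.trans (by rw [h, Finsupp.zero_apply])
      · exact fun h => Finsupp.ext fun a => (hπ x a).trans (h a.1 a.2.ge)
    · rw [hπ]
      refine (hN.repr_D hT x.2 a.2 j).trans ?_
      rw [← hπ x a]
      exact (repr_basisD b j (π x) a).symm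
    · rw [hπ, map_smul, Finsupp.smul_apply, smul_eq_mul]
      refine (hN.repr_F hT x.2 a.2 φ).trans ?_
      rw [← hπ x a]
      exact congrArg _ (repr_basisF b φ.toRingHom (π x) a).symm

theorem IsPeriod.frob_all (hT : E.IsPeriod e T)
    (hg : ∀ a b, E.form (e a) (e b) = gram (A p k n) n a b) (hp : 3 < p) (φ : FrobLift p k n)
    (a b : Idx n) : φ.MapsTo (T a b) (MvPowerSeries.C ((p : K p k) ^ a.deg)⁻¹ *
      ∑ c, T a c * incl p k n (e.repr (E.F φ (e b)) c)) := by
  have h := mapsTo_of_functional E.toFCrystal hp (g := rowFunctional e (T a)) (r := a.deg)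
    (rowFunctional_smul e (T a)) (hT.row_D hg a) (hT.row_F a) (fun d => ?_) (x := e b)
    (by rw [rowFunctional_basis]; exact hT.growth a b) φ
  · rwa [rowFunctional_basis] at h
  · classical
    choose N hN using fun y : Idx n × (Fin n →₀ ℕ) =>
      exists_pow_mul_mem_lat (MvPowerSeries.coeff y.2 (T a y.1)) 0
    refine ⟨∑ c, ∑ x ∈ HasAntidiagonal.antidiagonal d, N (c, x.1), fun x => ?_⟩
    rw [rowFunctional_apply, map_sum, Finset.mul_sum]
    refine sum_mem fun c _ => ?_
    rw [MvPowerSeries.coeff_mul, Finset.mul_sum]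
    refine sum_mem fun y hy => ?_
    have h1 : N (c, y.1) ≤ ∑ c, ∑ x ∈ HasAntidiagonal.antidiagonal d, N (c, x.1) :=
      (Finset.single_le_sum (f := fun x : (Fin n →₀ ℕ) × (Fin n →₀ ℕ) => N (c, x.1))
        (fun _ _ => Nat.zero_le _) hy).trans
      (Finset.single_le_sum (f := fun c => ∑ x ∈ HasAntidiagonal.antidiagonal d, N (c, x.1))
        (fun _ _ => Nat.zero_le _) (Finset.mem_univ c))
    obtain ⟨l, hl⟩ := Nat.exists_eq_add_of_le' h1
    rw [hl, pow_add, mul_assoc, ← mul_assoc (_ ^ N (c, y.1))]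
    exact lat_anti (Nat.zero_le _) (mul_mem_lat (p_pow_mem_lat l)
      (mul_mem_lat (hN (c, y.1)) (coeff_incl_mem_lat _)))

/-- Frames exist. -/
theorem nonempty_frame (hp : 3 < p) (hKS : Function.Bijective E.kodairaSpencer) :
    Nonempty (Frame E) := by
  obtain ⟨U, hU⟩ := exists_isSlopeFlag hp hKS
  obtain ⟨e, he, hF⟩ := hU.exists_good_basis hp hKS
  have hN : E.IsNormalised U e := ⟨hU, he, hF⟩
  obtain ⟨T, hT⟩ := hN.exists_isPeriod hp
  have hTe := eq_periodMatrix hT.eq_zero hT.eq_one (hT.gram_eq hN hp)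
  rw [← leftFactor_mul_rightFactor] at hTe
  have hdet : IsUnit T.det := by
    rw [hTe]
    exact isUnit_det_leftFactor_mul_rightFactor _ _ _ _
  refine ⟨{ U := U, slope := hN.isSlopeFiltration hT hp, e := e, e_mem := he.mem, e_gram := he.gram,
            τ23 := _, τ13 := _, τ12 := _, Z := _, T := T, T_eq := hTe, conn := fun j => ?_,
            frob := fun ψ => ?_ }⟩
  · have h1 : T * (Matrix.of fun a b => incl p k n (e.repr (E.D j (e b)) a)) =
        T.map (MvPowerSeries.pderiv (K p k) j) := by
      refine Matrix.ext fun a b => ?_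
      have := hT.row_D he.gram a j (e b)
      rw [rowFunctional_basis, rowFunctional_apply] at this
      rw [Matrix.mul_apply, Matrix.map_apply, this]
      rfl
    rw [← h1, ← Matrix.mul_assoc, Matrix.nonsing_inv_mul _ hdet, Matrix.one_mul]
  · refine ⟨Matrix.of fun a b => MvPowerSeries.C ((p : K p k) ^ a.deg)⁻¹ *
      ∑ c, T a c * incl p k n (e.repr (E.F ψ (e b)) c),
      fun a b => by
        rw [Matrix.of_apply]
        exact hT.frob_all he.gram hp ψ a b, ?_⟩
    have h1 : Matrix.diagonal (fun a : Idx n => (p : KA p k n) ^ a.deg) *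
        (Matrix.of fun a b => MvPowerSeries.C ((p : K p k) ^ a.deg)⁻¹ *
          ∑ c, T a c * incl p k n (e.repr (E.F ψ (e b)) c)) =
        T * (Matrix.of fun a b => incl p k n (e.repr (E.F ψ (e b)) a)) := by
      refine Matrix.ext fun a b => ?_
      rw [Matrix.diagonal_mul, Matrix.of_apply,
        ← map_natCast (MvPowerSeries.C (σ := Fin n) (R := K p k)) p, ← map_pow, ← mul_assoc, ← map_mul, mul_inv_cancel₀ (pow_ne_zero _ p_ne_zero_K), map_one, one_mul,
        Matrix.mul_apply]
      rfl
    rw [Matrix.mul_assoc, h1, ← Matrix.mul_assoc, Matrix.nonsing_inv_mul _ hdet, Matrix.one_mul]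

end OrdinaryCY3Crystal

end Frames

end CY3

end

noncomputable section

namespace CY3

open Finset

/-! ### Derivative of an exponential, growth of a logarithm. -/

section ExpDerivative

variable {p : ℕ} [Fact p.Prime] {k : Type v} [Field k] [CharP k p] [PerfectRing k p] {n : ℕ}

theorem PadicHasSum.pderiv {ι : Type*} {f : ι → KA p k n} {g : KA p k n} (h : PadicHasSum f g)
    (j : Fin n) : PadicHasSum (fun i => MvPowerSeries.pderiv (K p k) j (f i))
      (MvPowerSeries.pderiv (K p k) j g) := by
  rw [padicHasSum_iff] at *
  intro d
  simp only [MvPowerSeries.coeff_pderiv, mul_comm _ ((d j : K p k) + 1)]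
  exact (h _).mul_left _

theorem IsExp.pderiv {τ g : KA p k n} (h : IsExp τ g) (j : Fin n) :
    MvPowerSeries.pderiv (K p k) j g = MvPowerSeries.pderiv (K p k) j τ * g := by
  have h1 := PadicHasSum.pderiv h j
  have h2 := PadicHasSum.mul_left h (MvPowerSeries.pderiv (K p k) j τ)
  refine h1.unique (padicHasSum_iff.2 fun d => ?_)
  -- The derivative of the `(m+1)`-st term is `dτ` times the `m`-th term; the term `m = 0` has
  -- derivative zero.
  refine HS.of_injective Nat.succ Nat.succ_injective ?_ fun m hm => ?_
  · have h3 := padicHasSum_iff.1 h2 d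
    convert h3 using 2 with m
    congr 1
    have hm : ((m + 1 : ℕ) : K p k) ≠ 0 := by
      rw [← map_natCast (algebraMap (W p k) (K p k)),
        map_ne_zero_iff _ (IsFractionRing.injective (W p k) (K p k))]
      exact Nat.cast_ne_zero.2 m.succ_ne_zero
    have hfac : ((Nat.factorial (m + 1) : ℕ) : K p k)⁻¹ * ((m + 1 : ℕ) : K p k) =
        ((Nat.factorial m : ℕ) : K p k)⁻¹ := by
      rw [Nat.factorial_succ, Nat.cast_mul, mul_inv, mul_right_comm, inv_mul_cancel₀ hm, one_mul]
    rw [Derivation.leibniz, MvPowerSeries.pderiv_C, smul_zero, add_zero, smul_eq_mul,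
      MvPowerSeries.pderiv_pow, ← hfac, map_mul, map_natCast, Nat.succ_eq_add_one,
      Nat.add_sub_cancel]
    ring
  · obtain rfl : m = 0 := by
      by_contra h0
      exact hm ⟨m - 1, Nat.succ_pred_eq_of_ne_zero h0⟩
    simp only [Nat.factorial_zero, Nat.cast_one, inv_one, map_one, pow_zero, mul_one]
    rw [← map_one MvPowerSeries.C, MvPowerSeries.pderiv_C, map_zero]

/-- The growth of the coefficients of a logarithm. -/
theorem pow_degree_mul_coeff_mem {τ : KA p k n} {g : A p k n}
    (h : psiK p k n τ - p * τ = incl p k n (p * g))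
    (h0 : MvPowerSeries.constantCoeff τ ∈ lat p k 1) (d : Fin n →₀ ℕ) :
    (p : K p k) ^ d.degree * MvPowerSeries.coeff d τ ∈ lat p k 1 := by
  have key : ∀ N, ∀ d : Fin n →₀ ℕ, d.degree < N →
      (p : K p k) ^ d.degree * MvPowerSeries.coeff d τ ∈ lat p k 1 := by
    intro N
    induction N with
    | zero => exact fun d hd => absurd hd (Nat.not_lt_zero _)
    | succ N ih =>
      intro d hd
      by_cases hd0 : d = 0
      · subst hd0
        simpa using h0
      have hd1 : d.degree ≠ 0 := fun h => hd0 ((Finsupp.degree_eq_zero_iff d).1 h)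
      have h1 := congrArg (MvPowerSeries.coeff d) h
      rw [map_sub, map_mul (incl p k n), map_natCast (incl p k n),
        ← map_natCast (MvPowerSeries.C (σ := Fin n) (R := K p k)) p, MvPowerSeries.coeff_C_mul,
        MvPowerSeries.coeff_C_mul] at h1
      obtain ⟨m, hm⟩ := Nat.exists_eq_succ_of_ne_zero hd1
      have h2 : (p : K p k) ^ m * MvPowerSeries.coeff d (psiK p k n τ) ∈ lat p k 1 := by
        by_cases hpe : ∃ e, d = p • e
        · obtain ⟨e, rfl⟩ := hpe
          rw [map_nsmul, smul_eq_mul] at hm hd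
          have hp := (Fact.out : p.Prime).two_le
          have he : e.degree ≤ m := by nlinarith
          have h3 := sigK_mem_lat.2 (ih e (by omega))
          rw [map_mul, map_pow, map_natCast] at h3
          rw [coeff_frobSeries_smul, ← Nat.sub_add_cancel he, pow_add, mul_assoc]
          exact lat_anti (Nat.le_add_left _ _) (mul_mem_lat (p_pow_mem_lat _) h3)
        · push Not at hpe
          rw [coeff_frobSeries_eq_zero _ hpe, mul_zero]
          exact zero_mem _
      -- The relation expresses the coefficient at `d` as that of `ψ(τ)` divided by `p`, minus an
      -- integral one. The division is paid for by the degree: a nonzero coefficient of `ψ(τ)` comes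
      -- from degree `|d| / p < |d|`.
      have h4 : (p : K p k) ^ d.degree * MvPowerSeries.coeff d τ =
          (p : K p k) ^ m * MvPowerSeries.coeff d (psiK p k n τ) -
            (p : K p k) ^ (m + 1) * MvPowerSeries.coeff d (incl p k n g) := by
        rw [hm, Nat.succ_eq_add_one]
        linear_combination -(p : K p k) ^ m * h1
      rw [h4]
      refine sub_mem h2 ?_
      exact lat_anti (by omega) (mul_mem_lat (p_pow_mem_lat (m + 1)) (coeff_incl_mem_lat d))
  exact key _ d (Nat.lt_succ_self _)

end ExpDerivative

/-! ### What a given frame says about its last column. -/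

section Frames

variable {p : ℕ} [Fact p.Prime] {k : Type v} [Field k] [CharP k p] [IsAlgClosed k] {n : ℕ}
  {H : Type u} [AddCommGroup H] [Module (A p k n) H]

namespace Frame

variable {E : OrdinaryCY3Crystal p k n n H} (B : Frame E)

theorem T_eq_periodMatrix : B.T = periodMatrix B.τ23 B.τ13 B.τ12 B.Z := by
  rw [B.T_eq, leftFactor_mul_rightFactor]

theorem isUnit_det : IsUnit B.T.det := by
  rw [B.T_eq]
  exact isUnit_det_leftFactor_mul_rightFactor _ _ _ _

theorem conn_apply (j : Fin n) (a b : Idx n) :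
    ∑ c, B.T a c * incl p k n (B.e.repr (E.D j (B.e b)) c) =
      MvPowerSeries.pderiv (K p k) j (B.T a b) := by
  have h := congrArg (B.T * ·) (B.conn j)
  simp only [← Matrix.mul_assoc, Matrix.mul_nonsing_inv _ B.isUnit_det, Matrix.one_mul] at h
  exact congrFun (congrFun h a) b

theorem exists_frob (ψ : FrobLift p k n) : ∃ ψT : Matrix (Idx n) (Idx n) (KA p k n),
    (∀ a b, ψ.MapsTo (B.T a b) (ψT a b)) ∧
    ∀ a b, ∑ c, B.T a c * incl p k n (B.e.repr (E.F ψ (B.e b)) c) =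
      (p : KA p k n) ^ a.deg * ψT a b := by
  obtain ⟨ψT, h1, h2⟩ := B.frob ψ
  refine ⟨ψT, h1, fun a b => ?_⟩
  have h := congrArg (B.T * ·) h2
  simp only [← Matrix.mul_assoc, Matrix.mul_nonsing_inv _ B.isUnit_det, Matrix.one_mul] at h
  have := congrFun (congrFun h a) b
  rwa [Matrix.diagonal_mul] at this

theorem pow_dvd_repr_F (hp : 3 < p) (ψ : FrobLift p k n) (c : Idx n) :
    (p : A p k n) ^ 3 ∣ B.e.repr (E.F ψ (B.e Idx.i3)) c := by
  obtain ⟨y, hy⟩ := mem_pPow.1 (E.F_mem hp E.divisible ψ le_rfl (B.e_mem Idx.i3).2)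
  exact ⟨B.e.repr y c, by rw [← hy, map_smul, Finsupp.smul_apply, smul_eq_mul]⟩

theorem pderiv_τ23 (i j : Fin n) :
    incl p k n (B.e.repr (E.D j (B.e Idx.i3)) (Idx.i2 i)) =
      MvPowerSeries.pderiv (K p k) j (B.τ23 i) := by
  have h3 := B.conn_apply j Idx.i3 Idx.i3
  have h2 := B.conn_apply j (Idx.i2 i) Idx.i3
  rw [T_eq_periodMatrix] at h2 h3
  simp only [Fintype.sum_sum_type, Finset.univ_unique, Finset.sum_singleton, PUnit.default_eq_unit,
    periodMatrix, zero_mul, one_mul, Finset.sum_const_zero, zero_add, ite_mul, Finset.sum_ite_eq,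
    Finset.mem_univ, if_true] at h2 h3
  rw [← map_one MvPowerSeries.C, MvPowerSeries.pderiv_C] at h3
  rw [h3, mul_zero, add_zero] at h2
  exact h2

/-- The last column of the matrix of Frobenius. -/
theorem repr_F_i3 {ψ : FrobLift p k n} {ψT : Matrix (Idx n) (Idx n) (KA p k n)}
    (hψ : ∀ a b, ψ.MapsTo (B.T a b) (ψT a b))
    (h : ∀ a b, ∑ c, B.T a c * incl p k n (B.e.repr (E.F ψ (B.e b)) c) =
      (p : KA p k n) ^ a.deg * ψT a b) :
    incl p k n (B.e.repr (E.F ψ (B.e Idx.i3)) Idx.i3) = (p : KA p k n) ^ 3 ∧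
    ∀ i, incl p k n (B.e.repr (E.F ψ (B.e Idx.i3)) (Idx.i2 i)) =
      (p : KA p k n) ^ 2 * (ψT (Idx.i2 i) Idx.i3 - p * B.τ23 i) := by
  have h3 := h Idx.i3 Idx.i3
  have h2 := fun i => h (Idx.i2 i) Idx.i3
  have hψ3 : ψT Idx.i3 Idx.i3 = 1 := by
    have h1 := hψ Idx.i3 Idx.i3
    rw [show B.T Idx.i3 Idx.i3 = 1 by rw [T_eq_periodMatrix]; simp only [periodMatrix],
      FrobLift.mapsTo_iff] at h1
    exact h1.unique substHas_one
  rw [T_eq_periodMatrix, hψ3] at h3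
  simp only [T_eq_periodMatrix, Fintype.sum_sum_type, Finset.univ_unique, Finset.sum_singleton,
    PUnit.default_eq_unit, periodMatrix, zero_mul, one_mul, Finset.sum_const_zero, zero_add, ite_mul,
    Finset.sum_ite_eq, Finset.mem_univ, if_true, Idx.deg, mul_one] at h2 h3
  refine ⟨h3, fun i => ?_⟩
  have := h2 i
  rw [h3] at this
  linear_combination this

theorem exists_frob_τ23 (hp : 3 < p) (ψ : FrobLift p k n)
    {ψT : Matrix (Idx n) (Idx n) (KA p k n)}
    (hψ : ∀ a b, ψ.MapsTo (B.T a b) (ψT a b))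
    (h : ∀ a b, ∑ c, B.T a c * incl p k n (B.e.repr (E.F ψ (B.e b)) c) =
      (p : KA p k n) ^ a.deg * ψT a b) (i : Fin n) :
    ψ.MapsTo (B.τ23 i) (ψT (Idx.i2 i) Idx.i3) ∧
      ∃ g, ψT (Idx.i2 i) Idx.i3 - p * B.τ23 i = incl p k n (p * g) := by
  constructor
  · have h1 := hψ (Idx.i2 i) Idx.i3
    rwa [show B.T (Idx.i2 i) Idx.i3 = B.τ23 i by
      rw [T_eq_periodMatrix]; simp only [periodMatrix]] at h1
  · obtain ⟨g, hg⟩ := B.pow_dvd_repr_F hp ψ (Idx.i2 i)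
    refine ⟨g, mul_left_cancel₀ (pow_ne_zero 2 (p_ne_zero_KA (p := p) (k := k) (n := n))) ?_⟩
    rw [← (B.repr_F_i3 hψ h).2 i, hg, map_mul, map_mul, map_pow, map_natCast]
    ring

theorem mem_fil_three {x : H} (hx : x ∈ E.Fil 3) : x = B.e.repr x Idx.i3 • B.e Idx.i3 := by
  have hz : ∀ b : Idx n, 0 < b.deg → E.form x (B.e b) = 0 := fun b hb =>
    OrdinaryCY3Crystal.form_fil (by omega : 3 < 3 + b.deg) hx (B.e_mem b).2
  simp only [OrdinaryCY3Crystal.form_eq_of_gram B.e_gram] at hz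
  refine B.e.ext_elem fun c => ?_
  rw [map_smul, Finsupp.smul_apply, smul_eq_mul, B.e.repr_self]
  rcases c with (_ | j | j | _)
  · have := hz Idx.i3 (by simp [Idx.deg])
    simpa [Finsupp.single_apply] using this
  · have := hz (Idx.i2 j) (by simp [Idx.deg])
    simpa [Finsupp.single_apply] using this
  · have := hz (Idx.i1 j) (by simp [Idx.deg])
    simpa [Finsupp.single_apply] using this
  · simp

theorem isUnit_det_kodairaSpencer (hKS : Function.Bijective E.kodairaSpencer) :
    IsUnit (Matrix.of fun i j => B.e.repr (E.D j (B.e Idx.i3)) (Idx.i2 i)).det := by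
  have hsurj := (OrdinaryCY3Crystal.kodairaSpencer_at hKS (B.e_mem Idx.i3).2 (B.e.ne_zero _)
    fun x hx => ⟨_, B.mem_fil_three hx⟩).2
  choose a ha using fun l : Fin n => hsurj (Submodule.Quotient.mk ⟨B.e (Idx.i2 l), (B.e_mem (Idx.i2 l)).2⟩)
  refine Matrix.isUnit_det_of_right_inverse (B := Matrix.of fun j l => a l j)
    (Matrix.ext fun i l => ?_)
  have h1 : ∑ j, a l j • E.grD 2 j ⟨B.e Idx.i3, (B.e_mem Idx.i3).2⟩ =
      Submodule.Quotient.mk ⟨B.e (Idx.i2 l), (B.e_mem (Idx.i2 l)).2⟩ := ha l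
  rw [OrdinaryCY3Crystal.sum_grD (B.e_mem Idx.i3).2 (a l) (sum_mem fun j _ => Submodule.smul_mem _ _
    (E.transversal 2 j _ (B.e_mem Idx.i3).2)), Submodule.Quotient.eq, Submodule.submoduleOf,
    Submodule.mem_comap] at h1
  have h2 : ∑ j, a l j • E.D j (B.e Idx.i3) - B.e (Idx.i2 l) ∈ E.Fil 3 := h1
  have h3 := congrArg (fun x => B.e.repr x (Idx.i2 i)) (B.mem_fil_three h2)
  simp only [map_sub, map_sum, map_smul, Finsupp.sub_apply, Finsupp.finsetSum_apply,
    Finsupp.smul_apply, B.e.repr_self, smul_eq_mul] at h3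
  rw [Matrix.mul_apply, Matrix.one_apply]
  simp only [Matrix.of_apply, mul_comm (B.e.repr _ _)]
  rw [Finsupp.single_eq_of_ne (show Idx.i2 i ≠ Idx.i3 by simp), mul_zero, sub_eq_zero] at h3
  rw [h3, Finsupp.single_apply]
  simp [eq_comm]

end Frame

end Frames

end CY3

end

noncomputable section

namespace CY3

open Finset

/-! ### The coordinates `q_i`, the canonical lift and the function `Z`. -/

section Main

variable {p : ℕ} [Fact p.Prime] {k : Type v} [Field k] [CharP k p] [IsAlgClosed k] {n : ℕ}
  {H : Type u} [AddCommGroup H] [Module (A p k n) H]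

namespace Frame

variable {E : OrdinaryCY3Crystal p k n n H} (B : Frame E)

theorem exists_psiK_τ23 (hp : 3 < p) (i : Fin n) :
    ∃ g, psiK p k n (B.τ23 i) - p * B.τ23 i = incl p k n (p * g) := by
  obtain ⟨ψT, h1, h2⟩ := B.exists_frob (FrobLift.std p k n)
  obtain ⟨h3, g, hg⟩ := B.exists_frob_τ23 hp _ h1 h2 i
  refine ⟨g, ?_⟩
  rw [← hg, PadicHasSum.unique (FrobLift.std_mapsTo (B.τ23 i)) h3]

/-- The exponentials of the `τ_i` are integral. -/
theorem exists_q (hp : 3 < p) : ∃ q : Fin n → A p k n,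
    (∀ i, IsExp (B.τ23 i) (incl p k n (q i))) ∧
      ∀ i, (p : W p k) ∣ MvPowerSeries.constantCoeff (q i) - 1 := by
  choose g hg using B.exists_psiK_τ23 hp
  choose _ q hq hq1 using fun i => exists_exp_integral (by omega) (hg i)
  exact ⟨q, hq, hq1⟩

variable {q : Fin n → A p k n}

theorem isUnit_q (hq1 : ∀ i, (p : W p k) ∣ MvPowerSeries.constantCoeff (q i) - 1) (i : Fin n) :
    IsUnit (q i) := by
  rw [MvPowerSeries.isUnit_iff_constantCoeff, isUnit_W_iff]
  intro h
  have h1 := dvd_sub h (hq1 i)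
  rw [sub_sub_cancel] at h1
  exact isUnit_W_iff.1 isUnit_one h1

theorem sub_one_mem_J (hq1 : ∀ i, (p : W p k) ∣ MvPowerSeries.constantCoeff (q i) - 1) (i : Fin n) :
    q i - 1 ∈ J p k n 1 := by
  rw [mem_J]
  intro d
  by_cases hd : d = 0
  · subst hd
    simpa using hq1 i
  · have : d.degree ≠ 0 := fun h => hd ((Finsupp.degree_eq_zero_iff d).1 h)
    rw [show 1 - d.degree = 0 by omega, pow_zero]
    exact one_dvd _

/-- As `dq_i = q_i dτ_i`, the Jacobian is the Kodaira–Spencer matrix with its rows multiplied by the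
units `q_i`. -/
theorem isUnit_jacobian (hKS : Function.Bijective E.kodairaSpencer)
    (hq : ∀ i, IsExp (B.τ23 i) (incl p k n (q i)))
    (hq1 : ∀ i, (p : W p k) ∣ MvPowerSeries.constantCoeff (q i) - 1) :
    IsUnit (Matrix.of fun i j => MvPowerSeries.pderiv (W p k) j (q i - 1)).det := by
  have h1 : (Matrix.of fun i j => MvPowerSeries.pderiv (W p k) j (q i - 1)) =
      Matrix.of fun i j => q i * (Matrix.of fun i j =>
        B.e.repr (E.D j (B.e Idx.i3)) (Idx.i2 i)) i j := by
    refine Matrix.ext fun i j => incl_injective ?_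
    rw [Matrix.of_apply, Matrix.of_apply, Matrix.of_apply, map_sub, ← map_one MvPowerSeries.C,
      MvPowerSeries.pderiv_C, sub_zero, ← pderiv_incl, (hq i).pderiv j, ← B.pderiv_τ23, map_mul,
      mul_comm]
  rw [h1, Matrix.det_mul_column]
  exact (IsUnit.prod_univ_iff.2 fun i => isUnit_q hq1 i).mul (B.isUnit_det_kodairaSpencer hKS)

theorem growth (hp : 3 < p) (i : Fin n) (d : Fin n →₀ ℕ) :
    (p : K p k) ^ d.degree * MvPowerSeries.coeff d (B.τ23 i) ∈ lat p k 1 := by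
  obtain ⟨g, hg⟩ := B.exists_psiK_τ23 hp i
  exact pow_degree_mul_coeff_mem hg (exists_exp_integral (by omega) hg).1 d

/-- The canonical lift multiplies the `τ_i` by `p`. -/
theorem frob_τ23_eq (hp : 3 < p) (hq : ∀ i, IsExp (B.τ23 i) (incl p k n (q i)))
    (hq1 : ∀ i, (p : W p k) ∣ MvPowerSeries.constantCoeff (q i) - 1) {φ : FrobLift p k n}
    (hφ : ∀ i, φ.toRingHom (q i) = q i ^ p) {ψT : Matrix (Idx n) (Idx n) (KA p k n)}
    (hψ : ∀ a b, φ.MapsTo (B.T a b) (ψT a b))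
    (h : ∀ a b, ∑ c, B.T a c * incl p k n (B.e.repr (E.F φ (B.e b)) c) =
      (p : KA p k n) ^ a.deg * ψT a b) (i : Fin n) :
    ψT (Idx.i2 i) Idx.i3 = p * B.τ23 i := by
  obtain ⟨hmap, g, hg⟩ := B.exists_frob_τ23 hp φ hψ h i
  -- `exp(φ(τ_i)) = φ(q_i) = q_i^p = exp(pτ_i)`, so the exponential of the difference is `1`. The
  -- difference lies in `pA`, where `exp` is injective.
  have h1 := isExp_mapsTo (by omega) φ (B.growth hp i) (hq i) hmap
  rw [hφ, map_pow] at h1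
  have h2 := (hq i).natCast_mul p
  obtain ⟨b, hb, -⟩ := exists_isExp_p_mul (p := p) (k := k) (by omega) g
  have h3 := hb.add h2
  rw [← hg, sub_add_cancel] at h3
  have h4 : incl p k n b = 1 := by
    have hu : IsUnit (incl p k n (q i) ^ p) := ((isUnit_q hq1 i).map (incl p k n)).pow p
    refine hu.mul_right_cancel ?_
    rw [one_mul]
    exact h3.unique h1
  rw [h4] at hb
  have h5 := eq_zero_of_isExp_one (by omega) hb
  rw [h5, mul_zero, map_zero] at hg
  exact sub_eq_zero.1 hg

/-- The prepotential `Z` under the canonical lift. -/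
theorem exists_frob_Z (hp : 3 < p) (hq : ∀ i, IsExp (B.τ23 i) (incl p k n (q i)))
    (hq1 : ∀ i, (p : W p k) ∣ MvPowerSeries.constantCoeff (q i) - 1) (φ : FrobLift p k n)
    (hφ : ∀ i, φ.toRingHom (q i) = q i ^ p) :
    ∃ φZ : KA p k n, φ.MapsTo B.Z φZ ∧
      incl p k n (E.form (B.e Idx.i3) (E.F φ (B.e Idx.i3))) = φZ - (p : KA p k n) ^ 3 * B.Z ∧
      ∃ a : A p k n, MvPowerSeries.C (((p : K p k) ^ 3)⁻¹) * φZ - B.Z = incl p k n a := by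
  obtain ⟨ψT, hψ, h⟩ := B.exists_frob φ
  have hτ := B.frob_τ23_eq hp hq hq1 hφ hψ h
  have hmapτ : ∀ i, φ.MapsTo (B.τ23 i) (p * B.τ23 i) := fun i => by
    rw [← hτ i]
    exact (B.exists_frob_τ23 hp φ hψ h i).1
  have hmapσ : ∀ i, φ.MapsTo (B.τ13 i) (ψT (Idx.i1 i) Idx.i3) := fun i => by
    have h1 := hψ (Idx.i1 i) Idx.i3
    rwa [show B.T (Idx.i1 i) Idx.i3 = B.τ13 i by
      rw [T_eq_periodMatrix]; simp only [periodMatrix]] at h1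
  have hmap0 : φ.MapsTo (B.Z + ∑ l, B.τ23 l * B.τ13 l) (ψT Idx.i0 Idx.i3) := by
    have h1 := hψ Idx.i0 Idx.i3
    rwa [show B.T Idx.i0 Idx.i3 = B.Z + ∑ l, B.τ23 l * B.τ13 l by
      rw [T_eq_periodMatrix]; simp only [periodMatrix]] at h1
  -- The corner of `𝒯` is `Z + ∑ τ_l τ₁₃,l`; subtracting the image of the sum, computed with `φ(τ_l)
  -- = pτ_l`, leaves `φ(Z)` and proves its convergence.
  set φZ := ψT Idx.i0 Idx.i3 - ∑ l, p * B.τ23 l * ψT (Idx.i1 l) Idx.i3 with hφZ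
  have hmapZ : φ.MapsTo B.Z φZ := by
    have h1 := SubstHas.sub ((φ.mapsTo_iff _ _).1 hmap0) (SubstHas.sum Finset.univ
      (F := fun l => B.τ23 l * B.τ13 l) (G := fun l => p * B.τ23 l * ψT (Idx.i1 l) Idx.i3)
      fun l _ => SubstHas.mul ((φ.mapsTo_iff _ _).1 (hmapτ l)) ((φ.mapsTo_iff _ _).1 (hmapσ l)))
    rw [add_sub_cancel_right] at h1
    exact (φ.mapsTo_iff _ _).2 h1
  obtain ⟨hM3, hM2⟩ := B.repr_F_i3 hψ h
  have hM2' : ∀ i, incl p k n (B.e.repr (E.F φ (B.e Idx.i3)) (Idx.i2 i)) = 0 := fun i => by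
    rw [hM2, hτ, sub_self, mul_zero]
  have hM1 : ∀ i, incl p k n (B.e.repr (E.F φ (B.e Idx.i3)) (Idx.i1 i)) =
      p * ψT (Idx.i1 i) Idx.i3 - (p : KA p k n) ^ 3 * B.τ13 i := fun i => by
    have h1 := h (Idx.i1 i) Idx.i3
    simp only [T_eq_periodMatrix, Fintype.sum_sum_type, Finset.univ_unique, Finset.sum_singleton,
      PUnit.default_eq_unit, periodMatrix, hM2', hM3, zero_mul, one_mul, mul_zero,
      Finset.sum_const_zero, zero_add, ite_mul,
      Finset.sum_ite_eq, Finset.mem_univ, if_true, Idx.deg, pow_one] at h1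
    linear_combination h1
  have hM0 : incl p k n (B.e.repr (E.F φ (B.e Idx.i3)) Idx.i0) = φZ - (p : KA p k n) ^ 3 * B.Z := by
    have h1 := h Idx.i0 Idx.i3
    simp only [T_eq_periodMatrix, Fintype.sum_sum_type, Finset.univ_unique, Finset.sum_singleton,
      PUnit.default_eq_unit, periodMatrix, hM2', hM1, hM3, one_mul, mul_zero,
      Finset.sum_const_zero, zero_add, Idx.deg, pow_zero] at h1
    have h2 : ∑ l, B.τ23 l * (p * ψT (Idx.i1 l) Idx.i3 - (p : KA p k n) ^ 3 * B.τ13 l) =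
        ∑ l, p * B.τ23 l * ψT (Idx.i1 l) Idx.i3 - (p : KA p k n) ^ 3 * ∑ l, B.τ23 l * B.τ13 l := by
      rw [Finset.mul_sum, ← Finset.sum_sub_distrib]
      exact Finset.sum_congr rfl fun l _ => by ring
    rw [h2] at h1
    rw [hφZ]
    linear_combination h1
  -- Pairing on the left with the last basis vector reads off the coordinate of index 0, by the Gram
  -- matrix.
  have hform : E.form (B.e Idx.i3) (E.F φ (B.e Idx.i3)) = B.e.repr (E.F φ (B.e Idx.i3)) Idx.i0 := by
    rw [OrdinaryCY3Crystal.form_eq_of_gram B.e_gram]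
    simp
  refine ⟨φZ, hmapZ, by rw [hform, hM0], ?_⟩
  obtain ⟨a, ha⟩ := B.pow_dvd_repr_F hp φ Idx.i0
  refine ⟨a, ?_⟩
  have hC : MvPowerSeries.C (((p : K p k) ^ 3)⁻¹) * (p : KA p k n) ^ 3 = 1 := by
    rw [← map_natCast (MvPowerSeries.C (σ := Fin n) (R := K p k)) p, ← map_pow, ← map_mul,
      inv_mul_cancel₀ (pow_ne_zero _ p_ne_zero_K), map_one]
  rw [ha, map_mul, map_pow, map_natCast] at hM0
  have h1 : φZ = (p : KA p k n) ^ 3 * incl p k n a + (p : KA p k n) ^ 3 * B.Z := by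
    linear_combination -hM0
  rw [h1, ← mul_add, ← mul_assoc, hC, one_mul, add_sub_cancel_right]

end Frame

end Main

end CY3

end

theorem theorem2p4 {p : ℕ} [Fact p.Prime] (hp : 3 < p)
    {k : Type v} [Field k] [IsAlgClosed k] [CharP k p] {n h : ℕ}
    {H : Type u} [AddCommGroup H] [Module (CY3.A p k n) H]
    (E : CY3.OrdinaryCY3Crystal p k n h H)
    (hKS : Function.Bijective E.kodairaSpencer) :
    -- the number of variables is `h`, and adapted bases exist
    n = h ∧ Nonempty (CY3.Frame E) ∧
    -- for every choice of basis and matrix: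
    ∀ B : CY3.Frame E,
      -- `q_i = exp(τ_i)` is well defined and lies in `A`
      ∃ q : Fin h → CY3.A p k n,
        (∀ i, CY3.IsExp (B.τ23 i) (CY3.incl p k n (q i))) ∧
        (∀ i, (p : CY3.W p k) ∣ MvPowerSeries.constantCoeff (q i) - 1) ∧
        -- `p, q_1 - 1, …, q_h - 1` is a regular system of parameters
        CY3.IsRegularSystemOfParameters
          (fun o : Option (Fin h) => o.elim (p : CY3.A p k n) fun i => q i - 1) ∧
        -- `A = W[[q_1 - 1, …, q_h - 1]]`
        (∃ Θ : MvPowerSeries (Fin h) (CY3.W p k) ≃ₐ[CY3.W p k] CY3.A p k n,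
          ∀ i, Θ (MvPowerSeries.X i) = q i - 1) ∧
        -- the canonical lift of Frobenius
        (∃! φ : CY3.FrobLift p k n, ∀ i, φ.toRingHom (q i) = q i ^ p) ∧
        ∀ φ : CY3.FrobLift p k n, (∀ i, φ.toRingHom (q i) = q i ^ p) →
          ∃ φZ : CY3.KA p k n, φ.MapsTo B.Z φZ ∧
            CY3.incl p k n (E.form (B.e CY3.Idx.i3) (E.F φ (B.e CY3.Idx.i3))) =
              φZ - (p : CY3.KA p k n) ^ 3 * B.Z ∧
            ∃ a : CY3.A p k n,
              MvPowerSeries.C (((p : CY3.K p k) ^ 3)⁻¹) * φZ - B.Z = CY3.incl p k n a := by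
  obtain rfl := E.n_eq_h hKS
  refine ⟨rfl, E.nonempty_frame hp hKS, fun B => ?_⟩
  obtain ⟨q, hq, hq1⟩ := B.exists_q hp
  have hu := CY3.Frame.sub_one_mem_J hq1
  obtain ⟨α, β, hX⟩ := CY3.exists_X_eq hu (B.isUnit_jacobian hKS hq hq1)
  refine ⟨q, hq, hq1, CY3.isRegularSystemOfParameters hu hX, ⟨CY3.coordEquiv hu hX, fun i => ?_⟩, ?_,
    B.exists_frob_Z hp hq hq1⟩
  · rw [CY3.coordEquiv_apply, CY3.evalHom_X]
  · simpa only [add_sub_cancel] using CY3.existsUnique_frobLift hu hX
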